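/- Let $n\ge 4$ and $d\ge 1$ be integers and let $(K,k)$ be a smooth compact Riemannian manifold without boundary of dimension $d$, with volume measure $\mu_k$ and Levi-Civita connection; let $\Delta=k^{AB}\nabla_A\nabla_B$ be its Laplacian, acting on tensors on $\mathbb{R}^{1+n}\times K$. On $\mathbb{R}^{1+n}\times K$, with Cartesian coordinates $(x^0,\dots,x^n)=(t,x)$ on $\mathbb{R}^{1+n}$, let $\hat g=\eta+k$ with $\eta=-dt^2+\sum_{i=1}^n(dx^i)^2$, let $\hat\nabla$ be the Levi-Civita connection of $\hat g$, let $g_E=\hat g+2\,dt\otimes dt$, and let $|\cdot|_E$ be the norm of tensors induced by the Riemannian metric $g_E$. For $s>0$ let $\Sigma_s=\{(t,x): t>0,\ t^2-|x|^2=s^2\}$, parametrised by $x\in\mathbb{R}^n$ and carrying the flat volume $dx$. Let $Z_1,Z_2,\dots$ be an enumeration of the vector fields $\partial_i$ $(0\le i\le n)$ and $\eta_{jk}x^k\partial_i-\eta_{ik}x^k\partial_j$ $(0\le i<j\le n)$, and for a multi-index $I=(i_1,\dots,i_m)$ put $|I|=m$ and $Z^I=Z_{i_m}\circ\cdots\circ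 Z_{i_1}$. Let $Y_i=\partial_i+\frac{x_i}{t}\partial_t$ $(1\le i\le n)$, the coordinate vector fields $\partial_{y^i}$ of the coordinates $s=(t^2-|x|^2)^{1/2}$, $y=x$. These vector fields act on tensors by differentiating components in the Cartesian coordinates of $\mathbb{R}^{1+n}$, that is, by covariant differentiation. Let $\tilde d$ be the smallest even integer larger than $d/2$, let $\tilde\nu$ be the smallest integer greater than $n/2+\tilde d$, and let $\delta=\frac{n-2}{4}$. For every $s_0>1$ there is a constant $C$, depending only on $n$, $(K,k)$ and $s_0$, such that the following holds. Let $u,f$ be $(0,2)$-tensor fields on $\mathbb{R}^{1+n}\times K$ with $u\in C^{\tilde\nu}$ and $f\in C^\infty$, such that $f$ depends only on the Minkowski coordinates $(t,x)$, i.e. the covariant derivatives of $f$ in the directions of $K$ vanish, and $u=f$ wherever $|x|\ge t-1$. Suppose that there are constants $C_m$, $m=0,1,2,\dots$, with $$|\hat\nabla^m f|_E\le C_m\,|x|^{-\frac{n-1}{2}-m}\qquad\text{wherever } x\ne 0 .$$ Then for all $s\ge s_0$ $$\sup_{\Sigma_s\times K}s^{4\delta}|u|_E^2\ \le\ C\sum_{|I|+2j\le\tilde\nu}\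 \sum_{i=1}^n\int_{(\Sigma_s\times K)\cap\{|x|\le t-1\}}|Y_iZ^I\Delta^ju|_E^2\,dx\,d\mu_k+C\sum_{m=0}^{\tilde\nu-1}C_m^2$$ and $$\sup_{\Sigma_s\times K}t^{2\delta}|u|_E^2\ \le\ C\sum_{|I|+2j\le\tilde\nu}\ \sum_{i=1}^n\int_{(\Sigma_s\times K)\cap\{|x|\le t-1\}}|Y_iZ^I\Delta^ju|_E^2\,dx\,d\mu_k+C\sum_{m=0}^{\tilde\nu-1}C_m^2 .$$ (The derivatives of order $\tilde\nu+1$ on the right, which occur for $|I|+2j=\tilde\nu$, need not exist for $u\in C^{\tilde\nu}$; a component of such a derivative is counted as $0$ at points where it does not exist because the component of $Z^I\Delta^ju$ is not differentiable in $(t,x)$.) -/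

import Mathlib

open Set MeasureTheory Manifold Bundle
open scoped ContDiff ENNReal NNReal

noncomputable section

namespace HypSobolev

/-! ### Minkowski space, hyperboloids and vector fields -/

/-- Minkowski space `ℝ^{1+n}` with Cartesian coordinates `(x⁰, x¹, …, xⁿ)`, `t = x⁰`. -/
abbrev Mink (n : ℕ) : Type := EuclideanSpace ℝ (Fin (n + 1))

/-- The spatial part `(x¹, …, xⁿ)` of a point of Minkowski space; `|x|` is its Euclidean norm. -/
def spatial {n : ℕ} (p : Mink n) : EuclideanSpace ℝ (Fin n) :=
  WithLp.toLp 2 fun i => p i.succ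

/-- The Minkowski metric `diag(-1, 1, …, 1)`. -/
def eta (n : ℕ) : Matrix (Fin (n + 1)) (Fin (n + 1)) ℝ :=
  Matrix.diagonal fun i => if i = 0 then -1 else 1

/-- The hyperboloid `Σ_s`. -/
def hyperboloid (n : ℕ) (s : ℝ) : Set (Mink n) :=
  {p | 0 < p 0 ∧ ‖spatial p‖ ≤ p 0 ∧ Real.sqrt ((p 0) ^ 2 - ‖spatial p‖ ^ 2) = s}

/-- The point of `Σ_s` with hyperboloidal coordinates `(s, y)`, that is
`(t, x) = ((s² + |y|²)^{1/2}, y)`. -/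
def hypPoint {n : ℕ} (s : ℝ) (y : EuclideanSpace ℝ (Fin n)) : Mink n :=
  WithLp.toLp 2 (Fin.cons (Real.sqrt (s ^ 2 + ‖y‖ ^ 2)) fun i => y i)

/-- The constant coordinate vector field `∂_i`, `0 ≤ i ≤ n`. -/
def coordVec {n : ℕ} (i : Fin (n + 1)) : Mink n := EuclideanSpace.single i 1

/-- Labels of the generators of the Poincaré algebra: `X_i` for `0 ≤ i ≤ n` (with `X_0 = T`) and
`Z_{ij}` for `0 ≤ i < j ≤ n`. -/
abbrev GenIndex (n : ℕ) : Type :=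
  Fin (n + 1) ⊕ {ij : Fin (n + 1) × Fin (n + 1) // ij.1 < ij.2}

/-- The generators as vector fields on Minkowski space: `X_i = ∂_i` and
`Z_{ij} = η_{jk} x^k ∂_i - η_{ik} x^k ∂_j`. -/
def genField {n : ℕ} : GenIndex n → Mink n → Mink n
  | Sum.inl i, _ => coordVec i
  | Sum.inr ij, p =>
      (∑ k, eta n ij.1.2 k * p k) • coordVec ij.1.1
        - (∑ k, eta n ij.1.1 k * p k) • coordVec ij.1.2

/-- The vector field `Y_i = ∂_i + (x_i / t) ∂_t`, `1 ≤ i ≤ n`.  It is the coordinate vector field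
`∂_{y^i}` of the hyperboloidal coordinates `(s, y)`, see `hasDerivAt_hypPoint`. -/
def hypField {n : ℕ} (i : Fin n) (p : Mink n) : Mink n :=
  coordVec i.succ + (p i.succ / p 0) • coordVec 0

/-! ### Coordinates on the product spacetime -/

/-- The coordinate space of `ℝ^{1+n} × K` (Cartesian coordinates times a chart of `K`). -/
abbrev Coord (n d : ℕ) : Type := Mink n × EuclideanSpace ℝ (Fin d)

/-- Spacetime indices: Minkowski indices `inl i` and internal indices `inr A`. -/
abbrev Idx (n d : ℕ) : Type := Fin (n + 1) ⊕ Fin d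

/-- Components, in one coordinate system, of a covariant tensor field of rank `k`. -/
abbrev Comp (n d k : ℕ) : Type := Coord n d → (Fin k → Idx n d) → ℝ

/-- The standard basis of the coordinate space. -/
def basisVec {n d : ℕ} : Idx n d → Coord n d
  | Sum.inl i => (coordVec i, 0)
  | Sum.inr A => (0, EuclideanSpace.single A 1)

/-- The model with corners of the product spacetime. -/
abbrev model (n d : ℕ) :
    ModelWithCorners ℝ (Mink n × EuclideanSpace ℝ (Fin d))
      (ModelProd (Mink n) (EuclideanSpace ℝ (Fin d))) :=
  𝓘(ℝ, Mink n).prod 𝓘(ℝ, EuclideanSpace ℝ (Fin d))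

section Manifold

variable {n d : ℕ} {K : Type*} [TopologicalSpace K] [ChartedSpace (EuclideanSpace ℝ (Fin d)) K]

/-- The coordinate vector `∂_A` of the chart centred at `c`, at the point with coordinates `y`. -/
def intVec (c : K) (y : EuclideanSpace ℝ (Fin d)) (A : Fin d) :
    TangentSpace 𝓘(ℝ, EuclideanSpace ℝ (Fin d))
      ((extChartAt 𝓘(ℝ, EuclideanSpace ℝ (Fin d)) c).symm y) :=
  mfderiv 𝓘(ℝ, EuclideanSpace ℝ (Fin d)) 𝓘(ℝ, EuclideanSpace ℝ (Fin d))
    (extChartAt 𝓘(ℝ, EuclideanSpace ℝ (Fin d)) c).symm y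
    (EuclideanSpace.single A (1 : ℝ) : EuclideanSpace ℝ (Fin d))

/-- The coordinate frame `∂_μ` of `ℝ^{1+n} × K` in Cartesian coordinates on `ℝ^{1+n}` and the chart
of `K` centred at `c`. -/
def frame (c : K) (q : Coord n d) (a : Idx n d) :
    TangentSpace (model n d)
      ((q.1, (extChartAt 𝓘(ℝ, EuclideanSpace ℝ (Fin d)) c).symm q.2) : Mink n × K) :=
  match a with
  | Sum.inl i => ((coordVec i, 0) : Mink n × EuclideanSpace ℝ (Fin d))
  | Sum.inr A => ((0, intVec c q.2 A) : Mink n × EuclideanSpace ℝ (Fin d))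

/-- The coordinates of the point `z = (p, ω)`, in the chart of `K` centred at `ω`. -/
def coordOf (z : Mink n × K) : Coord n d :=
  (z.1, extChartAt 𝓘(ℝ, EuclideanSpace ℝ (Fin d)) z.2 z.2)

variable (n d K) in
/-- `(0,2)`-tensor fields on `ℝ^{1+n} × K` (not necessarily regular or symmetric). -/
abbrev TensorField : Type _ :=
  ∀ z : Mink n × K,
    TangentSpace (model n d) z →L[ℝ] TangentSpace (model n d) z →L[ℝ] ℝ

/-- The tensor field `u` is of class `C^r` on `ℝ^{1+n} × K`. -/
def TensorField.IsCk [IsManifold 𝓘(ℝ, EuclideanSpace ℝ (Fin d)) ∞ K]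
    (u : TensorField n d K) (r : WithTop ℕ∞) : Prop :=
  ContMDiff (model n d)
    ((model n d).prod
      𝓘(ℝ, (Mink n × EuclideanSpace ℝ (Fin d)) →L[ℝ]
        (Mink n × EuclideanSpace ℝ (Fin d)) →L[ℝ] ℝ)) r
    (fun z : Mink n × K =>
      TotalSpace.mk' ((Mink n × EuclideanSpace ℝ (Fin d)) →L[ℝ]
        (Mink n × EuclideanSpace ℝ (Fin d)) →L[ℝ] ℝ) z (u z))

/-- The components `u_{μν}` in the coordinates given by the chart of `K` centred at `c`. -/
def TensorField.comp (u : TensorField n d K) (c : K) : Comp n d 2 :=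
  fun q a =>
    u (q.1, (extChartAt 𝓘(ℝ, EuclideanSpace ℝ (Fin d)) c).symm q.2)
      (frame c q (a 0)) (frame c q (a 1))

variable (d K) in
/-- Smooth Riemannian metrics on `K`. -/
abbrev RMetric [IsManifold 𝓘(ℝ, EuclideanSpace ℝ (Fin d)) ∞ K] : Type _ :=
  ContMDiffRiemannianMetric 𝓘(ℝ, EuclideanSpace ℝ (Fin d)) ∞ (EuclideanSpace ℝ (Fin d))
    (fun x : K => TangentSpace 𝓘(ℝ, EuclideanSpace ℝ (Fin d)) x)

variable [IsManifold 𝓘(ℝ, EuclideanSpace ℝ (Fin d)) ∞ K]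

/-- The components `k_{AB}` of the metric of `K` in the chart centred at `c`. -/
def gram (g : RMetric d K) (c : K) (y : EuclideanSpace ℝ (Fin d)) :
    Matrix (Fin d) (Fin d) ℝ :=
  Matrix.of fun A B =>
    g.inner ((extChartAt 𝓘(ℝ, EuclideanSpace ℝ (Fin d)) c).symm y) (intVec c y A) (intVec c y B)

/-- The components of the product Lorentzian metric `η + k`. -/
def prodMetric (g : RMetric d K) (c : K) (q : Coord n d) : Matrix (Idx n d) (Idx n d) ℝ :=
  Matrix.fromBlocks (eta n) 0 0 (gram g c q.2)

/-- The components of the Riemannian metric `g_E = (η + k) + 2 dt ⊗ dt`. -/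
def euclMetric (g : RMetric d K) (c : K) (q : Coord n d) : Matrix (Idx n d) (Idx n d) ℝ :=
  prodMetric g c q + 2 • Matrix.single (Sum.inl 0) (Sum.inl 0) 1

/-! ### Norms, covariant derivatives, differential operators -/

/-- `|T|_E²` for the rank-`k` tensor with components `T` at the point with coordinates `q`. -/
def normSqE (g : RMetric d K) (c : K) (q : Coord n d) {k : ℕ}
    (T : (Fin k → Idx n d) → ℝ) : ℝ :=
  ∑ a : Fin k → Idx n d, ∑ b : Fin k → Idx n d,
    (∏ j, (euclMetric g c q)⁻¹ (a j) (b j)) * T a * T b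

/-- The coordinate partial derivative `∂_a` on scalar functions. -/
def pd (a : Idx n d) (F : Coord n d → ℝ) (q : Coord n d) : ℝ :=
  fderiv ℝ F q (basisVec a)

/-- The Christoffel symbols `Γ^e_{ab}` of the product metric `η + k`. -/
def christoffel (g : RMetric d K) (c : K) (q : Coord n d) (e a b : Idx n d) : ℝ :=
  (1 / 2) * ∑ h, (prodMetric g c q)⁻¹ e h *
    (pd a (fun q' => prodMetric g c q' h b) q + pd b (fun q' => prodMetric g c q' h a) q
      - pd h (fun q' => prodMetric g c q' a b) q)

/-- The covariant derivative (Levi-Civita connection of `η + k`) of a covariant tensor field of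
rank `k`; the differentiation index is put first. -/
def covDeriv (g : RMetric d K) (c : K) {k : ℕ} (T : Comp n d k) : Comp n d (k + 1) :=
  fun q a =>
    pd (a 0) (fun q' => T q' (Fin.tail a)) q
      - ∑ j : Fin k, ∑ e, christoffel g c q e (a 0) (a j.succ) *
          T q (Function.update (Fin.tail a) j e)

/-- The `k`-fold covariant derivative of a `(0,2)`-tensor field. -/
def covDerivIter (g : RMetric d K) (c : K) (T : Comp n d 2) : (k : ℕ) → Comp n d (2 + k)
  | 0 => T
  | k + 1 => covDeriv g c (covDerivIter g c T k)

/-- The Laplacian `k^{AB} ∇_A ∇_B` of the internal manifold, on `(0,2)`-tensor fields of the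
product (the internal and the product connections agree in internal directions). -/
def intLaplacian (g : RMetric d K) (c : K) (T : Comp n d 2) : Comp n d 2 :=
  fun q a => ∑ A : Fin d, ∑ B : Fin d,
    (gram g c q.2)⁻¹ A B *
      covDeriv g c (covDeriv g c T) q (Fin.cons (Sum.inr A) (Fin.cons (Sum.inr B) a))

/-- The derivative of a tensor field along a vector field `V` of Minkowski space.  As Minkowski
space is flat this differentiates the components in Cartesian coordinates on `ℝ^{1+n}` (it is
`∇_V`). -/
def alongMink {k : ℕ} (V : Mink n → Mink n) (T : Comp n d k) : Comp n d k :=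
  fun q a => fderiv ℝ (fun p => T (p, q.2) a) q.1 (V q.1)

/-- `Z^I = Z_{i_k} ∘ ⋯ ∘ Z_{i_1}` for a multi-index `I = (i_1, …, i_k)`. -/
def genPow {m k : ℕ} (I : Fin k → GenIndex n) (T : Comp n d m) : Comp n d m :=
  (List.ofFn I).foldl (fun S i => alongMink (genField i) S) T

/-- `|u|_E` at the point `z`. -/
def normE (g : RMetric d K) (u : TensorField n d K) (z : Mink n × K) : ℝ :=
  Real.sqrt (normSqE g z.2 (coordOf z) (u.comp z.2 (coordOf z)))

/-- `|∇^k u|_E` at the point `z`, with `∇` the Levi-Civita connection of `η + k`. -/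
def normCovDeriv (g : RMetric d K) (u : TensorField n d K) (k : ℕ) (z : Mink n × K) : ℝ :=
  Real.sqrt (normSqE g z.2 (coordOf z) (covDerivIter g z.2 (u.comp z.2) k (coordOf z)))

/-- `u` depends only on the Minkowski coordinates: its covariant derivatives in the internal
directions vanish. -/
def DependsOnlyOnMink (g : RMetric d K) (u : TensorField n d K) : Prop :=
  ∀ (z : Mink n × K) (A : Fin d) (a : Fin 2 → Idx n d),
    covDeriv g z.2 (u.comp z.2) (coordOf z) (Fin.cons (Sum.inr A) a) = 0

/-- `|Y_i Z^I Δ^j u|_E²` at the point `z`, with `Δ` the internal Laplacian. -/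
def termSq (g : RMetric d K) (u : TensorField n d K) (i : Fin n) {k : ℕ}
    (I : Fin k → GenIndex n) (j : ℕ) (z : Mink n × K) : ℝ :=
  normSqE g z.2 (coordOf z)
    (alongMink (hypField i) (genPow I ((intLaplacian g z.2)^[j] (u.comp z.2))) (coordOf z))

/-! ### The Riemannian volume of `K` and the integral norms on hyperboloids -/

section Volume

variable (d K) in
/-- A smooth partition of unity of `K` subordinate to the chart domains. -/
def chartPartition [T2Space K] [CompactSpace K] :
    SmoothPartitionOfUnity K 𝓘(ℝ, EuclideanSpace ℝ (Fin d)) K univ :=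
  (SmoothPartitionOfUnity.exists_isSubordinate_chartAt_source
    𝓘(ℝ, EuclideanSpace ℝ (Fin d)) K).choose

/-- The Riemannian volume measure of `K`: `∫ F dμ = ∑_c ∫ (ρ_c F) (det k_{AB})^{1/2} dy`, the
`c`-th integral being over the chart centred at `c`, where `ρ` is a partition of unity subordinate
to the charts.  (The measure does not depend on `ρ`.) -/
def riemVolume [T2Space K] [CompactSpace K] [MeasurableSpace K]
    (g : RMetric d K) : Measure K :=
  Measure.sum fun c : K =>
    ((volume.restrict (extChartAt 𝓘(ℝ, EuclideanSpace ℝ (Fin d)) c).target).withDensity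
      fun y => ENNReal.ofReal
        (chartPartition d K c ((extChartAt 𝓘(ℝ, EuclideanSpace ℝ (Fin d)) c).symm y)
          * Real.sqrt (gram g c y).det)).map
      (extChartAt 𝓘(ℝ, EuclideanSpace ℝ (Fin d)) c).symm

/-- `∑_{|I| + 2j ≤ N} ∑_i ∫_{Σ_s × K, |x| ≤ t - 1} |Y_i Z^I Δ^j u|_E² dx dμ`, where `Σ_s` is
parametrised by `x ∈ ℝⁿ` and carries the flat volume form `dx`. -/
def hypEnergy [T2Space K] [CompactSpace K] [MeasurableSpace K]
    (g : RMetric d K) (u : TensorField n d K) (N : ℕ) (s : ℝ) : ℝ≥0∞ :=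
  ∑ kj ∈ (Finset.range (N + 1) ×ˢ Finset.range (N + 1)).filter
      (fun kj : ℕ × ℕ => kj.1 + 2 * kj.2 ≤ N),
    ∑ I : Fin kj.1 → GenIndex n, ∑ i : Fin n,
      ∫⁻ x in {x : EuclideanSpace ℝ (Fin n) | ‖x‖ ≤ (hypPoint s x) 0 - 1},
        ∫⁻ w : K, ENNReal.ofReal (termSq g u i I kj.2 (hypPoint s x, w)) ∂(riemVolume g)

end Volume

end Manifold

/-- The smallest even integer larger than `d / 2`. -/
def dTilde (d : ℕ) : ℕ := sInf {m : ℕ | Even m ∧ (d : ℝ) / 2 < m}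

/-- The smallest integer greater than `n / 2 + dTilde d`. -/
def nuTilde (n d : ℕ) : ℕ := sInf {m : ℕ | (n : ℝ) / 2 + dTilde d < m}

/-- The decay rate `(n - 2) / 4`. -/
def decayRate (n : ℕ) : ℝ := ((n : ℝ) - 2) / 4

/-- In hyperboloidal coordinates `Y_i` is the coordinate vector field `∂_{y^i}`. -/
theorem hasDerivAt_hypPoint {n : ℕ} {s : ℝ} (hs : 0 < s) (y : EuclideanSpace ℝ (Fin n))
    (i : Fin n) :
    HasDerivAt (fun e : ℝ => hypPoint s (y + e • EuclideanSpace.single i (1 : ℝ)))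
      (hypField i (hypPoint s y)) 0 := by
  have hn : ∀ e : ℝ, ‖y + e • EuclideanSpace.single i (1 : ℝ)‖ ^ 2
      = ‖y‖ ^ 2 + 2 * e * y i + e ^ 2 := by
    intro e
    rw [norm_add_sq_real, inner_smul_right, EuclideanSpace.inner_single_right, norm_smul]
    simp
    ring
  have hpos : 0 < s ^ 2 + ‖y‖ ^ 2 := by positivity
  rw [hasDerivAt_iff_hasFDerivAt, ← hasFDerivWithinAt_univ, hasFDerivWithinAt_euclidean]
  intro k
  rw [hasFDerivWithinAt_univ]
  refine Fin.cases ?_ (fun k => ?_) k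
  · have h1 : HasDerivAt (fun e : ℝ => s ^ 2 + (‖y‖ ^ 2 + 2 * e * y i + e ^ 2)) (2 * y i) 0 := by
      have h2 := ((((hasDerivAt_id (0 : ℝ)).const_mul 2).mul_const (y i)).const_add
        (‖y‖ ^ 2)).add ((hasDerivAt_id (0 : ℝ)).pow 2)
      have h3 := h2.const_add (s ^ 2)
      simpa using h3
    have h4 := h1.sqrt (by simpa using hpos.ne')
    refine (hasDerivAt_iff_hasFDerivAt.mp (h4.congr_of_eventuallyEq
      (Filter.Eventually.of_forall fun e => ?_))).congr_fderiv ?_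
    · simp [hypPoint, hn]
    · ext
      simp [hypPoint, hypField, coordVec]
      field_simp
  · have h1 : ∀ a : ℝ, HasDerivAt (fun e : ℝ => y k + e * a) a 0 := fun a => by
      have h2 := ((hasDerivAt_id (0 : ℝ)).mul_const a).const_add (y k)
      rwa [one_mul] at h2
    refine (hasDerivAt_iff_hasFDerivAt.mp ((h1 ((EuclideanSpace.single i (1 : ℝ) :
      EuclideanSpace ℝ (Fin n)) k)).congr_of_eventuallyEq
      (Filter.Eventually.of_forall fun e => ?_))).congr_fderiv ?_
    · simp [hypPoint]
    · ext
      simp [hypField, coordVec]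

end HypSobolev

end

/-! The time weight is won along the hyperboloid, the supremum over `K` by elliptic estimates in the
compact directions, and the two are treated separately. Put R = (s² - 1)/2; on Σ_s the region |x| ≤
t - 1 is the ball |x| ≤ R.

For |x| ≥ R the field equals f and t ≤ |x| + 1, so the decay of f gives t^(n-2)|u|² ≲ |x|⁻¹ C₀²,
with |x| bounded below in terms of s₀.

For |x| ≤ R fix a point of `K` and regard a component of u as a function of x on Σ_s. Around x₀, at
time t₀, take a ball of radius ρ = κt₀ inside |x| ≤ R that contains x₀. There t is comparable to t₀,
and the boosts are t·Y_i, so after rescaling to the unit ball, derivatives are dominated by boosts.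
Sobolev's inequality of order ν > n/2 then bounds |u(x₀)|² by ρ^(-n) times squared L² norms of boost
derivatives. A term with at least one boost has the form t Y_i Z^I u and costs t₀² times an energy,
in total t₀^(2-n). The term without derivatives is handled by a Hardy inequality along rays reaching
the sphere |x| = R, where u = f; this is where n ≥ 4 enters (`lintegral_sq_le_of_boundary`). Thus
t^(n-2)|u|² is bounded by energies of Y_i Z^I u plus C₀² (`exists_hyperboloid_sobolev`). Since 4δ =
n - 2, s ≤ t, 2δ ≤ n - 2 and t ≥ 1, both assertions follow.

So far the integrals live over one fixed point of `K`. They are replaced by integrals over `K`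
through an interior estimate: |v(y)|² is bounded by the squared L² norms of v, Δv, …, Δ^M v, with 2M
the even integer above d/2 (`exists_elliptic_sup_bound`). It is applied to v = Y_i Z^I u; these
derivatives commute with Δ because the geometry of `K` does not depend on (t, x)
(`alongMink_intLaplacian`). With |I| ≤ ν - 1 and j ≤ M the total order of Y_i Z^I Δ^j is at most ν +
2M, so every derivative that is used exists.

Both Sobolev estimates come from one mechanism, `exists_sq_le_of_potential_bound`: a pointwise bound
by Riesz potentials is iterated until the composed kernel is locally square integrable, and then
Cauchy–Schwarz applies. On the ball the potential bound is the fundamental theorem of calculus along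
segments. For the Laplacian, a system with scalar principal part, it comes from a Levi parametrix
with coefficients frozen at the pole (`exists_levi_step`).

Norms and the Laplacian are given at each point in the chart centred at that point, while the
analysis takes place in one fixed chart. The change of chart is justified by tensorial covariance of
components, Christoffel symbols, covariant derivatives and Laplacian (`termSq_eq`). -/

noncomputable section

namespace HypSobolev

/-! ### Riesz potentials -/

section Potential

/-- Euclidean space of dimension `D`. -/
abbrev Euc (D : ℕ) : Type := EuclideanSpace ℝ (Fin D)

/-- The Riesz kernel `‖z‖^(a - D)` on `ℝ^D`. -/
def rieszKer {D : ℕ} (a : ℝ) (z : Euc D) : ℝ≥0∞ := ENNReal.ofReal ‖z‖ ^ (a - D)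

variable {D : ℕ}

theorem measurable_rieszKer (a : ℝ) : Measurable (rieszKer a : Euc D → ℝ≥0∞) := by
  unfold rieszKer
  fun_prop

theorem rieszKer_neg (a : ℝ) (z : Euc D) : rieszKer a (-z) = rieszKer a z := by
  simp [rieszKer]

theorem rieszKer_sub_comm (a : ℝ) (x y : Euc D) : rieszKer a (x - y) = rieszKer a (y - x) := by
  rw [← rieszKer_neg, neg_sub]

theorem rieszKer_smul (a : ℝ) {r : ℝ} (hr : 0 < r) (z : Euc D) :
    rieszKer a (r • z) = ENNReal.ofReal r ^ (a - D) * rieszKer a z := by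
  rcases eq_or_ne z 0 with rfl | hz
  · have h : ENNReal.ofReal r ≠ 0 := by simpa using hr
    have h1 : ENNReal.ofReal r ^ (a - D) ≠ 0 := by
      simp [ENNReal.rpow_eq_zero_iff, hr]
    simp only [rieszKer, smul_zero, norm_zero, ENNReal.ofReal_zero]
    rcases lt_trichotomy (a - D) 0 with h2 | h2 | h2
    · rw [ENNReal.zero_rpow_of_neg h2, ENNReal.mul_top h1]
    · rw [h2]; simp
    · rw [ENNReal.zero_rpow_of_pos h2, mul_zero]
  · have hz' : 0 < ‖z‖ := norm_pos_iff.mpr hz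
    rw [rieszKer, norm_smul, Real.norm_of_nonneg hr.le, ENNReal.ofReal_mul hr.le,
      ENNReal.mul_rpow_of_ne_zero (by simpa using hr) (by simpa using hz), rieszKer]

theorem lintegral_smul_euc {r : ℝ} (hr : 0 < r) (f : Euc D → ℝ≥0∞) :
    ∫⁻ z, f (r • z) = ENNReal.ofReal r ^ (-(D : ℝ)) * ∫⁻ z, f z := by
  have h := Measure.map_addHaar_smul (volume : Measure (Euc D)) hr.ne'
  have he : MeasurableEmbedding (fun z : Euc D => r • z) :=
    (Homeomorph.smulOfNeZero r hr.ne').measurableEmbedding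
  have h2 := he.lintegral_map f (μ := (volume : Measure (Euc D)))
  rw [← h2, h, lintegral_smul_measure, finrank_euclideanSpace_fin, smul_eq_mul,
    abs_of_pos (by positivity), ENNReal.rpow_neg, ENNReal.rpow_natCast,
    ENNReal.ofReal_inv_of_pos (by positivity), ENNReal.ofReal_pow hr.le]

/-- In polar coordinates the integrand is r^(a-1) (1+r)^(b-D): near 0 it is integrable since a > 0,
at infinity since a + b < D. -/
theorem lintegral_rieszKer_mul_lt_top [NeZero D] {a b : ℝ} (ha : 0 < a)
    (hab : a + b < D) :
    ∫⁻ z : Euc D, rieszKer a z * ENNReal.ofReal (1 + ‖z‖) ^ (b - D) < ⊤ := by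
  have hD : 0 < D := Nat.pos_of_ne_zero (NeZero.ne D)
  have key : Integrable (fun z : Euc D => ‖z‖ ^ (a - D) * (1 + ‖z‖) ^ (b - D)) := by
    refine (integrable_fun_norm_addHaar (volume : Measure (Euc D))
      (f := fun r => r ^ (a - D) * (1 + r) ^ (b - D))).mpr ?_
    rw [finrank_euclideanSpace_fin]
    have hform : ∀ y : ℝ, 0 < y → y ^ (D - 1) • (y ^ (a - D) * (1 + y) ^ (b - D))
        = y ^ (a - 1) * (1 + y) ^ (b - D) := by
      intro y hy
      rw [smul_eq_mul, ← mul_assoc, ← Real.rpow_natCast, ← Real.rpow_add hy, Nat.cast_sub hD]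
      congr 2
      push_cast
      ring
    rw [integrableOn_congr_fun (g := fun y : ℝ => y ^ (a - 1) * (1 + y) ^ (b - D))
      (fun (y : ℝ) (hy : y ∈ Ioi (0 : ℝ)) => hform y hy) measurableSet_Ioi,
      ← Ioc_union_Ioi_eq_Ioi (zero_le_one' ℝ)]
    have hmeas : ∀ s : Set ℝ, AEStronglyMeasurable
        (fun y : ℝ => y ^ (a - 1) * (1 + y) ^ (b - D)) (volume.restrict s) := fun s =>
      (by fun_prop : Measurable (fun y : ℝ => y ^ (a - 1) * (1 + y) ^ (b - D))).aestronglyMeasurable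
    refine IntegrableOn.union ?_ ?_
    · have h1 : IntegrableOn (fun y : ℝ => y ^ (a - 1)) (Ioc 0 1) := by
        rw [← intervalIntegrable_iff_integrableOn_Ioc_of_le zero_le_one]
        exact intervalIntegral.intervalIntegrable_rpow' (by linarith)
      refine Integrable.mono' h1 (hmeas _) ?_
      filter_upwards [ae_restrict_mem measurableSet_Ioc] with y hy
      have h0 : 0 ≤ y ^ (a - 1) := Real.rpow_nonneg hy.1.le _
      rw [Real.norm_of_nonneg (mul_nonneg h0 (Real.rpow_nonneg (by linarith [hy.1]) _))]
      refine mul_le_of_le_one_right h0 ?_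
      exact Real.rpow_le_one_of_one_le_of_nonpos (by linarith [hy.1]) (by linarith)
    · have h1 : IntegrableOn (fun y : ℝ => y ^ (a + b - D - 1)) (Ioi 1) :=
        integrableOn_Ioi_rpow_of_lt (by linarith) zero_lt_one
      refine Integrable.mono' h1 (hmeas _) ?_
      filter_upwards [ae_restrict_mem measurableSet_Ioi] with y hy
      have hy0 : 0 < y := lt_trans zero_lt_one hy
      have h0 : 0 ≤ y ^ (a - 1) := Real.rpow_nonneg hy0.le _
      rw [Real.norm_of_nonneg (mul_nonneg h0 (Real.rpow_nonneg (by linarith) _)),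
        show a + b - D - 1 = (a - 1) + (b - D) by ring, Real.rpow_add hy0]
      refine mul_le_mul_of_nonneg_left ?_ h0
      exact Real.rpow_le_rpow_of_nonpos hy0 (by linarith) (by linarith)
  refine lt_of_eq_of_lt (lintegral_congr_ae ?_) key.lintegral_lt_top
  have : ∀ᵐ z : Euc D, z ≠ 0 := by
    simp [ae_iff]
  filter_upwards [this] with z hz
  have hz' : 0 < ‖z‖ := norm_pos_iff.mpr hz
  rw [rieszKer, ENNReal.ofReal_mul (by positivity), ENNReal.ofReal_rpow_of_pos hz',
    ENNReal.ofReal_rpow_of_pos (by positivity)]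

/-- Where z is nearer to x than to y, the triangle inequality gives |x-y| + |z-x| ≤ 3|z-y|, so the
second kernel is harmless. Translating x to 0 and scaling by |x-y| produces the power |x-y|^(a+b-D)
times a fixed convergent integral. -/
theorem exists_rieszKer_half_comp [NeZero D] {a b : ℝ} (ha : 0 < a)
    (hab : a + b < D) : ∃ C : ℝ≥0, ∀ x y : Euc D, x ≠ y →
      ∫⁻ z in {z | ‖z - x‖ ≤ ‖z - y‖}, rieszKer a (x - z) * rieszKer b (z - y)
        ≤ C * rieszKer (a + b) (x - y) := by
  set I := ∫⁻ z : Euc D, rieszKer a z * ENNReal.ofReal (1 + ‖z‖) ^ (b - D) with hI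
  have hIlt : I < ⊤ := lintegral_rieszKer_mul_lt_top ha hab
  have h3 : (3 : ℝ≥0∞) ^ ((D : ℝ) - b) ≠ ⊤ := by
    apply ENNReal.rpow_ne_top_of_nonneg (by linarith) (by simp)
  have h3' : (3 : ℝ≥0∞) ^ ((D : ℝ) - b) ≠ 0 := by
    rw [Ne, ENNReal.rpow_eq_zero_iff]
    simp
  refine ⟨((3 : ℝ≥0∞) ^ (D - b) * I).toNNReal, fun x y hxy => ?_⟩
  rw [ENNReal.coe_toNNReal (ENNReal.mul_ne_top h3 hIlt.ne)]
  set ρ := ‖x - y‖ with hρ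
  have hρ0 : 0 < ρ := norm_pos_iff.mpr (sub_ne_zero.mpr hxy)
  have hpt : ∀ z ∈ {z | ‖z - x‖ ≤ ‖z - y‖}, rieszKer a (x - z) * rieszKer b (z - y)
      ≤ 3 ^ (D - b) * (rieszKer a (z - x) * ENNReal.ofReal (ρ + ‖z - x‖) ^ (b - D)) := by
    intro z hz
    have hz' : ‖z - x‖ ≤ ‖z - y‖ := hz
    have h1 : ρ ≤ ‖z - x‖ + ‖z - y‖ := by
      rw [hρ, show x - y = -(z - x) + (z - y) by abel]
      exact (norm_add_le _ _).trans (by rw [norm_neg])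
    have h2 : ρ + ‖z - x‖ ≤ 3 * ‖z - y‖ := by linarith
    rw [rieszKer_sub_comm a x z, mul_left_comm]
    gcongr
    rw [rieszKer, show b - (D : ℝ) = -(D - b) by ring, ENNReal.rpow_neg, ENNReal.rpow_neg,
      ENNReal.inv_le_iff_inv_le, ENNReal.mul_inv (Or.inl h3') (Or.inl h3), inv_inv]
    · rw [← ENNReal.div_eq_inv_mul]
      refine ENNReal.div_le_of_le_mul' ?_
      rw [← ENNReal.mul_rpow_of_nonneg _ _ (by linarith : (0:ℝ) ≤ D - b)]
      refine ENNReal.rpow_le_rpow ?_ (by linarith)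
      rw [show (3 : ℝ≥0∞) = ENNReal.ofReal 3 by simp, ← ENNReal.ofReal_mul (by norm_num)]
      exact ENNReal.ofReal_le_ofReal h2
  calc _ ≤ ∫⁻ z in {z | ‖z - x‖ ≤ ‖z - y‖}, 3 ^ (D - b) *
          (rieszKer a (z - x) * ENNReal.ofReal (ρ + ‖z - x‖) ^ (b - D)) :=
        setLIntegral_mono' (measurableSet_le (by fun_prop) (by fun_prop)) hpt
    _ ≤ ∫⁻ z, 3 ^ (D - b) *
          (rieszKer a (z - x) * ENNReal.ofReal (ρ + ‖z - x‖) ^ (b - D)) :=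
        setLIntegral_le_lintegral _ _
    _ = 3 ^ (D - b) * ∫⁻ z : Euc D, rieszKer a z * ENNReal.ofReal (ρ + ‖z‖) ^ (b - D) := by
        rw [lintegral_const_mul' _ _ h3]
        congr 1
        exact lintegral_sub_right_eq_self
          (fun z : Euc D => rieszKer a z * ENNReal.ofReal (ρ + ‖z‖) ^ (b - D)) x
    _ = 3 ^ (D - b) * (ENNReal.ofReal ρ ^ (D : ℝ) * ∫⁻ z : Euc D,
          rieszKer a (ρ • z) * ENNReal.ofReal (ρ + ‖ρ • z‖) ^ (b - D)) := by
        rw [lintegral_smul_euc hρ0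
          (fun z => rieszKer a z * ENNReal.ofReal (ρ + ‖z‖) ^ (b - D)), ← mul_assoc
          (ENNReal.ofReal ρ ^ (D : ℝ)), ← ENNReal.rpow_add _ _ (by simpa using hρ0) (by simp)]
        simp
    _ = 3 ^ (D - b) * (ENNReal.ofReal ρ ^ (D : ℝ) * ∫⁻ z : Euc D,
          ENNReal.ofReal ρ ^ (a - D) * ENNReal.ofReal ρ ^ (b - D) *
            (rieszKer a z * ENNReal.ofReal (1 + ‖z‖) ^ (b - D))) := by
        congr 3
        funext z
        rw [rieszKer_smul a hρ0, norm_smul, Real.norm_of_nonneg hρ0.le,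
          show ρ + ρ * ‖z‖ = ρ * (1 + ‖z‖) by ring, ENNReal.ofReal_mul hρ0.le,
          ENNReal.mul_rpow_of_ne_top (by simp) (by simp)]
        ring
    _ = 3 ^ (D - b) * I * rieszKer (a + b) (x - y) := by
        have hfin : ∀ c : ℝ, ENNReal.ofReal ρ ^ c ≠ ⊤ := fun c => by
          rw [ENNReal.ofReal_rpow_of_pos hρ0]; simp
        rw [lintegral_const_mul' _ _ (ENNReal.mul_ne_top (hfin _) (hfin _)), ← hI, rieszKer,
          ← hρ, show a + b - (D : ℝ) = D + ((a - D) + (b - D)) by ring,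
          ENNReal.rpow_add _ _ (by simpa using hρ0) (by simp),
          ENNReal.rpow_add _ _ (by simpa using hρ0) (by simp)]
        ring

/-- Composition of Riesz kernels. -/
theorem exists_rieszKer_comp [NeZero D] {a b : ℝ} (ha : 0 < a) (hb : 0 < b) (hab : a + b < D) :
    ∃ C : ℝ≥0, ∀ x y : Euc D, x ≠ y →
      ∫⁻ z, rieszKer a (x - z) * rieszKer b (z - y) ≤ C * rieszKer (a + b) (x - y) := by
  obtain ⟨C₁, h₁⟩ := exists_rieszKer_half_comp (D := D) ha hab
  obtain ⟨C₂, h₂⟩ := exists_rieszKer_half_comp (D := D) (a := b) (b := a) hb (by linarith)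
  refine ⟨C₁ + C₂, fun x y hxy => ?_⟩
  -- Split according to which pole is nearer; the second half is the first with the roles of (x, a)
  -- and (y, b) exchanged.
  have hcover : (univ : Set (Euc D)) ⊆ {z | ‖z - x‖ ≤ ‖z - y‖} ∪ {z | ‖z - y‖ ≤ ‖z - x‖} :=
    fun z _ => le_total ‖z - x‖ ‖z - y‖
  calc _ ≤ ∫⁻ z in {z | ‖z - x‖ ≤ ‖z - y‖} ∪ {z | ‖z - y‖ ≤ ‖z - x‖},
            rieszKer a (x - z) * rieszKer b (z - y) := by
          rw [← setLIntegral_univ]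
          exact lintegral_mono_set hcover
    _ ≤ (∫⁻ z in {z | ‖z - x‖ ≤ ‖z - y‖}, rieszKer a (x - z) * rieszKer b (z - y)) +
          ∫⁻ z in {z | ‖z - y‖ ≤ ‖z - x‖}, rieszKer a (x - z) * rieszKer b (z - y) :=
        lintegral_union_le _ _ _
    _ ≤ C₁ * rieszKer (a + b) (x - y) + C₂ * rieszKer (a + b) (x - y) := by
        gcongr
        · exact h₁ x y hxy
        · refine le_trans (le_of_eq ?_) ((h₂ y x hxy.symm).trans_eq ?_)
          · refine lintegral_congr fun z => ?_
            rw [rieszKer_sub_comm a, rieszKer_sub_comm b, mul_comm]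
          · rw [rieszKer_sub_comm, add_comm b a]
    _ = _ := by push_cast; ring

/-- On a bounded set a kernel of higher order is dominated by one of lower order. This allows orders
to be lowered so that all kernels match. -/
theorem rieszKer_le_of_le {a b R : ℝ} (hab : a ≤ b) {z : Euc D} (h0 : z ≠ 0) (hz : ‖z‖ ≤ R) :
    rieszKer b z ≤ ENNReal.ofReal R ^ (b - a) * rieszKer a z := by
  rw [rieszKer, show b - (D : ℝ) = (b - a) + (a - D) by ring,
    ENNReal.rpow_add _ _ (by simpa using h0) (by simp), rieszKer]
  gcongr

theorem lintegral_ball_rieszKer_lt_top [NeZero D] {a R : ℝ} (ha : 0 < a) :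
    ∫⁻ z in {z : Euc D | ‖z‖ ≤ R}, rieszKer a z < ⊤ := by
  have hD : 0 < (D : ℝ) := Nat.cast_pos.mpr (Nat.pos_of_ne_zero (NeZero.ne D))
  -- Any b with a + b < D and b ≤ D would do: the weight (1+|z|)^(b-D) makes the integral over all
  -- space converge and is bounded below on the ball.
  set b : ℝ := min 0 (D - a) - 1
  have hb0 : b ≤ -1 := by simp [b]
  have hb1 : b ≤ D - a - 1 := by simp [b]
  have h := lintegral_rieszKer_mul_lt_top (D := D) (b := b) ha (by linarith)
  have hR : (ENNReal.ofReal (1 + |R|)) ^ ((D : ℝ) - b) < ⊤ :=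
    ENNReal.rpow_lt_top_of_nonneg (by linarith) (by simp)
  refine lt_of_le_of_lt ?_ (ENNReal.mul_lt_top hR h)
  rw [← lintegral_const_mul' _ _ hR.ne]
  refine le_trans (setLIntegral_mono' (measurableSet_le (by fun_prop) (by fun_prop)) ?_)
    (setLIntegral_le_lintegral _ _)
  intro z hz
  have hz' : ‖z‖ ≤ |R| := le_trans hz (le_abs_self R)
  have h1 : 1 ≤ ENNReal.ofReal (1 + |R|) ^ (D - b) * ENNReal.ofReal (1 + ‖z‖) ^ (b - D) := by
    rw [ENNReal.ofReal_rpow_of_pos (by positivity), ENNReal.ofReal_rpow_of_pos (by positivity),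
      ← ENNReal.ofReal_mul (by positivity), ENNReal.one_le_ofReal,
      show b - (D : ℝ) = -(D - b) by ring, Real.rpow_neg (by positivity), ← div_eq_mul_inv,
      one_le_div (by positivity)]
    exact Real.rpow_le_rpow (by positivity) (by linarith) (by linarith)
  calc rieszKer a z = 1 * rieszKer a z := (one_mul _).symm
    _ ≤ _ := mul_le_mul_left h1 _
    _ = _ := by ring

theorem ae_ne_euc [NeZero D] (x : Euc D) : ∀ᵐ y : Euc D, x ≠ y := by
  rw [ae_iff]
  simp

/-- Tonelli and the composition of kernels: a potential of order a of something bounded by a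
potential of order c is bounded by a potential of order a + c. The null set y = x, where composition
is not controlled, is discarded. -/
theorem exists_lintegral_rieszKer_comp_le [NeZero D] {a c : ℝ} (ha : 0 < a) (hc : 0 < c)
    (hac : a + c < D) (B : ℝ≥0) : ∃ C : ℝ≥0, ∀ (Ω Ω' : Set (Euc D)), MeasurableSet Ω →
      ∀ θ Φ : Euc D → ℝ≥0∞, Measurable Φ →
      (∀ z ∈ Ω, θ z ≤ B * ∫⁻ y in Ω', rieszKer c (z - y) * Φ y) → ∀ x,
      ∫⁻ z in Ω, rieszKer a (x - z) * θ z ≤ C * ∫⁻ y in Ω', rieszKer (a + c) (x - y) * Φ y := by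
  obtain ⟨C, hC⟩ := exists_rieszKer_comp (D := D) ha hc hac
  refine ⟨B * C, fun Ω Ω' hΩ θ Φ hΦ hθ x => ?_⟩
  have hma := measurable_rieszKer (D := D) a
  have hmc := measurable_rieszKer (D := D) c
  calc ∫⁻ z in Ω, rieszKer a (x - z) * θ z
      ≤ ∫⁻ z in Ω, B * ∫⁻ y in Ω', rieszKer a (x - z) * (rieszKer c (z - y) * Φ y) := by
        refine setLIntegral_mono' hΩ fun z hz => ?_
        rw [lintegral_const_mul _ (by fun_prop), mul_left_comm]
        gcongr
        exact hθ z hz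
    _ = B * ∫⁻ z in Ω, ∫⁻ y in Ω', rieszKer a (x - z) * (rieszKer c (z - y) * Φ y) :=
        lintegral_const_mul' _ _ (by simp)
    _ = B * ∫⁻ y in Ω', ∫⁻ z in Ω, rieszKer a (x - z) * (rieszKer c (z - y) * Φ y) := by
        rw [lintegral_lintegral_swap]
        fun_prop
    _ ≤ B * ∫⁻ y in Ω', C * (rieszKer (a + c) (x - y) * Φ y) := by
        refine mul_le_mul_right (lintegral_mono_ae ?_) _
        filter_upwards [ae_restrict_of_ae (ae_ne_euc x)] with y hy
        calc _ = ∫⁻ z in Ω, (rieszKer a (x - z) * rieszKer c (z - y)) * Φ y := by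
              simp_rw [mul_assoc]
          _ = (∫⁻ z in Ω, rieszKer a (x - z) * rieszKer c (z - y)) * Φ y :=
              lintegral_mul_const _ (by fun_prop)
          _ ≤ (C * rieszKer (a + c) (x - y)) * Φ y := by
              gcongr
              exact (setLIntegral_le_lintegral _ _).trans (hC x y hy)
          _ = _ := mul_assoc _ _ _
    _ = _ := by
        rw [lintegral_const_mul' _ _ (by simp)]
        push_cast
        ring

/-- Cauchy–Schwarz: the square of the kernel of order a is the kernel of order 2a - D, which is
locally integrable exactly because 2a > D. -/
theorem lintegral_rieszKer_mul_sq_le [NeZero D] {a : ℝ} (ha : (D : ℝ) < 2 * a) (R : ℝ) :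
    ∃ C : ℝ≥0, ∀ (Ω : Set (Euc D)) (x : Euc D), MeasurableSet Ω → (∀ y ∈ Ω, ‖x - y‖ ≤ R) →
      ∀ Φ : Euc D → ℝ≥0∞, Measurable Φ →
      (∫⁻ y in Ω, rieszKer a (x - y) * Φ y) ^ 2 ≤ C * ∫⁻ y in Ω, Φ y ^ 2 := by
  have hfin : ∫⁻ z in {z : Euc D | ‖z‖ ≤ R}, rieszKer (2 * a - D) z < ⊤ :=
    lintegral_ball_rieszKer_lt_top (by linarith)
  refine ⟨(∫⁻ z in {z : Euc D | ‖z‖ ≤ R}, rieszKer (2 * a - D) z).toNNReal, ?_⟩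
  intro Ω x hΩ hR Φ hΦ
  rw [ENNReal.coe_toNNReal hfin.ne]
  have hma := measurable_rieszKer (D := D) a
  have hsq : ∀ z : Euc D, rieszKer a z ^ 2 = rieszKer (2 * a - D) z := fun z => by
    rw [rieszKer, rieszKer, ← ENNReal.rpow_natCast, ← ENNReal.rpow_mul]
    congr 1
    push_cast
    ring
  have h1 := ENNReal.lintegral_mul_le_Lp_mul_Lq (volume.restrict Ω)
    (p := 2) (q := 2) ⟨by norm_num, by norm_num, by norm_num⟩
    (f := fun y => rieszKer a (x - y)) (g := Φ) (by fun_prop) hΦ.aemeasurable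
  have h2 : ∫⁻ y in Ω, rieszKer a (x - y) ^ (2 : ℝ) ≤
      ∫⁻ z in {z : Euc D | ‖z‖ ≤ R}, rieszKer (2 * a - D) z := by
    have hm : MeasurableSet {z : Euc D | ‖z‖ ≤ R} := measurableSet_le (by fun_prop) (by fun_prop)
    rw [← lintegral_indicator hΩ, ← lintegral_indicator hm,
      ← lintegral_sub_left_eq_self (indicator {z : Euc D | ‖z‖ ≤ R} _) x]
    refine lintegral_mono fun y => ?_
    by_cases hy : y ∈ Ω
    · rw [indicator_of_mem hy, indicator_of_mem (show x - y ∈ {z : Euc D | ‖z‖ ≤ R} from hR y hy),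
        ← hsq]
      simp
    · rw [indicator_of_notMem hy]
      exact zero_le
  calc _ ≤ ((∫⁻ y in Ω, rieszKer a (x - y) ^ (2 : ℝ)) ^ (1 / 2 : ℝ) *
        (∫⁻ y in Ω, Φ y ^ (2 : ℝ)) ^ (1 / 2 : ℝ)) ^ 2 := by
        gcongr
        exact h1
    _ = (∫⁻ y in Ω, rieszKer a (x - y) ^ (2 : ℝ)) * ∫⁻ y in Ω, Φ y ^ (2 : ℝ) := by
        rw [mul_pow, ← ENNReal.rpow_natCast, ← ENNReal.rpow_natCast, ← ENNReal.rpow_mul,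
          ← ENNReal.rpow_mul]
        norm_num
    _ ≤ _ := by
        gcongr
        simp

/-- Iteration of the basic inequality: after k units of smoothing the kernel has order kb. Passing
from φ_j to φ_(j+1) costs two units, whence the constraint 2j + k ≤ 2M, which keeps all indices at
most M. Each step may enlarge the domain by one index of Ω, whence l + k ≤ 2M. -/
theorem exists_potential_bound [NeZero D] {b R : ℝ} {M : ℕ} (hb : 0 < b)
    (hlt : 2 * M * b < D) (A : ℝ≥0) : ∀ k : ℕ, 1 ≤ k → k ≤ 2 * M → ∃ C : ℝ≥0,
      ∀ Ω : ℕ → Set (Euc D), (∀ k, MeasurableSet (Ω k)) → Monotone Ω →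
      (∀ k, ∀ x ∈ Ω k, ∀ y ∈ Ω k, ‖x - y‖ ≤ R) →
      ∀ φ : ℕ → Euc D → ℝ≥0∞, (∀ j, Measurable (φ j)) →
      (∀ j < M, ∀ k < 2 * M, ∀ x ∈ Ω k, φ j x ≤ A * ∫⁻ y in Ω (k + 1),
        (rieszKer b (x - y) * φ j y + rieszKer (2 * b) (x - y) * φ (j + 1) y)) →
      ∀ j l, 2 * j + k ≤ 2 * M → l + k ≤ 2 * M → ∀ x ∈ Ω l, φ j x ≤ C * ∫⁻ y in Ω (l + k),
        rieszKer (k * b) (x - y) * ∑ i ∈ Finset.range (M + 1), φ i y := by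
  have hmono : ∀ {φ : ℕ → Euc D → ℝ≥0∞} {j : ℕ}, j ≤ M → ∀ y,
      φ j y ≤ ∑ i ∈ Finset.range (M + 1), φ i y := fun {φ j} hj y =>
    Finset.single_le_sum (f := fun i => φ i y) (fun _ _ => zero_le)
      (Finset.mem_range.mpr (by omega))
  have hm := fun a => measurable_rieszKer (D := D) a
  have hone : ∃ C : ℝ≥0,
      ∀ Ω : ℕ → Set (Euc D), (∀ k, MeasurableSet (Ω k)) → Monotone Ω →
      (∀ k, ∀ x ∈ Ω k, ∀ y ∈ Ω k, ‖x - y‖ ≤ R) →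
      ∀ φ : ℕ → Euc D → ℝ≥0∞, (∀ j, Measurable (φ j)) →
      (∀ j < M, ∀ k < 2 * M, ∀ x ∈ Ω k, φ j x ≤ A * ∫⁻ y in Ω (k + 1),
        (rieszKer b (x - y) * φ j y + rieszKer (2 * b) (x - y) * φ (j + 1) y)) →
      ∀ j l, 2 * j + 1 ≤ 2 * M → l + 1 ≤ 2 * M → ∀ x ∈ Ω l, φ j x ≤ C * ∫⁻ y in Ω (l + 1),
        rieszKer b (x - y) * ∑ i ∈ Finset.range (M + 1), φ i y := by
    have hRfin : ENNReal.ofReal R ^ (2 * b - b) ≠ ⊤ :=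
      ENNReal.rpow_ne_top_of_nonneg (by linarith) (by simp)
    refine ⟨A * (1 + (ENNReal.ofReal R ^ (2 * b - b)).toNNReal), ?_⟩
    intro Ω hΩ hmon hdiam φ hφ hyp j l hj hl x hx
    refine (hyp j (by omega) l (by omega) x hx).trans ?_
    push_cast
    rw [ENNReal.coe_toNNReal hRfin, mul_assoc]
    gcongr
    rw [← lintegral_const_mul' _ _ (by finiteness)]
    refine lintegral_mono_ae ?_
    filter_upwards [ae_restrict_of_ae (ae_ne_euc x), ae_restrict_mem (hΩ (l + 1))] with y hy hyΩ
    -- One unit of smoothing: the kernel of order 2b is weakened to order b, using the bounded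
    -- diameter.
    have h1 := rieszKer_le_of_le (by linarith : b ≤ 2 * b) (sub_ne_zero.mpr hy)
      (hdiam (l + 1) x (hmon (by omega) hx) y hyΩ)
    calc _ ≤ rieszKer b (x - y) * (∑ i ∈ Finset.range (M + 1), φ i y) +
          (ENNReal.ofReal R ^ (2 * b - b) * rieszKer b (x - y)) *
            (∑ i ∈ Finset.range (M + 1), φ i y) := by
          gcongr
          · exact hmono (φ := φ) (by omega) y
          · exact hmono (φ := φ) (by omega) y
      _ = _ := by ring
  intro k
  induction k using Nat.strong_induction_on with
  | _ k ih =>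
  intro hk1 hkM
  rcases (by omega : k = 1 ∨ 2 ≤ k) with rfl | hk2
  · simpa using hone
  obtain ⟨k, rfl⟩ := Nat.exists_eq_add_of_le hk2
  have hkb : (2 + k : ℝ) * b ≤ 2 * M * b := by
    gcongr
    exact_mod_cast hkM
  have hk0 : (0 : ℝ) ≤ k * b := by positivity
  -- To reach 2 + k units, the φ_j term (kernel b) still needs 1 + k of them and the φ_(j+1) term
  -- (kernel 2b) only k. For k = 0 the latter already has the required kernel.
  obtain ⟨B₁, hB₁⟩ := ih (1 + k) (by omega) (by omega) (by omega)
  obtain ⟨C₁, hC₁⟩ := exists_lintegral_rieszKer_comp_le (D := D) (a := b) (c := (1 + k : ℕ) * b)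
    hb (by positivity) (by push_cast; linarith) B₁
  have hsum : b + (1 + k : ℕ) * b = (2 + k : ℕ) * b := by push_cast; ring
  rw [hsum] at hC₁
  have hsecond : ∃ C₂ : ℝ≥0,
      ∀ Ω : ℕ → Set (Euc D), (∀ k, MeasurableSet (Ω k)) → Monotone Ω →
      (∀ k, ∀ x ∈ Ω k, ∀ y ∈ Ω k, ‖x - y‖ ≤ R) →
      ∀ φ : ℕ → Euc D → ℝ≥0∞, (∀ j, Measurable (φ j)) →
      (∀ j < M, ∀ k < 2 * M, ∀ x ∈ Ω k, φ j x ≤ A * ∫⁻ y in Ω (k + 1),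
        (rieszKer b (x - y) * φ j y + rieszKer (2 * b) (x - y) * φ (j + 1) y)) →
      ∀ j l, 2 * j + (2 + k) ≤ 2 * M → l + (2 + k) ≤ 2 * M → ∀ x,
        ∫⁻ y in Ω (l + 1), rieszKer (2 * b) (x - y) * φ (j + 1) y ≤ C₂ * ∫⁻ y in Ω (l + (2 + k)),
        rieszKer ((2 + k : ℕ) * b) (x - y) * ∑ i ∈ Finset.range (M + 1), φ i y := by
    rcases Nat.eq_zero_or_pos k with rfl | hk
    · refine ⟨1, ?_⟩
      intro Ω hΩ hmon hdiam φ hφ hyp j l hj hl x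
      rw [ENNReal.coe_one, one_mul]
      refine (lintegral_mono_set (hmon (by omega))).trans (lintegral_mono fun y => ?_)
      simp only [add_zero, Nat.cast_ofNat]
      gcongr
      exact hmono (φ := φ) (by omega) y
    · obtain ⟨B₂, hB₂⟩ := ih k (by omega) hk (by omega)
      have hkb' : 0 < (k : ℝ) * b := by positivity
      obtain ⟨C₂, hC₂⟩ := exists_lintegral_rieszKer_comp_le (D := D) (a := 2 * b) (c := k * b)
        (by linarith) hkb' (by linarith) B₂
      refine ⟨C₂, ?_⟩
      intro Ω hΩ hmon hdiam φ hφ hyp j l hj hl x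
      have := hC₂ (Ω (l + 1)) (Ω (l + 1 + k)) (hΩ _) (φ (j + 1))
        (fun y => ∑ i ∈ Finset.range (M + 1), φ i y) (by fun_prop)
        (fun z hz => hB₂ Ω hΩ hmon hdiam φ hφ hyp (j + 1) (l + 1) (by omega) (by omega) z hz) x
      refine this.trans ?_
      rw [show 2 * b + k * b = (2 + k : ℕ) * b by push_cast; ring]
      gcongr
      exact hmon (by omega)
  obtain ⟨C₂, hC₂⟩ := hsecond
  refine ⟨A * (C₁ + C₂), ?_⟩
  intro Ω hΩ hmon hdiam φ hφ hyp j l hj hl x hx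
  refine (hyp j (by omega) l (by omega) x hx).trans ?_
  rw [lintegral_add_left (by fun_prop)]
  push_cast
  rw [mul_assoc, add_mul]
  gcongr
  · have := hC₁ (Ω (l + 1)) (Ω (l + 1 + (1 + k))) (hΩ _) (φ j)
      (fun y => ∑ i ∈ Finset.range (M + 1), φ i y) (by fun_prop)
      (fun z hz => hB₁ Ω hΩ hmon hdiam φ hφ hyp j (l + 1) (by omega) (by omega) z hz) x
    rw [show l + 1 + (1 + k) = l + (2 + k) by omega] at this
    simpa using this
  · simpa using hC₂ Ω hΩ hmon hdiam φ hφ hyp j l hj hl x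

/-- Iterated potential estimate: from pointwise bounds by Riesz potentials to a pointwise bound by
`L²` norms. -/
theorem exists_sq_le_of_potential_bound [NeZero D] {b : ℝ} (R : ℝ) {M : ℕ} (hM : 0 < M)
    (hb : 0 < b) (hlt : 2 * M * b < D) (hgt : (D : ℝ) < 2 * (2 * M * b)) (A : ℝ≥0) : ∃ C : ℝ≥0,
      ∀ Ω : ℕ → Set (Euc D), (∀ k, MeasurableSet (Ω k)) → Monotone Ω →
      (∀ k, ∀ x ∈ Ω k, ∀ y ∈ Ω k, ‖x - y‖ ≤ R) →
      ∀ φ : ℕ → Euc D → ℝ≥0∞, (∀ j, Measurable (φ j)) →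
      (∀ j < M, ∀ k < 2 * M, ∀ x ∈ Ω k, φ j x ≤ A * ∫⁻ y in Ω (k + 1),
        (rieszKer b (x - y) * φ j y + rieszKer (2 * b) (x - y) * φ (j + 1) y)) →
      ∀ x ∈ Ω 0, φ 0 x ^ 2 ≤
        C * ∑ i ∈ Finset.range (M + 1), ∫⁻ y in Ω (2 * M), φ i y ^ 2 := by
  -- All 2M units are spent at level 0: the order 2Mb stays below D, so that kernels compose, but
  -- exceeds D/2, so that the final kernel is square integrable.
  obtain ⟨B, hB⟩ := exists_potential_bound (D := D) (R := R) hb hlt A (2 * M) (by omega) le_rfl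
  obtain ⟨B', hB'⟩ := lintegral_rieszKer_mul_sq_le (D := D) (a := 2 * M * b) hgt R
  refine ⟨B ^ 2 * B' * (M + 1), ?_⟩
  intro Ω hΩ hmon hdiam φ hφ hyp x hx
  have h1 := hB Ω hΩ hmon hdiam φ hφ hyp 0 0 (by omega) (by omega) x hx
  rw [zero_add] at h1
  push_cast at h1
  have h2 := hB' (Ω (2 * M)) x (hΩ _) (fun y hy => hdiam (2 * M) x (hmon (by omega) hx) y hy)
    (fun y => ∑ i ∈ Finset.range (M + 1), φ i y) (by fun_prop)
  calc φ 0 x ^ 2 ≤ (B * ∫⁻ y in Ω (2 * M), rieszKer (2 * M * b) (x - y) *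
        ∑ i ∈ Finset.range (M + 1), φ i y) ^ 2 := by gcongr
    _ ≤ B ^ 2 * (B' * ∫⁻ y in Ω (2 * M), (∑ i ∈ Finset.range (M + 1), φ i y) ^ 2) := by
        rw [mul_pow]; gcongr
    _ ≤ B ^ 2 * (B' * ∫⁻ y in Ω (2 * M), (M + 1) * ∑ i ∈ Finset.range (M + 1), φ i y ^ 2) := by
        gcongr with y
        have h3 := ENNReal.inner_le_Lp_mul_Lq (Finset.range (M + 1)) (fun _ => 1)
          (fun i => φ i y) (p := 2) (q := 2) ⟨by norm_num, by norm_num, by norm_num⟩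
        simp only [one_mul, ENNReal.one_rpow, Finset.sum_const, Finset.card_range, nsmul_eq_mul,
          mul_one] at h3
        calc _ ≤ (((M + 1 : ℕ) : ℝ≥0∞) ^ (1 / 2 : ℝ) *
              (∑ i ∈ Finset.range (M + 1), φ i y ^ (2 : ℝ)) ^ (1 / 2 : ℝ)) ^ 2 := by gcongr
          _ = _ := by
            rw [mul_pow, ← ENNReal.rpow_natCast, ← ENNReal.rpow_natCast, ← ENNReal.rpow_mul,
              ← ENNReal.rpow_mul]
            norm_num
    _ = _ := by
        rw [lintegral_const_mul' _ _ (by finiteness),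
          lintegral_finsetSum _ (fun i _ => by fun_prop)]
        push_cast
        ring

end Potential

/-! ### Potential representation and Sobolev inequality on the unit ball. -/

section Ball

variable {D : ℕ}

theorem enorm_sub_le_lintegral_fderiv {V : Euc D → ℝ} (hV : ContDiff ℝ 1 V) (x v : Euc D)
    {a b : ℝ} (hab : a ≤ b) :
    ‖V (x + b • v) - V (x + a • v)‖ₑ ≤
      ∫⁻ τ in Ioc a b, ‖fderiv ℝ V (x + τ • v)‖ₑ * ‖v‖ₑ := by
  have hd : ∀ τ ∈ uIcc a b, HasDerivAt (fun τ : ℝ => V (x + τ • v))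
      (fderiv ℝ V (x + τ • v) v) τ := by
    intro τ _
    have h1 : HasDerivAt (fun τ : ℝ => x + τ • v) v τ := by
      simpa using ((hasDerivAt_id τ).smul_const v).const_add x
    exact ((hV.differentiable one_ne_zero).differentiableAt.hasFDerivAt).comp_hasDerivAt τ h1
  have hc : Continuous fun τ : ℝ => fderiv ℝ V (x + τ • v) v := by
    have := hV.continuous_fderiv one_ne_zero
    fun_prop
  rw [← intervalIntegral.integral_eq_sub_of_hasDerivAt hd (hc.intervalIntegrable _ _),
    intervalIntegral.integral_of_le hab]
  refine (enorm_integral_le_lintegral_enorm _).trans (lintegral_mono fun τ => ?_)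
  exact (fderiv ℝ V (x + τ • v)).le_opENorm v

theorem lintegral_rpow_Ici_le {r : ℝ} (hr : 0 < r) {p : ℝ} (hp : p < -1) :
    ∫⁻ τ in Ici r, ENNReal.ofReal (τ ^ p) ≤ ENNReal.ofReal (-r ^ (p + 1) / (p + 1)) := by
  rw [setLIntegral_congr Ioi_ae_eq_Ici.symm, ← integral_Ioi_rpow_of_lt hp hr,
    ofReal_integral_eq_lintegral_ofReal (integrableOn_Ioi_rpow_of_lt hp hr)]
  filter_upwards [ae_restrict_mem measurableSet_Ioi] with τ hτ
  exact Real.rpow_nonneg (hr.trans hτ).le _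

/-- Substitute z = x + τ(y - x). The Jacobian contributes τ^(-D), the relation |y-x| = |z-x|/τ one
more factor, convexity keeps z in the ball, and |y-x| ≤ 2 becomes |z-x| ≤ 2τ. -/
theorem lintegral_comp_segment_le {x : Euc D} (hx : x ∈ Metric.closedBall 0 1)
    {h : Euc D → ℝ≥0∞} {τ : ℝ} (hτ : τ ∈ Ioc (0 : ℝ) 1) :
    ∫⁻ y in Metric.closedBall (0 : Euc D) 1, h (x + τ • (y - x)) * ‖y - x‖ₑ ≤
      ∫⁻ z in Metric.closedBall (0 : Euc D) 1, {τ : ℝ | ‖z - x‖ ≤ 2 * τ}.indicator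
        (fun τ => ENNReal.ofReal (τ ^ (-(D : ℝ) - 1))) τ * (h z * ‖z - x‖ₑ) := by
  set G : Euc D → ℝ≥0∞ := (Metric.closedBall (0 : Euc D) 1).indicator
    (fun z => {τ : ℝ | ‖z - x‖ ≤ 2 * τ}.indicator (fun τ => ENNReal.ofReal τ⁻¹) τ *
      (h z * ‖z - x‖ₑ)) with hG
  have hmem : ∀ y ∈ Metric.closedBall (0 : Euc D) 1,
      h (x + τ • (y - x)) * ‖y - x‖ₑ = G (x + τ • (y - x)) := by
    intro y hy
    have h1 : x + τ • (y - x) ∈ Metric.closedBall (0 : Euc D) 1 :=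
      (convex_closedBall (0 : Euc D) 1).add_smul_sub_mem hx hy ⟨hτ.1.le, hτ.2⟩
    have h2 : ‖y - x‖ ≤ 2 := by
      have := norm_sub_le y x
      rw [mem_closedBall_zero_iff] at hx hy
      linarith
    have h3 : ‖x + τ • (y - x) - x‖ ≤ 2 * τ := by
      rw [add_sub_cancel_left, norm_smul, Real.norm_of_nonneg hτ.1.le]
      nlinarith [hτ.1]
    rw [hG, indicator_of_mem h1, indicator_of_mem (show τ ∈ {τ : ℝ | _ ≤ 2 * τ} from h3),
      add_sub_cancel_left, enorm_smul, mul_left_comm (h _), ← mul_assoc,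
      Real.enorm_of_nonneg hτ.1.le, ← ENNReal.ofReal_mul (by simpa using hτ.1.le),
      inv_mul_cancel₀ hτ.1.ne', ENNReal.ofReal_one, one_mul]
  rw [setLIntegral_congr_fun measurableSet_closedBall hmem]
  refine (setLIntegral_le_lintegral _ _).trans ?_
  rw [lintegral_sub_right_eq_self (fun y => G (x + τ • y)) x,
    lintegral_smul_euc hτ.1 (fun y => G (x + y)), lintegral_add_left_eq_self G x, hG,
    lintegral_indicator measurableSet_closedBall, ← lintegral_const_mul']
  · refine lintegral_mono fun z => ?_
    by_cases hz : τ ∈ {τ : ℝ | ‖z - x‖ ≤ 2 * τ}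
    · simp only [indicator_of_mem hz]
      rw [← mul_assoc, ENNReal.ofReal_rpow_of_pos hτ.1,
        ← ENNReal.ofReal_mul (Real.rpow_nonneg hτ.1.le _), ← Real.rpow_neg_one,
        ← Real.rpow_add hτ.1, ← sub_eq_add_neg]
    · simp only [indicator_of_notMem hz]
      simp
  · rw [ENNReal.ofReal_rpow_of_pos hτ.1]
    simp

/-- A function on the unit ball is bounded by the Riesz potential of itself and its gradient. -/
theorem exists_enorm_le_potential_fderiv (D : ℕ) [NeZero D] : ∃ C : ℝ≥0, ∀ V : Euc D → ℝ,
    ContDiff ℝ 1 V → ∀ x ∈ Metric.closedBall (0 : Euc D) 1,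
      ‖V x‖ₑ ≤ C * ∫⁻ y in Metric.closedBall (0 : Euc D) 1,
        rieszKer 1 (x - y) * (‖V y‖ₑ + ‖fderiv ℝ V y‖ₑ) := by
  have hD : 0 < D := Nat.pos_of_ne_zero (NeZero.ne D)
  have hD1 : (1 : ℝ) ≤ D := by exact_mod_cast hD
  set Ω : Set (Euc D) := Metric.closedBall 0 1 with hΩ
  have hΩm : MeasurableSet Ω := measurableSet_closedBall
  set v := (volume : Measure (Euc D)) Ω
  have hv0 : v ≠ 0 := (Metric.measure_closedBall_pos volume (0 : Euc D) one_pos).ne'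
  have hvt : v ≠ ⊤ := measure_closedBall_lt_top.ne
  set c₁ : ℝ≥0∞ := ENNReal.ofReal 2 ^ ((D : ℝ) - 1)
  have hc₁ : c₁ ≠ ⊤ := ENNReal.rpow_ne_top_of_nonneg (by linarith) (by simp)
  set c₂ : ℝ≥0∞ := ENNReal.ofReal 2 ^ (D : ℝ)
  have hc₂ : c₂ ≠ ⊤ := ENNReal.rpow_ne_top_of_nonneg (by linarith) (by simp)
  refine ⟨(v⁻¹ * (c₁ + c₂)).toNNReal, fun V hV x hx => ?_⟩
  rw [ENNReal.coe_toNNReal (by finiteness)]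
  have hcont := hV.continuous_fderiv one_ne_zero
  have hVc := hV.continuous
  have hm := measurable_rieszKer (D := D) 1
  have hpt : ∀ y ∈ Ω, ‖V x‖ₑ ≤ ‖V y‖ₑ +
      ∫⁻ τ in Ioc (0 : ℝ) 1, ‖fderiv ℝ V (x + τ • (y - x))‖ₑ * ‖y - x‖ₑ := by
    intro y _
    have h := enorm_sub_le_lintegral_fderiv hV x (y - x) zero_le_one
    simp only [one_smul, zero_smul, add_zero, add_sub_cancel] at h
    calc ‖V x‖ₑ = ‖V y + -(V y - V x)‖ₑ := by congr 1; ring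
      _ ≤ ‖V y‖ₑ + ‖-(V y - V x)‖ₑ := enorm_add_le _ _
      _ ≤ _ := by rw [enorm_neg]; gcongr
  -- Average the fundamental theorem of calculus along the segments from x to y over all y in the
  -- ball.
  have hint : v * ‖V x‖ₑ ≤ ∫⁻ y in Ω, (‖V y‖ₑ +
      ∫⁻ τ in Ioc (0 : ℝ) 1, ‖fderiv ℝ V (x + τ • (y - x))‖ₑ * ‖y - x‖ₑ) := by
    rw [mul_comm, ← setLIntegral_const]
    exact setLIntegral_mono' hΩm hpt
  -- The ball has diameter 2, so the kernel of order 1 is bounded below; this puts the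
  -- undifferentiated term under the same potential as the gradient.
  have hker : ∀ y ∈ Ω, x ≠ y → (1 : ℝ≥0∞) ≤ c₁ * rieszKer 1 (x - y) := by
    intro y hy hxy
    have h2 : ‖x - y‖ ≤ 2 := by
      have := norm_sub_le x y
      rw [hΩ, mem_closedBall_zero_iff] at hx hy
      linarith
    have := rieszKer_le_of_le hD1 (sub_ne_zero.mpr hxy) h2
    simpa [rieszKer, c₁] using this
  have hfirst : ∫⁻ y in Ω, ‖V y‖ₑ ≤ c₁ * ∫⁻ y in Ω, rieszKer 1 (x - y) * ‖V y‖ₑ := by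
    rw [← lintegral_const_mul' _ _ hc₁]
    refine lintegral_mono_ae ?_
    filter_upwards [ae_restrict_mem hΩm, ae_restrict_of_ae (ae_ne_euc x)] with y hy hxy
    rw [← mul_assoc]
    exact le_mul_of_one_le_left zero_le (hker y hy hxy)
  have hsecond : ∫⁻ y in Ω, ∫⁻ τ in Ioc (0 : ℝ) 1,
      ‖fderiv ℝ V (x + τ • (y - x))‖ₑ * ‖y - x‖ₑ ≤
      c₂ * ∫⁻ y in Ω, rieszKer 1 (x - y) * ‖fderiv ℝ V y‖ₑ := by
    have hmeas : MeasurableSet {p : Euc D × ℝ | ‖p.1 - x‖ ≤ 2 * p.2} :=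
      measurableSet_le (by fun_prop) (by fun_prop)
    have hmeas2 : Measurable fun p : Euc D × ℝ => {τ : ℝ | ‖p.1 - x‖ ≤ 2 * τ}.indicator
        (fun τ => ENNReal.ofReal (τ ^ (-(D : ℝ) - 1))) p.2 := by
      have : (fun p : Euc D × ℝ => {τ : ℝ | ‖p.1 - x‖ ≤ 2 * τ}.indicator
        (fun τ => ENNReal.ofReal (τ ^ (-(D : ℝ) - 1))) p.2) =
        {p : Euc D × ℝ | ‖p.1 - x‖ ≤ 2 * p.2}.indicator
        (fun p => ENNReal.ofReal (p.2 ^ (-(D : ℝ) - 1))) := rfl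
      rw [this]
      exact Measurable.indicator (by fun_prop) hmeas
    calc _ = ∫⁻ τ in Ioc (0 : ℝ) 1, ∫⁻ y in Ω,
            ‖fderiv ℝ V (x + τ • (y - x))‖ₑ * ‖y - x‖ₑ := by
          rw [lintegral_lintegral_swap]
          fun_prop
      _ ≤ ∫⁻ τ in Ioc (0 : ℝ) 1, ∫⁻ z in Ω, {τ : ℝ | ‖z - x‖ ≤ 2 * τ}.indicator
            (fun τ => ENNReal.ofReal (τ ^ (-(D : ℝ) - 1))) τ * (‖fderiv ℝ V z‖ₑ * ‖z - x‖ₑ) :=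
          setLIntegral_mono' measurableSet_Ioc fun τ hτ =>
            lintegral_comp_segment_le (h := fun z => ‖fderiv ℝ V z‖ₑ) hx hτ
      _ = ∫⁻ z in Ω, ∫⁻ τ in Ioc (0 : ℝ) 1, {τ : ℝ | ‖z - x‖ ≤ 2 * τ}.indicator
            (fun τ => ENNReal.ofReal (τ ^ (-(D : ℝ) - 1))) τ * (‖fderiv ℝ V z‖ₑ * ‖z - x‖ₑ) := by
          rw [lintegral_lintegral_swap]
          have := hmeas2.comp measurable_swap
          simp only [Function.comp_def, Prod.fst_swap, Prod.snd_swap] at this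
          fun_prop
      _ ≤ ∫⁻ z in Ω, c₂ * (rieszKer 1 (x - z) * ‖fderiv ℝ V z‖ₑ) := by
          refine lintegral_mono_ae ?_
          filter_upwards [ae_restrict_of_ae (ae_ne_euc x)] with z hz
          have hr : 0 < ‖z - x‖ := norm_pos_iff.mpr (sub_ne_zero.mpr hz.symm)
          rw [lintegral_mul_const' _ _ (by finiteness)]
          have h1 : ∫⁻ τ in Ioc (0 : ℝ) 1, {τ : ℝ | ‖z - x‖ ≤ 2 * τ}.indicator
              (fun τ => ENNReal.ofReal (τ ^ (-(D : ℝ) - 1))) τ ≤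
              ENNReal.ofReal (2 ^ (D : ℝ) * ‖z - x‖ ^ (-(D : ℝ))) := by
            refine (setLIntegral_le_lintegral _ _).trans ?_
            -- The τ-integral of τ^(-D-1) starts at |z-x|/2 and gives a multiple of |z-x|^(-D); with
            -- the factor |z-x| this is the kernel of order 1.
            have hset : {τ : ℝ | ‖z - x‖ ≤ 2 * τ} = Ici (‖z - x‖ / 2) := by
              ext τ
              simp only [mem_ofPred_eq, mem_Ici]
              constructor <;> intro h <;> linarith
            rw [hset, lintegral_indicator measurableSet_Ici]
            refine (lintegral_rpow_Ici_le (by positivity) (by linarith)).trans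
              (ENNReal.ofReal_le_ofReal ?_)
            rw [sub_add_cancel, neg_div_neg_eq, Real.div_rpow hr.le (by norm_num),
              Real.rpow_neg (by norm_num : (0 : ℝ) ≤ 2), div_inv_eq_mul, mul_comm]
            exact div_le_self (by positivity) hD1
          calc _ ≤ ENNReal.ofReal (2 ^ (D : ℝ) * ‖z - x‖ ^ (-(D : ℝ))) *
                (‖fderiv ℝ V z‖ₑ * ‖z - x‖ₑ) := by gcongr
            _ = _ := by
              rw [ENNReal.ofReal_mul (by positivity), rieszKer_sub_comm, rieszKer,
                show (1 : ℝ) - D = 1 + -D from sub_eq_add_neg _ _,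
                ENNReal.rpow_add _ _ (by simpa using hr) (by simp),
                ENNReal.rpow_one, ← ENNReal.ofReal_rpow_of_pos hr,
                ← ENNReal.ofReal_rpow_of_pos (by norm_num), ofReal_norm]
              ring
      _ = _ := lintegral_const_mul' _ _ hc₂
  calc ‖V x‖ₑ = v⁻¹ * (v * ‖V x‖ₑ) := by
        rw [← mul_assoc, ENNReal.inv_mul_cancel hv0 hvt, one_mul]
    _ ≤ v⁻¹ * (c₁ * (∫⁻ y in Ω, rieszKer 1 (x - y) * ‖V y‖ₑ) +
          c₂ * ∫⁻ y in Ω, rieszKer 1 (x - y) * ‖fderiv ℝ V y‖ₑ) := by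
        gcongr
        refine hint.trans ?_
        rw [lintegral_add_left (by fun_prop)]
        gcongr
    _ ≤ v⁻¹ * (c₁ * (∫⁻ y in Ω, rieszKer 1 (x - y) * (‖V y‖ₑ + ‖fderiv ℝ V y‖ₑ)) +
          c₂ * ∫⁻ y in Ω, rieszKer 1 (x - y) * (‖V y‖ₑ + ‖fderiv ℝ V y‖ₑ)) := by
        gcongr
        · exact le_self_add
        · exact le_add_self
    _ = _ := by ring

theorem enorm_clm_le_sum (L : Euc D →L[ℝ] ℝ) :
    ‖L‖ₑ ≤ ∑ i, ‖L (EuclideanSpace.single i 1)‖ₑ := by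
  have h : ‖L‖ ≤ ∑ i, ‖L (EuclideanSpace.single i 1)‖ := by
    refine L.opNorm_le_bound (by positivity) fun x => ?_
    have hx : x = ∑ i, x i • (EuclideanSpace.single i (1 : ℝ) : Euc D) := by
      ext j
      simp [Pi.single_apply]
    calc ‖L x‖ = ‖∑ i, x i • L (EuclideanSpace.single i 1)‖ := by
          conv_lhs => rw [hx]
          simp [map_sum]
      _ ≤ ∑ i, ‖x i • L (EuclideanSpace.single i 1)‖ := norm_sum_le _ _
      _ ≤ ∑ i, ‖L (EuclideanSpace.single i 1)‖ * ‖x‖ := by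
          gcongr with i
          rw [norm_smul, mul_comm]
          gcongr
          exact PiLp.norm_apply_le x i
      _ = _ := by rw [Finset.sum_mul]
  rw [← ofReal_norm]
  refine (ENNReal.ofReal_le_ofReal h).trans ?_
  rw [ENNReal.ofReal_sum_of_nonneg (fun _ _ => norm_nonneg _)]
  exact (Finset.sum_congr rfl fun i _ => ofReal_norm _).le

/-- Sobolev inequality on the unit ball for a family of functions closed under differentiation. -/
theorem exists_sobolev_unitBall (D : ℕ) [NeZero D] {M : ℕ} (hM : (D : ℝ) / 2 < M)
    (hMD : M < D) : ∃ C : ℝ≥0, ∀ F : (k : ℕ) → (Fin k → Fin D) → Euc D → ℝ,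
      (∀ k < M, ∀ I, ContDiff ℝ 1 (F k I)) → (∀ k ≤ M, ∀ I, Continuous (F k I)) →
      (∀ k < M, ∀ I i, ∀ y ∈ Metric.closedBall (0 : Euc D) 1,
        |fderiv ℝ (F k I) y (EuclideanSpace.single i 1)| ≤
          |F (k + 1) (Fin.snoc I i : Fin (k + 1) → Fin D) y|) →
      ∀ x ∈ Metric.closedBall (0 : Euc D) 1, ‖F 0 Fin.elim0 x‖ₑ ^ 2 ≤
        C * ∑ k ∈ Finset.range (M + 1), ∑ I : Fin k → Fin D,
          ∫⁻ y in Metric.closedBall (0 : Euc D) 1, ‖F k I y‖ₑ ^ 2 := by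
  have hD0 : (0 : ℝ) < D := Nat.cast_pos.mpr (Nat.pos_of_ne_zero (NeZero.ne D))
  have hM0 : 0 < M := by
    have : (0 : ℝ) < M := by linarith
    exact_mod_cast this
  have hMD' : (M : ℝ) < D := by exact_mod_cast hMD
  set c : ℝ≥0∞ := ENNReal.ofReal 2 ^ ((1 : ℝ) - 1 / 2)
  have hc : c ≠ ⊤ := ENNReal.rpow_ne_top_of_nonneg (by norm_num) (by simp)
  obtain ⟨A, hA⟩ := exists_enorm_le_potential_fderiv D
  -- One derivative gains order 1 = 2b. Then 2Mb = M, and the two order conditions become D/2 < M <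
  -- D.
  obtain ⟨C, hC⟩ := exists_sq_le_of_potential_bound (D := D) (b := 1 / 2) 2 hM0 (by norm_num)
    (by linarith) (by linarith) (A * (c.toNNReal + 1))
  have hcard : ∀ k ≤ M, Fintype.card (Fin k → Fin D) ≤ D ^ M := by
    intro k hk
    simp only [Fintype.card_pi, Fintype.card_fin, Finset.prod_const, Finset.card_univ]
    exact Nat.pow_le_pow_right (Nat.pos_of_ne_zero (NeZero.ne D)) hk
  refine ⟨C * (D ^ M : ℕ), fun F hF hFc hder x hx => ?_⟩
  set Ω : Set (Euc D) := Metric.closedBall 0 1 with hΩ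
  have hΩm : MeasurableSet Ω := measurableSet_closedBall
  -- The total size of the derivatives of order k. The value 0 above M is only a default, keeping
  -- every member of the sequence measurable.
  set φ : ℕ → Euc D → ℝ≥0∞ := fun k y => if k ≤ M then ∑ I, ‖F k I y‖ₑ else 0 with hφ
  have hφm : ∀ k, Measurable (φ k) := by
    intro k
    by_cases hk : k ≤ M
    · simp only [hφ, if_pos hk]
      have := hFc k hk
      fun_prop
    · simp only [hφ, if_neg hk]
      fun_prop
  have hm := fun a => measurable_rieszKer (D := D) a
  have hdiam : ∀ x ∈ Ω, ∀ y ∈ Ω, ‖x - y‖ ≤ 2 := by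
    intro x hx y hy
    have := norm_sub_le x y
    rw [hΩ, mem_closedBall_zero_iff] at hx hy
    linarith
  have key := hC (fun _ => Ω) (fun _ => hΩm) monotone_const (fun _ => hdiam) φ hφm ?_ x hx
  · have h0 : φ 0 x = ‖F 0 Fin.elim0 x‖ₑ := by
      simp only [hφ, Nat.zero_le, if_true, Finset.univ_unique, Finset.sum_singleton]
      congr
    rw [← h0]
    refine key.trans ?_
    push_cast
    rw [mul_assoc]
    refine mul_le_mul_right ?_ _
    rw [Finset.mul_sum]
    refine Finset.sum_le_sum fun k hk => ?_
    have hk' : k ≤ M := by simpa [Nat.lt_succ_iff] using hk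
    rw [← lintegral_finsetSum _ (fun I _ => by have := hFc k hk' I; fun_prop),
      ← lintegral_const_mul' _ _ (by finiteness)]
    refine lintegral_mono fun y => ?_
    simp only [hφ, if_pos hk']
    have h3 := ENNReal.inner_le_Lp_mul_Lq Finset.univ (fun _ => 1)
      (fun I => ‖F k I y‖ₑ) (p := 2) (q := 2) ⟨by norm_num, by norm_num, by norm_num⟩
    simp only [one_mul, ENNReal.one_rpow, Finset.sum_const, Finset.card_univ, nsmul_eq_mul,
      mul_one] at h3
    calc _ ≤ (((Fintype.card (Fin k → Fin D) : ℕ) : ℝ≥0∞) ^ (1 / 2 : ℝ) *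
          (∑ I, ‖F k I y‖ₑ ^ (2 : ℝ)) ^ (1 / 2 : ℝ)) ^ 2 := by gcongr
      _ = (Fintype.card (Fin k → Fin D) : ℕ) * ∑ I, ‖F k I y‖ₑ ^ 2 := by
        rw [mul_pow, ← ENNReal.rpow_natCast, ← ENNReal.rpow_natCast, ← ENNReal.rpow_mul,
          ← ENNReal.rpow_mul]
        norm_num
      _ ≤ _ := by
        gcongr
        exact_mod_cast hcard k hk'
  · intro k hk _ _ z hz
    have hk1 : k + 1 ≤ M := hk
    have hgrad : ∀ y ∈ Ω, ∑ I, (‖F k I y‖ₑ + ‖fderiv ℝ (F k I) y‖ₑ) ≤ φ k y + φ (k + 1) y := by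
      intro y hy
      simp only [hφ, if_pos hk.le, if_pos hk1]
      rw [Finset.sum_add_distrib]
      gcongr
      calc ∑ I, ‖fderiv ℝ (F k I) y‖ₑ
          ≤ ∑ I : Fin k → Fin D, ∑ i : Fin D,
              ‖F (k + 1) (Fin.snoc I i : Fin (k + 1) → Fin D) y‖ₑ := by
            refine Finset.sum_le_sum fun I _ => (enorm_clm_le_sum _).trans ?_
            refine Finset.sum_le_sum fun i _ => ?_
            rw [enorm_le_iff_norm_le]
            exact hder k hk I i y hy
        _ = ∑ I : Fin (k + 1) → Fin D, ‖F (k + 1) I y‖ₑ := by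
            rw [← (Fin.snocEquiv (fun _ : Fin (k + 1) => Fin D)).sum_comp,
              Fintype.sum_prod_type_right]
            rfl
    calc φ k z = ∑ I, ‖F k I z‖ₑ := by simp only [hφ, if_pos hk.le]
      _ ≤ ∑ I, A * ∫⁻ y in Ω, rieszKer 1 (z - y) * (‖F k I y‖ₑ + ‖fderiv ℝ (F k I) y‖ₑ) :=
          Finset.sum_le_sum fun I _ => hA _ (hF k hk I) z hz
      _ = A * ∫⁻ y in Ω, rieszKer 1 (z - y) * ∑ I, (‖F k I y‖ₑ + ‖fderiv ℝ (F k I) y‖ₑ) := by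
          rw [← Finset.mul_sum, ← lintegral_finsetSum]
          · simp_rw [Finset.mul_sum]
          · intro I _
            have h1 := (hF k hk I).continuous_fderiv one_ne_zero
            have h2 := (hF k hk I).continuous
            fun_prop
      _ ≤ A * ∫⁻ y in Ω, ((c.toNNReal + 1 : ℝ≥0) : ℝ≥0∞) *
            (rieszKer (1 / 2) (z - y) * φ k y + rieszKer (2 * (1 / 2)) (z - y) * φ (k + 1) y) := by
          refine mul_le_mul_right (lintegral_mono_ae ?_) _
          filter_upwards [ae_restrict_mem hΩm, ae_restrict_of_ae (ae_ne_euc z)] with y hy hzy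
          have h1 := rieszKer_le_of_le (by norm_num : (1 / 2 : ℝ) ≤ 1) (sub_ne_zero.mpr hzy)
            (hdiam z hz y hy)
          push_cast
          rw [ENNReal.coe_toNNReal hc, mul_one_div_cancel (two_ne_zero)]
          calc _ ≤ rieszKer 1 (z - y) * (φ k y + φ (k + 1) y) := by gcongr; exact hgrad y hy
            _ = rieszKer 1 (z - y) * φ k y + rieszKer 1 (z - y) * φ (k + 1) y := by ring
            _ ≤ c * rieszKer (1 / 2) (z - y) * φ k y + rieszKer 1 (z - y) * φ (k + 1) y := by
                gcongr
            _ ≤ c * rieszKer (1 / 2) (z - y) * φ k y + rieszKer 1 (z - y) * φ (k + 1) y +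
                (c * rieszKer 1 (z - y) * φ (k + 1) y + rieszKer (1 / 2) (z - y) * φ k y) :=
                le_self_add
            _ = _ := by ring
      _ = _ := by
          rw [lintegral_const_mul' _ _ (by finiteness)]
          push_cast
          ring

end Ball

/-! ### Hardy inequality and weighted Sobolev inequality on a hyperboloid. -/

section Hyperboloid

variable {D : ℕ}

/-- Hardy-type inequality in a ball with boundary values. -/
theorem lintegral_sq_le_of_boundary (hD : 4 ≤ D) {V : Euc D → ℝ} (hV : ContDiff ℝ 1 V)
    {R P : ℝ} (hR : 0 < R) {B : ℝ≥0∞} (hB : ∀ y, ‖y‖ = R → ‖V y‖ₑ ≤ B) {S : Set (Euc D)}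
    (hS : MeasurableSet S) (hSR : S ⊆ Metric.closedBall 0 R) (hSP : S ⊆ Metric.closedBall 0 P) :
    ∫⁻ y in S, ‖V y‖ₑ ^ 2 ≤ 2 * B ^ 2 * volume S +
      2 * ENNReal.ofReal P ^ 2 * ∫⁻ y in Metric.closedBall (0 : Euc D) R, ‖fderiv ℝ V y‖ₑ ^ 2 := by
  have : NeZero D := ⟨by omega⟩
  have hD' : (4 : ℝ) ≤ D := by exact_mod_cast hD
  have hcont := hV.continuous_fderiv one_ne_zero
  set G : Euc D → ℝ≥0∞ := (Metric.closedBall (0 : Euc D) R).indicator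
    fun y => ‖fderiv ℝ V y‖ₑ ^ 2 with hG
  have hGm : Measurable G := Measurable.indicator (by fun_prop) measurableSet_closedBall
  have hray : ∀ y ∈ S, y ≠ 0 → ‖V y‖ₑ ^ 2 ≤ 2 * B ^ 2 + 2 * ENNReal.ofReal P ^ 2 *
      ∫⁻ l in Ioi (1 : ℝ), ENNReal.ofReal (l ^ (2 : ℝ)) * G (l • y) := by
    intro y hy hy0
    have hyn : 0 < ‖y‖ := norm_pos_iff.mpr hy0
    have hyR : ‖y‖ ≤ R := by simpa using hSR hy
    have hyP : ‖y‖ ≤ P := by simpa using hSP hy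
    -- The ray l ↦ l·y meets the sphere of radius R at l = R/|y|; the boundary value enters there.
    have hΛ : 1 ≤ R / ‖y‖ := (one_le_div hyn).mpr hyR
    have h1 := enorm_sub_le_lintegral_fderiv hV 0 y hΛ
    simp only [zero_add, one_smul] at h1
    have hb : ‖V ((R / ‖y‖) • y)‖ₑ ≤ B := by
      refine hB _ ?_
      rw [norm_smul, Real.norm_of_nonneg (by positivity), div_mul_cancel₀ _ hyn.ne']
    set J := ∫⁻ l in Ioc 1 (R / ‖y‖), ‖fderiv ℝ V (l • y)‖ₑ with hJ
    -- Cauchy–Schwarz with the weights l⁻¹ and l, since the integral of l⁻² over (1, ∞) is 1.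
    have hJle : J ^ 2 ≤ ∫⁻ l in Ioi (1 : ℝ), ENNReal.ofReal (l ^ (2 : ℝ)) * G (l • y) := by
      have hH := ENNReal.lintegral_mul_le_Lp_mul_Lq (volume.restrict (Ioc 1 (R / ‖y‖)))
        (p := 2) (q := 2) ⟨by norm_num, by norm_num, by norm_num⟩
        (f := fun l => ENNReal.ofReal (l ^ (-1 : ℝ)))
        (g := fun l => ENNReal.ofReal (l ^ (1 : ℝ)) * ‖fderiv ℝ V (l • y)‖ₑ)
        (by fun_prop) (by fun_prop)
      have hJ2 : J = ∫⁻ l in Ioc 1 (R / ‖y‖), ((fun l => ENNReal.ofReal (l ^ (-1 : ℝ))) *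
          fun l => ENNReal.ofReal (l ^ (1 : ℝ)) * ‖fderiv ℝ V (l • y)‖ₑ) l := by
        refine setLIntegral_congr_fun measurableSet_Ioc fun l hl => ?_
        have hl0 : 0 < l := lt_trans one_pos hl.1
        simp only [Pi.mul_apply]
        rw [← mul_assoc, ← ENNReal.ofReal_mul (by positivity), ← Real.rpow_add hl0]
        simp
      have hI1 : ∫⁻ l in Ioc 1 (R / ‖y‖), ENNReal.ofReal (l ^ (-1 : ℝ)) ^ (2 : ℝ) ≤ 1 := by
        calc _ ≤ ∫⁻ l in Ioc 1 (R / ‖y‖), ENNReal.ofReal (l ^ (-2 : ℝ)) := by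
              refine setLIntegral_mono' measurableSet_Ioc fun l hl => ?_
              have hl0 : 0 < l := lt_trans one_pos hl.1
              rw [ENNReal.ofReal_rpow_of_nonneg (by positivity) (by norm_num),
                ← Real.rpow_mul hl0.le]
              norm_num
          _ ≤ ∫⁻ l in Ici (1 : ℝ), ENNReal.ofReal (l ^ (-2 : ℝ)) :=
              lintegral_mono_set fun l hl => hl.1.le
          _ ≤ _ := by
              refine (lintegral_rpow_Ici_le one_pos (by norm_num)).trans ?_
              norm_num
      have hI2 : ∫⁻ l in Ioc 1 (R / ‖y‖), (ENNReal.ofReal (l ^ (1 : ℝ)) *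
          ‖fderiv ℝ V (l • y)‖ₑ) ^ (2 : ℝ) ≤
          ∫⁻ l in Ioi (1 : ℝ), ENNReal.ofReal (l ^ (2 : ℝ)) * G (l • y) := by
        refine le_trans (setLIntegral_mono' measurableSet_Ioc fun l hl => ?_)
          (lintegral_mono_set (s := Ioc 1 (R / ‖y‖)) fun l hl => hl.1)
        have hl0 : 0 < l := lt_trans one_pos hl.1
        have hmem : l • y ∈ Metric.closedBall (0 : Euc D) R := by
          rw [mem_closedBall_zero_iff, norm_smul, Real.norm_of_nonneg hl0.le]
          exact (le_div_iff₀ hyn).mp hl.2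
        rw [hG, indicator_of_mem hmem, ENNReal.mul_rpow_of_nonneg _ _ (by norm_num),
          ENNReal.ofReal_rpow_of_nonneg (by positivity) (by norm_num), ← Real.rpow_mul hl0.le]
        norm_num
      calc J ^ 2 ≤ ((∫⁻ l in Ioc 1 (R / ‖y‖), ENNReal.ofReal (l ^ (-1 : ℝ)) ^ (2 : ℝ)) ^
              (1 / 2 : ℝ) * (∫⁻ l in Ioc 1 (R / ‖y‖), (ENNReal.ofReal (l ^ (1 : ℝ)) *
              ‖fderiv ℝ V (l • y)‖ₑ) ^ (2 : ℝ)) ^ (1 / 2 : ℝ)) ^ 2 := by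
            gcongr
            rw [hJ2]
            exact hH
        _ = (∫⁻ l in Ioc 1 (R / ‖y‖), ENNReal.ofReal (l ^ (-1 : ℝ)) ^ (2 : ℝ)) *
              ∫⁻ l in Ioc 1 (R / ‖y‖), (ENNReal.ofReal (l ^ (1 : ℝ)) *
              ‖fderiv ℝ V (l • y)‖ₑ) ^ (2 : ℝ) := by
            rw [mul_pow, ← ENNReal.rpow_natCast, ← ENNReal.rpow_natCast, ← ENNReal.rpow_mul,
              ← ENNReal.rpow_mul]
            norm_num
        _ ≤ 1 * ∫⁻ l in Ioi (1 : ℝ), ENNReal.ofReal (l ^ (2 : ℝ)) * G (l • y) := by gcongr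
        _ = _ := one_mul _
    have hVy : ‖V y‖ₑ ≤ B + ENNReal.ofReal P * J := by
      calc ‖V y‖ₑ = ‖V ((R / ‖y‖) • y) + -(V ((R / ‖y‖) • y) - V y)‖ₑ := by congr 1; ring
        _ ≤ ‖V ((R / ‖y‖) • y)‖ₑ + ‖-(V ((R / ‖y‖) • y) - V y)‖ₑ := enorm_add_le _ _
        _ ≤ B + ∫⁻ l in Ioc 1 (R / ‖y‖), ‖fderiv ℝ V (l • y)‖ₑ * ‖y‖ₑ := by
            rw [enorm_neg]
            exact add_le_add hb h1
        _ ≤ _ := by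
            rw [lintegral_mul_const' _ _ (by finiteness), mul_comm]
            gcongr
            rw [← ofReal_norm]
            exact ENNReal.ofReal_le_ofReal hyP
    have hsq : ∀ a b : ℝ≥0∞, (a + b) ^ 2 ≤ 2 * a ^ 2 + 2 * b ^ 2 := by
      intro a b
      have := ENNReal.rpow_add_le_mul_rpow_add_rpow a b (p := 2) (by norm_num)
      norm_num at this
      rwa [mul_add] at this
    calc ‖V y‖ₑ ^ 2 ≤ (B + ENNReal.ofReal P * J) ^ 2 := by gcongr
      _ ≤ 2 * B ^ 2 + 2 * (ENNReal.ofReal P * J) ^ 2 := hsq _ _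
      _ ≤ _ := by
          rw [mul_pow, ← mul_assoc]
          gcongr
  calc ∫⁻ y in S, ‖V y‖ₑ ^ 2 ≤ ∫⁻ y in S, (2 * B ^ 2 + 2 * ENNReal.ofReal P ^ 2 *
        ∫⁻ l in Ioi (1 : ℝ), ENNReal.ofReal (l ^ (2 : ℝ)) * G (l • y)) := by
        refine lintegral_mono_ae ?_
        filter_upwards [ae_restrict_mem hS, ae_restrict_of_ae (ae_ne_euc (0 : Euc D))] with y h1 h2
        exact hray y h1 h2.symm
    _ = 2 * B ^ 2 * volume S + 2 * ENNReal.ofReal P ^ 2 *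
        ∫⁻ y in S, ∫⁻ l in Ioi (1 : ℝ), ENNReal.ofReal (l ^ (2 : ℝ)) * G (l • y) := by
        rw [lintegral_add_left (by fun_prop), setLIntegral_const,
          lintegral_const_mul' (2 * ENNReal.ofReal P ^ 2) _ (by finiteness)]
    _ ≤ _ := by
        refine add_le_add le_rfl (mul_le_mul' le_rfl ?_)
        calc _ = ∫⁻ l in Ioi (1 : ℝ), ∫⁻ y in S, ENNReal.ofReal (l ^ (2 : ℝ)) * G (l • y) := by
              rw [lintegral_lintegral_swap]
              fun_prop
          -- Scaling y by l produces l^(-D). The resulting integral of l^(2-D) over (1, ∞) equals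
          -- 1/(D-3), finite and at most 1 because D ≥ 4.
          _ ≤ ∫⁻ l in Ioi (1 : ℝ), ENNReal.ofReal (l ^ (2 - D : ℝ)) * ∫⁻ y, G y := by
              refine setLIntegral_mono' measurableSet_Ioi fun l hl => ?_
              have hl0 : 0 < l := lt_trans one_pos hl
              refine (setLIntegral_le_lintegral _ _).trans ?_
              rw [lintegral_const_mul' _ _ (by finiteness), lintegral_smul_euc hl0, ← mul_assoc,
                ENNReal.ofReal_rpow_of_pos hl0, ← ENNReal.ofReal_mul (by positivity),
                ← Real.rpow_add hl0, ← sub_eq_add_neg]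
          _ = (∫⁻ l in Ioi (1 : ℝ), ENNReal.ofReal (l ^ (2 - D : ℝ))) * ∫⁻ y, G y :=
              lintegral_mul_const _ (by fun_prop)
          _ ≤ 1 * ∫⁻ y, G y := by
              gcongr
              refine (lintegral_mono_set Ioi_subset_Ici_self).trans
                ((lintegral_rpow_Ici_le one_pos (by linarith)).trans ?_)
              rw [Real.one_rpow, ENNReal.ofReal_le_one, neg_div, ← div_neg]
              rw [div_le_one (by linarith)]
              linarith
          _ = _ := by rw [one_mul, hG, lintegral_indicator measurableSet_closedBall]

/-- The time coordinate on the hyperboloid `Σ_s`. -/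
def hypTime (s : ℝ) (y : Euc D) : ℝ := Real.sqrt (s ^ 2 + ‖y‖ ^ 2)

theorem hypTime_sq (s : ℝ) (y : Euc D) : hypTime s y ^ 2 = s ^ 2 + ‖y‖ ^ 2 :=
  Real.sq_sqrt (by positivity)

theorem hypTime_nonneg (s : ℝ) (y : Euc D) : 0 ≤ hypTime s y := Real.sqrt_nonneg _

theorem le_hypTime (s : ℝ) (y : Euc D) : s ≤ hypTime s y := by
  refine Real.le_sqrt_of_sq_le ?_
  nlinarith [norm_nonneg y]

theorem norm_le_hypTime (s : ℝ) (y : Euc D) : ‖y‖ ≤ hypTime s y := by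
  refine Real.le_sqrt_of_sq_le ?_
  nlinarith [sq_nonneg s]

/-- The time function on the hyperboloid is 1-Lipschitz because |z| ≤ t. Hence t is comparable to t₀
on balls of radius a small multiple of t₀. -/
theorem hypTime_sub_le (s : ℝ) (y z : Euc D) : hypTime s y ≤ hypTime s z + ‖y - z‖ := by
  have h1 := hypTime_sq s y
  have h2 := hypTime_sq s z
  have h3 : ‖y‖ ≤ ‖z‖ + ‖y - z‖ := by
    calc ‖y‖ = ‖z + (y - z)‖ := by congr 1; abel
      _ ≤ _ := norm_add_le _ _
  have h4 := norm_le_hypTime s z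
  have h5 := hypTime_nonneg s z
  have h6 := norm_nonneg (y - z)
  have h7 := norm_nonneg y
  refine Real.sqrt_le_iff.mpr ⟨by positivity, ?_⟩
  nlinarith [mul_le_mul_of_nonneg_right h4 h6, norm_nonneg z]

/-- Squaring t ≥ |y| + 1 and using t² = s² + |y|² leaves s² ≥ 2|y| + 1: inside the hyperboloid the
truncated region is a Euclidean ball. -/
theorem hypTime_le_iff {s : ℝ} (y : Euc D) :
    ‖y‖ ≤ hypTime s y - 1 ↔ ‖y‖ ≤ (s ^ 2 - 1) / 2 := by
  have h1 := hypTime_sq s y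
  have h2 := hypTime_nonneg s y
  have h3 := norm_nonneg y
  constructor
  · intro h
    nlinarith
  · intro h
    by_contra! hc
    nlinarith

/-- The weighted Sobolev inequality on hyperboloids, for functions with prescribed boundary
values. -/
theorem exists_hyperboloid_sobolev (hD : 4 ≤ D) {M : ℕ} (hM : (D : ℝ) / 2 < M) (hMD : M < D)
    {s₀ : ℝ} (hs₀ : 1 < s₀) : ∃ C : ℝ≥0, ∀ s, s₀ ≤ s →
      ∀ F : (k : ℕ) → (Fin k → Fin D) → Euc D → ℝ,
      (∀ k < M, ∀ I, ContDiff ℝ 1 (F k I)) → (∀ k ≤ M, ∀ I, Continuous (F k I)) →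
      (∀ k < M, ∀ I i y, hypTime s y * fderiv ℝ (F k I) y (EuclideanSpace.single i 1) =
        F (k + 1) (Fin.snoc I i : Fin (k + 1) → Fin D) y) →
      ∀ B : ℝ, (∀ y, ‖y‖ = (s ^ 2 - 1) / 2 →
        |F 0 Fin.elim0 y| ≤ B * ((s ^ 2 - 1) / 2) ^ (-((D : ℝ) - 1) / 2)) →
      ∀ y₀, ‖y₀‖ ≤ (s ^ 2 - 1) / 2 →
        ENNReal.ofReal (hypTime s y₀ ^ ((D : ℝ) - 2)) * ‖F 0 Fin.elim0 y₀‖ₑ ^ 2 ≤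
          C * ((∑ k ∈ Finset.range M, ∑ I : Fin k → Fin D, ∑ i : Fin D,
            ∫⁻ y in Metric.closedBall (0 : Euc D) ((s ^ 2 - 1) / 2),
              ‖fderiv ℝ (F k I) y (EuclideanSpace.single i 1)‖ₑ ^ 2) +
            ENNReal.ofReal (B ^ 2)) := by
  have : NeZero D := ⟨by omega⟩
  have hD' : (4 : ℝ) ≤ D := by exact_mod_cast hD
  obtain ⟨C₁, hC₁⟩ := exists_sobolev_unitBall D hM hMD
  set R₀ := (s₀ ^ 2 - 1) / 2 with hR₀def
  have hR₀ : 0 < R₀ := by rw [hR₀def]; nlinarith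
  -- The factor 1/4 keeps t within a factor 2 of t₀ on a ball of diameter 2κt₀. The other entry
  -- ensures κt₀ ≤ R, since t ≤ (s²+1)/2 on the ball of radius R = (s²-1)/2.
  set κ : ℝ := min (1 / 4) ((s₀ ^ 2 - 1) / (s₀ ^ 2 + 1)) with hκ
  have hκ0 : 0 < κ := lt_min (by norm_num) (div_pos (by nlinarith) (by positivity))
  have hκ1 : κ ≤ 1 / 4 := min_le_left _ _
  set v := (volume : Measure (Euc D)) (Metric.closedBall 0 1) with hv
  have hvt : v ≠ ⊤ := measure_closedBall_lt_top.ne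
  set ca : ℝ≥0∞ := ENNReal.ofReal (4 * κ ^ (-(D : ℝ))) with hca
  set cb : ℝ≥0∞ := 2 * v * ENNReal.ofReal (κ ^ (2 - (D : ℝ)) * R₀⁻¹) with hcb
  have hcbt : cb ≠ ⊤ := by finiteness
  refine ⟨C₁ * ((1 + 2 * D) * ca + cb).toNNReal, ?_⟩
  intro s hs F hF hFc hder B hB y₀ hy₀
  set R := (s ^ 2 - 1) / 2 with hRdef
  have hRR : R₀ ≤ R := by rw [hRdef, hR₀def]; nlinarith
  have hR : 0 < R := hR₀.trans_le hRR
  set t₀ := hypTime s y₀ with ht₀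
  have ht₀s : s ≤ t₀ := le_hypTime s y₀
  have ht₀0 : 0 < t₀ := by linarith
  have ht₀R : κ * t₀ ≤ R := by
    have h1 : t₀ ≤ (s ^ 2 + 1) / 2 := by
      have h2 := hypTime_sq s y₀
      rw [← ht₀] at h2
      have h3 : ‖y₀‖ ^ 2 ≤ R ^ 2 := by gcongr
      refine (sq_le_sq₀ ht₀0.le (by positivity)).mp ?_
      rw [h2]
      calc _ ≤ s ^ 2 + R ^ 2 := by gcongr
        _ = _ := by rw [hRdef]; ring
    have h2 : κ ≤ (s₀ ^ 2 - 1) / (s₀ ^ 2 + 1) := min_le_right _ _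
    calc κ * t₀ ≤ (s₀ ^ 2 - 1) / (s₀ ^ 2 + 1) * ((s ^ 2 + 1) / 2) :=
          mul_le_mul h2 h1 ht₀0.le (hκ0.le.trans h2)
      _ ≤ R := by
        rw [hRdef, div_mul_div_comm, div_le_div_iff₀ (by positivity) (by norm_num)]
        nlinarith
  set ρ := κ * t₀ with hρ
  have hρ0 : 0 < ρ := by positivity
  have hρ4 : ρ ≤ t₀ / 4 := by rw [hρ]; nlinarith
  -- Moving y₀ towards the origin puts the ball of radius ρ about `yc` inside the ball of radius R
  -- while it still contains y₀, which corresponds to y₀/R in the unit ball.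
  set yc : Euc D := (1 - ρ / R) • y₀ with hyc
  have hρR : ρ / R ≤ 1 := (div_le_one hR).mpr ht₀R
  have hycn : ‖yc‖ ≤ R - ρ := by
    rw [hyc, norm_smul, Real.norm_of_nonneg (by linarith)]
    calc (1 - ρ / R) * ‖y₀‖ ≤ (1 - ρ / R) * R := by
          gcongr
      _ = R - ρ := by field_simp
  have hy₀c : ‖y₀ - yc‖ ≤ ρ := by
    have : y₀ - yc = (ρ / R) • y₀ := by rw [hyc]; module
    rw [this, norm_smul, Real.norm_of_nonneg (by positivity)]
    calc ρ / R * ‖y₀‖ ≤ ρ / R * R := by gcongr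
      _ = ρ := by field_simp
  set S : Set (Euc D) := Metric.closedBall yc ρ with hS
  have hSm : MeasurableSet S := measurableSet_closedBall
  have hSR : S ⊆ Metric.closedBall 0 R := by
    intro y hy
    rw [hS, mem_closedBall_iff_norm] at hy
    rw [mem_closedBall_zero_iff]
    calc ‖y‖ = ‖(y - yc) + yc‖ := by congr 1; abel
      _ ≤ ‖y - yc‖ + ‖yc‖ := norm_add_le _ _
      _ ≤ R := by linarith
  have hSdist : ∀ y ∈ S, ‖y - y₀‖ ≤ 2 * ρ := by
    intro y hy
    rw [hS, mem_closedBall_iff_norm] at hy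
    calc ‖y - y₀‖ = ‖(y - yc) - (y₀ - yc)‖ := by congr 1; abel
      _ ≤ ‖y - yc‖ + ‖y₀ - yc‖ := norm_sub_le _ _
      _ ≤ 2 * ρ := by linarith
  have hSP : S ⊆ Metric.closedBall 0 (2 * t₀) := by
    intro y hy
    have h1 := hSdist y hy
    have h2 := norm_le_hypTime s y₀
    rw [mem_closedBall_zero_iff]
    calc ‖y‖ = ‖(y - y₀) + y₀‖ := by congr 1; abel
      _ ≤ ‖y - y₀‖ + ‖y₀‖ := norm_add_le _ _
      _ ≤ 2 * t₀ := by linarith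
  have hτle : ∀ y ∈ S, hypTime s y ≤ 2 * t₀ := fun y hy => by
    have h1 := hSdist y hy
    have h2 := hypTime_sub_le s y y₀
    linarith
  have hτge : ∀ y ∈ S, ρ ≤ hypTime s y := fun y hy => by
    have h1 := hSdist y hy
    have h2 := hypTime_sub_le s y₀ y
    rw [norm_sub_rev] at h2
    linarith
  have hmemS : ∀ ξ ∈ Metric.closedBall (0 : Euc D) 1, yc + ρ • ξ ∈ S := by
    intro ξ hξ
    rw [hS, mem_closedBall_iff_norm, add_sub_cancel_left, norm_smul, Real.norm_of_nonneg hρ0.le]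
    rw [mem_closedBall_zero_iff] at hξ
    nlinarith
  have hmemS' : ∀ ξ, yc + ρ • ξ ∈ S → ξ ∈ Metric.closedBall (0 : Euc D) 1 := by
    intro ξ hξ
    rw [hS, mem_closedBall_iff_norm, add_sub_cancel_left, norm_smul,
      Real.norm_of_nonneg hρ0.le] at hξ
    rw [mem_closedBall_zero_iff]
    nlinarith
  -- rescaling
  have hscale : ∀ k I, ∫⁻ ξ in Metric.closedBall (0 : Euc D) 1, ‖F k I (yc + ρ • ξ)‖ₑ ^ 2 =
      ENNReal.ofReal ρ ^ (-(D : ℝ)) * ∫⁻ y in S, ‖F k I y‖ₑ ^ 2 := by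
    intro k I
    have h1 := lintegral_smul_euc hρ0 (fun y => S.indicator (fun y => ‖F k I y‖ₑ ^ 2) (yc + y))
    rw [lintegral_add_left_eq_self (S.indicator (fun y => ‖F k I y‖ₑ ^ 2)) yc,
      lintegral_indicator hSm] at h1
    rw [← h1, ← lintegral_indicator measurableSet_closedBall]
    refine lintegral_congr fun ξ => ?_
    by_cases hξ : ξ ∈ Metric.closedBall (0 : Euc D) 1
    · rw [indicator_of_mem hξ, indicator_of_mem (hmemS ξ hξ)]
    · rw [indicator_of_notMem hξ, indicator_of_notMem (fun h => hξ (hmemS' ξ h))]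
  have hsob := hC₁ (fun k I ξ => F k I (yc + ρ • ξ))
    (fun k hk I => (hF k hk I).comp (by fun_prop))
    (fun k hk I => (hFc k hk I).comp (by fun_prop)) ?_ (R⁻¹ • y₀) ?_
  rotate_left
  · intro k hk I i ξ hξ
    have h1 : HasFDerivAt (fun ξ : Euc D => yc + ρ • ξ)
        (ρ • ContinuousLinearMap.id ℝ (Euc D)) ξ :=
      ((hasFDerivAt_id ξ).const_smul ρ).const_add yc
    have h2 := (((hF k hk I).differentiable one_ne_zero (yc + ρ • ξ)).hasFDerivAt).comp ξ h1
    have h3 : fderiv ℝ (fun ξ => F k I (yc + ρ • ξ)) ξ = _ := h2.fderiv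
    rw [h3]
    simp only [ContinuousLinearMap.comp_apply, _root_.smul_apply,
      ContinuousLinearMap.id_apply, map_smul, smul_eq_mul]
    -- The rescaled derivative is ρ∂_i, dominated by the boost t∂_i because ρ ≤ t on the ball.
    rw [← hder k hk I i, abs_mul, abs_of_pos hρ0, abs_mul, abs_of_nonneg (hypTime_nonneg _ _)]
    gcongr
    exact hτge _ (hmemS ξ hξ)
  · rw [mem_closedBall_zero_iff, norm_smul, norm_inv, Real.norm_of_nonneg hR.le,
      inv_mul_le_one₀ hR]
    exact hy₀
  have hpt : yc + ρ • R⁻¹ • y₀ = y₀ := by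
    rw [hyc, smul_smul, ← add_smul, ← div_eq_mul_inv]
    simp
  simp only [hpt, hscale] at hsob
  set T := ENNReal.ofReal (t₀ ^ ((D : ℝ) - 2)) with hT
  -- The powers of t₀ cancel: the weight t₀^(D-2), the volume factor ρ^(-D) and the two factors of t
  -- from a boost leave a pure constant. This fixes the exponent D - 2.
  have hTρ : T * ENNReal.ofReal ρ ^ (-(D : ℝ)) * ENNReal.ofReal (2 * t₀) ^ 2 = ca := by
    rw [hT, hca, ENNReal.ofReal_rpow_of_pos hρ0, ← ENNReal.ofReal_pow (by positivity),
      ← ENNReal.ofReal_mul (by positivity), ← ENNReal.ofReal_mul (by positivity)]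
    congr 1
    rw [hρ, Real.mul_rpow hκ0.le ht₀0.le, mul_pow]
    have : t₀ ^ ((D : ℝ) - 2) * t₀ ^ (-(D : ℝ)) * t₀ ^ 2 = 1 := by
      rw [← Real.rpow_natCast, ← Real.rpow_add ht₀0, ← Real.rpow_add ht₀0,
        show (D : ℝ) - 2 + -D + (2 : ℕ) = 0 by push_cast; ring, Real.rpow_zero]
    calc _ = 4 * κ ^ (-(D : ℝ)) * (t₀ ^ ((D : ℝ) - 2) * t₀ ^ (-(D : ℝ)) * t₀ ^ 2) := by ring
      _ = _ := by rw [this, mul_one]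
  set e : (k : ℕ) → (Fin k → Fin D) → Fin D → ℝ≥0∞ := fun k I i =>
    ∫⁻ y in Metric.closedBall (0 : Euc D) R,
      ‖fderiv ℝ (F k I) y (EuclideanSpace.single i 1)‖ₑ ^ 2 with he
  set E := ∑ k ∈ Finset.range M, ∑ I : Fin k → Fin D, ∑ i : Fin D, e k I i with hE
  have hpos : ∀ k < M, ∀ I i, T * (ENNReal.ofReal ρ ^ (-(D : ℝ)) *
      ∫⁻ y in S, ‖F (k + 1) (Fin.snoc I i : Fin (k + 1) → Fin D) y‖ₑ ^ 2) ≤ ca * e k I i := by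
    intro k hk I i
    calc _ ≤ T * (ENNReal.ofReal ρ ^ (-(D : ℝ)) * ∫⁻ y in S, ENNReal.ofReal (2 * t₀) ^ 2 *
          ‖fderiv ℝ (F k I) y (EuclideanSpace.single i 1)‖ₑ ^ 2) := by
          refine mul_le_mul_right (mul_le_mul_right (setLIntegral_mono' hSm fun y hy => ?_) _) _
          rw [← hder k hk I i, enorm_mul, mul_pow, Real.enorm_of_nonneg (hypTime_nonneg _ _)]
          gcongr
          exact hτle y hy
      _ ≤ T * (ENNReal.ofReal ρ ^ (-(D : ℝ)) * (ENNReal.ofReal (2 * t₀) ^ 2 * e k I i)) := by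
          rw [lintegral_const_mul' _ _ (by finiteness)]
          refine mul_le_mul_right (mul_le_mul_right (mul_le_mul_right ?_ _) _) _
          exact lintegral_mono_set hSR
      _ = _ := by rw [← hTρ]; ring
  -- The undifferentiated term carries no boost; the Hardy inequality with P = 2t₀ supplies the
  -- missing factor t₀² and a boundary contribution.
  have hzero : T * (ENNReal.ofReal ρ ^ (-(D : ℝ)) * ∫⁻ y in S, ‖F 0 Fin.elim0 y‖ₑ ^ 2) ≤
      cb * ENNReal.ofReal (B ^ 2) + 2 * D * ca * E := by
    have hM0 : 0 < M := by
      have : (0 : ℝ) < M := by linarith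
      exact_mod_cast this
    have hhardy := lintegral_sq_le_of_boundary hD (hF 0 hM0 Fin.elim0) hR
      (B := ENNReal.ofReal (|B| * R ^ (-((D : ℝ) - 1) / 2))) (P := 2 * t₀) (fun y hy => by
        rw [← ofReal_norm]
        refine ENNReal.ofReal_le_ofReal ((hB y hy).trans ?_)
        gcongr
        exact le_abs_self B) hSm hSR hSP
    have hvol : volume S = ENNReal.ofReal ρ ^ (D : ℝ) * v := by
      rw [hS, Measure.addHaar_closedBall _ _ hρ0.le, finrank_euclideanSpace_fin,
        ENNReal.ofReal_pow hρ0.le, ENNReal.rpow_natCast, hv,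
        Measure.addHaar_unitClosedBall_eq_addHaar_unitBall]
    have hgrad : ∫⁻ y in Metric.closedBall (0 : Euc D) R, ‖fderiv ℝ (F 0 Fin.elim0) y‖ₑ ^ 2 ≤
        D * E := by
      have hc0 := (hF 0 hM0 Fin.elim0).continuous_fderiv one_ne_zero
      calc _ ≤ ∫⁻ y in Metric.closedBall (0 : Euc D) R,
            D * ∑ i, ‖fderiv ℝ (F 0 Fin.elim0) y (EuclideanSpace.single i 1)‖ₑ ^ 2 := by
            refine lintegral_mono fun y => ?_
            have h3 := ENNReal.inner_le_Lp_mul_Lq Finset.univ (fun _ => 1)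
              (fun i => ‖fderiv ℝ (F 0 Fin.elim0) y (EuclideanSpace.single i 1)‖ₑ)
              (p := 2) (q := 2) ⟨by norm_num, by norm_num, by norm_num⟩
            simp only [one_mul, ENNReal.one_rpow, Finset.sum_const, Finset.card_univ, nsmul_eq_mul,
              mul_one, Fintype.card_fin] at h3
            calc _ ≤ (∑ i, ‖fderiv ℝ (F 0 Fin.elim0) y (EuclideanSpace.single i 1)‖ₑ) ^ 2 := by
                  gcongr
                  exact enorm_clm_le_sum _
              _ ≤ _ := by
                  refine (pow_le_pow_left₀ zero_le h3 2).trans (le_of_eq ?_)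
                  rw [mul_pow, ← ENNReal.rpow_natCast, ← ENNReal.rpow_natCast, ← ENNReal.rpow_mul,
                    ← ENNReal.rpow_mul]
                  norm_num
        _ = D * ∑ i, e 0 Fin.elim0 i := by
            rw [lintegral_const_mul' _ _ (by finiteness), lintegral_finsetSum _
              (fun i _ => by fun_prop)]
        _ ≤ D * E := by
            gcongr
            rw [hE, ← Finset.add_sum_erase _ _ (Finset.mem_range.mpr hM0)]
            refine le_trans (le_of_eq ?_) le_self_add
            simp only [Finset.univ_unique, Finset.sum_singleton]
            congr
    calc _ ≤ T * (ENNReal.ofReal ρ ^ (-(D : ℝ)) *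
          (2 * ENNReal.ofReal (|B| * R ^ (-((D : ℝ) - 1) / 2)) ^ 2 *
            (ENNReal.ofReal ρ ^ (D : ℝ) * v) + 2 * ENNReal.ofReal (2 * t₀) ^ 2 * (D * E))) := by
          rw [hvol] at hhardy
          gcongr
          refine hhardy.trans ?_
          gcongr
      _ = (ENNReal.ofReal ρ ^ (-(D : ℝ)) * ENNReal.ofReal ρ ^ (D : ℝ)) * (2 * v *
            (T * ENNReal.ofReal (|B| * R ^ (-((D : ℝ) - 1) / 2)) ^ 2)) +
          2 * D * (T * ENNReal.ofReal ρ ^ (-(D : ℝ)) * ENNReal.ofReal (2 * t₀) ^ 2) * E := by ring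
      _ ≤ _ := by
          rw [hTρ, ← ENNReal.rpow_add _ _ (by simpa using hρ0) (by simp), neg_add_cancel,
            ENNReal.rpow_zero, one_mul, hcb, mul_assoc (2 * v)]
          refine add_le_add (mul_le_mul_right ?_ _) le_rfl
          rw [hT, ← ENNReal.ofReal_pow (by positivity), ← ENNReal.ofReal_mul (by positivity),
            ← ENNReal.ofReal_mul (by positivity)]
          refine ENNReal.ofReal_le_ofReal ?_
          -- Since t₀ ≤ R/κ, the boundary term is at most a multiple of R^(D-2) R^(-(D-1)) B² =
          -- R⁻¹B², and R is bounded below by R₀.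
          have h1 : t₀ ^ ((D : ℝ) - 2) ≤ (R * κ⁻¹) ^ ((D : ℝ) - 2) := by
            refine Real.rpow_le_rpow ht₀0.le ?_ (by linarith)
            rw [← div_eq_mul_inv, le_div_iff₀ hκ0, mul_comm]
            exact ht₀R
          calc _ ≤ (R * κ⁻¹) ^ ((D : ℝ) - 2) * (|B| * R ^ (-((D : ℝ) - 1) / 2)) ^ 2 := by gcongr
            _ = κ ^ (2 - (D : ℝ)) * R⁻¹ * B ^ 2 := by
                rw [Real.mul_rpow hR.le (by positivity), mul_pow, sq_abs, ← Real.rpow_natCast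
                  (R ^ _), ← Real.rpow_mul hR.le, Real.inv_rpow hκ0.le, ← Real.rpow_neg hκ0.le,
                  ← Real.rpow_neg_one R]
                have : R ^ ((D : ℝ) - 2) * R ^ (-((D : ℝ) - 1) / 2 * (2 : ℕ)) = R ^ (-1 : ℝ) := by
                  rw [← Real.rpow_add hR]
                  congr 1
                  push_cast
                  ring
                rw [← this, neg_sub]
                ring
            _ ≤ _ := by gcongr
  calc T * ‖F 0 Fin.elim0 y₀‖ₑ ^ 2 ≤ T * (C₁ * ∑ k ∈ Finset.range (M + 1), ∑ I : Fin k → Fin D,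
        (ENNReal.ofReal ρ ^ (-(D : ℝ)) * ∫⁻ y in S, ‖F k I y‖ₑ ^ 2)) := by gcongr
    _ = C₁ * (∑ k ∈ Finset.range M, ∑ I : Fin k → Fin D, ∑ i : Fin D,
          T * (ENNReal.ofReal ρ ^ (-(D : ℝ)) *
            ∫⁻ y in S, ‖F (k + 1) (Fin.snoc I i : Fin (k + 1) → Fin D) y‖ₑ ^ 2) +
          T * (ENNReal.ofReal ρ ^ (-(D : ℝ)) * ∫⁻ y in S, ‖F 0 Fin.elim0 y‖ₑ ^ 2)) := by
        rw [mul_left_comm, Finset.sum_range_succ', mul_add T]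
        congr 2
        · rw [Finset.mul_sum]
          refine Finset.sum_congr rfl fun k _ => ?_
          rw [← (Fin.snocEquiv (fun _ : Fin (k + 1) => Fin D)).sum_comp,
            Fintype.sum_prod_type_right]
          simp only [Finset.mul_sum]
          rfl
        · simp only [Finset.univ_unique, Finset.sum_singleton]
          congr
    _ ≤ C₁ * (ca * E + (cb * ENNReal.ofReal (B ^ 2) + 2 * D * ca * E)) := by
        gcongr
        rw [hE, Finset.mul_sum]
        refine Finset.sum_le_sum fun k hk => ?_
        rw [Finset.mul_sum]
        refine Finset.sum_le_sum fun I _ => ?_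
        rw [Finset.mul_sum]
        exact Finset.sum_le_sum fun i _ => hpos k (Finset.mem_range.mp hk) I i
    _ ≤ C₁ * (((1 + 2 * D) * ca + cb) * (E + ENNReal.ofReal (B ^ 2))) := by
        gcongr
        calc _ ≤ ca * E + (cb * ENNReal.ofReal (B ^ 2) + 2 * D * ca * E) +
              (((1 + 2 * D) * ca) * ENNReal.ofReal (B ^ 2) + cb * E) := le_self_add
          _ = _ := by ring
    _ = _ := by
        push_cast
        rw [ENNReal.coe_toNNReal (by finiteness), mul_assoc]

end Hyperboloid

/-! ### Integration by parts, and the regularized parametrix with its bounds. -/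

section Parametrix

variable {d : ℕ}

/-- The partial derivative `∂_A` on `ℝ^d`. -/
def pdE (A : Fin d) (F : Euc d → ℝ) (y : Euc d) : ℝ := fderiv ℝ F y (EuclideanSpace.single A 1)

theorem contDiff_pdE {F : Euc d → ℝ} {m n : WithTop ℕ∞} (hF : ContDiff ℝ n F) (h : m + 1 ≤ n)
    (A : Fin d) : ContDiff ℝ m (pdE A F) :=
  (hF.fderiv_right h).clm_apply contDiff_const

theorem contDiffOn_pdE {F : Euc d → ℝ} {U : Set (Euc d)} (hU : IsOpen U) {m n : WithTop ℕ∞}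
    (hF : ContDiffOn ℝ n F U) (h : m + 1 ≤ n) (A : Fin d) : ContDiffOn ℝ m (pdE A F) U :=
  (hF.fderiv_of_isOpen hU h).clm_apply contDiffOn_const

theorem tsupport_pdE_subset (A : Fin d) (F : Euc d → ℝ) : tsupport (pdE A F) ⊆ tsupport F :=
  tsupport_fderiv_apply_subset ℝ _

/-- Off the support of the first factor the product vanishes, so nothing is required of the second
factor outside U. This is how functions controlled only in a chart domain are used globally. -/
theorem continuous_mul_of_tsupport {X : Type*} [TopologicalSpace X] {G V : X → ℝ} {U : Set X}
    (hU : IsOpen U) (hG : Continuous G) (hV : ContinuousOn V U) (hsub : tsupport G ⊆ U) :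
    Continuous fun y => G y * V y := by
  refine continuous_of_tsupport fun x hx => ?_
  have hxU : x ∈ U := hsub (tsupport_mul_subset_left hx)
  exact hG.continuousAt.mul (hV.continuousAt (hU.mem_nhds hxU))

theorem contDiff_mul_of_tsupport {G V : Euc d → ℝ} {U : Set (Euc d)} {n : WithTop ℕ∞}
    (hU : IsOpen U) (hG : ContDiff ℝ n G) (hV : ContDiffOn ℝ n V U) (hsub : tsupport G ⊆ U) :
    ContDiff ℝ n fun y => G y * V y := by
  rw [contDiff_iff_contDiffAt]
  intro x
  by_cases hx : x ∈ tsupport fun y => G y * V y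
  swap
  · refine (contDiffAt_const (c := (0 : ℝ))).congr_of_eventuallyEq ?_
    exact notMem_tsupport_iff_eventuallyEq.mp hx
  have hxU : x ∈ U := hsub (tsupport_mul_subset_left hx)
  exact hG.contDiffAt.mul (hV.contDiffAt (hU.mem_nhds hxU))

theorem integrable_mul_of_tsupport {G V : Euc d → ℝ} {U K : Set (Euc d)} (hU : IsOpen U)
    (hK : IsCompact K) (hKU : K ⊆ U) (hG : Continuous G) (hV : ContinuousOn V U)
    (hsub : tsupport G ⊆ K) : Integrable fun y => G y * V y :=
  (continuous_mul_of_tsupport hU hG hV (hsub.trans hKU)).integrable_of_hasCompactSupport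
    (HasCompactSupport.mul_right (hK.of_isClosed_subset (isClosed_tsupport _) hsub))

theorem integral_mul_pdE {G V : Euc d → ℝ} {U K : Set (Euc d)} (hU : IsOpen U)
    (hK : IsCompact K) (hKU : K ⊆ U) (hG : ContDiff ℝ 1 G) (hV : ContDiffOn ℝ 1 V U)
    (hsub : tsupport G ⊆ K) (A : Fin d) :
    ∫ y, G y * pdE A V y = - ∫ y, pdE A G y * V y := by
  refine integral_mul_fderiv_eq_neg_fderiv_mul_of_integrable ?_ ?_ ?_ ?_ ?_
  · exact integrable_mul_of_tsupport hU hK hKU (contDiff_pdE hG (m := 0) (by simp) A).continuous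
      hV.continuousOn ((tsupport_pdE_subset A G).trans hsub)
  · exact integrable_mul_of_tsupport hU hK hKU hG.continuous
      (contDiffOn_pdE hU hV (m := 0) (by simp) A).continuousOn hsub
  · exact integrable_mul_of_tsupport hU hK hKU hG.continuous hV.continuousOn hsub
  · exact fun x _ => hG.differentiable one_ne_zero x
  · exact fun x hx => (hV.differentiableOn one_ne_zero).differentiableAt
      (hU.mem_nhds (hKU (hsub hx)))

/-- A primitive of `σ ↦ σ^(-p)` on the half-line. -/
def negRpowPrim (p S σ : ℝ) : ℝ := -∫ τ in σ..S, τ ^ (-p)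

theorem hasDerivAt_negRpowPrim {p S σ : ℝ} (hσ : 0 < σ) (hS : 0 < S) :
    HasDerivAt (negRpowPrim p S) (σ ^ (-p)) σ := by
  have h0 : (0 : ℝ) ∉ uIcc σ S := by
    rw [mem_uIcc]
    rintro (h | h) <;> linarith [h.1, h.2]
  have h := intervalIntegral.integral_hasDerivAt_left
    (intervalIntegral.intervalIntegrable_rpow (r := -p) (Or.inr h0))
    ((Measurable.stronglyMeasurable (by fun_prop)).stronglyMeasurableAtFilter)
    (Real.continuousAt_rpow_const σ (-p) (Or.inl hσ.ne'))
  have h' := h.neg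
  rw [neg_neg] at h'
  exact h'

/-- For τ ≥ σ one has τ^(-p) ≤ σ^(b-p) τ^(-b), and the last factor is integrable at 0. The loss b <
1 absorbs the logarithm at p = 1, so all dimensions are treated alike. -/
theorem abs_negRpowPrim_le {p b S σ : ℝ} (hσ : 0 < σ) (hσS : σ ≤ S) (hb : b < 1) (hbp : b ≤ p) :
    |negRpowPrim p S σ| ≤ S ^ (1 - b) / (1 - b) * σ ^ (b - p) := by
  have h0 : (0 : ℝ) ∉ uIcc σ S := by
    rw [mem_uIcc]
    rintro (h | h) <;> linarith [h.1, h.2]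
  rw [negRpowPrim, abs_neg, abs_of_nonneg (intervalIntegral.integral_nonneg hσS fun τ hτ =>
    Real.rpow_nonneg (hσ.le.trans hτ.1) _)]
  calc ∫ τ in σ..S, τ ^ (-p) ≤ ∫ τ in σ..S, σ ^ (b - p) * τ ^ (-b) := by
        refine intervalIntegral.integral_mono_on hσS
          (intervalIntegral.intervalIntegrable_rpow (Or.inr h0))
          ((intervalIntegral.intervalIntegrable_rpow (Or.inr h0)).const_mul _) fun τ hτ => ?_
        have hτ0 : 0 < τ := hσ.trans_le hτ.1
        rw [show -p = (b - p) + -b by ring, Real.rpow_add hτ0]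
        exact mul_le_mul_of_nonneg_right (Real.rpow_le_rpow_of_nonpos hσ hτ.1 (by linarith))
          (Real.rpow_nonneg hτ0.le _)
    _ = σ ^ (b - p) * ((S ^ (1 - b) - σ ^ (1 - b)) / (1 - b)) := by
        rw [intervalIntegral.integral_const_mul, integral_rpow (Or.inl (by linarith)),
          show -b + 1 = 1 - b by ring]
    _ ≤ σ ^ (b - p) * (S ^ (1 - b) / (1 - b)) := by
        have h1 : 0 < 1 - b := by linarith
        have h2 : 0 ≤ σ ^ (1 - b) := Real.rpow_nonneg hσ.le _
        gcongr
        linarith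
    _ = _ := mul_comm _ _

/-- The quadratic form of a matrix. -/
def quadForm (k : Matrix (Fin d) (Fin d) ℝ) (z : Euc d) : ℝ := ∑ A, ∑ B, k A B * z A * z B

/-- The linear form `z ↦ ∑ k_{BC} z^C`. -/
def linForm (k : Matrix (Fin d) (Fin d) ℝ) (z : Euc d) (B : Fin d) : ℝ := ∑ C, k B C * z C

/-- The regularized parametrix with pole `x`. -/
def levi (S : ℝ) (k : Matrix (Fin d) (Fin d) ℝ) (x : Euc d) (ε : ℝ) (y : Euc d) : ℝ :=
  negRpowPrim (d / 2) S (quadForm k (y - x) + ε ^ 2)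

theorem hasFDerivAt_coord (A : Fin d) (y : Euc d) :
    HasFDerivAt (fun y : Euc d => y A) (EuclideanSpace.proj A : Euc d →L[ℝ] ℝ) y :=
  (EuclideanSpace.proj A : Euc d →L[ℝ] ℝ).hasFDerivAt

theorem contDiff_coord {n : WithTop ℕ∞} (A : Fin d) : ContDiff ℝ n (fun y : Euc d => y A) :=
  (EuclideanSpace.proj A : Euc d →L[ℝ] ℝ).contDiff

theorem contDiff_linForm {n : WithTop ℕ∞} (k : Matrix (Fin d) (Fin d) ℝ) (x : Euc d) (B : Fin d) :
    ContDiff ℝ n fun y => linForm k (y - x) B := by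
  unfold linForm
  refine ContDiff.sum fun C _ => contDiff_const.mul ?_
  exact (contDiff_coord C).comp (contDiff_id.sub contDiff_const)

theorem contDiff_quadForm {n : WithTop ℕ∞} (k : Matrix (Fin d) (Fin d) ℝ) (x : Euc d) :
    ContDiff ℝ n fun y => quadForm k (y - x) := by
  unfold quadForm
  have h : ∀ C, ContDiff ℝ n fun y : Euc d => (y - x) C := fun C =>
    (contDiff_coord C).comp (contDiff_id.sub contDiff_const)
  exact ContDiff.sum fun A _ => ContDiff.sum fun B _ => (contDiff_const.mul (h A)).mul (h B)

theorem pdE_linForm (k : Matrix (Fin d) (Fin d) ℝ) (x y : Euc d) (A B : Fin d) :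
    pdE A (fun y => linForm k (y - x) B) y = k B A := by
  have h : ∀ C : Fin d, HasFDerivAt (fun y : Euc d => (y - x) C)
      (EuclideanSpace.proj C : Euc d →L[ℝ] ℝ) y := fun C => by
    simpa using (hasFDerivAt_coord C y).sub_const (x C)
  have h2 := HasFDerivAt.fun_sum (u := Finset.univ) fun C _ => (h C).const_mul (k B C)
  unfold linForm
  rw [pdE, h2.fderiv]
  simp

theorem pdE_quadForm {k : Matrix (Fin d) (Fin d) ℝ} (hk : k.IsSymm) (x y : Euc d) (B : Fin d) :
    pdE B (fun y => quadForm k (y - x)) y = 2 * linForm k (y - x) B := by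
  have h : ∀ C : Fin d, HasFDerivAt (fun y : Euc d => (y - x) C)
      (EuclideanSpace.proj C : Euc d →L[ℝ] ℝ) y := fun C => by
    simpa using (hasFDerivAt_coord C y).sub_const (x C)
  have h2 := HasFDerivAt.fun_sum (u := Finset.univ) fun A _ =>
    HasFDerivAt.fun_sum (u := Finset.univ) fun C _ => ((h A).const_mul (k A C)).mul (h C)
  have h3 : fderiv ℝ (fun y => quadForm k (y - x)) y = _ := h2.fderiv
  rw [pdE, h3]
  simp only [_root_.sum_apply, _root_.add_apply, _root_.smul_apply,
    PiLp.proj_apply, smul_eq_mul, PiLp.single_apply, Finset.sum_add_distrib]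
  simp only [linForm, two_mul]
  congr 1
  · simp only [mul_ite, mul_one, mul_zero, Finset.sum_ite_eq', Finset.mem_univ, if_true]
    exact Finset.sum_congr rfl fun A _ => by rw [hk.apply]
  · rw [Finset.sum_comm]
    simp only [mul_ite, mul_one, mul_zero, Finset.sum_ite_eq', Finset.mem_univ, if_true]
    exact Finset.sum_congr rfl fun A _ => by ring

section Levi

variable {S ε : ℝ} {k : Matrix (Fin d) (Fin d) ℝ}

theorem levi_arg_pos (hk0 : ∀ z, 0 ≤ quadForm k z) (hε : 0 < ε) (z : Euc d) :
    0 < quadForm k z + ε ^ 2 := by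
  have := hk0 z
  positivity

theorem pdE_levi (hS : 0 < S) (hk : k.IsSymm) (hk0 : ∀ z, 0 ≤ quadForm k z) (hε : 0 < ε)
    (x : Euc d) (B : Fin d) :
    pdE B (levi S k x ε) = fun y => (quadForm k (y - x) + ε ^ 2) ^ (-((d : ℝ) / 2)) *
      (2 * linForm k (y - x) B) := by
  funext y
  have h1 : HasFDerivAt (fun y => quadForm k (y - x) + ε ^ 2)
      (fderiv ℝ (fun y => quadForm k (y - x)) y) y :=
    (((contDiff_quadForm (n := 1) k x).differentiable one_ne_zero y).hasFDerivAt).add_const _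
  have h2 := (hasDerivAt_negRpowPrim (p := d / 2) (levi_arg_pos hk0 hε (y - x)) hS).comp_hasFDerivAt
    y h1
  have h3 : fderiv ℝ (levi S k x ε) y = _ := h2.fderiv
  rw [pdE, h3, ← pdE_quadForm hk]
  simp [pdE]

theorem pdE_pdE_levi (hS : 0 < S) (hk : k.IsSymm) (hk0 : ∀ z, 0 ≤ quadForm k z) (hε : 0 < ε)
    (x y : Euc d) (A B : Fin d) :
    pdE A (pdE B (levi S k x ε)) y =
      2 * k B A * (quadForm k (y - x) + ε ^ 2) ^ (-((d : ℝ) / 2)) -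
      2 * d * (quadForm k (y - x) + ε ^ 2) ^ (-((d : ℝ) / 2) - 1) *
        (linForm k (y - x) A * linForm k (y - x) B) := by
  have h1 : HasFDerivAt (fun y => quadForm k (y - x) + ε ^ 2)
      (fderiv ℝ (fun y => quadForm k (y - x)) y) y :=
    (((contDiff_quadForm (n := 1) k x).differentiable one_ne_zero y).hasFDerivAt).add_const _
  have hpos := levi_arg_pos hk0 hε (y - x)
  have h2 := (Real.hasDerivAt_rpow_const (p := -((d : ℝ) / 2))
    (Or.inl hpos.ne')).comp_hasFDerivAt y h1
  have h3 := (((contDiff_linForm (n := 1) k x B).differentiable one_ne_zero y).hasFDerivAt).const_mul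
    2
  have h4 := h2.mul h3
  have h5 : fderiv ℝ (fun y => (quadForm k (y - x) + ε ^ 2) ^ (-((d : ℝ) / 2)) *
      (2 * linForm k (y - x) B)) y = _ := h4.fderiv
  rw [pdE_levi hS hk hk0 hε, pdE, h5]
  have e1 := pdE_quadForm hk x y A
  have e2 := pdE_linForm k x y A B
  rw [pdE] at e1 e2
  simp only [_root_.add_apply, _root_.smul_apply, smul_eq_mul, Function.comp_apply, e1, e2]
  ring

theorem contDiff_levi (hS : 0 < S) (hk : k.IsSymm) (hk0 : ∀ z, 0 ≤ quadForm k z) (hε : 0 < ε)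
    (x : Euc d) : ContDiff ℝ 2 (levi S k x ε) := by
  have hdiff : Differentiable ℝ (levi S k x ε) := by
    intro y
    have h1 : HasFDerivAt (fun y => quadForm k (y - x) + ε ^ 2)
        (fderiv ℝ (fun y => quadForm k (y - x)) y) y :=
      (((contDiff_quadForm (n := 1) k x).differentiable one_ne_zero y).hasFDerivAt).add_const _
    exact ((hasDerivAt_negRpowPrim (p := d / 2) (levi_arg_pos hk0 hε (y - x)) hS).comp_hasFDerivAt
      y h1).differentiableAt
  have h2 : (2 : WithTop ℕ∞) = 1 + 1 := by norm_num
  rw [h2, contDiff_succ_iff_fderiv]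
  refine ⟨hdiff, by simp, ?_⟩
  rw [contDiff_clm_apply_iff]
  intro v
  -- Second order regularity is read off from the explicit first partial derivatives, which are
  -- smooth because the regularized argument stays positive.
  have hv : v = ∑ i, v i • (EuclideanSpace.single i (1 : ℝ) : Euc d) := by
    ext j
    simp [Pi.single_apply]
  have hsum : (fun y => fderiv ℝ (levi S k x ε) y v) =
      fun y => ∑ i, v i * pdE i (levi S k x ε) y := by
    funext y
    conv_lhs => rw [hv]
    simp [map_sum, pdE]
  rw [hsum]
  refine ContDiff.sum fun i _ => contDiff_const.mul ?_
  rw [pdE_levi hS hk hk0 hε]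
  refine ContDiff.mul ?_ (contDiff_const.mul (contDiff_linForm k x i))
  exact ((contDiff_quadForm k x).add contDiff_const).rpow_const_of_ne
    fun y => (levi_arg_pos hk0 hε (y - x)).ne'

theorem abs_linForm_le {Λ : ℝ} (hΛ : ∀ A B, |k A B| ≤ Λ) (z : Euc d) (B : Fin d) :
    |linForm k z B| ≤ d * Λ * ‖z‖ := by
  calc |linForm k z B| ≤ ∑ C, |k B C * z C| := Finset.abs_sum_le_sum_abs _ _
    _ ≤ ∑ _C : Fin d, Λ * ‖z‖ := by
        refine Finset.sum_le_sum fun C _ => ?_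
        rw [abs_mul]
        have h1 : |z C| ≤ ‖z‖ := PiLp.norm_apply_le z C
        have h2 := hΛ B C
        have h3 : 0 ≤ Λ := (abs_nonneg _).trans h2
        gcongr
    _ = _ := by simp; ring

theorem rpow_arg_le {lam : ℝ} (hlam : 0 < lam) (hq : ∀ z, lam * ‖z‖ ^ 2 ≤ quadForm k z) {p : ℝ}
    (hp : p ≤ 0) {z : Euc d} (hz : z ≠ 0) :
    (quadForm k z + ε ^ 2) ^ p ≤ lam ^ p * ‖z‖ ^ (2 * p) := by
  have hz' : 0 < ‖z‖ := norm_pos_iff.mpr hz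
  have h1 := hq z
  calc _ ≤ (lam * ‖z‖ ^ 2) ^ p :=
        Real.rpow_le_rpow_of_nonpos (by positivity) (by nlinarith [sq_nonneg ε]) hp
    _ = _ := by
        rw [Real.mul_rpow hlam.le (by positivity), ← Real.rpow_natCast, ← Real.rpow_mul hz'.le]
        norm_num

end Levi

/-- Ellipticity makes the argument σ of the primitive at least lam·|y-x|², so powers of σ become
powers of |y-x|, uniformly in ε. The condition on S ensures σ ≤ S, the range in which the primitive
is controlled. -/
theorem exists_levi_bounds (d : ℕ) {lam Λ R b S : ℝ} (hlam : 0 < lam) (hb : b < 1)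
    (hbd : 2 * b < d) (hS : Λ * R ^ 2 + 1 ≤ S) : ∃ C : ℝ, 0 ≤ C ∧ ∀ (k : Matrix (Fin d) (Fin d) ℝ),
      k.IsSymm → (∀ A B, |k A B| ≤ Λ) → (∀ z, lam * ‖z‖ ^ 2 ≤ quadForm k z) →
      (∀ z, quadForm k z ≤ Λ * ‖z‖ ^ 2) → ∀ ε, 0 < ε → ε ≤ 1 → ∀ x y : Euc d, y - x ≠ 0 →
      ‖y - x‖ ≤ R →
      |levi S k x ε y| ≤ C * ‖y - x‖ ^ (2 * b - d) ∧
      (∀ B, |pdE B (levi S k x ε) y| ≤ C * ‖y - x‖ ^ (1 - (d : ℝ))) ∧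
      (∀ A B, |pdE A (pdE B (levi S k x ε)) y| ≤ C * ‖y - x‖ ^ (-(d : ℝ))) := by
  set C₁ : ℝ := |S| ^ (1 - b) / (1 - b) * lam ^ (b - d / 2) with hC₁
  set C₂ : ℝ := lam ^ (-((d : ℝ) / 2)) * (2 * (d * |Λ|)) with hC₂
  set C₃ : ℝ := 2 * |Λ| * lam ^ (-((d : ℝ) / 2)) +
    2 * d * lam ^ (-((d : ℝ) / 2) - 1) * (d * |Λ|) ^ 2 with hC₃
  have hb1 : 0 < 1 - b := by linarith
  have h₁ : 0 ≤ C₁ := by positivity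
  have h₂ : 0 ≤ C₂ := by positivity
  have h₃ : 0 ≤ C₃ := by positivity
  refine ⟨C₁ + C₂ + C₃, by positivity, ?_⟩
  intro k hk hkΛ hlow hup ε hε hε1 x y hxy hR
  have hr : 0 < ‖y - x‖ := norm_pos_iff.mpr hxy
  have hΛ0 : 0 ≤ Λ := by
    have := (mul_pos hlam (pow_pos hr 2)).trans_le ((hlow _).trans (hup (y - x)))
    exact (pos_of_mul_pos_left this (by positivity)).le
  have hk0 : ∀ z, 0 ≤ quadForm k z := fun z => (by positivity : 0 ≤ lam * ‖z‖ ^ 2).trans (hlow z)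
  have hpos := levi_arg_pos hk0 hε (y - x)
  have hSle : quadForm k (y - x) + ε ^ 2 ≤ S := by
    refine le_trans (add_le_add ((hup _).trans ?_) (by nlinarith : ε ^ 2 ≤ 1)) hS
    gcongr
  have hS0 : 0 < S := hpos.trans_le hSle
  rw [abs_of_nonneg hΛ0] at hC₂ hC₃
  rw [abs_of_pos hS0] at hC₁
  have hlin := fun B => abs_linForm_le hkΛ (y - x) B
  have hr1 : ‖y - x‖ ^ (1 - (d : ℝ)) = ‖y - x‖ ^ (2 * -((d : ℝ) / 2)) * ‖y - x‖ := by
    rw [← Real.rpow_add_one hr.ne']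
    congr 1
    ring
  have hr2 : ‖y - x‖ ^ (-(d : ℝ)) = ‖y - x‖ ^ (2 * -((d : ℝ) / 2)) := by
    congr 1
    ring
  have hr3 : ‖y - x‖ ^ (-(d : ℝ)) = ‖y - x‖ ^ (2 * (-((d : ℝ) / 2) - 1)) * ‖y - x‖ ^ 2 := by
    rw [← Real.rpow_natCast, ← Real.rpow_add hr]
    congr 1
    push_cast
    ring
  have hσ₁ := rpow_arg_le (ε := ε) (p := -((d : ℝ) / 2)) hlam hlow
    (neg_nonpos.mpr (by positivity)) hxy
  have hd0 : (0 : ℝ) ≤ (d : ℝ) / 2 := by positivity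
  have hσ₂ := rpow_arg_le (ε := ε) (p := -((d : ℝ) / 2) - 1) hlam hlow
    (by linarith) hxy
  have hσp : ∀ p : ℝ, 0 ≤ (quadForm k (y - x) + ε ^ 2) ^ p := fun p => Real.rpow_nonneg hpos.le _
  refine ⟨?_, fun B => ?_, fun A B => ?_⟩
  · have h := abs_negRpowPrim_le (p := d / 2) hpos hSle hb (by linarith)
    have hσ := rpow_arg_le (ε := ε) (p := b - d / 2) hlam hlow (by linarith) hxy
    rw [show 2 * (b - (d : ℝ) / 2) = 2 * b - d by ring] at hσ
    calc |levi S k x ε y| ≤ S ^ (1 - b) / (1 - b) * (lam ^ (b - (d : ℝ) / 2) *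
          ‖y - x‖ ^ (2 * b - d)) := by
          refine h.trans ?_
          gcongr
      _ = C₁ * ‖y - x‖ ^ (2 * b - d) := by rw [hC₁]; ring
      _ ≤ _ := by
          gcongr
          linarith
  · rw [pdE_levi hS0 hk hk0 hε, abs_mul, abs_of_nonneg (hσp _), abs_mul, abs_two]
    calc _ ≤ (lam ^ (-((d : ℝ) / 2)) * ‖y - x‖ ^ (2 * -((d : ℝ) / 2))) *
          (2 * (d * Λ * ‖y - x‖)) := by
          gcongr
          exact hlin B
      _ = C₂ * ‖y - x‖ ^ (1 - (d : ℝ)) := by rw [hr1, hC₂]; ring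
      _ ≤ _ := by
          gcongr
          linarith
  · rw [pdE_pdE_levi hS0 hk hk0 hε]
    refine (abs_sub _ _).trans ?_
    simp only [abs_mul, abs_two, abs_of_nonneg (hσp _), Nat.abs_cast]
    calc _ ≤ 2 * Λ * (lam ^ (-((d : ℝ) / 2)) * ‖y - x‖ ^ (2 * -((d : ℝ) / 2))) +
          2 * d * (lam ^ (-((d : ℝ) / 2) - 1) * ‖y - x‖ ^ (2 * (-((d : ℝ) / 2) - 1))) *
          ((d * Λ * ‖y - x‖) * (d * Λ * ‖y - x‖)) := by
          gcongr
          · exact hkΛ B A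
          · exact hlin A
          · exact hlin B
      _ = C₃ * ‖y - x‖ ^ (-(d : ℝ)) := by
          rw [hC₃, add_mul]
          congr 1
          · rw [hr2]; ring
          · rw [hr3]; ring
      _ ≤ _ := by
          gcongr
          linarith

/-- With frozen coefficients h = k⁻¹ the contractions are h·k = d and h(kz, kz) = k(z, z). The
singular terms cancel and only the part of σ = k(z, z) + ε² coming from ε² survives: a multiple of
an approximate identity. -/
theorem sum_mul_pdE_pdE_levi {S ε : ℝ} {k h : Matrix (Fin d) (Fin d) ℝ} (hS : 0 < S)
    (hk : k.IsSymm) (hk0 : ∀ z, 0 ≤ quadForm k z) (hε : 0 < ε) (hkh : h * k = 1) (x y : Euc d) :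
    ∑ A, ∑ B, h A B * pdE B (pdE A (levi S k x ε)) y =
      2 * d * ε ^ 2 * (quadForm k (y - x) + ε ^ 2) ^ (-((d : ℝ) / 2) - 1) := by
  set σ := quadForm k (y - x) + ε ^ 2 with hσ
  have hpos : 0 < σ := levi_arg_pos hk0 hε (y - x)
  have h1 : ∑ A, ∑ B, h A B * k A B = d := by
    have : ∀ A, ∑ B, h A B * k A B = 1 := fun A => by
      have := congrFun (congrFun hkh A) A
      rw [Matrix.mul_apply, Matrix.one_apply_eq] at this
      rw [← this]
      exact Finset.sum_congr rfl fun B _ => by rw [hk.apply]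
    simp [this]
  have h2 : ∑ A, ∑ B, h A B * (linForm k (y - x) B * linForm k (y - x) A) = quadForm k (y - x) := by
    have h3 : ∀ A, ∑ B, h A B * linForm k (y - x) B = (y - x) A := fun A => by
      simp only [linForm, Finset.mul_sum]
      rw [Finset.sum_comm]
      have h4 : ∀ C, ∑ B, h A B * (k B C * (y - x) C) = (if A = C then 1 else 0) * (y - x) C :=
        fun C => by
          have := congrFun (congrFun hkh A) C
          rw [Matrix.mul_apply, Matrix.one_apply] at this
          rw [← this, Finset.sum_mul]
          exact Finset.sum_congr rfl fun B _ => by ring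
      simp only [h4, ite_mul, one_mul, zero_mul, Finset.sum_ite_eq, Finset.mem_univ, if_true]
    calc _ = ∑ A, (∑ B, h A B * linForm k (y - x) B) * linForm k (y - x) A := by
          refine Finset.sum_congr rfl fun A _ => ?_
          rw [Finset.sum_mul]
          exact Finset.sum_congr rfl fun B _ => by ring
      _ = _ := by
          simp only [h3, quadForm]
          refine Finset.sum_congr rfl fun A _ => ?_
          rw [linForm, Finset.mul_sum]
          exact Finset.sum_congr rfl fun B _ => by ring
  have h5 : σ ^ (-((d : ℝ) / 2)) = σ ^ (-((d : ℝ) / 2) - 1) * σ := by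
    rw [← Real.rpow_add_one hpos.ne']
    congr 1
    ring
  calc _ = ∑ A, ∑ B, (2 * σ ^ (-((d : ℝ) / 2)) * (h A B * k A B) -
        2 * d * σ ^ (-((d : ℝ) / 2) - 1) *
          (h A B * (linForm k (y - x) B * linForm k (y - x) A))) := by
        refine Finset.sum_congr rfl fun A _ => Finset.sum_congr rfl fun B _ => ?_
        rw [pdE_pdE_levi hS hk hk0 hε, ← hσ]
        ring
    _ = 2 * σ ^ (-((d : ℝ) / 2)) * d - 2 * d * σ ^ (-((d : ℝ) / 2) - 1) * quadForm k (y - x) := by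
        simp only [Finset.sum_sub_distrib, ← Finset.mul_sum]
        rw [h1, h2]
    _ = _ := by
        rw [h5, hσ]
        ring

end Parametrix

/-! ### The approximate identity, and the adjoint of a second order system. -/

section LeviEstimate

variable {d : ℕ}

open Filter Topology

/-- By ellipticity the integrand is comparable to (1+|z|²)^(-(d+2)/2), whose decay exceeds the
dimension. -/
theorem integrable_quadForm_rpow {k : Matrix (Fin d) (Fin d) ℝ} {lam : ℝ} (hlam : 0 < lam)
    (hq : ∀ z, lam * ‖z‖ ^ 2 ≤ quadForm k z) :
    Integrable fun z : Euc d => (quadForm k z + 1) ^ (-((d : ℝ) / 2) - 1) := by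
  have h1 : Integrable fun z : Euc d => (1 + ‖z‖ ^ 2) ^ (-((d : ℝ) + 2) / 2) :=
    integrable_rpow_neg_one_add_norm_sq (by rw [finrank_euclideanSpace_fin]; linarith)
  set l := min lam 1 with hl
  have hl0 : 0 < l := lt_min hlam one_pos
  have hqm : Continuous fun z : Euc d => quadForm k z := by
    simpa using (contDiff_quadForm (n := 0) k (0 : Euc d)).continuous
  refine Integrable.mono' (h1.const_mul (l ^ (-((d : ℝ) + 2) / 2))) ?_ (ae_of_all _ fun z => ?_)
  · exact (by fun_prop : Measurable fun z : Euc d =>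
      (quadForm k z + 1) ^ (-((d : ℝ) / 2) - 1)).aestronglyMeasurable
  · have h2 : l * (1 + ‖z‖ ^ 2) ≤ quadForm k z + 1 := by
      have h3 : l ≤ lam := min_le_left _ _
      have h4 : l ≤ 1 := min_le_right _ _
      nlinarith [hq z, sq_nonneg ‖z‖]
    have h5 : 0 < l * (1 + ‖z‖ ^ 2) := by positivity
    rw [Real.norm_of_nonneg (Real.rpow_nonneg (h5.le.trans h2) _),
      ← Real.mul_rpow hl0.le (by positivity), show -((d : ℝ) / 2) - 1 = -((d : ℝ) + 2) / 2 by ring]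
    have hd0 : (0 : ℝ) ≤ d := by positivity
    exact Real.rpow_le_rpow_of_nonpos h5 h2 (by linarith)

/-- The approximate identity arising from the regularized parametrix. -/
theorem tendsto_setIntegral_poisson {k : Matrix (Fin d) (Fin d) ℝ} {lam : ℝ} (hlam : 0 < lam)
    (hq : ∀ z, lam * ‖z‖ ^ 2 ≤ quadForm k z) {K : Set (Euc d)} (hK : IsCompact K) {x : Euc d}
    (hx : x ∈ interior K) {w : Euc d → ℝ} (hw : ContinuousOn w K) :
    Tendsto (fun ε : ℝ => ∫ y in K, 2 * d * ε ^ 2 *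
      (quadForm k (y - x) + ε ^ 2) ^ (-((d : ℝ) / 2) - 1) * w y) (𝓝[>] 0)
      (𝓝 ((∫ z, 2 * d * (quadForm k z + 1) ^ (-((d : ℝ) / 2) - 1)) * w x)) := by
  have hq0 : ∀ z, 0 ≤ quadForm k z := fun z => (by positivity : 0 ≤ lam * ‖z‖ ^ 2).trans (hq z)
  have hKm : MeasurableSet K := hK.isClosed.measurableSet
  obtain ⟨B, hB⟩ := hK.exists_bound_of_continuousOn hw
  have hB0 : 0 ≤ B := (norm_nonneg _).trans (hB x (interior_subset hx))
  have hqm : Continuous fun z : Euc d => quadForm k z := by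
    simpa using (contDiff_quadForm (n := 0) k (0 : Euc d)).continuous
  have hwm : StronglyMeasurable (K.indicator w) := by
    classical
    rw [← piecewise_eq_indicator]
    exact (hw.measurable_piecewise continuousOn_const hKm).stronglyMeasurable
  set P : Euc d → ℝ := fun z => 2 * d * (quadForm k z + 1) ^ (-((d : ℝ) / 2) - 1) with hP
  have hPint : Integrable P := (integrable_quadForm_rpow hlam hq).const_mul _
  have hP0 : ∀ z, 0 ≤ P z := fun z =>
    mul_nonneg (by positivity) (Real.rpow_nonneg (by linarith [hq0 z]) _)
  have hsub : ∀ ε : ℝ, 0 < ε → ∫ y in K, 2 * d * ε ^ 2 *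
      (quadForm k (y - x) + ε ^ 2) ^ (-((d : ℝ) / 2) - 1) * w y =
      ∫ z, P z * K.indicator w (x + ε • z) := by
    intro ε hε
    -- The substitution y = x + εz: the powers ε^d, ε² and (ε²)^(-d/2-1) cancel exactly, leaving a
    -- kernel independent of ε.
    have h1 : ∀ z, P z * K.indicator w (x + ε • z) = ε ^ d * (2 * d * ε ^ 2 *
        (quadForm k (ε • z) + ε ^ 2) ^ (-((d : ℝ) / 2) - 1) * K.indicator w (x + ε • z)) := by
      intro z
      have h2 : quadForm k (ε • z) + ε ^ 2 = ε ^ 2 * (quadForm k z + 1) := by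
        simp only [quadForm, mul_add, Finset.mul_sum, PiLp.smul_apply, smul_eq_mul, mul_one]
        congr 1
        exact Finset.sum_congr rfl fun A _ => Finset.sum_congr rfl fun B _ => by ring
      rw [h2, Real.mul_rpow (by positivity) (by linarith [hq0 z]), hP]
      have h3 : ε ^ d * ε ^ 2 * (ε ^ 2) ^ (-((d : ℝ) / 2) - 1) = 1 := by
        rw [← Real.rpow_natCast, ← Real.rpow_natCast, ← Real.rpow_mul hε.le, ← Real.rpow_add hε,
          ← Real.rpow_add hε]
        push_cast
        rw [show (d : ℝ) + 2 + 2 * (-((d : ℝ) / 2) - 1) = 0 by ring, Real.rpow_zero]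
      linear_combination (-(2 * (d : ℝ) * (quadForm k z + 1) ^ (-((d : ℝ) / 2) - 1) *
        K.indicator w (x + ε • z))) * h3
    simp only [h1]
    rw [integral_const_mul, Measure.integral_comp_smul volume (fun z => 2 * d * ε ^ 2 *
        (quadForm k z + ε ^ 2) ^ (-((d : ℝ) / 2) - 1) * K.indicator w (x + z)) ε,
      finrank_euclideanSpace_fin, abs_of_pos (by positivity), smul_eq_mul, ← mul_assoc,
      mul_inv_cancel₀ (by positivity), one_mul, ← integral_indicator hKm]
    rw [← integral_add_left_eq_self _ x]
    refine integral_congr_ae (ae_of_all _ fun z => ?_)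
    by_cases hz : x + z ∈ K
    · simp only [indicator_of_mem hz, add_sub_cancel_left]
    · simp only [indicator_of_notMem hz, mul_zero]
  have hlim : Tendsto (fun ε : ℝ => ∫ z, P z * K.indicator w (x + ε • z)) (𝓝[>] 0)
      (𝓝 (∫ z, P z * w x)) := by
    refine tendsto_integral_filter_of_dominated_convergence (fun z => P z * B) ?_ ?_ ?_ ?_
    · refine Eventually.of_forall fun ε => ?_
      refine hPint.aestronglyMeasurable.mul ?_
      exact (hwm.comp_measurable (by fun_prop)).aestronglyMeasurable
    · refine Eventually.of_forall fun ε => ae_of_all _ fun z => ?_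
      rw [norm_mul, Real.norm_of_nonneg (hP0 z)]
      refine mul_le_mul_of_nonneg_left ?_ (hP0 z)
      by_cases hz : x + ε • z ∈ K
      · rw [indicator_of_mem hz]; exact hB _ hz
      · rw [indicator_of_notMem hz]; simpa using hB0
    · exact hPint.mul_const B
    · refine ae_of_all _ fun z => Tendsto.const_mul _ ?_
      have hcont : ContinuousAt (K.indicator w) x := by
        refine (hw.continuousAt (mem_interior_iff_mem_nhds.mp hx)).congr ?_
        filter_upwards [mem_interior_iff_mem_nhds.mp hx] with y hy
        rw [indicator_of_mem hy]
      have h4 : Tendsto (fun ε : ℝ => x + ε • z) (𝓝[>] 0) (𝓝 x) := by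
        have : Continuous fun ε : ℝ => x + ε • z := by fun_prop
        simpa using (this.tendsto 0).mono_left nhdsWithin_le_nhds
      have h5 := hcont.tendsto.comp h4
      rwa [indicator_of_mem (interior_subset hx)] at h5
  rw [integral_mul_const] at hlim
  refine hlim.congr' ?_
  filter_upwards [self_mem_nhdsWithin] with ε hε
  exact (hsub ε hε).symm

/-- The limiting mass depends on the frozen matrix. On the unit ball the integrand is at least its
value with the form replaced by Λ, so one may divide by the mass uniformly in the pole. -/
theorem exists_poisson_mass_lower (d : ℕ) [NeZero d] {lam Λ : ℝ} (hlam : 0 < lam) (hΛ : 0 ≤ Λ) :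
    ∃ c : ℝ, 0 < c ∧ ∀ k : Matrix (Fin d) (Fin d) ℝ, (∀ z, lam * ‖z‖ ^ 2 ≤ quadForm k z) →
      (∀ z, quadForm k z ≤ Λ * ‖z‖ ^ 2) →
      c ≤ ∫ z, 2 * d * (quadForm k z + 1) ^ (-((d : ℝ) / 2) - 1) := by
  have hd : (0 : ℝ) < d := Nat.cast_pos.mpr (Nat.pos_of_ne_zero (NeZero.ne d))
  set m := (volume : Measure (Euc d)).real (Metric.ball 0 1) with hm
  have hm0 : 0 < m := ENNReal.toReal_pos (Metric.measure_ball_pos volume (0 : Euc d) one_pos).ne'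
    measure_ball_lt_top.ne
  refine ⟨m * (2 * d * (Λ + 1) ^ (-((d : ℝ) / 2) - 1)), by positivity, fun k hlow hup => ?_⟩
  have hint : Integrable fun z : Euc d => 2 * d * (quadForm k z + 1) ^ (-((d : ℝ) / 2) - 1) :=
    (integrable_quadForm_rpow hlam hlow).const_mul _
  have hq0 : ∀ z, 0 ≤ quadForm k z := fun z => (by positivity : 0 ≤ lam * ‖z‖ ^ 2).trans (hlow z)
  calc _ = ∫ z in Metric.ball (0 : Euc d) 1, 2 * d * (Λ + 1) ^ (-((d : ℝ) / 2) - 1) := by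
        rw [setIntegral_const, smul_eq_mul]
    _ ≤ ∫ z in Metric.ball (0 : Euc d) 1, 2 * d * (quadForm k z + 1) ^ (-((d : ℝ) / 2) - 1) := by
        refine setIntegral_mono_on (integrableOn_const measure_ball_lt_top.ne) hint.integrableOn
          measurableSet_ball fun z hz => ?_
        refine mul_le_mul_of_nonneg_left ?_ (by positivity)
        refine Real.rpow_le_rpow_of_nonpos (by linarith [hq0 z]) ?_ (by linarith)
        have h1 : ‖z‖ ≤ 1 := (mem_ball_zero_iff.mp hz).le
        have h2 : Λ * ‖z‖ ^ 2 ≤ Λ * 1 := by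
          gcongr
          exact pow_le_one₀ (norm_nonneg _) h1
        linarith [hup z]
    _ ≤ _ := setIntegral_le_integral hint (ae_of_all _ fun z =>
        mul_nonneg (by positivity) (Real.rpow_nonneg (by linarith [hq0 z]) _))

theorem exists_bound_family {κ : Type*} [Finite κ] {K : Set (Euc d)} (hK : IsCompact K)
    (F : κ → Euc d → ℝ) (hF : ∀ i, Continuous (F i)) (hs : ∀ i, tsupport (F i) ⊆ K) :
    ∃ C : ℝ, 0 ≤ C ∧ ∀ i y, |F i y| ≤ C := by
  have h : ∀ i, ∃ C, ∀ y, ‖F i y‖ ≤ C := fun i =>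
    (hF i).bounded_above_of_compact_support (hK.of_isClosed_subset (isClosed_tsupport _) (hs i))
  choose c hc using h
  obtain ⟨C, hC⟩ := (Set.finite_range c).bddAbove
  refine ⟨max C 0, le_max_right _ _, fun i y => ?_⟩
  exact (hc i y).trans ((hC ⟨i, rfl⟩).trans (le_max_left _ _))

theorem pdE_mul {F G : Euc d → ℝ} {y : Euc d} (hF : DifferentiableAt ℝ F y)
    (hG : DifferentiableAt ℝ G y) (A : Fin d) :
    pdE A (fun y => F y * G y) y = pdE A F y * G y + F y * pdE A G y := by
  rw [pdE, fderiv_fun_mul hF hG]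
  simp only [_root_.add_apply, _root_.smul_apply, smul_eq_mul, pdE]
  ring

theorem pdE_pdE_mul {F G : Euc d → ℝ} (hF : ContDiff ℝ 2 F) (hG : ContDiff ℝ 2 G) (A B : Fin d)
    (y : Euc d) : pdE B (pdE A (fun y => F y * G y)) y = pdE B (pdE A F) y * G y +
      pdE A F y * pdE B G y + pdE B F y * pdE A G y + F y * pdE B (pdE A G) y := by
  have hF1 : Differentiable ℝ F := hF.differentiable two_ne_zero
  have hG1 : Differentiable ℝ G := hG.differentiable two_ne_zero
  have hF2 : Differentiable ℝ (pdE A F) := (contDiff_pdE hF (m := 1) (by norm_num) A).differentiable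
    one_ne_zero
  have hG2 : Differentiable ℝ (pdE A G) := (contDiff_pdE hG (m := 1) (by norm_num) A).differentiable
    one_ne_zero
  have h1 : pdE A (fun y => F y * G y) = fun y => pdE A F y * G y + F y * pdE A G y :=
    funext fun y => pdE_mul (hF1 y) (hG1 y) A
  have h4 : fderiv ℝ (fun y => pdE A F y * G y + F y * pdE A G y) y = _ :=
    fderiv_add ((hF2 y).mul (hG1 y)) ((hF1 y).mul (hG2 y))
  rw [h1, pdE, h4]
  have h2 := pdE_mul (hF2 y) (hG1 y) B
  have h3 := pdE_mul (hF1 y) (hG2 y) B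
  rw [pdE] at h2 h3
  rw [_root_.add_apply, h2, h3]
  ring

theorem exists_lipschitz_family {κ : Type*} [Finite κ] {K : Set (Euc d)} (hK : IsCompact K)
    (F : κ → Euc d → ℝ) (hF : ∀ i, ContDiff ℝ 1 (F i)) (hs : ∀ i, tsupport (F i) ⊆ K) :
    ∃ C : ℝ, 0 ≤ C ∧ ∀ i x y, |F i y - F i x| ≤ C * ‖y - x‖ := by
  have h : ∀ i, ∃ C : ℝ≥0, LipschitzWith C (F i) := fun i =>
    (hF i).lipschitzWith_of_hasCompactSupport
      (hK.of_isClosed_subset (isClosed_tsupport _) (hs i)) one_ne_zero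
  choose c hc using h
  obtain ⟨C, hC⟩ := (Set.finite_range c).bddAbove
  refine ⟨C, C.2, fun i x y => ?_⟩
  have h1 := (hc i).dist_le_mul y x
  rw [Real.dist_eq, dist_eq_norm] at h1
  refine h1.trans ?_
  gcongr
  exact hC ⟨i, rfl⟩

/-- The adjoint of a second order operator in divergence-free form, applied to a test function. -/
theorem integral_mul_operator_eq {ι : Type*} [Fintype ι] {U K : Set (Euc d)} (hU : IsOpen U)
    (hK : IsCompact K) (hKU : K ⊆ U) {G : Euc d → ℝ} (hG : ContDiff ℝ 2 G)
    {g : Fin d → Fin d → Euc d → ℝ} (hg : ∀ A B, ContDiff ℝ 2 (g A B))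
    (hgs : ∀ A B, tsupport (g A B) ⊆ K)
    {β : ι → Fin d → Euc d → ℝ} (hβ : ∀ e A, ContDiff ℝ 1 (β e A))
    (hβs : ∀ e A, tsupport (β e A) ⊆ K)
    {γ : ι → Euc d → ℝ} (hγ : ∀ e, Continuous (γ e)) (hγs : ∀ e, tsupport (γ e) ⊆ K)
    {W : ι → Euc d → ℝ} (hW : ∀ e, ContDiffOn ℝ 2 (W e) U) (a : ι) :
    ∫ y in K, G y * (∑ A, ∑ B, g A B y * pdE A (pdE B (W a)) y +
        ∑ e, ∑ A, β e A y * pdE A (W e) y + ∑ e, γ e y * W e y) =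
      ∫ y in K, ((∑ A, ∑ B, pdE B (pdE A (fun y => g A B y * G y)) y) * W a y +
        ∑ e, (-(∑ A, pdE A (fun y => β e A y * G y) y) + γ e y * G y) * W e y) := by
  have hW1 : ∀ e, ContDiffOn ℝ 1 (W e) U := fun e => (hW e).of_le (by norm_num)
  have hG1 : ContDiff ℝ 1 G := hG.of_le (by norm_num)
  have hgG : ∀ A B, ContDiff ℝ 2 fun y => g A B y * G y := fun A B => (hg A B).mul hG
  have hgGs : ∀ A B, tsupport (fun y => g A B y * G y) ⊆ K := fun A B =>
    (tsupport_mul_subset_left).trans (hgs A B)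
  have hβG : ∀ e A, ContDiff ℝ 1 fun y => β e A y * G y := fun e A => (hβ e A).mul hG1
  have hβGs : ∀ e A, tsupport (fun y => β e A y * G y) ⊆ K := fun e A =>
    (tsupport_mul_subset_left).trans (hβs e A)
  have hγGs : ∀ e, tsupport (fun y => γ e y * G y) ⊆ K := fun e =>
    (tsupport_mul_subset_left).trans (hγs e)
  have hpW : ∀ e B, ContDiffOn ℝ 1 (pdE B (W e)) U := fun e B =>
    contDiffOn_pdE hU (hW e) (by norm_num) B
  -- integrability
  have i1 : ∀ A B, Integrable fun y => (g A B y * G y) * pdE A (pdE B (W a)) y := fun A B =>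
    integrable_mul_of_tsupport hU hK hKU (hgG A B).continuous
      (contDiffOn_pdE hU (hpW a B) (m := 0) (by simp) A).continuousOn (hgGs A B)
  have i2 : ∀ e A, Integrable fun y => (β e A y * G y) * pdE A (W e) y := fun e A =>
    integrable_mul_of_tsupport hU hK hKU (hβG e A).continuous (hpW e A).continuousOn (hβGs e A)
  have i3 : ∀ e, Integrable fun y => (γ e y * G y) * W e y := fun e =>
    integrable_mul_of_tsupport hU hK hKU ((hγ e).mul hG.continuous) (hW e).continuousOn (hγGs e)
  have hpgG : ∀ A B, ContDiff ℝ 1 (pdE A fun y => g A B y * G y) := fun A B =>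
    contDiff_pdE (hgG A B) (by norm_num) A
  have i4 : ∀ A B, Integrable fun y => pdE B (pdE A (fun y => g A B y * G y)) y * W a y :=
    fun A B => integrable_mul_of_tsupport hU hK hKU
      (contDiff_pdE (hpgG A B) (m := 0) (by simp) B).continuous (hW a).continuousOn
      ((tsupport_pdE_subset B _).trans ((tsupport_pdE_subset A _).trans (hgGs A B)))
  have i5 : ∀ e A, Integrable fun y => pdE A (fun y => β e A y * G y) y * W e y := fun e A =>
    integrable_mul_of_tsupport hU hK hKU (contDiff_pdE (hβG e A) (m := 0) (by simp) A).continuous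
      (hW e).continuousOn ((tsupport_pdE_subset A _).trans (hβGs e A))
  -- integration by parts
  have p1 : ∀ A B, ∫ y, (g A B y * G y) * pdE A (pdE B (W a)) y =
      ∫ y, pdE B (pdE A (fun y => g A B y * G y)) y * W a y := fun A B => by
    rw [integral_mul_pdE hU hK hKU ((hgG A B).of_le (by norm_num)) (hpW a B) (hgGs A B) A,
      integral_mul_pdE hU hK hKU (hpgG A B) (hW1 a)
        ((tsupport_pdE_subset A _).trans (hgGs A B)) B, neg_neg]
  have p2 : ∀ e A, ∫ y, (β e A y * G y) * pdE A (W e) y =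
      -∫ y, pdE A (fun y => β e A y * G y) y * W e y := fun e A =>
    integral_mul_pdE hU hK hKU (hβG e A) (hW1 e) (hβGs e A) A
  have hzero : ∀ {F : Euc d → ℝ}, tsupport F ⊆ K → ∀ y, y ∉ K → F y = 0 := fun h y hy =>
    image_eq_zero_of_notMem_tsupport fun hy' => hy (h hy')
  rw [setIntegral_eq_integral_of_forall_compl_eq_zero, setIntegral_eq_integral_of_forall_compl_eq_zero]
  · calc _ = ∫ y, (∑ A, ∑ B, (g A B y * G y) * pdE A (pdE B (W a)) y +
          ∑ e, ∑ A, (β e A y * G y) * pdE A (W e) y + ∑ e, (γ e y * G y) * W e y) := by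
          congr 1
          funext y
          simp only [mul_add, Finset.mul_sum]
          congr 1
          · congr 1
            · exact Finset.sum_congr rfl fun A _ => Finset.sum_congr rfl fun B _ => by ring
            · exact Finset.sum_congr rfl fun A _ => Finset.sum_congr rfl fun B _ => by ring
          · exact Finset.sum_congr rfl fun A _ => by ring
      _ = (∑ A, ∑ B, ∫ y, (g A B y * G y) * pdE A (pdE B (W a)) y) +
          (∑ e, ∑ A, ∫ y, (β e A y * G y) * pdE A (W e) y) +
          ∑ e, ∫ y, (γ e y * G y) * W e y := by
          rw [integral_add, integral_add, integral_finsetSum, integral_finsetSum,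
            integral_finsetSum]
          · congr 1
            congr 1
            · exact Finset.sum_congr rfl fun A _ => integral_finsetSum _ fun B _ => i1 A B
            · exact Finset.sum_congr rfl fun e _ => integral_finsetSum _ fun A _ => i2 e A
          · exact fun e _ => i3 e
          · exact fun e _ => integrable_finsetSum _ fun A _ => i2 e A
          · exact fun A _ => integrable_finsetSum _ fun B _ => i1 A B
          · exact integrable_finsetSum _ fun A _ => integrable_finsetSum _ fun B _ => i1 A B
          · exact integrable_finsetSum _ fun e _ => integrable_finsetSum _ fun A _ => i2 e A
          · exact (integrable_finsetSum _ fun A _ => integrable_finsetSum _ fun B _ => i1 A B).add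
              (integrable_finsetSum _ fun e _ => integrable_finsetSum _ fun A _ => i2 e A)
          · exact integrable_finsetSum _ fun e _ => i3 e
      _ = (∑ A, ∑ B, ∫ y, pdE B (pdE A (fun y => g A B y * G y)) y * W a y) +
          ∑ e, (-(∑ A, ∫ y, pdE A (fun y => β e A y * G y) y * W e y) +
            ∫ y, (γ e y * G y) * W e y) := by
          simp only [p1, p2, Finset.sum_neg_distrib, Finset.sum_add_distrib]
          ring
      _ = _ := by
          have i6 : ∀ e, Integrable fun y => (-(∑ A, pdE A (fun y => β e A y * G y) y) +
              γ e y * G y) * W e y := fun e => by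
            have := (integrable_finsetSum Finset.univ fun A _ => i5 e A).neg.add (i3 e)
            refine this.congr (ae_of_all _ fun y => ?_)
            simp only [Pi.add_apply, Pi.neg_apply, add_mul, neg_mul,
              Finset.sum_mul]
          have i7 : Integrable fun y =>
              (∑ A, ∑ B, pdE B (pdE A (fun y => g A B y * G y)) y) * W a y := by
            simp only [Finset.sum_mul]
            exact integrable_finsetSum _ fun A _ => integrable_finsetSum _ fun B _ => i4 A B
          rw [integral_add i7 (integrable_finsetSum _ fun e _ => i6 e),
            integral_finsetSum _ fun e _ => i6 e]
          congr 1
          · simp only [Finset.sum_mul]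
            rw [integral_finsetSum _ fun A _ => integrable_finsetSum _ fun B _ => i4 A B]
            exact Finset.sum_congr rfl fun A _ => (integral_finsetSum _ fun B _ => i4 A B).symm
          · refine Finset.sum_congr rfl fun e _ => ?_
            simp only [add_mul, neg_mul, Finset.sum_mul]
            have h8 := integrable_finsetSum Finset.univ fun A _ => i5 e A
            rw [← integral_finsetSum _ fun A _ => i5 e A, ← integral_neg]
            exact (integral_add h8.neg (i3 e)).symm
  · intro y hy
    have h1 : ∀ A B, pdE B (pdE A (fun y => g A B y * G y)) y = 0 := fun A B =>
      hzero ((tsupport_pdE_subset B _).trans ((tsupport_pdE_subset A _).trans (hgGs A B))) y hy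
    have h2 : ∀ e A, pdE A (fun y => β e A y * G y) y = 0 := fun e A =>
      hzero ((tsupport_pdE_subset A _).trans (hβGs e A)) y hy
    have h3 : ∀ e, γ e y = 0 := fun e => hzero (hγs e) y hy
    simp [h1, h2, h3]
  · intro y hy
    have h1 : ∀ A B, g A B y = 0 := fun A B => hzero (hgs A B) y hy
    have h2 : ∀ e A, β e A y = 0 := fun e A => hzero (hβs e A) y hy
    have h3 : ∀ e, γ e y = 0 := fun e => hzero (hγs e) y hy
    simp [h1, h2, h3]

end LeviEstimate

/-! ### One Levi step for an elliptic system. -/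

section LeviStep

variable {d : ℕ}

open Filter Topology

/-- Quantitative ellipticity of a symmetric matrix. -/
def IsElliptic (lam Λ : ℝ) (k : Matrix (Fin d) (Fin d) ℝ) : Prop :=
  k.IsSymm ∧ (∀ A B, |k A B| ≤ Λ) ∧ (∀ z, lam * ‖z‖ ^ 2 ≤ quadForm k z) ∧
    ∀ z, quadForm k z ≤ Λ * ‖z‖ ^ 2

theorem IsElliptic.quadForm_nonneg {lam Λ : ℝ} {k : Matrix (Fin d) (Fin d) ℝ}
    (h : IsElliptic lam Λ k) (hlam : 0 < lam) (z : Euc d) : 0 ≤ quadForm k z :=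
  (by positivity : 0 ≤ lam * ‖z‖ ^ 2).trans (h.2.2.1 z)

/-- The adjoint operator applied to the parametrix, minus the approximate identity, is only weakly
singular. Terms with at most one derivative on the parametrix are mild by themselves; in the term
with two derivatives the coefficient is g(y) - g(x), whose Lipschitz bound gains one power of |y-x|.
-/
theorem exists_levi_adjoint_bound [NeZero d] {ι : Type*} [Finite ι] {Kc X : Set (Euc d)}
    (hK : IsCompact Kc) {g : Fin d → Fin d → Euc d → ℝ} (hg : ∀ A B, ContDiff ℝ 2 (g A B))
    (hgs : ∀ A B, tsupport (g A B) ⊆ Kc) {β : ι → Fin d → Euc d → ℝ}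
    (hβ : ∀ e A, ContDiff ℝ 1 (β e A)) (hβs : ∀ e A, tsupport (β e A) ⊆ Kc)
    {γ : ι → Euc d → ℝ} (hγ : ∀ e, Continuous (γ e)) (hγs : ∀ e, tsupport (γ e) ⊆ Kc)
    {k : Euc d → Matrix (Fin d) (Fin d) ℝ} {lam Λ R b S : ℝ} (hlam : 0 < lam)
    (hell : ∀ x ∈ X, IsElliptic lam Λ (k x))
    (hinv : ∀ x ∈ X, Matrix.of (fun A B => g A B x) * k x = 1)
    (hb : b < 1) (hb0 : 0 < b) (hbd : 2 * b < d) (hS : Λ * R ^ 2 + 1 ≤ S) (hS0 : 0 < S) :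
    ∃ C : ℝ, 0 ≤ C ∧ ∀ x ∈ X, ∀ ε, 0 < ε → ε ≤ 1 → ∀ y : Euc d, y - x ≠ 0 → ‖y - x‖ ≤ R →
      |levi S (k x) x ε y| ≤ C * ‖y - x‖ ^ (2 * b - d) ∧
      |(∑ A, ∑ B, pdE B (pdE A (fun y => g A B y * levi S (k x) x ε y)) y) -
        2 * d * ε ^ 2 * (quadForm (k x) (y - x) + ε ^ 2) ^ (-((d : ℝ) / 2) - 1)|
        ≤ C * ‖y - x‖ ^ (b - d) ∧
      ∀ e, |-(∑ A, pdE A (fun y => β e A y * levi S (k x) x ε y) y) + γ e y * levi S (k x) x ε y|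
        ≤ C * ‖y - x‖ ^ (b - d) := by
  obtain ⟨C₀, hC₀, hlevi⟩ := exists_levi_bounds d (R := R) hlam hb hbd hS
  have hg1 : ∀ A B C, ContDiff ℝ 1 (pdE C (g A B)) := fun A B C =>
    contDiff_pdE (hg A B) (by norm_num) C
  obtain ⟨G₁, hG₁, hg1b⟩ := exists_bound_family hK (fun i : Fin d × Fin d × Fin d =>
    pdE i.2.2 (g i.1 i.2.1)) (fun i => (hg1 _ _ _).continuous)
    (fun i => (tsupport_pdE_subset _ _).trans (hgs _ _))
  obtain ⟨G₂, hG₂, hg2b⟩ := exists_bound_family hK (fun i : (Fin d × Fin d) × Fin d × Fin d =>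
    pdE i.2.2 (pdE i.2.1 (g i.1.1 i.1.2)))
    (fun i => (contDiff_pdE (hg1 _ _ _) (m := 0) (by simp) _).continuous)
    (fun i => (tsupport_pdE_subset _ _).trans ((tsupport_pdE_subset _ _).trans (hgs _ _)))
  obtain ⟨G₃, hG₃, hgl⟩ := exists_lipschitz_family hK (fun i : Fin d × Fin d => g i.1 i.2)
    (fun i => (hg _ _).of_le (by norm_num)) (fun i => hgs _ _)
  obtain ⟨B₀, hB₀, hβ0b⟩ := exists_bound_family hK (fun i : ι × Fin d => β i.1 i.2)
    (fun i => (hβ _ _).continuous) (fun i => hβs _ _)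
  obtain ⟨B₁, hB₁, hβ1b⟩ := exists_bound_family hK (fun i : ι × Fin d => pdE i.2 (β i.1 i.2))
    (fun i => (contDiff_pdE (hβ _ _) (m := 0) (by simp) _).continuous)
    (fun i => (tsupport_pdE_subset _ _).trans (hβs _ _))
  obtain ⟨Γ, hΓ, hγb⟩ := exists_bound_family hK γ hγ hγs
  set Rp := max R 0
  -- On a set of diameter at most R both |y-x|^(2b-d) and |y-x|^(1-d) are bounded by q·|y-x|^(b-d),
  -- so all errors share a single kernel.
  set q := Rp ^ b + Rp ^ (1 - b) with hq
  have hRp : 0 ≤ Rp := le_max_right _ _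
  have hq0 : 0 ≤ q := by positivity
  have hdd : (0 : ℝ) < d := Nat.cast_pos.mpr (Nat.pos_of_ne_zero (NeZero.ne d))
  set E₁ := (d : ℝ) * (d * (G₂ * (C₀ * q) + G₁ * (C₀ * q) + G₁ * (C₀ * q) + G₃ * (C₀ * q)))
    with hE₁
  set E₂ := (d : ℝ) * (B₁ * (C₀ * q) + B₀ * (C₀ * q)) + Γ * (C₀ * q) with hE₂
  have hE₁0 : 0 ≤ E₁ := by positivity
  have hE₂0 : 0 ≤ E₂ := by positivity
  refine ⟨C₀ + E₁ + E₂, by positivity, fun x hx ε hε hε1 y hyx hyR => ?_⟩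
  obtain ⟨hk, hkΛ, hlow, hup⟩ := hell x hx
  have hk0 := (hell x hx).quadForm_nonneg hlam
  obtain ⟨l0, l1, l2⟩ := hlevi (k x) hk hkΛ hlow hup ε hε hε1 x y hyx hyR
  set L := levi S (k x) x ε
  have hL : ContDiff ℝ 2 L := contDiff_levi hS0 hk hk0 hε x
  have hLd : Differentiable ℝ L := hL.differentiable two_ne_zero
  set r := ‖y - x‖ with hr
  have hr0 : 0 < r := norm_pos_iff.mpr hyx
  have hrR : r ≤ Rp := hyR.trans (le_max_left _ _)
  set w := r ^ (b - (d : ℝ)) with hw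
  have hw0 : 0 < w := Real.rpow_pos_of_pos hr0 _
  have e0 : r ^ (2 * b - (d : ℝ)) ≤ q * w := by
    rw [show 2 * b - (d : ℝ) = b + (b - d) by ring, Real.rpow_add hr0]
    refine mul_le_mul_of_nonneg_right ?_ hw0.le
    exact (Real.rpow_le_rpow hr0.le hrR hb0.le).trans (le_add_of_nonneg_right (by positivity))
  have e1 : r ^ (1 - (d : ℝ)) ≤ q * w := by
    rw [show 1 - (d : ℝ) = (1 - b) + (b - d) by ring, Real.rpow_add hr0]
    refine mul_le_mul_of_nonneg_right ?_ hw0.le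
    exact (Real.rpow_le_rpow hr0.le hrR (by linarith)).trans
      (le_add_of_nonneg_left (by positivity))
  have e2 : r * r ^ (-(d : ℝ)) ≤ q * w := by
    refine le_trans (le_of_eq ?_) e1
    rw [sub_eq_add_neg, Real.rpow_add hr0, Real.rpow_one]
  have b0 : |L y| ≤ C₀ * q * w := l0.trans (by rw [mul_assoc]; gcongr)
  have b1 : ∀ B, |pdE B L y| ≤ C₀ * q * w := fun B => (l1 B).trans (by rw [mul_assoc]; gcongr)
  refine ⟨l0.trans ?_, ?_, fun e => ?_⟩
  · gcongr
    linarith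
  · have h1 : (∑ A, ∑ B, pdE B (pdE A (fun y => g A B y * L y)) y) -
        2 * d * ε ^ 2 * (quadForm (k x) (y - x) + ε ^ 2) ^ (-((d : ℝ) / 2) - 1) =
        ∑ A, ∑ B, (pdE B (pdE A (g A B)) y * L y + pdE A (g A B) y * pdE B L y +
          pdE B (g A B) y * pdE A L y + (g A B y - g A B x) * pdE B (pdE A L) y) := by
      rw [← sum_mul_pdE_pdE_levi (S := S) hS0 hk hk0 hε (hinv x hx) x y,
        ← Finset.sum_sub_distrib]
      refine Finset.sum_congr rfl fun A _ => ?_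
      rw [← Finset.sum_sub_distrib]
      refine Finset.sum_congr rfl fun B _ => ?_
      rw [pdE_pdE_mul (hg A B) hL, Matrix.of_apply]
      ring
    rw [h1]
    have h2 : ∀ A B, |pdE B (pdE A (g A B)) y * L y + pdE A (g A B) y * pdE B L y +
          pdE B (g A B) y * pdE A L y + (g A B y - g A B x) * pdE B (pdE A L) y| ≤
        (G₂ * (C₀ * q) + G₁ * (C₀ * q) + G₁ * (C₀ * q) + G₃ * (C₀ * q)) * w := by
      intro A B
      have t1 : |pdE B (pdE A (g A B)) y * L y| ≤ G₂ * (C₀ * q * w) := by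
        rw [abs_mul]; exact mul_le_mul (hg2b ((A, B), A, B) y) b0 (abs_nonneg _) hG₂
      have t2 : |pdE A (g A B) y * pdE B L y| ≤ G₁ * (C₀ * q * w) := by
        rw [abs_mul]; exact mul_le_mul (hg1b (A, B, A) y) (b1 B) (abs_nonneg _) hG₁
      have t3 : |pdE B (g A B) y * pdE A L y| ≤ G₁ * (C₀ * q * w) := by
        rw [abs_mul]; exact mul_le_mul (hg1b (A, B, B) y) (b1 A) (abs_nonneg _) hG₁
      -- The borderline singularity |y-x|^(-d) is improved to |y-x|^(1-d) by freezing the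
      -- coefficients at the pole.
      have t4 : |(g A B y - g A B x) * pdE B (pdE A L) y| ≤ G₃ * (C₀ * q * w) := by
        rw [abs_mul]
        calc _ ≤ (G₃ * r) * (C₀ * r ^ (-(d : ℝ))) :=
              mul_le_mul (hgl (A, B) x y) (l2 B A) (abs_nonneg _) (by positivity)
          _ = G₃ * (C₀ * (r * r ^ (-(d : ℝ)))) := by ring
          _ ≤ _ := by rw [mul_assoc C₀]; gcongr
      refine (abs_add_le _ _).trans ?_
      have t5 := abs_add_three (pdE B (pdE A (g A B)) y * L y) (pdE A (g A B) y * pdE B L y)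
        (pdE B (g A B) y * pdE A L y)
      linarith
    calc _ ≤ ∑ A : Fin d, ∑ B : Fin d,
          (G₂ * (C₀ * q) + G₁ * (C₀ * q) + G₁ * (C₀ * q) + G₃ * (C₀ * q)) * w :=
          (Finset.abs_sum_le_sum_abs _ _).trans (Finset.sum_le_sum fun A _ =>
            (Finset.abs_sum_le_sum_abs _ _).trans (Finset.sum_le_sum fun B _ => h2 A B))
      _ = E₁ * w := by simp [hE₁]; ring
      _ ≤ _ := by gcongr; linarith
  · have h2 : ∀ A, |pdE A (fun y => β e A y * L y) y| ≤
        (B₁ * (C₀ * q) + B₀ * (C₀ * q)) * w := by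
      intro A
      rw [pdE_mul ((hβ e A).differentiable one_ne_zero y) (hLd y)]
      have t1 : |pdE A (β e A) y * L y| ≤ B₁ * (C₀ * q * w) := by
        rw [abs_mul]; exact mul_le_mul (hβ1b (e, A) y) b0 (abs_nonneg _) hB₁
      have t2 : |β e A y * pdE A L y| ≤ B₀ * (C₀ * q * w) := by
        rw [abs_mul]; exact mul_le_mul (hβ0b (e, A) y) (b1 A) (abs_nonneg _) hB₀
      refine (abs_add_le _ _).trans ?_
      linarith
    have t3 : |γ e y * L y| ≤ Γ * (C₀ * q * w) := by
      rw [abs_mul]; exact mul_le_mul (hγb e y) b0 (abs_nonneg _) hΓ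
    calc _ ≤ (∑ A : Fin d, (B₁ * (C₀ * q) + B₀ * (C₀ * q)) * w) + Γ * (C₀ * q * w) := by
          refine (abs_add_le _ _).trans (add_le_add ?_ t3)
          rw [abs_neg]
          exact (Finset.abs_sum_le_sum_abs _ _).trans (Finset.sum_le_sum fun A _ => h2 A)
      _ = E₂ * w := by simp [hE₂]; ring
      _ ≤ _ := by gcongr; linarith

theorem enorm_le_mul_rieszKer {C a v : ℝ} (hC : 0 ≤ C) {x y : Euc d} (hyx : y - x ≠ 0)
    (h : |v| ≤ C * ‖y - x‖ ^ (a - d)) : ‖v‖ₑ ≤ C.toNNReal * rieszKer a (x - y) := by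
  rw [Real.enorm_eq_ofReal_abs, rieszKer_sub_comm, rieszKer,
    ENNReal.ofReal_rpow_of_pos (norm_pos_iff.mpr hyx)]
  change _ ≤ ENNReal.ofReal C * _
  rw [← ENNReal.ofReal_mul hC]
  exact ENNReal.ofReal_le_ofReal h

/-- One step of the Levi estimate for an elliptic system with scalar principal part. -/
theorem exists_levi_step [NeZero d] {ι : Type*} [Fintype ι] {U Kc X : Set (Euc d)} (hU : IsOpen U)
    (hK : IsCompact Kc) (hKU : Kc ⊆ U) (hX : X ⊆ interior Kc)
    {g : Fin d → Fin d → Euc d → ℝ} (hg : ∀ A B, ContDiff ℝ 2 (g A B))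
    (hgs : ∀ A B, tsupport (g A B) ⊆ Kc) {β : ι → ι → Fin d → Euc d → ℝ}
    (hβ : ∀ a e A, ContDiff ℝ 1 (β a e A)) (hβs : ∀ a e A, tsupport (β a e A) ⊆ Kc)
    {γ : ι → ι → Euc d → ℝ} (hγ : ∀ a e, Continuous (γ a e))
    (hγs : ∀ a e, tsupport (γ a e) ⊆ Kc)
    {k : Euc d → Matrix (Fin d) (Fin d) ℝ} {lam Λ R b : ℝ} (hlam : 0 < lam) (hΛ : 0 ≤ Λ)
    (hell : ∀ x ∈ X, IsElliptic lam Λ (k x))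
    (hinv : ∀ x ∈ X, Matrix.of (fun A B => g A B x) * k x = 1)
    (hb : b < 1) (hb0 : 0 < b) (hbd : 2 * b < d) (hR : ∀ x ∈ Kc, ∀ y ∈ Kc, ‖y - x‖ ≤ R) :
    ∃ C : ℝ≥0, ∀ W W' : ι → Euc d → ℝ, (∀ e, ContDiffOn ℝ 2 (W e) U) →
      (∀ a, ∀ y ∈ Kc, W' a y = ∑ A, ∑ B, g A B y * pdE A (pdE B (W a)) y +
        ∑ e, ∑ A, β a e A y * pdE A (W e) y + ∑ e, γ a e y * W e y) →
      ∀ a, ∀ x ∈ X, ‖W a x‖ₑ ≤ C * ∫⁻ y in Kc, (rieszKer b (x - y) * ∑ e, ‖W e y‖ₑ +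
        rieszKer (2 * b) (x - y) * ∑ e, ‖W' e y‖ₑ) := by
  set S := Λ * R ^ 2 + 1 with hS
  have hS0 : 0 < S := by positivity
  have h := fun a => exists_levi_adjoint_bound hK hg hgs (hβ a) (hβs a) (hγ a) (hγs a) hlam hell
    hinv hb hb0 hbd hS.ge hS0 (R := R)
  choose Ca hCa hadj using h
  obtain ⟨C, hC⟩ := (Set.finite_range Ca).bddAbove
  obtain ⟨c, hc, hmass⟩ := exists_poisson_mass_lower d hlam hΛ
  refine ⟨c.toNNReal⁻¹ * (C.toNNReal + C.toNNReal), fun W W' hW hW' a x hx => ?_⟩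
  have hCaC : Ca a ≤ C := hC ⟨a, rfl⟩
  have hC0 : 0 ≤ C := (hCa a).trans hCaC
  have hell' := hell x hx
  have hk0 := hell'.quadForm_nonneg hlam
  have hKm : MeasurableSet Kc := hK.isClosed.measurableSet
  have hWc : ∀ e, ContinuousOn (W e) Kc := fun e => (hW e).continuousOn.mono hKU
  set N := ∫⁻ y in Kc, (rieszKer b (x - y) * ∑ e, ‖W e y‖ₑ +
        rieszKer (2 * b) (x - y) * ∑ e, ‖W' e y‖ₑ) with hN
  set P : ℝ → ℝ := fun ε => ∫ y in Kc, 2 * d * ε ^ 2 *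
      (quadForm (k x) (y - x) + ε ^ 2) ^ (-((d : ℝ) / 2) - 1) * W a y with hP
  have key : ∀ ε, 0 < ε → ε ≤ 1 → ‖P ε‖ₑ ≤ (C.toNNReal + C.toNNReal : ℝ≥0) * N := by
    intro ε hε hε1
    set L := levi S (k x) x ε with hLdef
    have hL : ContDiff ℝ 2 L := contDiff_levi hS0 hell'.1 hk0 hε x
    set m : Euc d → ℝ := fun y => 2 * d * ε ^ 2 *
      (quadForm (k x) (y - x) + ε ^ 2) ^ (-((d : ℝ) / 2) - 1) with hm
    have hmc : Continuous m := by
      have h1 : Continuous fun y => quadForm (k x) (y - x) :=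
        (contDiff_quadForm (n := 0) (k x) x).continuous
      refine continuous_const.mul ((h1.add continuous_const).rpow_const fun y => Or.inl ?_)
      exact (add_pos_of_nonneg_of_pos (hk0 (y - x)) (by positivity)).ne'
    set Q : Euc d → ℝ := fun y => ∑ A, ∑ B, pdE B (pdE A (fun y => g A B y * L y)) y with hQ
    set T : ι → Euc d → ℝ := fun e y =>
      -(∑ A, pdE A (fun y => β a e A y * L y) y) + γ a e y * L y with hT
    have hQc : Continuous Q := continuous_finsetSum _ fun A _ => continuous_finsetSum _
      fun B _ => (contDiff_pdE (contDiff_pdE ((hg A B).mul hL) (m := 1) (by norm_num) A)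
        (m := 0) (by simp) B).continuous
    have hTc : ∀ e, Continuous (T e) := fun e => (continuous_finsetSum _ fun A _ =>
      (contDiff_pdE ((hβ a e A).mul (hL.of_le (by norm_num))) (m := 0) (by simp)
        A).continuous).neg.add ((hγ a e).mul hL.continuous)
    have hid := integral_mul_operator_eq hU hK hKU hL hg hgs (hβ a) (hβs a) (hγ a) (hγs a) hW a
    have hi1 : IntegrableOn (fun y => Q y * W a y + ∑ e, T e y * W e y) Kc :=
      ContinuousOn.integrableOn_compact hK ((hQc.continuousOn.mul (hWc a)).add
        (continuousOn_finsetSum _ fun e _ => (hTc e).continuousOn.mul (hWc e)))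
    have hi2 : IntegrableOn (fun y => (Q y - m y) * W a y + ∑ e, T e y * W e y) Kc :=
      ContinuousOn.integrableOn_compact hK (((hQc.sub hmc).continuousOn.mul (hWc a)).add
        (continuousOn_finsetSum _ fun e _ => (hTc e).continuousOn.mul (hWc e)))
    -- Green's identity: moving the operator onto the parametrix produces the approximate identity,
    -- which isolates W(x) as ε → 0, plus errors already bounded by weakly singular kernels.
    have hPe : P ε = (∫ y in Kc, L y * W' a y) -
        ∫ y in Kc, ((Q y - m y) * W a y + ∑ e, T e y * W e y) := by
      have h1 : ∫ y in Kc, L y * W' a y = ∫ y in Kc, (Q y * W a y + ∑ e, T e y * W e y) := by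
        rw [← hid]
        exact setIntegral_congr_fun hKm fun y hy => by simp only [hW' a y hy]
      rw [h1, ← integral_sub hi1 hi2]
      refine integral_congr_ae (ae_of_all _ fun y => ?_)
      simp only [hm]
      ring
    have hWe : AEMeasurable (fun y => rieszKer b (x - y) * ∑ e, ‖W e y‖ₑ)
        (volume.restrict Kc) := by
      have h3 : Measurable fun y : Euc d => rieszKer b (x - y) :=
        (measurable_rieszKer b).comp (by fun_prop)
      exact h3.aemeasurable.mul (Finset.aemeasurable_fun_sum _ fun e _ =>
        ((hWc e).aemeasurable hKm).enorm)
    have hLb : ‖∫ y in Kc, L y * W' a y‖ₑ ≤ ∫⁻ y in Kc, C.toNNReal *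
        (rieszKer (2 * b) (x - y) * ∑ e, ‖W' e y‖ₑ) := by
      refine (enorm_integral_le_lintegral_enorm _).trans ?_
      refine lintegral_mono_ae ?_
      filter_upwards [ae_restrict_of_ae (ae_ne_euc x), ae_restrict_mem hKm] with y hy hyK
      have hyx : y - x ≠ 0 := sub_ne_zero.mpr hy.symm
      obtain ⟨h1, -, -⟩ := hadj a x hx ε hε hε1 y hyx (hR x (interior_subset (hX hx)) y hyK)
      rw [enorm_mul, ← mul_assoc]
      refine mul_le_mul' (enorm_le_mul_rieszKer hC0 hyx (h1.trans ?_)) ?_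
      · gcongr
      · exact Finset.single_le_sum (f := fun e => ‖W' e y‖ₑ) (fun _ _ => zero_le)
          (Finset.mem_univ a)
    have hEb : ‖∫ y in Kc, ((Q y - m y) * W a y + ∑ e, T e y * W e y)‖ₑ ≤
        ∫⁻ y in Kc, (C.toNNReal + C.toNNReal : ℝ≥0) * (rieszKer b (x - y) * ∑ e, ‖W e y‖ₑ) := by
      refine (enorm_integral_le_lintegral_enorm _).trans ?_
      refine lintegral_mono_ae ?_
      filter_upwards [ae_restrict_of_ae (ae_ne_euc x), ae_restrict_mem hKm] with y hy hyK
      have hyx : y - x ≠ 0 := sub_ne_zero.mpr hy.symm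
      obtain ⟨-, h2, h3⟩ := hadj a x hx ε hε hε1 y hyx (hR x (interior_subset (hX hx)) y hyK)
      have h4 : ‖(Q y - m y) * W a y‖ₑ ≤ C.toNNReal * (rieszKer b (x - y) * ∑ e, ‖W e y‖ₑ) := by
        rw [enorm_mul, ← mul_assoc]
        refine mul_le_mul' (enorm_le_mul_rieszKer hC0 hyx (h2.trans (by gcongr))) ?_
        exact Finset.single_le_sum (f := fun e => ‖W e y‖ₑ) (fun _ _ => zero_le)
          (Finset.mem_univ a)
      have h5 : ‖∑ e, T e y * W e y‖ₑ ≤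
          C.toNNReal * (rieszKer b (x - y) * ∑ e, ‖W e y‖ₑ) := by
        refine (enorm_sum_le _ _).trans ?_
        rw [← mul_assoc, Finset.mul_sum]
        refine Finset.sum_le_sum fun e _ => ?_
        rw [enorm_mul]
        exact mul_le_mul' (enorm_le_mul_rieszKer hC0 hyx ((h3 e).trans (by gcongr))) le_rfl
      refine (enorm_add_le _ _).trans ((add_le_add h4 h5).trans (le_of_eq ?_))
      push_cast
      ring
    have hle2 : (C.toNNReal : ℝ≥0∞) ≤ (C.toNNReal + C.toNNReal : ℝ≥0) := by
      exact_mod_cast le_add_of_nonneg_left zero_le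
    calc ‖P ε‖ₑ ≤ ‖∫ y in Kc, L y * W' a y‖ₑ +
          ‖∫ y in Kc, ((Q y - m y) * W a y + ∑ e, T e y * W e y)‖ₑ := by
          rw [hPe]; exact enorm_sub_le
      _ ≤ (∫⁻ y in Kc, C.toNNReal * (rieszKer (2 * b) (x - y) * ∑ e, ‖W' e y‖ₑ)) +
          ∫⁻ y in Kc, (C.toNNReal + C.toNNReal : ℝ≥0) *
            (rieszKer b (x - y) * ∑ e, ‖W e y‖ₑ) := add_le_add hLb hEb
      _ ≤ _ := by
          rw [lintegral_const_mul' _ _ ENNReal.coe_ne_top,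
            lintegral_const_mul' _ _ ENNReal.coe_ne_top, hN, lintegral_add_left' hWe, mul_add,
            add_comm]
          exact add_le_add le_rfl (mul_le_mul' hle2 le_rfl)
  -- The bound on P(ε) is uniform in ε, so it passes to the limit, which is the mass times W(x).
  have hlim := tendsto_setIntegral_poisson hlam hell'.2.2.1 hK (hX hx) (hWc a)
  have hle := le_of_tendsto ((continuous_enorm.tendsto _).comp hlim) (b :=
    ((C.toNNReal + C.toNNReal : ℝ≥0) : ℝ≥0∞) * N) ?_
  · rw [enorm_mul] at hle
    have h1 : (c.toNNReal : ℝ≥0∞) ≤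
        ‖∫ z, 2 * d * (quadForm (k x) z + 1) ^ (-((d : ℝ) / 2) - 1)‖ₑ := by
      rw [Real.enorm_eq_ofReal_abs]
      exact ENNReal.ofReal_le_ofReal ((hmass _ hell'.2.2.1 hell'.2.2.2).trans (le_abs_self _))
    have h2 : (c.toNNReal : ℝ≥0∞) * ‖W a x‖ₑ ≤ (C.toNNReal + C.toNNReal : ℝ≥0) * N :=
      (mul_le_mul' h1 le_rfl).trans hle
    have hc' : c.toNNReal ≠ 0 := by simpa using hc
    rw [ENNReal.coe_mul, ENNReal.coe_inv hc', mul_assoc]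
    rw [← ENNReal.div_eq_inv_mul, ENNReal.le_div_iff_mul_le (by simp [hc]) (by simp), mul_comm]
    exact h2
  · have : Ioc (0 : ℝ) 1 ∈ 𝓝[>] (0 : ℝ) := Ioc_mem_nhdsGT one_pos
    filter_upwards [this] with ε hε
    exact key ε hε.1 hε.2

end LeviStep

/-! ### Interior sup estimate for elliptic systems. -/

section EllipticSup

variable {d : ℕ}

open Filter Topology

/-- Compactness of the product of the base set with the unit sphere, then homogeneity. Besides
ellipticity of the metric it later gives the equivalence of tensor norms. -/
theorem exists_isElliptic_of_isCompact {X : Type*} [TopologicalSpace X] {Kc : Set X}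
    (hK : IsCompact Kc) {k : X → Matrix (Fin d) (Fin d) ℝ} (hk : ∀ A B, ContinuousOn (fun y => k y A B) Kc)
    (hsymm : ∀ y ∈ Kc, (k y).IsSymm) (hpos : ∀ y ∈ Kc, ∀ z, z ≠ 0 → 0 < quadForm (k y) z) :
    ∃ lam Λ : ℝ, 0 < lam ∧ 0 ≤ Λ ∧ ∀ y ∈ Kc, IsElliptic lam Λ (k y) := by
  have hcont : ContinuousOn (fun p : X × Euc d => quadForm (k p.1) p.2)
      (Kc ×ˢ Metric.sphere 0 1) := by
    refine continuousOn_finsetSum _ fun A _ => continuousOn_finsetSum _ fun B _ => ?_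
    refine ContinuousOn.mul (ContinuousOn.mul ?_ (by fun_prop)) (by fun_prop)
    exact (hk A B).comp continuousOn_fst fun p hp => hp.1
  have hcpt : IsCompact (Kc ×ˢ Metric.sphere (0 : Euc d) 1) := hK.prod (isCompact_sphere 0 1)
  obtain ⟨lam, hlam, hl⟩ := hcpt.exists_forall_le' hcont (a := 0) fun p hp => hpos p.1 hp.1 p.2 (by
    intro h; have := hp.2; simp [h] at this)
  obtain ⟨Λ₁, hΛ₁⟩ := hcpt.exists_bound_of_continuousOn hcont
  choose Λ₂ hΛ₂ using fun A B => hK.exists_bound_of_continuousOn (hk A B)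
  have hscale : ∀ (M : Matrix (Fin d) (Fin d) ℝ) (c : ℝ) (z : Euc d),
      quadForm M (c • z) = c ^ 2 * quadForm M z := by
    intro M c z
    simp only [quadForm, Finset.mul_sum, PiLp.smul_apply, smul_eq_mul]
    exact Finset.sum_congr rfl fun A _ => Finset.sum_congr rfl fun B _ => by ring
  have hnorm : ∀ (M : Matrix (Fin d) (Fin d) ℝ) (z : Euc d), z ≠ 0 →
      quadForm M z = ‖z‖ ^ 2 * quadForm M (‖z‖⁻¹ • z) := by
    intro M z hz
    have : ‖z‖ ≠ 0 := norm_ne_zero_iff.mpr hz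
    rw [hscale]
    field_simp
  have hzero : ∀ M : Matrix (Fin d) (Fin d) ℝ, quadForm M (0 : Euc d) = 0 := fun M => by
    simp [quadForm]
  have hsph : ∀ z : Euc d, z ≠ 0 → ‖z‖⁻¹ • z ∈ Metric.sphere (0 : Euc d) 1 := fun z hz => by
    have : ‖z‖ ≠ 0 := norm_ne_zero_iff.mpr hz
    simp [norm_smul, this]
  have hs0 : 0 ≤ ∑ A, ∑ B, |Λ₂ A B| := Finset.sum_nonneg fun A _ => Finset.sum_nonneg
    fun B _ => abs_nonneg _
  refine ⟨lam, |Λ₁| + ∑ A, ∑ B, |Λ₂ A B|, hlam, by positivity, fun y hy =>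
    ⟨hsymm y hy, fun A B => ?_, fun z => ?_, fun z => ?_⟩⟩
  · have h1 : |k y A B| ≤ |Λ₂ A B| := (hΛ₂ A B y hy).trans (le_abs_self _)
    have h2 : |Λ₂ A B| ≤ ∑ B, |Λ₂ A B| := Finset.single_le_sum (f := fun B => |Λ₂ A B|)
      (fun _ _ => abs_nonneg _) (Finset.mem_univ B)
    have h3 : ∑ B, |Λ₂ A B| ≤ ∑ A, ∑ B, |Λ₂ A B| :=
      Finset.single_le_sum (f := fun A => ∑ B, |Λ₂ A B|)
        (fun _ _ => Finset.sum_nonneg fun B _ => abs_nonneg _) (Finset.mem_univ A)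
    linarith [abs_nonneg Λ₁]
  · rcases eq_or_ne z 0 with rfl | hz
    · simp [hzero]
    · rw [hnorm _ z hz, mul_comm]
      exact mul_le_mul_of_nonneg_left (hl (y, ‖z‖⁻¹ • z) ⟨hy, hsph z hz⟩) (by positivity)
  · rcases eq_or_ne z 0 with rfl | hz
    · simp [hzero]
    · rw [hnorm _ z hz, mul_comm]
      refine mul_le_mul_of_nonneg_right ?_ (by positivity)
      have h1 := hΛ₁ (y, ‖z‖⁻¹ • z) ⟨hy, hsph z hz⟩
      have h2 := le_abs_self (quadForm (k y) (‖z‖⁻¹ • z))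
      have h3 := le_abs_self Λ₁
      rw [Real.norm_eq_abs] at h1
      linarith

/-- Interior pointwise estimate for a second order elliptic system with scalar principal part. -/
theorem exists_elliptic_sup_bound [NeZero d] {ι : Type*} [Fintype ι] {U : Set (Euc d)}
    (hU : IsOpen U) {y₀ : Euc d} {r₀ : ℝ} (hr₀ : 0 < r₀) (hball : Metric.closedBall y₀ r₀ ⊆ U)
    {k : Euc d → Matrix (Fin d) (Fin d) ℝ} {h : Fin d → Fin d → Euc d → ℝ}
    (hk : ∀ A B, ContinuousOn (fun y => k y A B) U)
    (hsymm : ∀ y ∈ U, (k y).IsSymm) (hpos : ∀ y ∈ U, ∀ z, z ≠ 0 → 0 < quadForm (k y) z)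
    (hh : ∀ A B, ContDiffOn ℝ 2 (h A B) U)
    (hhk : ∀ y ∈ U, Matrix.of (fun A B => h A B y) * k y = 1)
    {β : ι → ι → Fin d → Euc d → ℝ} (hβ : ∀ a e A, ContDiffOn ℝ 1 (β a e A) U)
    {γ : ι → ι → Euc d → ℝ} (hγ : ∀ a e, ContinuousOn (γ a e) U)
    {M : ℕ} (hM : (d : ℝ) / 2 < 2 * M) :
    ∃ C : ℝ≥0, ∀ W : ℕ → ι → Euc d → ℝ, (∀ j < M, ∀ a, ContDiffOn ℝ 2 (W j a) U) →
      (∀ a, ContinuousOn (W M a) U) →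
      (∀ j < M, ∀ a, ∀ y ∈ U, W (j + 1) a y = ∑ A, ∑ B, h A B y * pdE A (pdE B (W j a)) y +
        ∑ e, ∑ A, β a e A y * pdE A (W j e) y + ∑ e, γ a e y * W j e y) →
      ∀ x ∈ Metric.closedBall y₀ (r₀ / 2), (∑ a, ‖W 0 a x‖ₑ) ^ 2 ≤
        C * ∑ j ∈ Finset.range (M + 1), ∫⁻ y in Metric.closedBall y₀ r₀,
          (∑ a, ‖W j a y‖ₑ) ^ 2 := by
  have hd0 : (0 : ℝ) < d := Nat.cast_pos.mpr (Nat.pos_of_ne_zero (NeZero.ne d))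
  have hM0 : 0 < M := by
    rcases Nat.eq_zero_or_pos M with rfl | h
    · norm_num at hM; linarith
    · exact h
  have hMr : (1 : ℝ) ≤ M := by exact_mod_cast hM0
  -- The total order t = 2Mb must exceed d/2 for a square integrable kernel, stay below d for
  -- composition, and stay below 2M so that b < 1, as the parametrix requires.
  obtain ⟨t, ht1, ht2⟩ := exists_between (lt_min hM (by linarith : (d : ℝ) / 2 < d))
  obtain ⟨ht2, ht3⟩ := lt_min_iff.mp ht2
  set b := t / (2 * M) with hbdef
  have hbt : 2 * M * b = t := by rw [hbdef]; field_simp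
  have hb0 : 0 < b := div_pos (by linarith) (by positivity)
  have hb1 : b < 1 := (div_lt_one (by positivity)).mpr ht2
  have hbd : 2 * b < d := by nlinarith
  -- The radii grow from r₀/2 to r₀ in 2M equal increments, one for each unit of smoothing, and stay
  -- constant afterwards.
  set rad : ℕ → ℝ := fun i => r₀ / 2 + r₀ / 2 * min ((i : ℝ) / (2 * M)) 1 with hrad
  have hrad_mono : Monotone rad := fun i j hij => by
    simp only [hrad]
    gcongr
  have hrad_le : ∀ i, rad i ≤ r₀ := fun i => by
    simp only [hrad]
    nlinarith [min_le_right ((i : ℝ) / (2 * M)) 1]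
  have hrad_pos : ∀ i, 0 < rad i := fun i => by
    simp only [hrad]
    have : 0 ≤ min ((i : ℝ) / (2 * M)) 1 := by positivity
    positivity
  have hrad_lt : ∀ i < 2 * M, rad i < rad (i + 1) := fun i hi => by
    simp only [hrad]
    have h1 : ((i + 1 : ℕ) : ℝ) / (2 * M) ≤ 1 := by
      rw [div_le_one (by positivity)]; exact_mod_cast hi
    have h2 : (i : ℝ) / (2 * M) < ((i + 1 : ℕ) : ℝ) / (2 * M) := by
      gcongr; simp
    rw [min_eq_left h1, min_eq_left (h2.le.trans h1)]
    gcongr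
  have hrad_zero : rad 0 = r₀ / 2 := by simp [hrad]
  have hrad_top : rad (2 * M) = r₀ := by
    simp only [hrad]
    push_cast
    rw [div_self (by positivity), min_self]; ring
  set Ω : ℕ → Set (Euc d) := fun i => Metric.closedBall y₀ (rad i) with hΩ
  have hΩmono : Monotone Ω := fun i j hij => Metric.closedBall_subset_closedBall (hrad_mono hij)
  have hΩsub : ∀ i, Ω i ⊆ Metric.closedBall y₀ r₀ := fun i =>
    Metric.closedBall_subset_closedBall (hrad_le i)
  have hΩ0 : Ω 0 = Metric.closedBall y₀ (r₀ / 2) := by simp only [hΩ, hrad_zero]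
  have hΩtop : Ω (2 * M) = Metric.closedBall y₀ r₀ := by simp only [hΩ, hrad_top]
  have hΩm : ∀ i, MeasurableSet (Ω i) := fun i => measurableSet_closedBall
  have hdiam : ∀ i, ∀ x ∈ Ω i, ∀ y ∈ Ω i, ‖x - y‖ ≤ 2 * r₀ := fun i x hx y hy => by
    have h1 := Metric.mem_closedBall.mp (hΩsub i hx)
    have h2 := Metric.mem_closedBall.mp (hΩsub i hy)
    rw [← dist_eq_norm]
    linarith [dist_triangle_right x y y₀]
  obtain ⟨lam, Λ, hlam, hΛ, hell⟩ := exists_isElliptic_of_isCompact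
    (isCompact_closedBall y₀ r₀) (fun A B => (hk A B).mono hball)
    (fun y hy => hsymm y (hball hy)) (fun y hy => hpos y (hball hy))
  have hstep : ∀ i : ℕ, ∃ C : ℝ≥0, i < 2 * M → ∀ W : ℕ → ι → Euc d → ℝ, ∀ j,
      (∀ a, ContDiffOn ℝ 2 (W j a) U) →
      (∀ a, ∀ y ∈ U, W (j + 1) a y = ∑ A, ∑ B, h A B y * pdE A (pdE B (W j a)) y +
        ∑ e, ∑ A, β a e A y * pdE A (W j e) y + ∑ e, γ a e y * W j e y) →
      ∀ a, ∀ x ∈ Ω i, ‖W j a x‖ₑ ≤ C * ∫⁻ y in Ω (i + 1), (rieszKer b (x - y) *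
        ∑ e, ‖W j e y‖ₑ + rieszKer (2 * b) (x - y) * ∑ e, ‖W (j + 1) e y‖ₑ) := by
    intro i
    by_cases hi : i < 2 * M
    swap
    · exact ⟨0, fun h => absurd h hi⟩
    -- The coefficients, not the solution, are cut off. The operator is unchanged on the inner ball,
    -- where the poles lie, and the image becomes χ·W_(j+1), which is dominated by W_(j+1).
    let χ : ContDiffBump y₀ := ⟨rad i, rad (i + 1), hrad_pos i, hrad_lt i hi⟩
    have hχs : tsupport χ ⊆ Ω (i + 1) := χ.tsupport_eq.subset
    have hχU : tsupport χ ⊆ U := hχs.trans ((hΩsub _).trans hball)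
    have hχ1 : ∀ x ∈ Ω i, χ x = 1 := fun x hx => χ.one_of_mem_closedBall hx
    have hs : ∀ F : Euc d → ℝ, tsupport (fun y => χ y * F y) ⊆ Ω (i + 1) := fun F =>
      tsupport_mul_subset_left.trans hχs
    obtain ⟨C, hC⟩ := exists_levi_step (ι := ι) hU (isCompact_closedBall y₀ (rad (i + 1)))
      ((hΩsub _).trans hball) (X := Ω i)
      ((Metric.closedBall_subset_ball (hrad_lt i hi)).trans Metric.ball_subset_interior_closedBall)
      (g := fun A B y => χ y * h A B y)
      (fun A B => contDiff_mul_of_tsupport hU χ.contDiff (hh A B) hχU) (fun A B => hs _)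
      (β := fun a e A y => χ y * β a e A y)
      (fun a e A => contDiff_mul_of_tsupport hU χ.contDiff (hβ a e A) hχU) (fun a e A => hs _)
      (γ := fun a e y => χ y * γ a e y)
      (fun a e => continuous_mul_of_tsupport hU χ.continuous (hγ a e) hχU)
      (fun a e => hs _) hlam hΛ (k := k) (fun x hx => hell x (hΩsub _ hx))
      (fun x hx => by
        simp only [hχ1 x hx, one_mul]
        exact hhk x (hball (hΩsub _ hx))) hb1 hb0 hbd
      (R := 2 * r₀) (fun x hx y hy => hdiam (i + 1) y hy x hx)
    refine ⟨C, fun _ W j hW hWj a x hx => ?_⟩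
    refine (hC (W j) (fun a y => χ y * W (j + 1) a y) hW (fun a y hy => ?_) a x hx).trans ?_
    · rw [hWj a y (hball (hΩsub _ hy))]
      simp only [mul_add, Finset.mul_sum, mul_assoc]
    · refine mul_le_mul' le_rfl (lintegral_mono fun y => ?_)
      refine add_le_add le_rfl (mul_le_mul' le_rfl (Finset.sum_le_sum fun e _ => ?_))
      rw [enorm_mul]
      refine mul_le_of_le_one_left' ?_
      rw [Real.enorm_eq_ofReal χ.nonneg]
      exact ENNReal.ofReal_le_one.mpr χ.le_one
  choose Cs hCs using hstep
  obtain ⟨C, hC⟩ := exists_sq_le_of_potential_bound (D := d) (b := b) (2 * r₀) hM0 hb0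
    (by rw [hbt]; exact ht3) (by rw [hbt]; linarith)
    (∑ _a : ι, ∑ i ∈ Finset.range (2 * M), Cs i)
  refine ⟨C, fun W hW hWM hWj x hx => ?_⟩
  have hcont : ∀ j ≤ M, ∀ a, ContinuousOn (W j a) U := fun j hj a => by
    rcases hj.lt_or_eq with hj | rfl
    · exact (hW j hj a).continuousOn
    · exact hWM a
  set φ : ℕ → Euc d → ℝ≥0∞ := fun j =>
    if j ≤ M then (Ω (2 * M)).indicator fun y => ∑ a, ‖W j a y‖ₑ else 0 with hφ
  have hφe : ∀ j ≤ M, ∀ i ≤ 2 * M, ∀ y ∈ Ω i, φ j y = ∑ a, ‖W j a y‖ₑ := by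
    intro j hj i hi y hy
    simp only [hφ, if_pos hj]
    rw [indicator_of_mem (hΩmono hi hy)]
  have hφm : ∀ j, Measurable (φ j) := by
    intro j
    by_cases hj : j ≤ M
    · simp only [hφ, if_pos hj]
      classical
      rw [← piecewise_eq_indicator]
      refine ContinuousOn.measurable_piecewise ?_ continuousOn_const (hΩm _)
      exact continuousOn_finsetSum _ fun a _ =>
        (((hcont j hj a).mono ((hΩsub _).trans hball))).enorm
    · simp only [hφ, if_neg hj]
      exact measurable_const
  have hmain := hC Ω hΩm hΩmono hdiam φ hφm (fun j hj i hi x hx => ?_) x (by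
    rwa [hΩ0])
  · rw [hφe 0 (Nat.zero_le _) 0 (Nat.zero_le _) x (by rwa [hΩ0])] at hmain
    refine hmain.trans (mul_le_mul' le_rfl (Finset.sum_le_sum fun j hj => ?_))
    rw [hΩtop]
    refine (setLIntegral_congr_fun measurableSet_closedBall fun y hy => ?_).le
    rw [hφe j (Nat.lt_succ_iff.mp (Finset.mem_range.mp hj)) (2 * M) le_rfl y
      (by rwa [hΩtop])]
  · rw [hφe j hj.le i hi.le x hx]
    have h1 : ∫⁻ y in Ω (i + 1), (rieszKer b (x - y) * φ j y +
        rieszKer (2 * b) (x - y) * φ (j + 1) y) = ∫⁻ y in Ω (i + 1), (rieszKer b (x - y) *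
        ∑ e, ‖W j e y‖ₑ + rieszKer (2 * b) (x - y) * ∑ e, ‖W (j + 1) e y‖ₑ) :=
      setLIntegral_congr_fun (hΩm _) fun y hy => by
        rw [hφe j hj.le (i + 1) hi y hy, hφe (j + 1) hj (i + 1) hi y hy]
    rw [h1]
    set N := ∫⁻ y in Ω (i + 1), (rieszKer b (x - y) *
        ∑ e, ‖W j e y‖ₑ + rieszKer (2 * b) (x - y) * ∑ e, ‖W (j + 1) e y‖ₑ)
    calc ∑ a, ‖W j a x‖ₑ ≤ ∑ _a : ι, (Cs i : ℝ≥0∞) * N :=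
          Finset.sum_le_sum fun a _ => hCs i hi W j (hW j hj) (hWj j hj) a x hx
      _ ≤ _ := by
          rw [← Finset.sum_mul]
          refine mul_le_mul' ?_ le_rfl
          push_cast
          refine Finset.sum_le_sum fun _ _ => ?_
          exact Finset.single_le_sum (f := fun i => (Cs i : ℝ≥0∞)) (fun _ _ => zero_le)
            (Finset.mem_range.mpr hi)

end EllipticSup

/-! ### Smoothness of frames, tensor components and metric coefficients in a chart. -/

section FrameSmooth

theorem contMDiffOn_mfderiv_const {E : Type*} [NormedAddCommGroup E] [NormedSpace ℝ E]
    {F : Type*} [NormedAddCommGroup F] [NormedSpace ℝ F] {H : Type*} [TopologicalSpace H]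
    {I : ModelWithCorners ℝ F H} {M : Type*} [TopologicalSpace M] [ChartedSpace H M]
    [IsManifold I ∞ M] {f : E → M} {s : Set E} (hs : IsOpen s)
    (hf : ContMDiffOn 𝓘(ℝ, E) I ∞ f s) (v : E) :
    ContMDiffOn 𝓘(ℝ, E) (I.prod 𝓘(ℝ, F)) ∞
      (fun q => TotalSpace.mk' F (E := fun x : M => TangentSpace I x) (f q)
        (mfderiv 𝓘(ℝ, E) I f q v)) s := by
  have h1 := hf.contMDiffOn_tangentMapWithin (m := ∞) (by simp) hs.uniqueMDiffOn
  have h2 : ContMDiffOn 𝓘(ℝ, E) (𝓘(ℝ, E).prod 𝓘(ℝ, E)) ∞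
      (fun q : E => TotalSpace.mk' E (E := fun x : E => TangentSpace 𝓘(ℝ, E) x) q v) s :=
    contMDiffOn_vectorSpace_iff_contDiffOn (V := fun _ => v).mpr contDiffOn_const
  refine (h1.comp h2 fun q hq => hq).congr fun q hq => ?_
  simp only [Function.comp, tangentMapWithin]
  rw [mfderivWithin_of_isOpen hs hq]

variable {n d : ℕ} {K : Type*} [TopologicalSpace K] [ChartedSpace (EuclideanSpace ℝ (Fin d)) K]

/-- The coordinate range of the chart of `K` centred at `c`. -/
abbrev chartDom (c : K) : Set (Euc d) := (extChartAt 𝓘(ℝ, EuclideanSpace ℝ (Fin d)) c).target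

theorem isOpen_chartDom (c : K) : IsOpen (chartDom (d := d) c) := isOpen_extChartAt_target c

/-- The coordinate range of the chart of the product spacetime given by the chart at `c`. -/
abbrev prodDom (n : ℕ) (c : K) : Set (Coord n d) := univ ×ˢ chartDom c

theorem isOpen_prodDom (c : K) : IsOpen (prodDom (d := d) n c) :=
  isOpen_univ.prod (isOpen_chartDom c)

/-- The point of the product spacetime with coordinates `q`. -/
def chartPt (c : K) (q : Coord n d) : Mink n × K :=
  (q.1, (extChartAt 𝓘(ℝ, EuclideanSpace ℝ (Fin d)) c).symm q.2)

theorem sum_smul_intVec (c : K) (y z : Euc d) :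
    (∑ A, z A • intVec c y A : TangentSpace 𝓘(ℝ, EuclideanSpace ℝ (Fin d))
      ((extChartAt 𝓘(ℝ, EuclideanSpace ℝ (Fin d)) c).symm y)) =
      mfderiv 𝓘(ℝ, EuclideanSpace ℝ (Fin d)) 𝓘(ℝ, EuclideanSpace ℝ (Fin d))
        (extChartAt 𝓘(ℝ, EuclideanSpace ℝ (Fin d)) c).symm y z := by
  have hz : z = ∑ A, z A • (EuclideanSpace.single A (1 : ℝ) : Euc d) := by
    ext B
    simp [Pi.single_apply]
  conv_rhs => rw [hz]
  simp only [intVec]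
  exact (map_sum (mfderiv 𝓘(ℝ, EuclideanSpace ℝ (Fin d)) 𝓘(ℝ, EuclideanSpace ℝ (Fin d))
    (extChartAt 𝓘(ℝ, EuclideanSpace ℝ (Fin d)) c).symm y) _ _ |>.trans
    (Finset.sum_congr rfl fun A _ => map_smul _ _ _)).symm

variable [IsManifold 𝓘(ℝ, EuclideanSpace ℝ (Fin d)) ∞ K]

theorem contMDiffOn_chart_symm (c : K) :
    ContMDiffOn 𝓘(ℝ, EuclideanSpace ℝ (Fin d)) 𝓘(ℝ, EuclideanSpace ℝ (Fin d)) ∞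
      (extChartAt 𝓘(ℝ, EuclideanSpace ℝ (Fin d)) c).symm (chartDom c) :=
  contMDiffOn_extChartAt_symm c

theorem contMDiffOn_chartPt (c : K) :
    ContMDiffOn 𝓘(ℝ, Coord n d) (model n d) ∞ (chartPt (n := n) (d := d) c) (prodDom n c) := by
  have h1 : ContMDiffOn 𝓘(ℝ, Coord n d) 𝓘(ℝ, Mink n) ∞ (fun q : Coord n d => q.1)
      (prodDom n c) := contDiff_fst.contMDiff.contMDiffOn
  have h2 : ContMDiffOn 𝓘(ℝ, Coord n d) 𝓘(ℝ, EuclideanSpace ℝ (Fin d)) ∞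
      (fun q : Coord n d => q.2) (prodDom n c) := contDiff_snd.contMDiff.contMDiffOn
  exact h1.prodMk ((contMDiffOn_chart_symm c).comp h2 fun q hq => hq.2)

/-- Seen as the push-forward of a constant vector under the inverse product chart, the frame
inherits smoothness from the tangent map and its transformation law from the chain rule. -/
theorem frame_eq_mfderiv {c : K} {q : Coord n d} (hq : q ∈ prodDom n c) (a : Idx n d) :
    frame c q a = mfderiv 𝓘(ℝ, Coord n d) (model n d) (chartPt (n := n) (d := d) c) q (basisVec a) := by
  have hd : MDifferentiableAt 𝓘(ℝ, EuclideanSpace ℝ (Fin d)) 𝓘(ℝ, EuclideanSpace ℝ (Fin d))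
      (extChartAt 𝓘(ℝ, EuclideanSpace ℝ (Fin d)) c).symm q.2 :=
    (((contMDiffOn_chart_symm c).contMDiffAt
      ((isOpen_chartDom c).mem_nhds hq.2)).mdifferentiableAt (by simp))
  have h1 : HasMFDerivAt 𝓘(ℝ, Coord n d) 𝓘(ℝ, Mink n) (fun q : Coord n d => q.1) q
      (ContinuousLinearMap.fst ℝ (Mink n) (EuclideanSpace ℝ (Fin d))) :=
    hasFDerivAt_fst.hasMFDerivAt
  have h2 : HasMFDerivAt 𝓘(ℝ, Coord n d) 𝓘(ℝ, EuclideanSpace ℝ (Fin d))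
      (fun q : Coord n d => q.2) q
      (ContinuousLinearMap.snd ℝ (Mink n) (EuclideanSpace ℝ (Fin d))) :=
    hasFDerivAt_snd.hasMFDerivAt
  have h3 := h1.prodMk (hd.hasMFDerivAt.comp q h2)
  have h4 : HasMFDerivAt 𝓘(ℝ, Coord n d) (model n d) (chartPt (n := n) (d := d) c) q _ := h3
  rw [h4.mfderiv]
  rcases a with i | A
  · refine Prod.ext rfl ?_
    exact (map_zero (mfderiv 𝓘(ℝ, EuclideanSpace ℝ (Fin d)) 𝓘(ℝ, EuclideanSpace ℝ (Fin d))
      (extChartAt 𝓘(ℝ, EuclideanSpace ℝ (Fin d)) c).symm q.2)).symm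
  · rfl

theorem contMDiffOn_frame (c : K) (a : Idx n d) :
    ContMDiffOn 𝓘(ℝ, Coord n d) ((model n d).prod
        𝓘(ℝ, Mink n × EuclideanSpace ℝ (Fin d))) ∞
      (fun q => TotalSpace.mk' (Mink n × EuclideanSpace ℝ (Fin d))
        (E := fun z : Mink n × K => TangentSpace (model n d) z) (chartPt c q) (frame c q a))
      (prodDom n c) := by
  refine (contMDiffOn_mfderiv_const (isOpen_prodDom c) (contMDiffOn_chartPt c)
    (basisVec a)).congr fun q hq => ?_
  rw [← frame_eq_mfderiv hq]

/-- Bundle regularity becomes regularity of components by pairing with the frame, itself smooth to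
order ∞; hence the bound on r. -/
theorem contDiffOn_comp {u : TensorField n d K} {r : WithTop ℕ∞} (hr : r ≤ (∞ : WithTop ℕ∞)) (hu : u.IsCk r)
    (c : K) (a : Fin 2 → Idx n d) : ContDiffOn ℝ r (fun q => u.comp c q a) (prodDom n c) := by
  have h1 : ContMDiffOn 𝓘(ℝ, Coord n d) ((model n d).prod
      𝓘(ℝ, (Mink n × EuclideanSpace ℝ (Fin d)) →L[ℝ]
        (Mink n × EuclideanSpace ℝ (Fin d)) →L[ℝ] ℝ)) r
      (fun q => TotalSpace.mk' ((Mink n × EuclideanSpace ℝ (Fin d)) →L[ℝ]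
        (Mink n × EuclideanSpace ℝ (Fin d)) →L[ℝ] ℝ)
        (E := fun z : Mink n × K => TangentSpace (model n d) z →L[ℝ]
          TangentSpace (model n d) z →L[ℝ] ℝ) (chartPt c q) (u (chartPt c q))) (prodDom n c) :=
    ContMDiff.comp_contMDiffOn (g := fun z : Mink n × K =>
      TotalSpace.mk' ((Mink n × EuclideanSpace ℝ (Fin d)) →L[ℝ]
        (Mink n × EuclideanSpace ℝ (Fin d)) →L[ℝ] ℝ) z (u z)) hu
      ((contMDiffOn_chartPt c).of_le hr)
  have h2 := ContMDiffOn.clm_bundle_apply₂ (F₃ := ℝ) (E₃ := fun _ : Mink n × K => ℝ) h1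
    ((contMDiffOn_frame c (a 0)).of_le hr) ((contMDiffOn_frame c (a 1)).of_le hr)
  intro q hq
  have h3 := (Bundle.contMDiffWithinAt_totalSpace.mp (h2 q hq)).2
  exact h3.contDiffWithinAt

theorem contMDiffOn_intVec (c : K) (A : Fin d) :
    ContMDiffOn 𝓘(ℝ, EuclideanSpace ℝ (Fin d)) (𝓘(ℝ, EuclideanSpace ℝ (Fin d)).prod
        𝓘(ℝ, EuclideanSpace ℝ (Fin d))) ∞
      (fun y => TotalSpace.mk' (EuclideanSpace ℝ (Fin d))
        (E := fun z : K => TangentSpace 𝓘(ℝ, EuclideanSpace ℝ (Fin d)) z)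
        ((extChartAt 𝓘(ℝ, EuclideanSpace ℝ (Fin d)) c).symm y) (intVec c y A))
      (chartDom c) :=
  contMDiffOn_mfderiv_const (isOpen_chartDom c) (contMDiffOn_chart_symm c) _

theorem contDiffOn_gram (g : RMetric d K) (c : K) (A B : Fin d) :
    ContDiffOn ℝ ∞ (fun y => gram g c y A B) (chartDom c) := by
  have h1 : ContMDiffOn 𝓘(ℝ, EuclideanSpace ℝ (Fin d)) (𝓘(ℝ, EuclideanSpace ℝ (Fin d)).prod
      𝓘(ℝ, EuclideanSpace ℝ (Fin d) →L[ℝ] EuclideanSpace ℝ (Fin d) →L[ℝ] ℝ)) ∞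
      (fun y => TotalSpace.mk' (EuclideanSpace ℝ (Fin d) →L[ℝ]
        EuclideanSpace ℝ (Fin d) →L[ℝ] ℝ)
        (E := fun z : K => TangentSpace 𝓘(ℝ, EuclideanSpace ℝ (Fin d)) z →L[ℝ]
          TangentSpace 𝓘(ℝ, EuclideanSpace ℝ (Fin d)) z →L[ℝ] ℝ)
        ((extChartAt 𝓘(ℝ, EuclideanSpace ℝ (Fin d)) c).symm y)
        (g.inner ((extChartAt 𝓘(ℝ, EuclideanSpace ℝ (Fin d)) c).symm y))) (chartDom c) :=
    g.contMDiff.comp_contMDiffOn (contMDiffOn_chart_symm c)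
  have h2 := ContMDiffOn.clm_bundle_apply₂ (F₃ := ℝ) (E₃ := fun _ : K => ℝ) h1
    (contMDiffOn_intVec c A) (contMDiffOn_intVec c B)
  intro q hq
  have h3 := (Bundle.contMDiffWithinAt_totalSpace.mp (h2 q hq)).2
  exact h3.contDiffWithinAt

theorem isSymm_gram (g : RMetric d K) (c : K) (y : Euc d) : (gram g c y).IsSymm := by
  ext A B
  simp only [gram, Matrix.transpose_apply, Matrix.of_apply]
  exact g.symm _ _ _

/-- The form is the squared length of the image of z under the derivative of the inverse chart,
which is injective. -/
theorem quadForm_gram_pos (g : RMetric d K) {c : K} {y : Euc d} (hy : y ∈ chartDom c) (z : Euc d)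
    (hz : z ≠ 0) : 0 < quadForm (gram g c y) z := by
  set v := mfderiv 𝓘(ℝ, EuclideanSpace ℝ (Fin d)) 𝓘(ℝ, EuclideanSpace ℝ (Fin d))
        (extChartAt 𝓘(ℝ, EuclideanSpace ℝ (Fin d)) c).symm y z with hv
  have h1 : quadForm (gram g c y) z =
      g.inner ((extChartAt 𝓘(ℝ, EuclideanSpace ℝ (Fin d)) c).symm y) v v := by
    rw [hv, ← sum_smul_intVec]
    simp only [map_sum, map_smul, _root_.sum_apply, _root_.smul_apply, smul_eq_mul,
      quadForm, gram, Matrix.of_apply]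
    rw [Finset.sum_comm]
    refine Finset.sum_congr rfl fun A _ => ?_
    rw [Finset.mul_sum]
    exact Finset.sum_congr rfl fun B _ => by ring
  rw [h1]
  refine g.pos _ _ fun h0 => hz ?_
  have hinv := isInvertible_mfderivWithin_extChartAt_symm (I := 𝓘(ℝ, EuclideanSpace ℝ (Fin d)))
    hy
  rw [ModelWithCorners.range_eq_univ, mfderivWithin_univ] at hinv
  exact hinv.injective (by rw [← hv, h0]; exact (map_zero (mfderiv _ _ _ _)).symm)

theorem posDef_gram (g : RMetric d K) {c : K} {y : Euc d} (hy : y ∈ chartDom c) :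
    (gram g c y).PosDef := by
  refine Matrix.PosDef.of_dotProduct_mulVec_pos (by
    rw [Matrix.IsHermitian, Matrix.conjTranspose_eq_transpose_of_trivial]
    exact isSymm_gram g c y) fun x hx => ?_
  have h1 := quadForm_gram_pos g hy (WithLp.toLp 2 x) (by simpa using hx)
  refine h1.trans_eq ?_
  simp only [quadForm, dotProduct, Matrix.mulVec, Pi.star_apply, star_trivial, Finset.mul_sum]
  exact Finset.sum_congr rfl fun A _ => Finset.sum_congr rfl fun B _ => by ring

theorem gram_inv_mul (g : RMetric d K) {c : K} {y : Euc d} (hy : y ∈ chartDom c) :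
    (gram g c y)⁻¹ * gram g c y = 1 :=
  Matrix.nonsing_inv_mul _ (posDef_gram g hy).det_pos.ne'.isUnit

theorem contDiffOn_matrix_inv {E κ : Type*} [NormedAddCommGroup E] [NormedSpace ℝ E] [Fintype κ]
    [DecidableEq κ] {m : WithTop ℕ∞} {s : Set E} {N : E → Matrix κ κ ℝ}
    (hN : ∀ i j, ContDiffOn ℝ m (fun x => N x i j) s) (hdet : ∀ x ∈ s, (N x).det ≠ 0) (i j : κ) :
    ContDiffOn ℝ m (fun x => (N x)⁻¹ i j) s := by
  have hdetc : ∀ N' : E → Matrix κ κ ℝ, (∀ i j, ContDiffOn ℝ m (fun x => N' x i j) s) →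
      ContDiffOn ℝ m (fun x => (N' x).det) s := by
    intro N' hN'
    simp only [Matrix.det_apply]
    exact ContDiffOn.sum fun σ _ => (contDiffOn_prod fun i _ => hN' _ _).const_smul _
  simp only [Matrix.inv_def, Ring.inverse_eq_inv', Matrix.smul_apply, smul_eq_mul]
  refine ((hdetc N hN).inv hdet).mul ?_
  simp only [Matrix.adjugate_apply]
  refine hdetc _ fun k l => ?_
  by_cases hk : k = j
  · subst hk
    simp only [Matrix.updateRow_self]
    exact contDiffOn_const
  · simp only [Matrix.updateRow_ne hk]
    exact hN k l

end FrameSmooth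

/-! ### Changes of coordinates and the Christoffel transformation law. -/

section Jacobian

variable {n d : ℕ}

/-- The coordinate functionals on the coordinate space. -/
def coordFun : Idx n d → Coord n d →L[ℝ] ℝ
  | Sum.inl i => (EuclideanSpace.proj i).comp (ContinuousLinearMap.fst ℝ _ _)
  | Sum.inr A => (EuclideanSpace.proj A).comp (ContinuousLinearMap.snd ℝ _ _)

theorem sum_coordFun_smul (v : Coord n d) : ∑ a, coordFun a v • (basisVec a : Coord n d) = v := by
  rw [Fintype.sum_sum_type]
  refine Prod.ext ?_ ?_
  · rw [Prod.fst_add, Prod.fst_sum, Prod.fst_sum]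
    ext i
    simp [coordFun, basisVec, coordVec, Pi.single_apply]
  · rw [Prod.snd_add, Prod.snd_sum, Prod.snd_sum]
    ext i
    simp [coordFun, basisVec, Pi.single_apply]

theorem map_eq_sum_coordFun {F : Type*} [AddCommMonoid F] [Module ℝ F] [TopologicalSpace F]
    (L : Coord n d →L[ℝ] F) (v : Coord n d) : L v = ∑ a, coordFun a v • L (basisVec a) := by
  conv_lhs => rw [← sum_coordFun_smul v]
  simp

/-- The Jacobian matrix of a change of coordinates. -/
def jac (Ψ : Coord n d → Coord n d) (q : Coord n d) : Matrix (Idx n d) (Idx n d) ℝ :=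
  Matrix.of fun a b => coordFun b (fderiv ℝ Ψ q (basisVec a))

/-- `T` is the pullback of the covariant tensor field `T'` under the coordinate change `Ψ`. -/
def IsPullback (Ψ : Coord n d → Coord n d) (S : Set (Coord n d)) {k : ℕ} (T T' : Comp n d k) :
    Prop :=
  ∀ q ∈ S, ∀ a, T q a = ∑ b, (∏ j, jac Ψ q (a j) (b j)) * T' (Ψ q) b

theorem contDiffOn_jac {Ψ : Coord n d → Coord n d} {S : Set (Coord n d)} (hS : IsOpen S)
    (hΨ : ContDiffOn ℝ ∞ Ψ S) (a b : Idx n d) : ContDiffOn ℝ ∞ (fun q => jac Ψ q a b) S := by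
  have h1 : ContDiffOn ℝ ∞ (fderiv ℝ Ψ) S := hΨ.fderiv_of_isOpen hS (by simp)
  exact (coordFun b).contDiff.comp_contDiffOn (h1.clm_apply contDiffOn_const)

theorem pd_jac_comm {Ψ : Coord n d → Coord n d} {S : Set (Coord n d)} (hS : IsOpen S)
    (hΨ : ContDiffOn ℝ ∞ Ψ S) {q : Coord n d} (hq : q ∈ S) (a b m : Idx n d) :
    pd a (fun q => jac Ψ q b m) q = pd b (fun q => jac Ψ q a m) q := by
  have h1 : ContDiffAt ℝ ∞ Ψ q := hΨ.contDiffAt (hS.mem_nhds hq)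
  have h2 : DifferentiableAt ℝ (fderiv ℝ Ψ) q :=
    (h1.fderiv_right (m := 1) (by norm_cast)).differentiableAt one_ne_zero
  have h3 : ∀ a b, pd a (fun q => jac Ψ q b m) q =
      coordFun m (fderiv ℝ (fderiv ℝ Ψ) q (basisVec a) (basisVec b)) := by
    intro a b
    have h4 : HasFDerivAt (fun q => fderiv ℝ Ψ q (basisVec b))
        ((fderiv ℝ (fderiv ℝ Ψ) q).flip (basisVec b)) q := by
      have := h2.hasFDerivAt.clm_apply (hasFDerivAt_const (basisVec b : Coord n d) q)
      refine this.congr_fderiv ?_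
      ext <;> simp
    have h5 : HasFDerivAt (fun q => jac Ψ q b m)
      ((coordFun m).comp ((fderiv ℝ (fderiv ℝ Ψ) q).flip (basisVec b))) q :=
      (coordFun m).hasFDerivAt.comp q h4
    rw [pd, h5.fderiv]
    rfl
  have hsymm : IsSymmSndFDerivAt ℝ Ψ q := h1.isSymmSndFDerivAt (by
    simp only [minSmoothness_of_isRCLikeNormedField]; norm_cast)
  rw [h3, h3, hsymm.eq]

theorem pd_comp {Ψ : Coord n d → Coord n d} {F : Coord n d → ℝ} {q : Coord n d}
    (hF : DifferentiableAt ℝ F (Ψ q)) (hΨ : DifferentiableAt ℝ Ψ q) (a : Idx n d) :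
    pd a (fun q => F (Ψ q)) q = ∑ m, jac Ψ q a m * pd m F (Ψ q) := by
  have h1 : HasFDerivAt (fun q => F (Ψ q)) ((fderiv ℝ F (Ψ q)).comp (fderiv ℝ Ψ q)) q :=
    hF.hasFDerivAt.comp q hΨ.hasFDerivAt
  rw [pd, h1.fderiv, ContinuousLinearMap.comp_apply, map_eq_sum_coordFun]
  rfl

theorem pd_sum {κ : Type*} (s : Finset κ) {F : κ → Coord n d → ℝ} {q : Coord n d}
    (hF : ∀ i ∈ s, DifferentiableAt ℝ (F i) q) (a : Idx n d) :
    pd a (fun q => ∑ i ∈ s, F i q) q = ∑ i ∈ s, pd a (F i) q := by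
  rw [pd, fderiv_fun_sum hF, _root_.sum_apply]
  rfl

theorem pd_mul {F G : Coord n d → ℝ} {q : Coord n d} (hF : DifferentiableAt ℝ F q)
    (hG : DifferentiableAt ℝ G q) (a : Idx n d) :
    pd a (fun q => F q * G q) q = pd a F q * G q + F q * pd a G q := by
  rw [pd, fderiv_fun_mul hF hG]
  simp only [_root_.add_apply, _root_.smul_apply, smul_eq_mul, pd]
  ring

theorem pd_prod {κ : Type*} [DecidableEq κ] (s : Finset κ) {F : κ → Coord n d → ℝ}
    {q : Coord n d} (hF : ∀ i ∈ s, DifferentiableAt ℝ (F i) q) (a : Idx n d) :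
    pd a (fun q => ∏ i ∈ s, F i q) q = ∑ i ∈ s, pd a (F i) q * ∏ j ∈ s.erase i, F j q := by
  have h1 := HasFDerivAt.finsetProd (u := s) fun i hi => (hF i hi).hasFDerivAt
  rw [pd, h1.fderiv, _root_.sum_apply]
  exact Finset.sum_congr rfl fun i _ => by
    rw [_root_.smul_apply, smul_eq_mul, mul_comm]; rfl

theorem pd_congr {F G : Coord n d → ℝ} {S : Set (Coord n d)} (hS : IsOpen S) {q : Coord n d}
    (hq : q ∈ S) (h : ∀ q ∈ S, F q = G q) (a : Idx n d) : pd a F q = pd a G q := by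
  rw [pd, pd, Filter.EventuallyEq.fderiv_eq (Filter.eventuallyEq_of_mem (hS.mem_nhds hq) h)]

/-- The transformation law of the Christoffel symbols, as an algebraic identity. -/
theorem sum_christoffel_mul_jac {κ : Type*} [Fintype κ] [DecidableEq κ]
    {G G' J : Matrix κ κ ℝ} {dG dG' dJ : κ → κ → κ → ℝ} (hG' : G'.IsSymm) (hdet : G'.det ≠ 0)
    (hinv : J.transpose * G⁻¹ * J = G'⁻¹) (hdJ : ∀ a b m, dJ a b m = dJ b a m)
    (hdG : ∀ c a b, dG c a b = ∑ m, ∑ l, ((dJ c a m * J b l + J a m * dJ c b l) * G' m l +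
      J a m * J b l * ∑ k, J c k * dG' k m l)) (a b e' : κ) :
    ∑ e, (1 / 2 * ∑ h, G⁻¹ e h * (dG a h b + dG b h a - dG h a b)) * J e e' =
      dJ a b e' + ∑ k, ∑ l, J a k * J b l *
        (1 / 2 * ∑ h, G'⁻¹ e' h * (dG' k h l + dG' l h k - dG' h k l)) := by
  have hG's : ∀ m l, G' m l = G' l m := fun m l => by
    conv_lhs => rw [← hG'.eq]
    rfl
  set Z : κ → ℝ := fun m => ∑ k, ∑ l, J a k * J b l * (dG' k m l + dG' l m k - dG' m k l) with hZ
  set Y : κ → ℝ := fun m => 2 * ∑ l, G' m l * dJ a b l + Z m with hY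
  -- In the Koszul combination the second derivatives of the coordinate change cancel in pairs by
  -- symmetry, except one pair, which gives the inhomogeneous term. The free index h then appears
  -- only through J, ready to be contracted with G⁻¹.
  have hX : ∀ h, dG a h b + dG b h a - dG h a b = ∑ m, J h m * Y m := by
    intro h
    have e1 : ∑ m, ∑ l, dJ b h m * J a l * G' m l = ∑ m, ∑ l, J a m * dJ h b l * G' m l := by
      rw [Finset.sum_comm]
      refine Finset.sum_congr rfl fun m _ => Finset.sum_congr rfl fun l _ => ?_
      rw [hdJ b h, hG's l m]; ring
    have e2 : ∑ m, ∑ l, J h m * J a l * ∑ k, J b k * dG' k m l =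
        ∑ m, J h m * ∑ k, ∑ l, J a k * J b l * dG' l m k := by
      simp only [Finset.mul_sum]
      refine Finset.sum_congr rfl fun m _ => Finset.sum_congr rfl fun k _ =>
        Finset.sum_congr rfl fun l _ => by ring
    have e3 : ∑ m, ∑ l, J h m * J b l * ∑ k, J a k * dG' k m l =
        ∑ m, J h m * ∑ k, ∑ l, J a k * J b l * dG' k m l := by
      simp only [Finset.mul_sum]
      refine Finset.sum_congr rfl fun m _ => ?_
      rw [Finset.sum_comm]
      exact Finset.sum_congr rfl fun k _ => Finset.sum_congr rfl fun l _ => by ring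
    have e4 : ∑ m, ∑ l, J a m * J b l * ∑ k, J h k * dG' k m l =
        ∑ m, J h m * ∑ k, ∑ l, J a k * J b l * dG' m k l := by
      simp only [Finset.mul_sum]
      have : ∀ m, ∑ l, ∑ k, J a m * J b l * (J h k * dG' k m l) =
          ∑ k, ∑ l, J a m * J b l * (J h k * dG' k m l) := fun m => Finset.sum_comm
      simp only [this]
      rw [Finset.sum_comm]
      exact Finset.sum_congr rfl fun m _ => Finset.sum_congr rfl fun k _ =>
        Finset.sum_congr rfl fun l _ => by ring
    have e5 : ∑ m, J h m * Y m = 2 * (∑ m, ∑ l, J h m * dJ a b l * G' m l) +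
        (∑ m, J h m * ∑ k, ∑ l, J a k * J b l * dG' k m l) +
        (∑ m, J h m * ∑ k, ∑ l, J a k * J b l * dG' l m k) -
        ∑ m, J h m * ∑ k, ∑ l, J a k * J b l * dG' m k l := by
      simp only [hY, hZ, mul_add, mul_sub, Finset.sum_add_distrib, Finset.sum_sub_distrib,
        Finset.mul_sum]
      have : ∀ m l, J h m * (2 * (G' m l * dJ a b l)) = 2 * (J h m * dJ a b l * G' m l) :=
        fun m l => by ring
      simp only [this]
      ring
    have e6 : ∑ m, ∑ l, J h m * dJ b a l * G' m l = ∑ m, ∑ l, J h m * dJ a b l * G' m l := by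
      simp only [hdJ b a]
    have e7 : ∑ m, ∑ l, dJ a h m * J b l * G' m l = ∑ m, ∑ l, dJ h a m * J b l * G' m l := by
      simp only [hdJ a h]
    rw [e5, hdG a h b, hdG b h a, hdG h a b]
    simp only [add_mul, Finset.sum_add_distrib]
    rw [e3, e2, e4, e1, e6, e7]
    ring
  have h1 : ∑ e, (1 / 2 * ∑ h, G⁻¹ e h * (dG a h b + dG b h a - dG h a b)) * J e e' =
      1 / 2 * ∑ m, (J.transpose * G⁻¹ * J) e' m * Y m := by
    simp only [hX, Matrix.mul_apply, Matrix.transpose_apply, Finset.mul_sum, Finset.sum_mul]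
    rw [Finset.sum_comm]
    have : ∀ m, ∑ h, ∑ e, 1 / 2 * (J e e' * G⁻¹ e h * J h m * Y m) =
        ∑ h, ∑ e, 1 / 2 * (G⁻¹ e h * (J h m * Y m)) * J e e' := fun m =>
      Finset.sum_congr rfl fun _ _ => Finset.sum_congr rfl fun _ _ => by ring
    simp only [this]
    have h2 : ∀ h, ∑ e, ∑ m, 1 / 2 * (G⁻¹ e h * (J h m * Y m)) * J e e' =
        ∑ m, ∑ e, 1 / 2 * (G⁻¹ e h * (J h m * Y m)) * J e e' := fun h => Finset.sum_comm
    simp only [h2]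
    exact Finset.sum_comm
  have h3 : ∑ m, G'⁻¹ e' m * ∑ l, G' m l * dJ a b l = dJ a b e' := by
    have h4 : G'⁻¹ * G' = 1 := Matrix.nonsing_inv_mul _ hdet.isUnit
    calc _ = (G'⁻¹.mulVec (G'.mulVec (dJ a b))) e' := rfl
      _ = _ := by rw [Matrix.mulVec_mulVec, h4, Matrix.one_mulVec]
  rw [h1, hinv]
  simp only [hY, mul_add, Finset.sum_add_distrib]
  have h5 : ∑ m, G'⁻¹ e' m * (2 * ∑ l, G' m l * dJ a b l) = 2 * dJ a b e' := by
    rw [← h3, Finset.mul_sum]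
    exact Finset.sum_congr rfl fun m _ => by ring
  rw [h5]
  have h6 : ∑ m, G'⁻¹ e' m * Z m = ∑ k, ∑ l, J a k * J b l *
      ∑ h, G'⁻¹ e' h * (dG' k h l + dG' l h k - dG' h k l) := by
    simp only [hZ, Finset.mul_sum]
    rw [Finset.sum_comm]
    refine Finset.sum_congr rfl fun k _ => ?_
    rw [Finset.sum_comm]
    exact Finset.sum_congr rfl fun l _ => Finset.sum_congr rfl fun m _ => by ring
  rw [h6, Finset.mul_sum]
  have h7 : ∀ k, 1 / 2 * ∑ l, J a k * J b l *
      ∑ h, G'⁻¹ e' h * (dG' k h l + dG' l h k - dG' h k l) = ∑ l, J a k * J b l *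
        (1 / 2 * ∑ h, G'⁻¹ e' h * (dG' k h l + dG' l h k - dG' h k l)) := fun k => by
    rw [Finset.mul_sum]
    exact Finset.sum_congr rfl fun l _ => by ring
  simp only [h7]
  ring

end Jacobian

/-! ### Covariance of the covariant derivative and of metric contractions. -/

section Covariance

theorem sum_fin_succ_fun {ι M : Type*} [Fintype ι] [AddCommMonoid M] {k : ℕ}
    (F : (Fin (k + 1) → ι) → M) : ∑ b, F b = ∑ x, ∑ b : Fin k → ι, F (Fin.cons x b) := by
  rw [← (Fin.consEquiv fun _ => ι).sum_comp, Fintype.sum_prod_type]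
  rfl

/-- Exchanging the j-th entry with the extra summation index is an involution of the index set. -/
theorem sum_update_comm {ι M : Type*} [Fintype ι] [AddCommMonoid M] {k : ℕ} (j : Fin k)
    (F : (Fin k → ι) → ι → M) :
    ∑ b, ∑ l, F b l = ∑ b, ∑ e, F (Function.update b j e) (b j) := by
  rw [← Fintype.sum_prod_type', ← Fintype.sum_prod_type']
  have hinv : Function.Involutive fun p : (Fin k → ι) × ι => (Function.update p.1 j p.2, p.1 j) :=
    fun p => by simp
  exact (Equiv.sum_comp (hinv.toPerm _) fun p : (Fin k → ι) × ι => F p.1 p.2).symm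

variable {n d : ℕ} {K : Type*} [TopologicalSpace K] [ChartedSpace (EuclideanSpace ℝ (Fin d)) K]
  [IsManifold 𝓘(ℝ, EuclideanSpace ℝ (Fin d)) ∞ K]

/-- Differentiating the pulled back components produces derivatives of the Jacobian, one for each
slot, and these are exactly the inhomogeneous terms of the Christoffel symbols. -/
theorem isPullback_covDeriv {g : RMetric d K} {c c' : K} {Ψ : Coord n d → Coord n d}
    {S : Set (Coord n d)} (hS : IsOpen S) (hΨ : ContDiffOn ℝ ∞ Ψ S)
    (hΓ : ∀ q ∈ S, ∀ a b e', ∑ e, christoffel g c q e a b * jac Ψ q e e' =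
      pd a (fun q => jac Ψ q b e') q +
        ∑ k, ∑ l, jac Ψ q a k * jac Ψ q b l * christoffel g c' (Ψ q) e' k l)
    {k : ℕ} {T T' : Comp n d k} (hT : IsPullback Ψ S T T')
    (hT' : ∀ q ∈ S, ∀ b, DifferentiableAt ℝ (fun q => T' q b) (Ψ q)) :
    IsPullback Ψ S (covDeriv g c T) (covDeriv g c' T') := by
  intro q hq a
  have hΨd : DifferentiableAt ℝ Ψ q :=
    (hΨ.contDiffAt (hS.mem_nhds hq)).differentiableAt (by simp)
  have hJd : ∀ a b, DifferentiableAt ℝ (fun q => jac Ψ q a b) q := fun a b =>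
    ((contDiffOn_jac hS hΨ a b).contDiffAt (hS.mem_nhds hq)).differentiableAt (by simp)
  have hT'd : ∀ b, DifferentiableAt ℝ (fun q => T' (Ψ q) b) q := fun b =>
    (hT' q hq b).comp q hΨd
  set J := jac Ψ q with hJ
  set α := Fin.tail a with hα
  set dJ : Idx n d → Idx n d → Idx n d → ℝ := fun a b m => pd a (fun q => jac Ψ q b m) q with hdJ
  set Γ' := christoffel g c' (Ψ q) with hΓ'
  set D : Idx n d → (Fin k → Idx n d) → ℝ := fun m b => pd m (fun q => T' q b) (Ψ q) with hD
  set P : (Fin k → Idx n d) → ℝ := fun b => ∏ j, J (α j) (b j) with hP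
  set Pe : Fin k → (Fin k → Idx n d) → ℝ := fun j b => ∏ i ∈ Finset.univ.erase j, J (α i) (b i)
    with hPe
  have hPPe : ∀ j b, P b = J (α j) (b j) * Pe j b := fun j b =>
    (Finset.mul_prod_erase _ (fun i => J (α i) (b i)) (Finset.mem_univ j)).symm
  have hPeu : ∀ j b l, Pe j (Function.update b j l) = Pe j b := fun j b l =>
    Finset.prod_congr rfl fun i hi => by rw [Function.update_of_ne (Finset.ne_of_mem_erase hi)]
  have hprodd : ∀ b : Fin k → Idx n d, DifferentiableAt ℝ (fun q => ∏ j, jac Ψ q (α j) (b j)) q :=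
    fun b => (HasFDerivAt.finsetProd (u := Finset.univ) fun i _ =>
      (hJd (α i) (b i)).hasFDerivAt).differentiableAt
  have A1 : pd (a 0) (fun q => T q α) q = ∑ b, ((∑ j, dJ (a 0) (α j) (b j) * Pe j b) * T' (Ψ q) b
      + P b * ∑ m, J (a 0) m * D m b) := by
    have hs := pd_sum Finset.univ (F := fun b q => (∏ j, jac Ψ q (α j) (b j)) * T' (Ψ q) b)
      (fun b _ => (hprodd b).mul (hT'd b)) (a 0)
    rw [pd_congr hS hq (fun q hq => hT q hq α), hs]
    refine Finset.sum_congr rfl fun b _ => ?_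
    rw [pd_mul (hprodd b) (hT'd b), pd_comp (hT' q hq b) hΨd,
      pd_prod _ fun i _ => hJd (α i) (b i)]
  have A2 : ∀ j e, T q (Function.update α j e) = ∑ b, J e (b j) * Pe j b * T' (Ψ q) b := by
    intro j e
    rw [hT q hq]
    refine Finset.sum_congr rfl fun b _ => ?_
    rw [← Finset.mul_prod_erase _ _ (Finset.mem_univ j), Function.update_self]
    congr 2
    exact Finset.prod_congr rfl fun i hi => by
      rw [Function.update_of_ne (Finset.ne_of_mem_erase hi)]
  have A3 : ∀ j, ∑ e, christoffel g c q e (a 0) (α j) * T q (Function.update α j e) =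
      ∑ b, (dJ (a 0) (α j) (b j) + ∑ m, ∑ l, J (a 0) m * J (α j) l * Γ' (b j) m l) * Pe j b *
        T' (Ψ q) b := by
    intro j
    simp only [A2, Finset.mul_sum]
    rw [Finset.sum_comm]
    refine Finset.sum_congr rfl fun b _ => ?_
    rw [← hΓ q hq, Finset.sum_mul, Finset.sum_mul]
    exact Finset.sum_congr rfl fun e _ => by ring
  -- `Pe j` is the product of Jacobian factors without slot j. Relabelling the index in that slot
  -- restores the full product and moves the change of index into T', as in the covariant derivative
  -- of T'.
  have A4 : ∀ j m, ∑ b, ∑ l, J (α j) l * Γ' (b j) m l * Pe j b * T' (Ψ q) b =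
      ∑ b, ∑ e, P b * (Γ' e m (b j) * T' (Ψ q) (Function.update b j e)) := by
    intro j m
    rw [sum_update_comm j]
    refine Finset.sum_congr rfl fun b _ => Finset.sum_congr rfl fun e _ => ?_
    rw [hPeu, hPPe j b, Function.update_self]
    ring
  have L : covDeriv g c T q a = (∑ b, P b * ∑ m, J (a 0) m * D m b) -
      ∑ j, ∑ m, J (a 0) m * ∑ b, ∑ l, J (α j) l * Γ' (b j) m l * Pe j b * T' (Ψ q) b := by
    have e1 : ∀ j, ∑ b, (∑ m, ∑ l, J (a 0) m * J (α j) l * Γ' (b j) m l) * Pe j b * T' (Ψ q) b =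
        ∑ m, J (a 0) m * ∑ b, ∑ l, J (α j) l * Γ' (b j) m l * Pe j b * T' (Ψ q) b := by
      intro j
      simp only [Finset.sum_mul, Finset.mul_sum]
      rw [Finset.sum_comm]
      exact Finset.sum_congr rfl fun m _ => Finset.sum_congr rfl fun b _ =>
        Finset.sum_congr rfl fun l _ => by ring
    have e2 : ∑ b, (∑ j, dJ (a 0) (α j) (b j) * Pe j b) * T' (Ψ q) b =
        ∑ j, ∑ b, dJ (a 0) (α j) (b j) * Pe j b * T' (Ψ q) b := by
      simp only [Finset.sum_mul]
      exact Finset.sum_comm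
    have e3 : covDeriv g c T q a = pd (a 0) (fun q => T q α) q - ∑ j, ∑ e,
      christoffel g c q e (a 0) (α j) * T q (Function.update α j e) := rfl
    rw [e3, A1]
    simp only [A3, add_mul, Finset.sum_add_distrib, e1, e2]
    ring
  rw [L, sum_fin_succ_fun]
  simp only [Fin.prod_univ_succ, Fin.cons_zero, Fin.cons_succ, covDeriv, Fin.tail_cons, mul_sub,
    Finset.sum_sub_distrib]
  congr 1
  · simp only [Finset.mul_sum]
    rw [Finset.sum_comm]
    exact Finset.sum_congr rfl fun m _ => Finset.sum_congr rfl fun b _ => by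
      simp only [hP, hD, hα, Fin.tail]; ring
  · simp only [A4]
    rw [Finset.sum_comm]
    refine Finset.sum_congr rfl fun m _ => ?_
    simp only [Finset.mul_sum]
    rw [Finset.sum_comm]
    exact Finset.sum_congr rfl fun b _ => Finset.sum_congr rfl fun j _ =>
      Finset.sum_congr rfl fun e _ => by
        simp only [hP, hα, Fin.tail]; ring

theorem sum_comm_pair {α β γ δ M : Type*} [Fintype α] [Fintype β] [Fintype γ] [Fintype δ]
    [AddCommMonoid M] (f : α → β → γ → δ → M) :
    ∑ a, ∑ b, ∑ c, ∑ e, f a b c e = ∑ c, ∑ e, ∑ a, ∑ b, f a b c e := by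
  calc _ = ∑ p : α × β, ∑ r : γ × δ, f p.1 p.2 r.1 r.2 := by simp only [Fintype.sum_prod_type]
    _ = ∑ r : γ × δ, ∑ p : α × β, f p.1 p.2 r.1 r.2 := Finset.sum_comm
    _ = _ := by simp only [Fintype.sum_prod_type]

/-- Invariance of the norm: slot by slot the contraction is JᵀGJ = G', and a product of sums over
slots expands into a sum over multi-indices. -/
theorem prod_matrix_contract {κ : Type*} [Fintype κ] {k : ℕ} {J G G' : Matrix κ κ ℝ}
    (hinv : J.transpose * G * J = G') (T' : (Fin k → κ) → ℝ) :
    ∑ a : Fin k → κ, ∑ b : Fin k → κ, (∏ j, G (a j) (b j)) *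
        (∑ a', (∏ j, J (a j) (a' j)) * T' a') * (∑ b', (∏ j, J (b j) (b' j)) * T' b') =
      ∑ a' : Fin k → κ, ∑ b' : Fin k → κ, (∏ j, G' (a' j) (b' j)) * T' a' * T' b' := by
  have h1 : ∀ a' b' : Fin k → κ, ∏ j, G' (a' j) (b' j) = ∑ a : Fin k → κ, ∑ b : Fin k → κ,
      (∏ j, G (a j) (b j)) * (∏ j, J (a j) (a' j)) * ∏ j, J (b j) (b' j) := by
    intro a' b'
    have h2 : ∀ x y, G' x y = ∑ p : κ × κ, G p.1 p.2 * J p.1 x * J p.2 y := by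
      intro x y
      rw [← hinv, Fintype.sum_prod_type]
      simp only [Matrix.mul_apply, Matrix.transpose_apply, Finset.sum_mul]
      rw [Finset.sum_comm]
      exact Finset.sum_congr rfl fun _ _ => Finset.sum_congr rfl fun _ _ => by ring
    classical
    simp only [h2]
    rw [Finset.prod_univ_sum, Fintype.piFinset_univ, ← Fintype.sum_prod_type',
      ← (Equiv.arrowProdEquivProdArrow (Fin k) (fun _ => κ) (fun _ => κ)).sum_comp]
    refine Finset.sum_congr rfl fun p _ => ?_
    simp only [Finset.prod_mul_distrib]
    rfl
  simp only [h1, Finset.sum_mul, Finset.mul_sum]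
  refine Eq.trans ?_ (sum_comm_pair fun (a b a' b' : Fin k → κ) => (∏ j, G (a j) (b j)) *
    (∏ j, J (a j) (a' j)) * (∏ j, J (b j) (b' j)) * T' a' * T' b')
  refine Finset.sum_congr rfl fun a _ => Finset.sum_congr rfl fun b _ => ?_
  rw [Finset.sum_comm]
  exact Finset.sum_congr rfl fun _ _ => Finset.sum_congr rfl fun _ _ => by ring

end Covariance

/-! ### Transition between charts: tensors, metrics and norms. -/

section ChartChange

variable {n d : ℕ} {K : Type*} [TopologicalSpace K] [ChartedSpace (EuclideanSpace ℝ (Fin d)) K]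

/-- The overlap of two charts, in the coordinates of the first one. -/
def overlap (n : ℕ) (c c' : K) : Set (Coord n d) :=
  univ ×ˢ (chartDom c ∩ (extChartAt 𝓘(ℝ, EuclideanSpace ℝ (Fin d)) c).symm ⁻¹'
    (extChartAt 𝓘(ℝ, EuclideanSpace ℝ (Fin d)) c').source)

/-- The change of coordinates between two charts. -/
def chartTrans (c c' : K) (q : Coord n d) : Coord n d :=
  (q.1, extChartAt 𝓘(ℝ, EuclideanSpace ℝ (Fin d)) c'
    ((extChartAt 𝓘(ℝ, EuclideanSpace ℝ (Fin d)) c).symm q.2))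

theorem isOpen_overlap (c c' : K) : IsOpen (overlap (d := d) n c c') :=
  isOpen_univ.prod ((continuousOn_extChartAt_symm c).isOpen_inter_preimage (isOpen_chartDom c)
    (isOpen_extChartAt_source c'))

theorem overlap_subset (c c' : K) : overlap (d := d) n c c' ⊆ prodDom n c := fun _ hq =>
  ⟨trivial, hq.2.1⟩

theorem chartTrans_mem {c c' : K} {q : Coord n d} (hq : q ∈ overlap n c c') :
    chartTrans c c' q ∈ prodDom n c' :=
  ⟨trivial, (extChartAt 𝓘(ℝ, EuclideanSpace ℝ (Fin d)) c').map_source hq.2.2⟩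

theorem chartPt_chartTrans {c c' : K} {q : Coord n d} (hq : q ∈ overlap n c c') :
    chartPt c' (chartTrans c c' q) = chartPt c q := by
  refine Prod.ext rfl ?_
  exact (extChartAt 𝓘(ℝ, EuclideanSpace ℝ (Fin d)) c').left_inv hq.2.2

/-- The value of a tensor field, as a bilinear form on the model space. -/
def TensorField.eval (u : TensorField n d K) (z : Mink n × K) :
    (Mink n × EuclideanSpace ℝ (Fin d)) →L[ℝ] (Mink n × EuclideanSpace ℝ (Fin d)) →L[ℝ] ℝ := u z

/-- The coordinate frame, as vectors of the model space. -/
def frameVec (c : K) (q : Coord n d) (a : Idx n d) : Mink n × EuclideanSpace ℝ (Fin d) :=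
  frame c q a

theorem comp_eq_eval (u : TensorField n d K) (c : K) (q : Coord n d) (a : Fin 2 → Idx n d) :
    u.comp c q a = u.eval (chartPt c q) (frameVec c q (a 0)) (frameVec c q (a 1)) := rfl

variable [IsManifold 𝓘(ℝ, EuclideanSpace ℝ (Fin d)) ∞ K]

theorem contDiffOn_chartTrans (c c' : K) :
    ContDiffOn ℝ ∞ (chartTrans (n := n) (d := d) c c') (overlap n c c') := by
  refine contDiffOn_fst.prodMk ?_
  have h := contDiffOn_ext_coord_change (𝕜 := ℝ) (n := ∞)
    (I := 𝓘(ℝ, EuclideanSpace ℝ (Fin d))) c' c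
  refine h.comp contDiffOn_snd fun q hq => ?_
  rw [PartialEquiv.trans_source, PartialEquiv.symm_source]
  exact hq.2

/-- The chain rule for one inverse chart written as the other one composed with the transition map.
-/
theorem frame_chartTrans {c c' : K} {q : Coord n d} (hq : q ∈ overlap n c c') (a : Idx n d) :
    (frame c q a : Mink n × EuclideanSpace ℝ (Fin d)) =
      ∑ b, jac (chartTrans c c') q a b •
        (frame c' (chartTrans c c' q) b : Mink n × EuclideanSpace ℝ (Fin d)) := by
  have hS := (isOpen_overlap (n := n) c c').mem_nhds hq
  have hΨ : HasMFDerivAt 𝓘(ℝ, Coord n d) 𝓘(ℝ, Coord n d) (chartTrans (n := n) c c') q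
      (fderiv ℝ (chartTrans c c') q) :=
    (((contDiffOn_chartTrans c c').contDiffAt hS).differentiableAt
      (by simp)).hasFDerivAt.hasMFDerivAt
  have h1 : MDifferentiableAt 𝓘(ℝ, Coord n d) (model n d) (chartPt (n := n) (d := d) c')
      (chartTrans c c' q) :=
    ((contMDiffOn_chartPt c').contMDiffAt
      ((isOpen_prodDom c').mem_nhds (chartTrans_mem hq))).mdifferentiableAt (by simp)
  have h2 := h1.hasMFDerivAt.comp q hΨ
  have h3 : chartPt (n := n) (d := d) c =ᶠ[nhds q] chartPt c' ∘ chartTrans c c' :=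
    Filter.eventuallyEq_of_mem hS fun x hx => (chartPt_chartTrans hx).symm
  have h4 := (h2.congr_of_eventuallyEq h3).mfderiv
  rw [frame_eq_mfderiv (overlap_subset c c' hq), h4]
  have h5 : ∀ L : Coord n d →L[ℝ] (Mink n × EuclideanSpace ℝ (Fin d)),
      L (fderiv ℝ (chartTrans c c') q (basisVec a)) =
        ∑ b, jac (chartTrans c c') q a b • L (basisVec b) := fun L => map_eq_sum_coordFun L _
  refine (h5 (mfderiv 𝓘(ℝ, Coord n d) (model n d) (chartPt (n := n) (d := d) c')
      (chartTrans c c' q))).trans (Finset.sum_congr rfl fun b _ => ?_)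
  rw [frame_eq_mfderiv (chartTrans_mem hq)]
  rfl

theorem sum_fin_two_fun {ι M : Type*} [Fintype ι] [AddCommMonoid M] (F : (Fin 2 → ι) → M) :
    ∑ b, F b = ∑ x, ∑ y, F ![x, y] := by
  rw [sum_fin_succ_fun]
  refine Finset.sum_congr rfl fun x _ => ?_
  rw [sum_fin_succ_fun]
  refine Finset.sum_congr rfl fun y _ => ?_
  rw [Fintype.sum_unique]
  congr 1

theorem isPullback_comp (u : TensorField n d K) (c c' : K) :
    IsPullback (chartTrans c c') (overlap n c c') (u.comp c) (u.comp c') := by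
  intro q hq a
  have hf : ∀ a, frameVec c q a = ∑ b, jac (chartTrans c c') q a b •
      frameVec c' (chartTrans c c' q) b := frame_chartTrans hq
  rw [comp_eq_eval, hf, hf, sum_fin_two_fun, ← chartPt_chartTrans hq]
  simp only [comp_eq_eval, map_sum, map_smul, _root_.sum_apply, _root_.smul_apply, smul_eq_mul,
    Fin.prod_univ_two]
  rw [Finset.sum_comm]
  refine Finset.sum_congr rfl fun x _ => ?_
  rw [Finset.mul_sum]
  refine Finset.sum_congr rfl fun y _ => ?_
  simp only [Matrix.cons_val_zero, Matrix.cons_val_one]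
  ring

/-- The metric of `K`, as a bilinear form on the model space. -/
def innerForm (g : RMetric d K) (w : K) :
    EuclideanSpace ℝ (Fin d) →L[ℝ] EuclideanSpace ℝ (Fin d) →L[ℝ] ℝ := g.inner w

/-- The block-diagonal bilinear form with constant Minkowski block `M` and internal block the
metric. -/
def blockField (M : Matrix (Fin (n + 1)) (Fin (n + 1)) ℝ) (g : RMetric d K) :
    TensorField n d K := fun z =>
  ((∑ i, ∑ j, M i j • (EuclideanSpace.proj i : Mink n →L[ℝ] ℝ).smulRight
      (EuclideanSpace.proj j : Mink n →L[ℝ] ℝ)).bilinearComp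
        (ContinuousLinearMap.fst ℝ (Mink n) (EuclideanSpace ℝ (Fin d)))
        (ContinuousLinearMap.fst ℝ (Mink n) (EuclideanSpace ℝ (Fin d))) +
    (innerForm g z.2).bilinearComp
      (ContinuousLinearMap.snd ℝ (Mink n) (EuclideanSpace ℝ (Fin d)))
      (ContinuousLinearMap.snd ℝ (Mink n) (EuclideanSpace ℝ (Fin d))) :
    (Mink n × EuclideanSpace ℝ (Fin d)) →L[ℝ] (Mink n × EuclideanSpace ℝ (Fin d)) →L[ℝ] ℝ)

theorem eval_blockField (M : Matrix (Fin (n + 1)) (Fin (n + 1)) ℝ) (g : RMetric d K)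
    (z : Mink n × K) (v w : Mink n × EuclideanSpace ℝ (Fin d)) :
    (blockField M g).eval z v w =
      (∑ i, ∑ j, M i j * (v.1 i * w.1 j)) + innerForm g z.2 v.2 w.2 := by
  simp [TensorField.eval, blockField]

theorem comp_blockField (M : Matrix (Fin (n + 1)) (Fin (n + 1)) ℝ) (g : RMetric d K) (c : K)
    (q : Coord n d) (a b : Idx n d) :
    (blockField M g).comp c q ![a, b] = Matrix.fromBlocks M 0 0 (gram g c q.2) a b := by
  have hl : ∀ i, frameVec c q (Sum.inl i) =
      ((coordVec i, 0) : Mink n × EuclideanSpace ℝ (Fin d)) := fun i => rfl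
  have hr : ∀ A, frameVec c q (Sum.inr A) =
      ((0, intVec c q.2 A) : Mink n × EuclideanSpace ℝ (Fin d)) := fun i => rfl
  rw [comp_eq_eval, eval_blockField]
  rcases a with i | A <;> rcases b with j | B
  · simp [hl, coordVec]
  · simp [hl, hr]
    rfl
  · simp [hl, hr]
  · simp only [hr, Matrix.cons_val_zero, Matrix.cons_val_one, PiLp.zero_apply, mul_zero,
      Finset.sum_const_zero, zero_add, Matrix.fromBlocks_apply₂₂]
    rfl

/-- The block matrix collects the components of a genuine tensor field, so the law for components
applies. It is used with the identity block for g_E and with η for the product metric. -/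
theorem fromBlocks_chartTrans (M : Matrix (Fin (n + 1)) (Fin (n + 1)) ℝ) (g : RMetric d K)
    {c c' : K} {q : Coord n d} (hq : q ∈ overlap n c c') :
    Matrix.fromBlocks M 0 0 (gram g c q.2) = jac (chartTrans c c') q *
      Matrix.fromBlocks M 0 0 (gram g c' (chartTrans c c' q).2) *
        (jac (chartTrans c c') q).transpose := by
  ext a b
  have h1 := isPullback_comp (blockField M g) c c' q hq ![a, b]
  rw [sum_fin_two_fun] at h1
  simp only [comp_blockField, Fin.prod_univ_two, Matrix.cons_val_zero, Matrix.cons_val_one] at h1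
  rw [h1]
  simp only [Matrix.mul_apply, Matrix.transpose_apply, Finset.sum_mul]
  rw [Finset.sum_comm]
  exact Finset.sum_congr rfl fun x _ => Finset.sum_congr rfl fun y _ => by ring

theorem transpose_mul_inv_mul {κ : Type*} [Fintype κ] [DecidableEq κ] {J G G' : Matrix κ κ ℝ}
    (h : G = J * G' * J.transpose) (hdet : G.det ≠ 0) : J.transpose * G⁻¹ * J = G'⁻¹ := by
  have h1 : G.det = J.det * G'.det * J.det := by
    rw [h, Matrix.det_mul, Matrix.det_mul, Matrix.det_transpose]
  have hJ : IsUnit J.det := isUnit_iff_ne_zero.mpr fun h0 => hdet (by rw [h1, h0]; ring)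
  have hJt : IsUnit J.transpose.det := by rwa [Matrix.det_transpose]
  rw [h, Matrix.mul_inv_rev, Matrix.mul_inv_rev]
  calc _ = (J.transpose * J.transpose⁻¹) * G'⁻¹ * (J⁻¹ * J) := by simp only [Matrix.mul_assoc]
    _ = _ := by rw [Matrix.mul_nonsing_inv _ hJt, Matrix.nonsing_inv_mul _ hJ, Matrix.one_mul,
        Matrix.mul_one]

theorem det_eta_ne (n : ℕ) : (eta n).det ≠ 0 := by
  rw [eta, Matrix.det_diagonal, Finset.prod_ne_zero_iff]
  intro i _
  split_ifs <;> norm_num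

/-- The Minkowski block of the Riemannian metric `g_E`. -/
theorem euclMetric_eq (g : RMetric d K) (c : K) (q : Coord n d) :
    euclMetric g c q = Matrix.fromBlocks 1 0 0 (gram g c q.2) := by
  ext a b
  rcases a with i | A <;> rcases b with j | B
  · by_cases hij : i = j
    · subst hij
      by_cases hi : i = 0
      · subst hi; simp [euclMetric, prodMetric, eta]; norm_num
      · simp [euclMetric, prodMetric, eta, hi, Ne.symm hi]
    · have : ¬(0 = i ∧ 0 = j) := fun h => hij (h.1.symm.trans h.2)
      simp [euclMetric, prodMetric, eta, Matrix.diagonal_apply_ne _ hij,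
        Matrix.one_apply_ne hij, this]
  all_goals simp [euclMetric, prodMetric]

theorem det_fromBlocks_gram_ne {M : Matrix (Fin (n + 1)) (Fin (n + 1)) ℝ} (hM : M.det ≠ 0)
    (g : RMetric d K) {c : K} {y : Euc d} (hy : y ∈ chartDom c) :
    (Matrix.fromBlocks M 0 0 (gram g c y)).det ≠ 0 := by
  rw [Matrix.det_fromBlocks_zero₂₁]
  exact mul_ne_zero hM (posDef_gram g hy).det_pos.ne'

theorem normSqE_chartTrans (g : RMetric d K) {c c' : K} {q : Coord n d} (hq : q ∈ overlap n c c')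
    {k : ℕ} {T T' : Comp n d k} (hT : IsPullback (chartTrans c c') (overlap n c c') T T') :
    normSqE g c q (T q) = normSqE g c' (chartTrans c c' q) (T' (chartTrans c c' q)) := by
  have h1 := fromBlocks_chartTrans (n := n) 1 g hq
  have h2 := transpose_mul_inv_mul h1 (det_fromBlocks_gram_ne (by simp) g hq.2.1)
  simp only [normSqE, euclMetric_eq, hT q hq]
  exact prod_matrix_contract h2 _

end ChartChange

/-! ### The operators in the energy do not depend on the chart. -/

section OperatorCovariance

variable {n d : ℕ} {K : Type*} [TopologicalSpace K] [ChartedSpace (EuclideanSpace ℝ (Fin d)) K]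

/-- The components of a tensor field are of class `C^m` in the chart centred at `c`. -/
def IsSmoothComp (c : K) (m : WithTop ℕ∞) {k : ℕ} (T : Comp n d k) : Prop :=
  ∀ a, ContDiffOn ℝ m (fun q => T q a) (prodDom n c)

theorem IsSmoothComp.of_le {c : K} {m m' : WithTop ℕ∞} {k : ℕ} {T : Comp n d k}
    (h : IsSmoothComp c m T) (hm : m' ≤ m) : IsSmoothComp c m' T := fun a => (h a).of_le hm

theorem IsSmoothComp.differentiableAt {c : K} {m : WithTop ℕ∞} {k : ℕ} {T : Comp n d k}
    (h : IsSmoothComp c m T) (hm : m ≠ 0) (a : Fin k → Idx n d) {q : Coord n d}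
    (hq : q ∈ prodDom n c) : DifferentiableAt ℝ (fun q => T q a) q :=
  ((h a).contDiffAt ((isOpen_prodDom c).mem_nhds hq)).differentiableAt hm

theorem contDiffOn_pd {S : Set (Coord n d)} (hS : IsOpen S) {F : Coord n d → ℝ}
    {m m' : WithTop ℕ∞} (hF : ContDiffOn ℝ m F S) (hm : m' + 1 ≤ m) (a : Idx n d) :
    ContDiffOn ℝ m' (pd a F) S :=
  (hF.fderiv_of_isOpen hS hm).clm_apply contDiffOn_const

theorem fderiv_slice_fst {F : Coord n d → ℝ} {q : Coord n d} (hF : DifferentiableAt ℝ F q)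
    (v : Mink n) : fderiv ℝ (fun p => F (p, q.2)) q.1 v = fderiv ℝ F q (v, 0) := by
  have h1 : HasFDerivAt (fun p : Mink n => ((p, q.2) : Coord n d))
      ((ContinuousLinearMap.id ℝ (Mink n)).prod 0) q.1 :=
    (hasFDerivAt_id q.1).prodMk (hasFDerivAt_const q.2 q.1)
  have h2 : HasFDerivAt (fun p => F (p, q.2)) _ q.1 := hF.hasFDerivAt.comp q.1 h1
  rw [h2.fderiv]
  rfl

theorem fderiv_slice_snd {F : Coord n d → ℝ} {q : Coord n d} (hF : DifferentiableAt ℝ F q)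
    (v : EuclideanSpace ℝ (Fin d)) :
    fderiv ℝ (fun y => F (q.1, y)) q.2 v = fderiv ℝ F q (0, v) := by
  have h1 : HasFDerivAt (fun y : EuclideanSpace ℝ (Fin d) => ((q.1, y) : Coord n d))
      ((0 : EuclideanSpace ℝ (Fin d) →L[ℝ] Mink n).prod (ContinuousLinearMap.id ℝ _)) q.2 :=
    (hasFDerivAt_const q.1 q.2).prodMk (hasFDerivAt_id q.2)
  have h2 : HasFDerivAt (fun y => F (q.1, y)) _ q.2 := hF.hasFDerivAt.comp q.2 h1
  rw [h2.fderiv]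
  rfl

theorem alongMink_eq {k : ℕ} {T : Comp n d k} {a : Fin k → Idx n d} {q : Coord n d}
    (hT : DifferentiableAt ℝ (fun q => T q a) q) (V : Mink n → Mink n) :
    alongMink V T q a = fderiv ℝ (fun q => T q a) q (V q.1, 0) :=
  fderiv_slice_fst hT (V q.1)

theorem IsSmoothComp.alongMink {c : K} {m m' : WithTop ℕ∞} {k : ℕ} {T : Comp n d k}
    (hT : IsSmoothComp c m T) (hm : m' + 1 ≤ m) {V : Mink n → Mink n} (hV : ContDiff ℝ m' V) :
    IsSmoothComp c m' (alongMink V T) := by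
  intro a
  have h1 : ContDiffOn ℝ m' (fun q => fderiv ℝ (fun q => T q a) q ((V q.1, 0) : Coord n d))
      (prodDom n c) :=
    ((hT a).fderiv_of_isOpen (isOpen_prodDom c) hm).clm_apply
      (((hV.comp contDiff_fst).prodMk contDiff_const).contDiffOn)
  refine h1.congr fun q hq => alongMink_eq (hT.differentiableAt ?_ a hq) V
  rintro rfl
  simp at hm

theorem contDiff_genField {m : WithTop ℕ∞} (i : GenIndex n) :
    ContDiff ℝ m (genField i : Mink n → Mink n) := by
  have hc : ∀ k, ContDiff ℝ m fun p : Mink n => p k := fun k =>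
    (EuclideanSpace.proj (𝕜 := ℝ) k).contDiff
  rcases i with i | ij
  · exact contDiff_const
  · exact ((ContDiff.sum fun k _ => contDiff_const.mul (hc k)).smul contDiff_const).sub
      ((ContDiff.sum fun k _ => contDiff_const.mul (hc k)).smul contDiff_const)

theorem isSmoothComp_foldl {c : K} {k : ℕ} (l : List (GenIndex n)) {m : ℕ} {T : Comp n d k}
    (hT : IsSmoothComp c ((m + l.length : ℕ) : WithTop ℕ∞) T) :
    IsSmoothComp c (m : WithTop ℕ∞) (l.foldl (fun S i => alongMink (genField i) S) T) := by
  induction l generalizing T with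
  | nil => simpa using hT
  | cons i l ih =>
    rw [List.foldl_cons]
    refine ih (hT.alongMink ?_ (contDiff_genField i))
    norm_cast

theorem IsSmoothComp.genPow {c : K} {k m r : ℕ} {T : Comp n d k} (I : Fin r → GenIndex n)
    (hT : IsSmoothComp c ((m + r : ℕ) : WithTop ℕ∞) T) :
    IsSmoothComp c (m : WithTop ℕ∞) (genPow I T) :=
  isSmoothComp_foldl _ (by simpa using hT)

theorem genPow_snoc {k r : ℕ} (I : Fin r → GenIndex n) (i : GenIndex n) (T : Comp n d k) :
    genPow (Fin.snoc I i : Fin (r + 1) → GenIndex n) T = alongMink (genField i) (genPow I T) := by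
  simp only [genPow]
  rw [List.ofFn_succ', List.concat_eq_append, List.foldl_append]
  simp

/-- The transition map is the identity in Minkowski space and acts on the internal coordinates
alone, so it commutes with Minkowski translations. -/
theorem jac_chartTrans_const (c c' : K) (p p' : Mink n) (y : Euc d) :
    jac (chartTrans c c') (p, y) = jac (chartTrans c c') (p', y) := by
  have h1 : fderiv ℝ (chartTrans (n := n) (d := d) c c') (p, y) =
      fderiv ℝ (chartTrans c c') (p', y) := by
    have h2 : ∀ q : Coord n d, chartTrans c c' q =
        chartTrans c c' (q + ((p' - p, 0) : Coord n d)) + ((p - p', 0) : Coord n d) := by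
      intro q
      refine Prod.ext ?_ ?_
      · simp only [chartTrans, Prod.fst_add]
        abel
      · simp [chartTrans]
    have h3 : chartTrans (n := n) (d := d) c c' = fun q =>
        chartTrans c c' (q + ((p' - p, 0) : Coord n d)) + ((p - p', 0) : Coord n d) := funext h2
    conv_lhs => rw [h3]
    rw [fderiv_add_const, fderiv_comp_add_right]
    simp
  ext a b
  simp [jac, h1]

/-- Differentiation in Minkowski directions sees the Jacobian factors as constants, so no connection
terms arise. -/
theorem isPullback_alongMink {c c' : K} {k : ℕ} {T T' : Comp n d k}
    (hT : IsPullback (chartTrans c c') (overlap n c c') T T') {m : WithTop ℕ∞}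
    (hT' : IsSmoothComp c' m T') (hm : m ≠ 0) (V : Mink n → Mink n) :
    IsPullback (chartTrans c c') (overlap n c c') (alongMink V T) (alongMink V T') := by
  intro q hq a
  have h1 : ∀ p, T (p, q.2) a = ∑ b, (∏ j, jac (chartTrans c c') q (a j) (b j)) *
      T' (p, (chartTrans c c' q).2) b := by
    intro p
    have hp : ((p, q.2) : Coord n d) ∈ overlap n c c' := ⟨trivial, hq.2⟩
    rw [hT _ hp]
    rw [jac_chartTrans_const c c' p q.1 q.2]
    rfl
  have h2 : ∀ b, DifferentiableAt ℝ (fun p => T' (p, (chartTrans c c' q).2) b) q.1 := fun b =>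
    DifferentiableAt.comp (g := fun q => T' q b)
      (f := fun p => ((p, (chartTrans c c' q).2) : Coord n d)) q.1
      (hT'.differentiableAt hm b (chartTrans_mem hq))
      (differentiableAt_id.prodMk (differentiableAt_const _))
  simp only [HypSobolev.alongMink, h1]
  rw [fderiv_fun_sum fun b _ => (h2 b).const_mul _, _root_.sum_apply]
  refine Finset.sum_congr rfl fun b _ => ?_
  rw [fderiv_const_mul (h2 b), _root_.smul_apply, smul_eq_mul]
  rfl

theorem isPullback_foldl {c c' : K} {k : ℕ} (l : List (GenIndex n)) {T T' : Comp n d k}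
    (hT : IsPullback (chartTrans c c') (overlap n c c') T T')
    (hT' : IsSmoothComp c' ((l.length : ℕ) : WithTop ℕ∞) T') :
    IsPullback (chartTrans c c') (overlap n c c')
      (l.foldl (fun S i => alongMink (genField i) S) T)
      (l.foldl (fun S i => alongMink (genField i) S) T') := by
  induction l generalizing T T' with
  | nil => exact hT
  | cons i l ih =>
    rw [List.foldl_cons, List.foldl_cons]
    refine ih (isPullback_alongMink hT hT' (by simp) _) ?_
    exact hT'.alongMink (by simp) (contDiff_genField i)

theorem isPullback_genPow {c c' : K} {k r : ℕ} {T T' : Comp n d k}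
    (hT : IsPullback (chartTrans c c') (overlap n c c') T T') (I : Fin r → GenIndex n)
    (hT' : IsSmoothComp c' (r : WithTop ℕ∞) T') :
    IsPullback (chartTrans c c') (overlap n c c') (genPow I T) (genPow I T') :=
  isPullback_foldl _ hT (by simpa using hT')

variable [IsManifold 𝓘(ℝ, EuclideanSpace ℝ (Fin d)) ∞ K]

theorem contDiffOn_prodMetric (g : RMetric d K) (c : K) (a b : Idx n d) :
    ContDiffOn ℝ ∞ (fun q => prodMetric (n := n) g c q a b) (prodDom n c) := by
  rcases a with i | A <;> rcases b with j | B
  · exact contDiffOn_const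
  · exact contDiffOn_const
  · exact contDiffOn_const
  · exact (contDiffOn_gram g c A B).comp contDiffOn_snd fun q hq => hq.2

theorem det_prodMetric_ne (g : RMetric d K) {c : K} {q : Coord n d} (hq : q ∈ prodDom n c) :
    (prodMetric g c q).det ≠ 0 :=
  det_fromBlocks_gram_ne (det_eta_ne n) g hq.2

theorem contDiffOn_christoffel (g : RMetric d K) (c : K) (e a b : Idx n d) :
    ContDiffOn ℝ ∞ (fun q => christoffel g c q e a b) (prodDom n c) := by
  have h1 : ∀ x a b, ContDiffOn ℝ ∞ (pd x fun q => prodMetric (n := n) g c q a b)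
      (prodDom n c) := fun x a b =>
    contDiffOn_pd (isOpen_prodDom c) (contDiffOn_prodMetric g c a b) (by simp) x
  exact contDiffOn_const.mul (ContDiffOn.sum fun h _ =>
    (contDiffOn_matrix_inv (contDiffOn_prodMetric g c) (fun q hq => det_prodMetric_ne g hq) e
      h).mul (((h1 _ _ _).add (h1 _ _ _)).sub (h1 _ _ _)))

theorem IsSmoothComp.covDeriv {g : RMetric d K} {c : K} {m m' : ℕ} {k : ℕ} {T : Comp n d k}
    (hT : IsSmoothComp c (m : WithTop ℕ∞) T) (hm : m' + 1 ≤ m) :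
    IsSmoothComp c (m' : WithTop ℕ∞) (covDeriv g c T) := by
  intro a
  have hmm : (m' : WithTop ℕ∞) ≤ m := by exact_mod_cast (Nat.le_succ m').trans hm
  refine (contDiffOn_pd (isOpen_prodDom c) (hT _) (by exact_mod_cast hm) (a 0)).sub
    (ContDiffOn.sum fun j _ => ContDiffOn.sum fun e _ => ContDiffOn.mul ?_ ((hT _).of_le hmm))
  exact (contDiffOn_christoffel g c e _ _).of_le (by exact_mod_cast le_top)

theorem IsSmoothComp.intLaplacian {g : RMetric d K} {c : K} {m m' : ℕ} {T : Comp n d 2}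
    (hT : IsSmoothComp c (m : WithTop ℕ∞) T) (hm : m' + 2 ≤ m) :
    IsSmoothComp c (m' : WithTop ℕ∞) (intLaplacian g c T) := by
  intro a
  have h1 : IsSmoothComp c (m' : WithTop ℕ∞) (HypSobolev.covDeriv g c (HypSobolev.covDeriv g c T)) :=
    (hT.covDeriv (m' := m' + 1) hm).covDeriv le_rfl
  refine ContDiffOn.sum fun A _ => ContDiffOn.sum fun B _ => ContDiffOn.mul ?_ (h1 _)
  have h2 := contDiffOn_matrix_inv (contDiffOn_gram g c) (fun y hy => (posDef_gram g
    hy).det_pos.ne') A B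
  exact (h2.of_le (by exact_mod_cast le_top)).comp contDiffOn_snd fun q hq => hq.2

theorem IsSmoothComp.intLaplacian_iterate {g : RMetric d K} {c : K} {m : ℕ} (j : ℕ)
    {T : Comp n d 2} (hT : IsSmoothComp c ((m + 2 * j : ℕ) : WithTop ℕ∞) T) :
    IsSmoothComp c (m : WithTop ℕ∞) ((HypSobolev.intLaplacian g c)^[j] T) := by
  induction j generalizing T with
  | zero => simpa using hT
  | succ j ih =>
    rw [Function.iterate_succ_apply]
    exact ih (hT.intLaplacian (by omega))

theorem sum_christoffel_chartTrans (g : RMetric d K) (c c' : K) {q : Coord n d}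
    (hq : q ∈ overlap n c c') (a b e' : Idx n d) :
    ∑ e, christoffel g c q e a b * jac (chartTrans c c') q e e' =
      pd a (fun q => jac (chartTrans c c') q b e') q + ∑ k, ∑ l, jac (chartTrans c c') q a k *
        jac (chartTrans c c') q b l * christoffel g c' (chartTrans c c' q) e' k l := by
  have hS := isOpen_overlap (n := n) (d := d) c c'
  have hΨ := contDiffOn_chartTrans (n := n) (d := d) c c'
  have hq' := chartTrans_mem hq
  have hΨd : DifferentiableAt ℝ (chartTrans (n := n) c c') q :=
    (hΨ.contDiffAt (hS.mem_nhds hq)).differentiableAt (by simp)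
  have hJd : ∀ a b, DifferentiableAt ℝ (fun q => jac (chartTrans (n := n) c c') q a b) q :=
    fun a b => ((contDiffOn_jac hS hΨ a b).contDiffAt (hS.mem_nhds hq)).differentiableAt (by simp)
  have hGd : ∀ m l, DifferentiableAt ℝ (fun q => prodMetric (n := n) g c' q m l)
      (chartTrans c c' q) := fun m l => ((contDiffOn_prodMetric g c' m l).contDiffAt
        ((isOpen_prodDom c').mem_nhds hq')).differentiableAt (by simp)
  have hGΨ : ∀ m l, DifferentiableAt ℝ (fun q => prodMetric (n := n) g c' (chartTrans c c' q) m l)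
      q := fun m l => (hGd m l).comp q hΨd
  refine sum_christoffel_mul_jac (G := prodMetric g c q)
    (G' := prodMetric g c' (chartTrans c c' q)) (J := jac (chartTrans c c') q)
    (dG := fun x a b => pd x (fun q => prodMetric g c q a b) q)
    (dG' := fun x a b => pd x (fun q => prodMetric g c' q a b) (chartTrans c c' q))
    (dJ := fun x a b => pd x (fun q => jac (chartTrans c c') q a b) q) ?_ ?_ ?_ ?_ ?_ a b e'
  · refine Matrix.IsSymm.fromBlocks ?_ (by simp) (isSymm_gram g c' _)
    exact Matrix.diagonal_transpose _
  · exact det_prodMetric_ne g hq'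
  · exact transpose_mul_inv_mul (fromBlocks_chartTrans (eta n) g hq)
      (det_prodMetric_ne g (overlap_subset c c' hq))
  · exact fun a b m => pd_jac_comm hS hΨ hq a b m
  · intro x a b
    have h1 : ∀ q ∈ overlap n c c', prodMetric g c q a b = ∑ m, ∑ l,
        (jac (chartTrans c c') q a m * jac (chartTrans c c') q b l) *
          prodMetric g c' (chartTrans c c' q) m l := by
      intro q hq
      have h2 := congrFun (congrFun (fromBlocks_chartTrans (eta n) g hq) a) b
      rw [prodMetric, h2]
      simp only [Matrix.mul_apply, Matrix.transpose_apply, Finset.sum_mul]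
      rw [Finset.sum_comm]
      exact Finset.sum_congr rfl fun m _ => Finset.sum_congr rfl fun l _ => by
        rw [prodMetric]; ring
    have h3 : ∀ m l, DifferentiableAt ℝ (fun q => (jac (chartTrans (n := n) c c') q a m *
        jac (chartTrans c c') q b l) * prodMetric g c' (chartTrans c c' q) m l) q := fun m l =>
      ((hJd a m).mul (hJd b l)).mul (hGΨ m l)
    rw [pd_congr hS hq h1 x]
    have h4 := pd_sum Finset.univ (F := fun m q => ∑ l, (jac (chartTrans (n := n) c c') q a m *
        jac (chartTrans c c') q b l) * prodMetric g c' (chartTrans c c' q) m l) (q := q)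
      (fun m _ => DifferentiableAt.fun_sum fun l _ => h3 m l) x
    rw [h4]
    refine Finset.sum_congr rfl fun m _ => ?_
    rw [pd_sum Finset.univ (F := fun l q => (jac (chartTrans (n := n) c c') q a m *
        jac (chartTrans c c') q b l) * prodMetric g c' (chartTrans c c' q) m l)
      (fun l _ => h3 m l) x]
    refine Finset.sum_congr rfl fun l _ => ?_
    have h5 := pd_mul (F := fun q => jac (chartTrans (n := n) c c') q a m *
      jac (chartTrans c c') q b l) ((hJd a m).mul (hJd b l)) (hGΨ m l) x
    rw [h5, pd_mul (hJd a m) (hJd b l), pd_comp (hGd m l) hΨd]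

/-- Internal directions do not move the Minkowski coordinates. This vanishing block is what makes a
contraction over internal indices alone tensorial. -/
theorem jac_chartTrans_inr_inl {c c' : K} {q : Coord n d} (hq : q ∈ overlap n c c') (A : Fin d)
    (i : Fin (n + 1)) : jac (chartTrans c c') q (Sum.inr A) (Sum.inl i) = 0 := by
  have hΨd : DifferentiableAt ℝ (chartTrans (n := n) c c') q :=
    ((contDiffOn_chartTrans c c').contDiffAt
      ((isOpen_overlap c c').mem_nhds hq)).differentiableAt (by simp)
  have h1 : HasFDerivAt (fun q : Coord n d => q.1)
      ((ContinuousLinearMap.fst ℝ _ _).comp (fderiv ℝ (chartTrans c c') q)) q :=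
    HasFDerivAt.comp (g := Prod.fst) (f := chartTrans c c') q hasFDerivAt_fst hΨd.hasFDerivAt
  have h2 := h1.unique hasFDerivAt_fst
  have h3 := congrArg (fun L => L (basisVec (Sum.inr A))) h2
  have h4 : (fderiv ℝ (chartTrans c c') q (basisVec (Sum.inr A))).1 = (0 : Mink n) := h3
  simp [jac, coordFun, h4]

theorem isPullback_intLaplacian (g : RMetric d K) {c c' : K} {T T' : Comp n d 2}
    (hT : IsPullback (chartTrans c c') (overlap n c c') T T')
    (hT' : IsSmoothComp c' ((2 : ℕ) : WithTop ℕ∞) T') :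
    IsPullback (chartTrans c c') (overlap n c c') (intLaplacian g c T) (intLaplacian g c' T') := by
  have hS := isOpen_overlap (n := n) (d := d) c c'
  have hΨ := contDiffOn_chartTrans (n := n) (d := d) c c'
  have hΓ := fun q (hq : q ∈ overlap n c c') => sum_christoffel_chartTrans g c c' hq
  have h1 := isPullback_covDeriv hS hΨ hΓ hT
    fun q hq b => hT'.differentiableAt (by simp) b (chartTrans_mem hq)
  have h2 := isPullback_covDeriv hS hΨ hΓ h1
    fun q hq b => (hT'.covDeriv (g := g) (m' := 1) le_rfl).differentiableAt (by simp) b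
      (chartTrans_mem hq)
  intro q hq a
  set J := jac (chartTrans c c') q with hJ
  set JK : Matrix (Fin d) (Fin d) ℝ := Matrix.of fun A B => J (Sum.inr A) (Sum.inr B) with hJK
  have hgr : gram g c q.2 = JK * gram g c' (chartTrans c c' q).2 * JK.transpose := by
    ext A B
    have h3 := congrFun (congrFun (fromBlocks_chartTrans (eta n) g hq) (Sum.inr A)) (Sum.inr B)
    simp only [Matrix.mul_apply, Fintype.sum_sum_type, jac_chartTrans_inr_inl hq,
      Matrix.fromBlocks_apply₂₂, Matrix.transpose_apply, zero_mul,
      mul_zero, Finset.sum_const_zero, zero_add] at h3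
    rw [h3]
    simp only [Matrix.mul_apply, Matrix.transpose_apply, hJK, Matrix.of_apply, hJ]
  have hinv := transpose_mul_inv_mul hgr (posDef_gram g hq.2.1).det_pos.ne'
  have hcontr : ∀ A' B', (gram g c' (chartTrans c c' q).2)⁻¹ A' B' = ∑ A, ∑ B,
      (gram g c q.2)⁻¹ A B * (J (Sum.inr A) (Sum.inr A') * J (Sum.inr B) (Sum.inr B')) := by
    intro A' B'
    rw [← hinv]
    simp only [Matrix.mul_apply, Matrix.transpose_apply, Finset.sum_mul, hJK, Matrix.of_apply]
    rw [Finset.sum_comm]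
    exact Finset.sum_congr rfl fun _ _ => Finset.sum_congr rfl fun _ _ => by ring
  simp only [intLaplacian, hcontr]
  set N := covDeriv g c' (covDeriv g c' T') (chartTrans c c' q) with hN
  -- With internal indices in the first two slots, only internal summands survive there.
  have h5 : ∀ A B : Fin d, ∑ b : Fin 4 → Idx n d, (∏ j, J ((Fin.cons (Sum.inr A)
      (Fin.cons (Sum.inr B) a : Fin 3 → Idx n d) : Fin 4 → Idx n d) j) (b j)) * N b =
      ∑ A', ∑ B', ∑ b : Fin 2 → Idx n d, J (Sum.inr A) (Sum.inr A') *
        J (Sum.inr B) (Sum.inr B') * (∏ j, J (a j) (b j)) *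
          N (Fin.cons (Sum.inr A') (Fin.cons (Sum.inr B') b)) := by
    intro A B
    rw [sum_fin_succ_fun, Fintype.sum_sum_type]
    have h6 : ∀ i : Fin (n + 1), J (Sum.inr A) (Sum.inl i) = 0 := jac_chartTrans_inr_inl hq A
    have h7 : ∀ i : Fin (n + 1), J (Sum.inr B) (Sum.inl i) = 0 := jac_chartTrans_inr_inl hq B
    simp only [Fin.prod_univ_succ (n := 3), Fin.cons_zero, Fin.cons_succ, h6, zero_mul,
      Finset.sum_const_zero, zero_add]
    refine Finset.sum_congr rfl fun A' _ => ?_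
    rw [sum_fin_succ_fun, Fintype.sum_sum_type]
    simp only [Fin.prod_univ_succ (n := 2), Fin.cons_zero, Fin.cons_succ, h7, zero_mul, mul_zero,
      Finset.sum_const_zero, zero_add, mul_assoc]
  have h9 : ∀ A B, covDeriv g c (covDeriv g c T) q (Fin.cons (Sum.inr A)
      (Fin.cons (Sum.inr B) a)) = _ := fun A B => (h2 q hq _).trans (h5 A B)
  simp only [h9, Finset.mul_sum, Finset.sum_mul]
  refine (sum_comm_pair fun (A B A' B' : Fin d) => ∑ b : Fin 2 → Idx n d,
    (gram g c q.2)⁻¹ A B * (J (Sum.inr A) (Sum.inr A') *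
        J (Sum.inr B) (Sum.inr B') * (∏ j, J (a j) (b j)) *
          N (Fin.cons (Sum.inr A') (Fin.cons (Sum.inr B') b)))).trans ?_
  have h8 : ∀ F : Fin d → Fin d → Fin d → Fin d → (Fin 2 → Idx n d) → ℝ,
      ∑ A', ∑ B', ∑ A, ∑ B, ∑ b, F A' B' A B b = ∑ b, ∑ A', ∑ B', ∑ A, ∑ B, F A' B' A B b := by
    intro F
    calc _ = ∑ p : (Fin d × Fin d) × Fin d × Fin d, ∑ b, F p.1.1 p.1.2 p.2.1 p.2.2 b := by
          simp only [Fintype.sum_prod_type]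
      _ = ∑ b, ∑ p : (Fin d × Fin d) × Fin d × Fin d, F p.1.1 p.1.2 p.2.1 p.2.2 b :=
          Finset.sum_comm
      _ = _ := by simp only [Fintype.sum_prod_type]
  rw [h8]
  exact Finset.sum_congr rfl fun b _ => Finset.sum_congr rfl fun A' _ =>
    Finset.sum_congr rfl fun B' _ => Finset.sum_congr rfl fun A _ =>
      Finset.sum_congr rfl fun B _ => by ring

theorem isPullback_intLaplacian_iterate (g : RMetric d K) {c c' : K} (j : ℕ) {T T' : Comp n d 2}
    (hT : IsPullback (chartTrans c c') (overlap n c c') T T')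
    (hT' : IsSmoothComp c' ((2 * j : ℕ) : WithTop ℕ∞) T') :
    IsPullback (chartTrans c c') (overlap n c c') ((intLaplacian g c)^[j] T)
      ((intLaplacian g c')^[j] T') := by
  induction j generalizing T T' with
  | zero => exact hT
  | succ j ih =>
    rw [Function.iterate_succ_apply, Function.iterate_succ_apply]
    refine ih (isPullback_intLaplacian g hT (hT'.of_le ?_)) (hT'.intLaplacian (by omega))
    exact_mod_cast (by omega : 2 ≤ 2 * (j + 1))

/-- The energy density may be computed in any chart around the point. -/
theorem termSq_eq (g : RMetric d K) {u : TensorField n d K} {r j N : ℕ} (i : Fin n)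
    (I : Fin r → GenIndex n) (hu : u.IsCk (N : WithTop ℕ∞)) (hN : r + 2 * j + 1 ≤ N) {c : K}
    {y : Euc d} (hy : y ∈ chartDom c) (p : Mink n) :
    termSq g u i I j (p, (extChartAt 𝓘(ℝ, EuclideanSpace ℝ (Fin d)) c).symm y) =
      normSqE g c (p, y) (alongMink (hypField i) (genPow I ((intLaplacian g c)^[j] (u.comp c)))
        (p, y)) := by
  set w := (extChartAt 𝓘(ℝ, EuclideanSpace ℝ (Fin d)) c).symm y with hw
  have hq : ((p, y) : Coord n d) ∈ overlap n c w :=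
    ⟨trivial, hy, by exact mem_extChartAt_source w⟩
  have hsm : ∀ c : K, IsSmoothComp c (N : WithTop ℕ∞) (u.comp c) := fun c a =>
    contDiffOn_comp (by exact_mod_cast le_top) hu c a
  have h1 := isPullback_intLaplacian_iterate g j (isPullback_comp u c w)
    ((hsm w).of_le (by exact_mod_cast (by omega : 2 * j ≤ N)))
  have h2 : IsSmoothComp w ((1 + r : ℕ) : WithTop ℕ∞) ((intLaplacian g w)^[j] (u.comp w)) :=
    IsSmoothComp.intLaplacian_iterate j
      ((hsm w).of_le (by exact_mod_cast (by omega : 1 + r + 2 * j ≤ N)))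
  have h3 := isPullback_genPow h1 I (h2.of_le (by exact_mod_cast (by omega : r ≤ 1 + r)))
  have h4 := isPullback_alongMink h3 (m := (1 : ℕ)) (h2.genPow I) (by simp) (hypField i)
  exact (normSqE_chartTrans g hq h4).symm

theorem normE_sq_nonneg_eq (g : RMetric d K) (u : TensorField n d K) {c : K} {y : Euc d}
    (hy : y ∈ chartDom c) (p : Mink n) :
    normE g u (p, (extChartAt 𝓘(ℝ, EuclideanSpace ℝ (Fin d)) c).symm y) =
      Real.sqrt (normSqE g c (p, y) (u.comp c (p, y))) := by
  set w := (extChartAt 𝓘(ℝ, EuclideanSpace ℝ (Fin d)) c).symm y with hw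
  have hq : ((p, y) : Coord n d) ∈ overlap n c w :=
    ⟨trivial, hy, by exact mem_extChartAt_source w⟩
  rw [normSqE_chartTrans g hq (isPullback_comp u c w)]
  rfl

end OperatorCovariance

/-! ### The internal Laplacian as a system with scalar principal part. -/

section OperatorStructure

variable {n d : ℕ} {K : Type*} [TopologicalSpace K] [ChartedSpace (EuclideanSpace ℝ (Fin d)) K]

theorem pd_eq_of_forall_snd {F : Coord n d → ℝ} (hF : ∀ p p' y, F (p, y) = F (p', y))
    (a : Idx n d) (p p' : Mink n) (y : Euc d) : pd a F (p, y) = pd a F (p', y) := by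
  have h1 : F = fun q => F (q + ((p' - p, 0) : Coord n d)) := by
    funext q
    have : q + ((p' - p, 0) : Coord n d) = (q.1 + (p' - p), q.2) := by simp [Prod.ext_iff]
    rw [this]
    exact hF _ _ _
  rw [pd]
  conv_lhs => rw [h1]
  rw [fderiv_comp_add_right, pd]
  simp

theorem pd_inl_of_forall_snd {F : Coord n d → ℝ} (hF : ∀ p p' y, F (p, y) = F (p', y))
    {q : Coord n d} (hd : DifferentiableAt ℝ F q) (i : Fin (n + 1)) : pd (Sum.inl i) F q = 0 := by
  have h1 := fderiv_slice_fst hd (coordVec i)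
  have h2 : (fun p => F (p, q.2)) = fun _ => F q := funext fun p => hF p q.1 q.2
  rw [h2, fderiv_fun_const] at h1
  exact h1.symm

/-- First order differential operators in the internal directions, with smooth coefficients that
depend only on the internal coordinates. -/
def IsFirstOrder (c : K) (Q : Comp n d 2 → Coord n d → ℝ) : Prop :=
  ∃ (β : (Fin 2 → Idx n d) → Fin d → Euc d → ℝ) (γ : (Fin 2 → Idx n d) → Euc d → ℝ),
    (∀ e A, ContDiffOn ℝ ∞ (β e A) (chartDom c)) ∧ (∀ e, ContDiffOn ℝ ∞ (γ e) (chartDom c)) ∧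
    ∀ T : Comp n d 2, IsSmoothComp c ((2 : ℕ) : WithTop ℕ∞) T → ∀ q ∈ prodDom n c,
      Q T q = ∑ e, ∑ A, β e A q.2 * pd (Sum.inr A) (fun q => T q e) q + ∑ e, γ e q.2 * T q e

theorem IsFirstOrder.congr {c : K} {Q Q' : Comp n d 2 → Coord n d → ℝ} (h : IsFirstOrder c Q)
    (hQ : ∀ T : Comp n d 2, IsSmoothComp c ((2 : ℕ) : WithTop ℕ∞) T → ∀ q ∈ prodDom n c,
      Q' T q = Q T q) : IsFirstOrder c Q' := by
  obtain ⟨β, γ, hβ, hγ, h⟩ := h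
  exact ⟨β, γ, hβ, hγ, fun T hT q hq => (hQ T hT q hq).trans (h T hT q hq)⟩

theorem IsFirstOrder.zero (c : K) : IsFirstOrder (n := n) (d := d) c fun _ _ => 0 :=
  ⟨fun _ _ _ => 0, fun _ _ => 0, fun _ _ => contDiffOn_const, fun _ => contDiffOn_const,
    fun T _ q _ => by simp⟩

theorem IsFirstOrder.add {c : K} {Q Q' : Comp n d 2 → Coord n d → ℝ} (h : IsFirstOrder c Q)
    (h' : IsFirstOrder c Q') : IsFirstOrder c fun T q => Q T q + Q' T q := by
  obtain ⟨β, γ, hβ, hγ, h⟩ := h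
  obtain ⟨β', γ', hβ', hγ', h'⟩ := h'
  refine ⟨fun e A y => β e A y + β' e A y, fun e y => γ e y + γ' e y,
    fun e A => (hβ e A).add (hβ' e A), fun e => (hγ e).add (hγ' e), fun T hT q hq => ?_⟩
  simp only [h T hT q hq, h' T hT q hq, add_mul, Finset.sum_add_distrib]
  ring

theorem IsFirstOrder.mul {c : K} {Q : Comp n d 2 → Coord n d → ℝ} (h : IsFirstOrder c Q)
    {φ : Euc d → ℝ} (hφ : ContDiffOn ℝ ∞ φ (chartDom c)) :
    IsFirstOrder c fun T q => φ q.2 * Q T q := by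
  obtain ⟨β, γ, hβ, hγ, h⟩ := h
  refine ⟨fun e A y => φ y * β e A y, fun e y => φ y * γ e y,
    fun e A => hφ.mul (hβ e A), fun e => hφ.mul (hγ e), fun T hT q hq => ?_⟩
  simp only [h T hT q hq, mul_add, Finset.mul_sum, mul_assoc]

theorem IsFirstOrder.sub {c : K} {Q Q' : Comp n d 2 → Coord n d → ℝ} (h : IsFirstOrder c Q)
    (h' : IsFirstOrder c Q') : IsFirstOrder c fun T q => Q T q - Q' T q :=
  (h.add (h'.mul (φ := fun _ => -1) contDiffOn_const)).congr fun T _ q _ => by ring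

theorem IsFirstOrder.sum {c : K} {κ : Type*} (s : Finset κ)
    {Q : κ → Comp n d 2 → Coord n d → ℝ} (h : ∀ i, IsFirstOrder c (Q i)) :
    IsFirstOrder c fun T q => ∑ i ∈ s, Q i T q := by
  classical
  induction s using Finset.induction_on with
  | empty => simpa using IsFirstOrder.zero c
  | insert i s hi ih =>
    exact ((h i).add ih).congr fun T _ q _ => by rw [Finset.sum_insert hi]

theorem IsFirstOrder.component (c : K) (e : Fin 2 → Idx n d) :
    IsFirstOrder (d := d) c fun T q => T q e := by
  classical
  refine ⟨fun _ _ _ => 0, fun e' _ => if e' = e then 1 else 0, fun _ _ => contDiffOn_const,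
    fun _ => contDiffOn_const, fun T _ q _ => ?_⟩
  simp

theorem IsFirstOrder.pd_component (c : K) (e : Fin 2 → Idx n d) (A : Fin d) :
    IsFirstOrder c fun T q => pd (Sum.inr A) (fun q => T q e) q := by
  classical
  refine ⟨fun e' A' _ => if e' = e then (if A' = A then 1 else 0) else 0, fun _ _ => 0,
    fun _ _ => contDiffOn_const, fun _ => contDiffOn_const, fun T _ q _ => ?_⟩
  have : ∀ (e' : Fin 2 → Idx n d) (A' : Fin d), (if e' = e then (if A' = A then (1 : ℝ) else 0)
      else 0) * pd (Sum.inr A') (fun q => T q e') q = if e' = e then (if A' = A then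
      pd (Sum.inr A') (fun q => T q e') q else 0) else 0 := by
    intro e' A'
    split_ifs <;> simp
  simp only [this, zero_mul, Finset.sum_const_zero, add_zero]
  rw [Finset.sum_eq_single e (fun b _ hb => by simp [hb]) (by simp)]
  simp

variable [IsManifold 𝓘(ℝ, EuclideanSpace ℝ (Fin d)) ∞ K]

theorem christoffel_const (g : RMetric d K) (c : K) (e a b : Idx n d) (p p' : Mink n) (y : Euc d) :
    christoffel g c (p, y) e a b = christoffel g c (p', y) e a b := by
  have h : ∀ x a b, pd x (fun q => prodMetric g c q a b) (p, y) =
      pd x (fun q => prodMetric g c q a b) (p', y) := fun x a b =>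
    pd_eq_of_forall_snd (fun _ _ _ => rfl) x p p' y
  simp only [christoffel, h]
  rfl

/-- The inverse metric has no mixed entries, the mixed components vanish, and the metric of `K` does
not depend on (t, x). Hence second internal derivatives produce no Minkowski derivatives. -/
theorem christoffel_inl_inr_inr (g : RMetric d K) {c : K} {q : Coord n d} (hq : q ∈ prodDom n c)
    (i : Fin (n + 1)) (A B : Fin d) :
    christoffel g c q (Sum.inl i) (Sum.inr A) (Sum.inr B) = 0 := by
  have hinv : ∀ C, (prodMetric (n := n) g c q)⁻¹ (Sum.inl i) (Sum.inr C) = 0 := by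
    intro C
    have h1 : IsUnit (eta n) ↔ IsUnit (gram g c q.2) := by
      rw [Matrix.isUnit_iff_isUnit_det, Matrix.isUnit_iff_isUnit_det]
      exact iff_of_true (det_eta_ne n).isUnit (posDef_gram g hq.2).det_pos.ne'.isUnit
    rw [prodMetric, Matrix.inv_fromBlocks_zero₂₁_of_isUnit_iff _ _ _ h1]
    simp
  have h0 : ∀ (x : Idx n d) (k : Fin (n + 1)) (B : Fin d),
      pd x (fun q => prodMetric (n := n) g c q (Sum.inl k) (Sum.inr B)) q = 0 := by
    intro x k B
    have : (fun q => prodMetric (n := n) g c q (Sum.inl k) (Sum.inr B)) = fun _ => 0 := rfl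
    rw [this, pd, fderiv_fun_const]
    rfl
  have h2 : ∀ k : Fin (n + 1), pd (Sum.inl k)
      (fun q => prodMetric (n := n) g c q (Sum.inr A) (Sum.inr B)) q = 0 := fun k =>
    pd_inl_of_forall_snd (fun _ _ _ => rfl) (((contDiffOn_prodMetric g c _ _).contDiffAt
      ((isOpen_prodDom c).mem_nhds hq)).differentiableAt (by simp)) k
  simp [christoffel, Fintype.sum_sum_type, hinv, h0, h2]

/-- The Christoffel symbols as functions of the internal coordinates. -/
def intChristoffel (n : ℕ) (g : RMetric d K) (c : K) (e a b : Idx n d) (y : Euc d) : ℝ :=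
  christoffel g c (0, y) e a b

theorem christoffel_eq (g : RMetric d K) (c : K) (q : Coord n d) (e a b : Idx n d) :
    christoffel g c q e a b = intChristoffel n g c e a b q.2 :=
  christoffel_const g c e a b q.1 0 q.2

theorem contDiffOn_intChristoffel (g : RMetric d K) (c : K) (e a b : Idx n d) :
    ContDiffOn ℝ ∞ (intChristoffel n g c e a b) (chartDom c) :=
  (contDiffOn_christoffel g c e a b).comp (contDiff_const.prodMk contDiff_id).contDiffOn
    fun _ hy => ⟨trivial, hy⟩

theorem isFirstOrder_covDeriv (g : RMetric d K) (c : K) (B : Fin d) (a : Fin 2 → Idx n d) :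
    IsFirstOrder c fun T q => covDeriv g c T q (Fin.cons (Sum.inr B) a) := by
  refine ((IsFirstOrder.pd_component c a B).sub (IsFirstOrder.sum Finset.univ fun j : Fin 2 =>
    IsFirstOrder.sum Finset.univ fun e : Idx n d =>
      (IsFirstOrder.component c (Function.update a j e)).mul
        (contDiffOn_intChristoffel g c e (Sum.inr B) (a j)))).congr fun T _ q _ => ?_
  simp only [covDeriv, Fin.cons_zero, Fin.tail_cons, Fin.cons_succ, christoffel_eq]

theorem differentiableAt_comp_snd {φ : Euc d → ℝ} {c : K} (hφ : ContDiffOn ℝ ∞ φ (chartDom c))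
    {q : Coord n d} (hq : q ∈ prodDom n c) : DifferentiableAt ℝ (fun q : Coord n d => φ q.2) q :=
  DifferentiableAt.comp (g := φ) (f := Prod.snd) q ((hφ.contDiffAt
    ((isOpen_chartDom c).mem_nhds hq.2)).differentiableAt (by simp)) differentiableAt_snd

theorem pd_comp_snd {φ : Euc d → ℝ} {c : K} (hφ : ContDiffOn ℝ ∞ φ (chartDom c))
    {q : Coord n d} (hq : q ∈ prodDom n c) (A : Fin d) :
    pd (Sum.inr A) (fun q : Coord n d => φ q.2) q = pdE A φ q.2 :=
  (fderiv_slice_snd (differentiableAt_comp_snd hφ hq) (EuclideanSpace.single A 1)).symm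

/-- Every term except the iterated partial derivative contains a Christoffel symbol or its
derivative, hence has order at most one, with coefficients depending on the internal coordinates
alone. -/
theorem isFirstOrder_covDeriv_covDeriv (g : RMetric d K) (c : K) (A B : Fin d)
    (a : Fin 2 → Idx n d) :
    IsFirstOrder c fun T q => covDeriv g c (covDeriv g c T) q
        (Fin.cons (Sum.inr A) (Fin.cons (Sum.inr B) a)) -
      pd (Sum.inr A) (pd (Sum.inr B) fun q => T q a) q := by
  have hΓ := fun e x y => contDiffOn_intChristoffel (n := n) g c e x y
  have hdΓ := fun e x y => contDiffOn_pdE (isOpen_chartDom c) (hΓ e x y) (m := ∞) (by simp) A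
  have h1 : IsFirstOrder c fun T q => ∑ j : Fin 2, ∑ e : Idx n d,
      (pdE A (intChristoffel n g c e (Sum.inr B) (a j)) q.2 * T q (Function.update a j e) +
        intChristoffel n g c e (Sum.inr B) (a j) q.2 *
          pd (Sum.inr A) (fun q => T q (Function.update a j e)) q) :=
    IsFirstOrder.sum Finset.univ fun j => IsFirstOrder.sum Finset.univ fun e =>
      ((IsFirstOrder.component c _).mul (hdΓ e _ _)).add
        ((IsFirstOrder.pd_component c _ A).mul (hΓ e _ _))
  have h2 : IsFirstOrder (n := n) c fun T q => ∑ C : Fin d,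
      intChristoffel n g c (Sum.inr C) (Sum.inr A) (Sum.inr B) q.2 *
        covDeriv g c T q (Fin.cons (Sum.inr C) a) :=
    IsFirstOrder.sum Finset.univ fun C => (isFirstOrder_covDeriv g c C a).mul (hΓ _ _ _)
  have h3 : IsFirstOrder c fun T q => ∑ j : Fin 2, ∑ e : Idx n d,
      intChristoffel n g c e (Sum.inr A) (a j) q.2 *
        covDeriv g c T q (Fin.cons (Sum.inr B) (Function.update a j e)) :=
    IsFirstOrder.sum Finset.univ fun j => IsFirstOrder.sum Finset.univ fun e =>
      (isFirstOrder_covDeriv g c B _).mul (hΓ _ _ _)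
  refine ((IsFirstOrder.zero c).sub (h1.add (h2.add h3))).congr fun T hT q hq => ?_
  have hTd := fun e => hT.differentiableAt (by simp) e hq
  have hpTd : DifferentiableAt ℝ (pd (Sum.inr B) fun q => T q a) q :=
    ((contDiffOn_pd (isOpen_prodDom c) (hT a) (m' := 1) (by norm_cast) _).contDiffAt
      ((isOpen_prodDom c).mem_nhds hq)).differentiableAt one_ne_zero
  have hterm : ∀ (j : Fin 2) (e : Idx n d), DifferentiableAt ℝ (fun q : Coord n d =>
      intChristoffel n g c e (Sum.inr B) (a j) q.2 * T q (Function.update a j e)) q := fun j e =>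
    (differentiableAt_comp_snd (hΓ _ _ _) hq).mul (hTd _)
  have e1 : pd (Sum.inr A) (fun q => covDeriv g c T q (Fin.cons (Sum.inr B) a)) q =
      pd (Sum.inr A) (pd (Sum.inr B) fun q => T q a) q - ∑ j : Fin 2, ∑ e : Idx n d,
      (pdE A (intChristoffel n g c e (Sum.inr B) (a j)) q.2 * T q (Function.update a j e) +
        intChristoffel n g c e (Sum.inr B) (a j) q.2 *
          pd (Sum.inr A) (fun q => T q (Function.update a j e)) q) := by
    have h4 : (fun q => covDeriv g c T q (Fin.cons (Sum.inr B) a)) = fun q =>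
        pd (Sum.inr B) (fun q => T q a) q - ∑ j : Fin 2, ∑ e : Idx n d,
          intChristoffel n g c e (Sum.inr B) (a j) q.2 * T q (Function.update a j e) := by
      funext q
      simp only [covDeriv, Fin.cons_zero, Fin.tail_cons, Fin.cons_succ, christoffel_eq]
    have h5 : ∀ j : Fin 2, DifferentiableAt ℝ (fun q : Coord n d => ∑ e : Idx n d,
        intChristoffel n g c e (Sum.inr B) (a j) q.2 * T q (Function.update a j e)) q := fun j =>
      DifferentiableAt.fun_sum fun e _ => hterm j e
    have h6 : DifferentiableAt ℝ (fun q : Coord n d => ∑ j : Fin 2, ∑ e : Idx n d,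
        intChristoffel n g c e (Sum.inr B) (a j) q.2 * T q (Function.update a j e)) q :=
      DifferentiableAt.fun_sum fun j _ => h5 j
    rw [h4, pd, fderiv_fun_sub hpTd h6, _root_.sub_apply]
    congr 1
    refine (pd_sum Finset.univ (fun j _ => h5 j) (Sum.inr A)).trans
      (Finset.sum_congr rfl fun j _ => ?_)
    refine (pd_sum Finset.univ (fun e _ => hterm j e) (Sum.inr A)).trans
      (Finset.sum_congr rfl fun e _ => ?_)
    rw [pd_mul (differentiableAt_comp_snd (hΓ _ _ _) hq) (hTd _), pd_comp_snd (hΓ _ _ _) hq]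
  have e2 : covDeriv g c (covDeriv g c T) q (Fin.cons (Sum.inr A) (Fin.cons (Sum.inr B) a)) =
      pd (Sum.inr A) (fun q => covDeriv g c T q (Fin.cons (Sum.inr B) a)) q -
        ((∑ C : Fin d, intChristoffel n g c (Sum.inr C) (Sum.inr A) (Sum.inr B) q.2 *
          covDeriv g c T q (Fin.cons (Sum.inr C) a)) + ∑ j : Fin 2, ∑ e : Idx n d,
          intChristoffel n g c e (Sum.inr A) (a j) q.2 *
            covDeriv g c T q (Fin.cons (Sum.inr B) (Function.update a j e))) := by
    rw [covDeriv, Fin.cons_zero, Fin.tail_cons, Fin.sum_univ_succ]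
    congr 2
    -- The connection term of the differentiation slot: its Minkowski part drops out, so only
    -- internal first derivatives remain.
    · rw [Fintype.sum_sum_type]
      simp only [Fin.cons_succ, Fin.cons_zero, christoffel_inl_inr_inr g hq, zero_mul,
        Finset.sum_const_zero, zero_add, christoffel_eq, Fin.update_cons_zero]
    · simp only [Fin.cons_succ, christoffel_eq, Fin.cons_update]
  rw [e2, e1]
  ring

/-- The internal Laplacian is a second order operator with principal part `k^{AB} ∂_A ∂_B`. -/
theorem exists_intLaplacian_eq (n : ℕ) (g : RMetric d K) (c : K) :
    ∃ (β : (Fin 2 → Idx n d) → (Fin 2 → Idx n d) → Fin d → Euc d → ℝ)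
      (γ : (Fin 2 → Idx n d) → (Fin 2 → Idx n d) → Euc d → ℝ),
      (∀ a e A, ContDiffOn ℝ ∞ (β a e A) (chartDom c)) ∧
      (∀ a e, ContDiffOn ℝ ∞ (γ a e) (chartDom c)) ∧
      ∀ T : Comp n d 2, IsSmoothComp c ((2 : ℕ) : WithTop ℕ∞) T → ∀ q ∈ prodDom n c, ∀ a,
        intLaplacian g c T q a =
          ∑ A, ∑ B, (gram g c q.2)⁻¹ A B * pd (Sum.inr A) (pd (Sum.inr B) fun q => T q a) q +
          ∑ e, ∑ A, β a e A q.2 * pd (Sum.inr A) (fun q => T q e) q +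
          ∑ e, γ a e q.2 * T q e := by
  have hinv := fun A B => contDiffOn_matrix_inv (contDiffOn_gram g c) (fun y hy => (posDef_gram g
    hy).det_pos.ne') A B
  have h : ∀ a : Fin 2 → Idx n d, IsFirstOrder c fun T q => ∑ A, ∑ B, (gram g c q.2)⁻¹ A B *
      (covDeriv g c (covDeriv g c T) q (Fin.cons (Sum.inr A) (Fin.cons (Sum.inr B) a)) -
        pd (Sum.inr A) (pd (Sum.inr B) fun q => T q a) q) := fun a =>
    IsFirstOrder.sum Finset.univ fun A => IsFirstOrder.sum Finset.univ fun B =>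
      (isFirstOrder_covDeriv_covDeriv g c A B a).mul (hinv A B)
  choose β γ hβ hγ h using h
  refine ⟨β, γ, hβ, hγ, fun T hT q hq a => ?_⟩
  rw [add_assoc, ← h a T hT q hq]
  simp only [mul_sub, Finset.sum_sub_distrib, intLaplacian]
  ring

end OperatorStructure

/-! ### Minkowski derivatives commute with the internal Laplacian. -/

section Commutation

variable {n d : ℕ} {K : Type*} [TopologicalSpace K] [ChartedSpace (EuclideanSpace ℝ (Fin d)) K]

/-- The vector field does not depend on the internal coordinates, so the internal derivative falls
on F alone; symmetry of second derivatives does the rest. -/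
theorem pd_inr_fderiv_along {S : Set (Coord n d)} (hS : IsOpen S) {F : Coord n d → ℝ}
    (hF : ContDiffOn ℝ 2 F S) {V : Mink n → Mink n} (hV : ContDiff ℝ 1 V) {q : Coord n d}
    (hq : q ∈ S) (B : Fin d) :
    pd (Sum.inr B) (fun q' => fderiv ℝ F q' ((V q'.1, 0) : Coord n d)) q =
      fderiv ℝ (pd (Sum.inr B) F) q ((V q.1, 0) : Coord n d) := by
  have h1 : ContDiffAt ℝ 2 F q := hF.contDiffAt (hS.mem_nhds hq)
  have h2 : DifferentiableAt ℝ (fderiv ℝ F) q :=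
    (h1.fderiv_right (m := 1) (by norm_num)).differentiableAt one_ne_zero
  have hVd : HasFDerivAt V (fderiv ℝ V q.1) q.1 :=
    (hV.differentiable one_ne_zero q.1).hasFDerivAt
  have hW : HasFDerivAt (fun q' : Coord n d => ((V q'.1, 0) : Coord n d))
      (((fderiv ℝ V q.1).comp (ContinuousLinearMap.fst ℝ _ _)).prod 0) q :=
    (HasFDerivAt.comp (g := V) (f := Prod.fst) q hVd hasFDerivAt_fst).prodMk
      (hasFDerivAt_const _ _)
  have h3 : HasFDerivAt (fun q' => fderiv ℝ F q' ((V q'.1, 0) : Coord n d)) _ q :=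
    h2.hasFDerivAt.clm_apply hW
  have h4 : HasFDerivAt (pd (Sum.inr B) F)
      ((fderiv ℝ (fderiv ℝ F) q).flip (basisVec (Sum.inr B))) q := by
    have := h2.hasFDerivAt.clm_apply (hasFDerivAt_const (basisVec (Sum.inr B) : Coord n d) q)
    refine this.congr_fderiv ?_
    ext <;> simp
  have hsymm : IsSymmSndFDerivAt ℝ F q := h1.isSymmSndFDerivAt (by
    simp only [minSmoothness_of_isRCLikeNormedField]; norm_cast)
  rw [pd, h3.fderiv, h4.fderiv, ContinuousLinearMap.flip_apply, hsymm.eq]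
  simp only [basisVec, _root_.add_apply, ContinuousLinearMap.comp_apply, ContinuousLinearMap.prod_apply,
    ContinuousLinearMap.coe_fst', map_zero, _root_.zero_apply, ContinuousLinearMap.flip_apply]
  exact (congrArg (· + _) (map_zero (fderiv ℝ F q))).trans (zero_add _)

theorem fderiv_slice_sum {κ : Type*} [Fintype κ] (C : κ → ℝ) (G : κ → Coord n d → ℝ)
    {q : Coord n d} (hG : ∀ i, DifferentiableAt ℝ (G i) q) (v : Mink n) :
    fderiv ℝ (fun p => ∑ i, C i * G i (p, q.2)) q.1 v = ∑ i, C i * fderiv ℝ (G i) q (v, 0) := by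
  have h1 : ∀ i, DifferentiableAt ℝ (fun p => G i (p, q.2)) q.1 := fun i =>
    DifferentiableAt.comp (g := G i) (f := fun p => ((p, q.2) : Coord n d)) q.1 (hG i)
      (differentiableAt_id.prodMk (differentiableAt_const _))
  rw [fderiv_fun_sum fun i _ => (h1 i).const_mul _, _root_.sum_apply]
  refine Finset.sum_congr rfl fun i _ => ?_
  rw [fderiv_const_mul (h1 i), _root_.smul_apply, smul_eq_mul, fderiv_slice_fst (hG i)]

theorem alongMink_congr {c : K} {k : ℕ} {T T' : Comp n d k}
    (h : ∀ q ∈ prodDom n c, ∀ a, T q a = T' q a) (V : Mink n → Mink n) :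
    ∀ q ∈ prodDom n c, ∀ a, alongMink V T q a = alongMink V T' q a := by
  intro q hq a
  have : (fun p => T (p, q.2) a) = fun p => T' (p, q.2) a :=
    funext fun p => h (p, q.2) ⟨trivial, hq.2⟩ a
  simp only [alongMink, this]

theorem foldl_alongMink_congr {c : K} {k : ℕ} (l : List (GenIndex n)) {T T' : Comp n d k}
    (h : ∀ q ∈ prodDom n c, ∀ a, T q a = T' q a) :
    ∀ q ∈ prodDom n c, ∀ a, l.foldl (fun S i => alongMink (genField i) S) T q a =
      l.foldl (fun S i => alongMink (genField i) S) T' q a := by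
  induction l generalizing T T' with
  | nil => exact h
  | cons i l ih => exact ih (alongMink_congr h _)

variable [IsManifold 𝓘(ℝ, EuclideanSpace ℝ (Fin d)) ∞ K]

/-- In the coordinate form of the Laplacian all coefficients depend on the internal coordinates
only, so differentiation along V passes through each term. Three derivatives of T are involved. -/
theorem alongMink_intLaplacian (g : RMetric d K) {c : K} {T : Comp n d 2}
    (hT : IsSmoothComp c ((3 : ℕ) : WithTop ℕ∞) T) {V : Mink n → Mink n} (hV : ContDiff ℝ 2 V)
    {q : Coord n d} (hq : q ∈ prodDom n c) (a : Fin 2 → Idx n d) :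
    alongMink V (intLaplacian g c T) q a = intLaplacian g c (alongMink V T) q a := by
  obtain ⟨β, γ, -, -, hL⟩ := exists_intLaplacian_eq n g c
  have hS := isOpen_prodDom (n := n) (d := d) c
  have hT2 : IsSmoothComp c ((2 : ℕ) : WithTop ℕ∞) T := hT.of_le (by norm_cast)
  have hV1 : ContDiff ℝ 1 V := hV.of_le (by norm_num)
  have hDT : IsSmoothComp c ((2 : ℕ) : WithTop ℕ∞) (alongMink V T) :=
    hT.alongMink (by norm_cast) hV
  have hTd := fun e => hT.differentiableAt (by simp) e hq
  have hT2' : ∀ e, ContDiffOn ℝ 2 (fun q => T q e) (prodDom n c) := fun e => hT2 e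
  have hpB : ∀ B e, ContDiffOn ℝ 2 (pd (Sum.inr B) fun q => T q e) (prodDom n c) := fun B e =>
    contDiffOn_pd hS (hT e) (by norm_cast) _
  have hpd : ∀ B e, DifferentiableAt ℝ (pd (Sum.inr B) fun q => T q e) q := fun B e =>
    ((hpB B e).contDiffAt (hS.mem_nhds hq)).differentiableAt two_ne_zero
  have hppd : ∀ A B e, DifferentiableAt ℝ (pd (Sum.inr A) (pd (Sum.inr B) fun q => T q e)) q :=
    fun A B e => ((contDiffOn_pd hS (hpB B e) (m' := 1) (by norm_num) (Sum.inr A)).contDiffAt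
      (hS.mem_nhds hq)).differentiableAt one_ne_zero
  have hal : ∀ q ∈ prodDom n c, ∀ e, alongMink V T q e =
      fderiv ℝ (fun q => T q e) q ((V q.1, 0) : Coord n d) := fun q hq e =>
    alongMink_eq (hT.differentiableAt (by simp) e hq) V
  have hpal : ∀ q ∈ prodDom n c, ∀ B e, pd (Sum.inr B) (fun q => alongMink V T q e) q =
      fderiv ℝ (pd (Sum.inr B) fun q => T q e) q ((V q.1, 0) : Coord n d) := fun q hq B e => by
    rw [pd_congr hS hq (fun q hq => hal q hq e), pd_inr_fderiv_along hS (hT2' e) hV1 hq]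
  have hppal : ∀ A B e, pd (Sum.inr A) (pd (Sum.inr B) fun q => alongMink V T q e) q =
      fderiv ℝ (pd (Sum.inr A) (pd (Sum.inr B) fun q => T q e)) q ((V q.1, 0) : Coord n d) :=
    fun A B e => by
      rw [pd_congr hS hq (fun q hq => hpal q hq B e), pd_inr_fderiv_along hS (hpB B e) hV1 hq]
  have hsum := fderiv_slice_sum (q := q)
    (κ := (Fin d × Fin d) ⊕ (((Fin 2 → Idx n d) × Fin d) ⊕ (Fin 2 → Idx n d)))
    (Sum.elim (fun i => (gram g c q.2)⁻¹ i.1 i.2)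
      (Sum.elim (fun i => β a i.1 i.2 q.2) fun i => γ a i q.2))
    (Sum.elim (fun i => pd (Sum.inr i.1) (pd (Sum.inr i.2) fun q => T q a))
      (Sum.elim (fun i => pd (Sum.inr i.2) fun q => T q i.1) fun i q => T q i))
    (by
      rintro (i | i | i)
      · exact hppd _ _ _
      · exact hpd _ _
      · exact hTd _) (V q.1)
  simp only [Fintype.sum_sum_type, Fintype.sum_prod_type, Sum.elim_inl, Sum.elim_inr] at hsum
  have hslice : (fun p => intLaplacian g c T (p, q.2) a) = fun p =>
      ∑ A, ∑ B, (gram g c q.2)⁻¹ A B * pd (Sum.inr A) (pd (Sum.inr B) fun q => T q a) (p, q.2) +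
      (∑ e, ∑ A, β a e A q.2 * pd (Sum.inr A) (fun q => T q e) (p, q.2) +
      ∑ e, γ a e q.2 * T (p, q.2) e) := by
    funext p
    rw [hL T hT2 (p, q.2) ⟨trivial, hq.2⟩ a, add_assoc]
  rw [alongMink, hslice, hsum, hL _ hDT q hq a, add_assoc]
  simp only [hal q hq, hpal q hq, hppal]

theorem foldl_alongMink_intLaplacian (g : RMetric d K) {c : K} (l : List (GenIndex n))
    {T : Comp n d 2} (hT : IsSmoothComp c ((2 + l.length : ℕ) : WithTop ℕ∞) T) :
    ∀ q ∈ prodDom n c, ∀ a, l.foldl (fun S i => alongMink (genField i) S) (intLaplacian g c T) q a =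
      intLaplacian g c (l.foldl (fun S i => alongMink (genField i) S) T) q a := by
  induction l generalizing T with
  | nil => exact fun _ _ _ => rfl
  | cons i l ih =>
    intro q hq a
    simp only [List.foldl_cons]
    have h3 : IsSmoothComp c ((3 : ℕ) : WithTop ℕ∞) T := hT.of_le (by
      have : 3 ≤ 2 + (i :: l).length := by rw [List.length_cons]; omega
      exact_mod_cast this)
    rw [foldl_alongMink_congr l (fun q hq a => alongMink_intLaplacian g h3
      (contDiff_genField i) hq a) q hq a]
    refine ih (hT.alongMink ?_ (contDiff_genField i)) q hq a
    rw [List.length_cons]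
    norm_cast

theorem alongMink_genPow_intLaplacian (g : RMetric d K) {c : K} {r : ℕ} (I : Fin r → GenIndex n)
    {T : Comp n d 2} (hT : IsSmoothComp c ((3 + r : ℕ) : WithTop ℕ∞) T) {V : Mink n → Mink n}
    (hV : ContDiff ℝ 2 V) {q : Coord n d} (hq : q ∈ prodDom n c) (a : Fin 2 → Idx n d) :
    alongMink V (genPow I (intLaplacian g c T)) q a =
      intLaplacian g c (alongMink V (genPow I T)) q a := by
  rw [← alongMink_intLaplacian g (hT.genPow I) hV hq a]
  refine alongMink_congr (foldl_alongMink_intLaplacian g (List.ofFn I) (hT.of_le ?_)) V q hq a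
  rw [List.length_ofFn]
  exact_mod_cast (by omega : 2 + r ≤ 3 + r)

end Commutation

/-! ### Comparison with Lebesgue measure and with Euclidean norms in a chart. -/

section VolumeAndNorm

open Filter Topology

variable {n d : ℕ} {K : Type*} [TopologicalSpace K] [ChartedSpace (EuclideanSpace ℝ (Fin d)) K]
  [IsManifold 𝓘(ℝ, EuclideanSpace ℝ (Fin d)) ∞ K]

/-- Near any point, the Riemannian volume dominates Lebesgue measure in a suitable chart. -/
theorem exists_lintegral_chart_le [T2Space K] [CompactSpace K] [MeasurableSpace K] [BorelSpace K]
    (g : RMetric d K) (w₀ : K) :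
    ∃ c : K, w₀ ∈ (extChartAt 𝓘(ℝ, EuclideanSpace ℝ (Fin d)) c).source ∧ ∃ r₀ : ℝ, 0 < r₀ ∧
      Metric.closedBall (extChartAt 𝓘(ℝ, EuclideanSpace ℝ (Fin d)) c w₀) r₀ ⊆ chartDom c ∧
      ∃ C : ℝ≥0, ∀ F : K → ℝ≥0∞, Continuous F →
        ∫⁻ y in Metric.closedBall (extChartAt 𝓘(ℝ, EuclideanSpace ℝ (Fin d)) c w₀) r₀,
          F ((extChartAt 𝓘(ℝ, EuclideanSpace ℝ (Fin d)) c).symm y) ≤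
          C * ∫⁻ w, F w ∂(riemVolume g) := by
  -- The chart is chosen so that its partition function is positive at w₀. Its summand alone then
  -- has density bounded below near w₀, and the other summands are dropped.
  obtain ⟨c, hc⟩ := (chartPartition d K).exists_pos_of_mem (mem_univ w₀)
  have hsub : (chartPartition d K).IsSubordinate fun x =>
      (chartAt (EuclideanSpace ℝ (Fin d)) x).source :=
    (SmoothPartitionOfUnity.exists_isSubordinate_chartAt_source
      𝓘(ℝ, EuclideanSpace ℝ (Fin d)) K).choose_spec
  have hw : w₀ ∈ (extChartAt 𝓘(ℝ, EuclideanSpace ℝ (Fin d)) c).source := by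
    rw [extChartAt_source]
    exact hsub c (subset_tsupport _ hc.ne')
  refine ⟨c, hw, ?_⟩
  set φ := extChartAt 𝓘(ℝ, EuclideanSpace ℝ (Fin d)) c with hφ
  have hy : φ w₀ ∈ chartDom c := φ.map_source hw
  set ρ : Euc d → ℝ := fun y => chartPartition d K c (φ.symm y) * Real.sqrt (gram g c y).det
    with hρ
  have hdetc : ContinuousOn (fun y => (gram g c y).det) (chartDom c) := by
    simp only [Matrix.det_apply]
    exact continuousOn_finsetSum _ fun σ _ => (continuousOn_finsetProd _ fun i _ =>
      (contDiffOn_gram g c _ _).continuousOn).const_smul _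
  have hρc : ContinuousOn ρ (chartDom c) :=
    ((chartPartition d K c).2.continuous.comp_continuousOn
      (continuousOn_extChartAt_symm c)).mul hdetc.sqrt
  have hρ0 : 0 < ρ (φ w₀) := by
    simp only [hρ]
    rw [φ.left_inv hw]
    exact mul_pos hc (Real.sqrt_pos.mpr (posDef_gram g hy).det_pos)
  have hev : ∀ᶠ y in 𝓝 (φ w₀), ρ (φ w₀) / 2 < ρ y ∧ y ∈ chartDom c :=
    ((hρc.continuousAt ((isOpen_chartDom c).mem_nhds hy)).eventually_const_lt
      (half_lt_self hρ0)).and ((isOpen_chartDom c).mem_nhds hy)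
  obtain ⟨r₀, hr₀, hball⟩ := Metric.nhds_basis_closedBall.eventually_iff.mp hev
  refine ⟨r₀, hr₀, fun y hy => (hball hy).2, (ρ (φ w₀) / 2).toNNReal⁻¹, fun F hF => ?_⟩
  have hm : MeasurableSet (chartDom (d := d) c) := (isOpen_chartDom c).measurableSet
  set ν := (volume.restrict (chartDom c)).withDensity fun y => ENNReal.ofReal (ρ y) with hν
  have hsymm : AEMeasurable φ.symm (volume.restrict (chartDom c)) :=
    (continuousOn_extChartAt_symm c).aemeasurable hm
  have hρm : AEMeasurable (fun y => ENNReal.ofReal (ρ y)) (volume.restrict (chartDom c)) :=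
    (hρc.aemeasurable hm).ennreal_ofReal
  have h1 : ∫⁻ w, F w ∂(ν.map φ.symm) ≤ ∫⁻ w, F w ∂(riemVolume g) := by
    rw [riemVolume, lintegral_sum_measure]
    exact ENNReal.le_tsum (f := fun c : K => ∫⁻ w, F w ∂(((volume.restrict (extChartAt
      𝓘(ℝ, EuclideanSpace ℝ (Fin d)) c).target).withDensity fun y => ENNReal.ofReal
        (chartPartition d K c ((extChartAt 𝓘(ℝ, EuclideanSpace ℝ (Fin d)) c).symm y)
          * Real.sqrt (gram g c y).det)).map
      (extChartAt 𝓘(ℝ, EuclideanSpace ℝ (Fin d)) c).symm)) c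
  rw [lintegral_map' hF.measurable.aemeasurable
      (hsymm.mono_ac (withDensity_absolutelyContinuous _ _)),
    lintegral_withDensity_eq_lintegral_mul₀ hρm (g := fun a => F (φ.symm a)) (hF.measurable.comp_aemeasurable hsymm)] at h1
  have h2 : ENNReal.ofReal (ρ (φ w₀) / 2) * ∫⁻ y in Metric.closedBall (φ w₀) r₀, F (φ.symm y) ≤
      ∫⁻ y in chartDom c, ((fun y => ENNReal.ofReal (ρ y)) * fun a => F (φ.symm a)) y := by
    rw [← lintegral_const_mul' _ _ ENNReal.ofReal_ne_top]
    refine (setLIntegral_mono' measurableSet_closedBall fun y hy => ?_).trans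
      (lintegral_mono_set fun y hy => (hball hy).2)
    exact mul_le_mul' (ENNReal.ofReal_le_ofReal (hball hy).1.le) le_rfl
  have hne : (ρ (φ w₀) / 2).toNNReal ≠ 0 := by simpa using hρ0
  rw [ENNReal.coe_inv hne, ← ENNReal.div_eq_inv_mul, ENNReal.le_div_iff_mul_le (by simp [hρ0])
    (by simp), mul_comm]
  exact h2.trans h1

theorem posDef_fromBlocks_gram (g : RMetric d K) {c : K} {y : Euc d} (hy : y ∈ chartDom c) :
    (Matrix.fromBlocks (1 : Matrix (Fin (n + 1)) (Fin (n + 1)) ℝ) 0 0 (gram g c y)).PosDef := by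
  have h1 : (Matrix.fromBlocks (1 : Matrix (Fin (n + 1)) (Fin (n + 1)) ℝ) 0
      (0 : Matrix (Fin (n + 1)) (Fin d) ℝ).conjTranspose (gram g c y)).PosSemidef := by
    have : Invertible (1 : Matrix (Fin (n + 1)) (Fin (n + 1)) ℝ) := invertibleOne
    rw [Matrix.PosDef.fromBlocks₁₁ _ _ Matrix.PosDef.one]
    simpa using (posDef_gram g hy).posSemidef
  rw [Matrix.conjTranspose_zero] at h1
  exact h1.posDef_iff_isUnit.mpr ((Matrix.isUnit_iff_isUnit_det _).mpr
    (det_fromBlocks_gram_ne (by simp) g hy).isUnit)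

theorem normSqE_two_eq (g : RMetric d K) (c : K) (q : Coord n d) (T : (Fin 2 → Idx n d) → ℝ) :
    normSqE g c q T = ∑ a, ∑ b, (∏ j, (Matrix.fromBlocks
      (1 : Matrix (Fin (n + 1)) (Fin (n + 1)) ℝ) 0 0 (gram g c q.2))⁻¹ (a j) (b j)) * T a * T b := by
  simp only [normSqE, euclMetric_eq]

theorem continuousOn_inv_fromBlocks_gram (g : RMetric d K) (c : K) (a b : Idx n d) :
    ContinuousOn (fun y => (Matrix.fromBlocks (1 : Matrix (Fin (n + 1)) (Fin (n + 1)) ℝ) 0 0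
      (gram g c y))⁻¹ a b) (chartDom c) := by
  have h1 : ∀ a b, ContDiffOn ℝ ∞ (fun y => Matrix.fromBlocks
      (1 : Matrix (Fin (n + 1)) (Fin (n + 1)) ℝ) 0 0 (gram g c y) a b) (chartDom c) := by
    rintro (i | A) (j | B)
    · exact contDiffOn_const
    · exact contDiffOn_const
    · exact contDiffOn_const
    · exact contDiffOn_gram g c A B
  exact (contDiffOn_matrix_inv h1 (fun y hy => det_fromBlocks_gram_ne (by simp) g hy)
    a b).continuousOn

/-- On compact coordinate sets the invariant norm of `(0,2)`-tensors is equivalent to the Euclidean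
norm of the components. -/
theorem exists_normSqE_equiv (n : ℕ) (g : RMetric d K) (c : K) {Kc : Set (Euc d)}
    (hK : IsCompact Kc) (hKc : Kc ⊆ chartDom c) :
    ∃ κ : ℝ, 0 ≤ κ ∧ ∀ (p : Mink n), ∀ y ∈ Kc, ∀ T : (Fin 2 → Idx n d) → ℝ,
      normSqE g c (p, y) T ≤ κ * ∑ a, T a ^ 2 ∧ ∑ a, T a ^ 2 ≤ κ * normSqE g c (p, y) T := by
  classical
  set E : Euc d → Matrix (Idx n d) (Idx n d) ℝ := fun y => Matrix.fromBlocks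
      (1 : Matrix (Fin (n + 1)) (Fin (n + 1)) ℝ) 0 0 (gram g c y) with hE
  have hEpos : ∀ y ∈ Kc, (E y)⁻¹.PosDef := fun y hy => (posDef_fromBlocks_gram g (hKc hy)).inv
  have hEc : ∀ a b, ContinuousOn (fun y => (E y)⁻¹ a b) (chartDom c) :=
    continuousOn_inv_fromBlocks_gram g c
  -- Pairs of indices are enumerated so that the norm becomes an ordinary quadratic form. It is
  -- positive as the Kronecker square of the inverse metric, and the compactness bound applies.
  set e := Fintype.equivFin (Fin 2 → Idx n d) with he
  set k : Euc d → Matrix (Fin (Fintype.card (Fin 2 → Idx n d)))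
      (Fin (Fintype.card (Fin 2 → Idx n d))) ℝ := fun y => Matrix.of fun A B =>
        ∏ j, (E y)⁻¹ (e.symm A j) (e.symm B j) with hk
  have hkc : ∀ A B, ContinuousOn (fun y => k y A B) Kc := fun A B => by
    simp only [hk, Matrix.of_apply]
    exact continuousOn_finsetProd _ fun j _ => (hEc _ _).mono hKc
  have hsymm : ∀ y ∈ Kc, (k y).IsSymm := fun y hy => by
    ext A B
    simp only [hk, Matrix.transpose_apply, Matrix.of_apply]
    refine Finset.prod_congr rfl fun j _ => ?_
    have := (hEpos y hy).isHermitian.apply (e.symm A j) (e.symm B j)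
    simpa using this
  have hquad : ∀ y (z : EuclideanSpace ℝ (Fin (Fintype.card (Fin 2 → Idx n d)))),
      quadForm (k y) z = ∑ a, ∑ b, (∏ j, (E y)⁻¹ (a j) (b j)) * z (e a) * z (e b) := by
    intro y z
    rw [quadForm, ← e.sum_comp]
    refine Finset.sum_congr rfl fun a _ => ?_
    rw [← e.sum_comp]
    simp [hk]
  have hpos : ∀ y ∈ Kc, ∀ z, z ≠ 0 → 0 < quadForm (k y) z := by
    intro y hy z hz
    have h1 := (hEpos y hy).kronecker (hEpos y hy)
    set x : Idx n d × Idx n d → ℝ := fun p => z (e ((finTwoArrowEquiv _).symm p)) with hx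
    have hx0 : x ≠ 0 := by
      intro h0
      refine hz ?_
      ext A
      have h2 := congrFun h0 (finTwoArrowEquiv _ (e.symm A))
      simp only [hx, Equiv.symm_apply_apply, Equiv.apply_symm_apply] at h2
      exact h2
    refine (h1.dotProduct_mulVec_pos hx0).trans_eq ?_
    rw [hquad, ← (finTwoArrowEquiv (Idx n d)).symm.sum_comp]
    simp only [dotProduct, Matrix.mulVec, Pi.star_apply, star_trivial, Finset.mul_sum]
    refine Finset.sum_congr rfl fun p _ => ?_
    rw [← (finTwoArrowEquiv (Idx n d)).symm.sum_comp]
    refine Finset.sum_congr rfl fun r _ => ?_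
    simp [hx, Fin.prod_univ_two]
    ring
  obtain ⟨lam, Λ, hlam, hΛ, hell⟩ := exists_isElliptic_of_isCompact hK hkc hsymm hpos
  refine ⟨max Λ lam⁻¹, le_max_of_le_left hΛ, fun p y hy T => ?_⟩
  set z : EuclideanSpace ℝ (Fin (Fintype.card (Fin 2 → Idx n d))) :=
    WithLp.toLp 2 fun A => T (e.symm A) with hz
  have hzn : ‖z‖ ^ 2 = ∑ a, T a ^ 2 := by
    rw [EuclideanSpace.real_norm_sq_eq, ← e.sum_comp]
    simp [hz]
  have hq : quadForm (k y) z = normSqE g c (p, y) T := by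
    rw [hquad, normSqE_two_eq]
    simp [hz, hE]
  obtain ⟨-, -, hlow, hup⟩ := hell y hy
  have h1 := hlow z
  have h2 := hup z
  rw [hzn, hq] at h1 h2
  have hs0 : 0 ≤ ∑ a, T a ^ 2 := Finset.sum_nonneg fun a _ => sq_nonneg _
  have hn0 : 0 ≤ normSqE g c (p, y) T := (mul_nonneg hlam.le hs0).trans h1
  refine ⟨h2.trans (mul_le_mul_of_nonneg_right (le_max_left _ _) hs0), ?_⟩
  calc ∑ a, T a ^ 2 = lam⁻¹ * (lam * ∑ a, T a ^ 2) := by field_simp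
    _ ≤ lam⁻¹ * normSqE g c (p, y) T := by gcongr
    _ ≤ _ := mul_le_mul_of_nonneg_right (le_max_right _ _) hn0

end VolumeAndNorm

/-! ### Slices: Sobolev along the hyperboloid and in the internal manifold. -/

section HyperboloidSlices

variable {n d : ℕ} {K : Type*} [TopologicalSpace K] [ChartedSpace (EuclideanSpace ℝ (Fin d)) K]

theorem hypPoint_zero (s : ℝ) (y : Euc n) : hypPoint s y 0 = hypTime s y := rfl

theorem spatial_hypPoint (s : ℝ) (y : Euc n) : spatial (hypPoint s y) = y := by
  ext i
  rfl

theorem hypTime_pos {s : ℝ} (hs : 0 < s) (y : Euc n) : 0 < hypTime s y :=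
  hs.trans_le (le_hypTime s y)

theorem contDiff_hypPoint {s : ℝ} (hs : 0 < s) {m : WithTop ℕ∞} :
    ContDiff ℝ m (hypPoint s : Euc n → Mink n) := by
  rw [contDiff_euclidean]
  refine Fin.cases ?_ fun i => ?_
  · exact (contDiff_const.add (contDiff_norm_sq ℝ)).sqrt fun y => by positivity
  · exact contDiff_coord i

/-- Along Σ_s, parametrised by x, partial derivatives are the fields Y_i: the chain rule together
with `hasDerivAt_hypPoint`. -/
theorem fderiv_comp_hypPoint {s : ℝ} (hs : 0 < s) {G : Mink n → ℝ} {x : Euc n}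
    (hG : DifferentiableAt ℝ G (hypPoint s x)) (i : Fin n) :
    fderiv ℝ (fun x => G (hypPoint s x)) x (EuclideanSpace.single i 1) =
      fderiv ℝ G (hypPoint s x) (hypField i (hypPoint s x)) := by
  have h1 : HasFDerivAt (hypPoint s : Euc n → Mink n) (fderiv ℝ (hypPoint s) x) x :=
    ((contDiff_hypPoint hs (m := 1)).differentiable one_ne_zero x).hasFDerivAt
  have h2 : HasFDerivAt (fun x => G (hypPoint s x)) _ x := hG.hasFDerivAt.comp x h1
  rw [h2.fderiv, ContinuousLinearMap.comp_apply]
  congr 1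
  have h3 := h1.hasLineDerivAt (EuclideanSpace.single i (1 : ℝ))
  exact h3.unique (hasDerivAt_hypPoint hs x i)

/-- The label of the boost mixing `t` and `xⁱ`. -/
def boost (i : Fin n) : GenIndex n := Sum.inr ⟨(0, i.succ), i.succ_pos⟩

/-- The boost x_i ∂_t + t ∂_i is t·Y_i; this is the source of the time weight. -/
theorem genField_boost (i : Fin n) {p : Mink n} (hp : p 0 ≠ 0) :
    genField (boost i) p = p 0 • hypField i p := by
  simp only [boost, genField, hypField, eta, Matrix.diagonal_apply, ite_mul, zero_mul,
    Finset.sum_ite_eq, Finset.mem_univ, if_true, i.succ_ne_zero, if_false, smul_add, smul_smul]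
  rw [mul_div_cancel₀ _ hp]
  module

variable {c : K}

theorem alongMink_boost {k : ℕ} (T : Comp n d k) (i : Fin n) {p : Mink n} (hp : p 0 ≠ 0)
    (y : Euc d) (a : Fin k → Idx n d) :
    alongMink (genField (boost i)) T (p, y) a = p 0 * alongMink (hypField i) T (p, y) a := by
  simp only [alongMink, genField_boost i hp, map_smul, smul_eq_mul]

/-- The hyperboloidal Sobolev inequality for the components of a tensor field, at a fixed point of
the internal manifold. -/
theorem exists_slice_sobolev (hn : 4 ≤ n) {M : ℕ} (hM : (n : ℝ) / 2 < M) (hMn : M < n)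
    {s₀ : ℝ} (hs₀ : 1 < s₀) : ∃ C : ℝ≥0, ∀ (c : K) (m : ℕ) (T : Comp n d m),
      IsSmoothComp c (M : WithTop ℕ∞) T → ∀ y ∈ chartDom (d := d) c, ∀ a, ∀ s, s₀ ≤ s → ∀ B : ℝ,
      (∀ x, ‖x‖ = (s ^ 2 - 1) / 2 →
        |T (hypPoint s x, y) a| ≤ B * ((s ^ 2 - 1) / 2) ^ (-((n : ℝ) - 1) / 2)) →
      ∀ x₀, ‖x₀‖ ≤ (s ^ 2 - 1) / 2 →
        ENNReal.ofReal (hypTime s x₀ ^ ((n : ℝ) - 2)) * ‖T (hypPoint s x₀, y) a‖ₑ ^ 2 ≤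
          C * ((∑ k ∈ Finset.range M, ∑ I : Fin k → Fin n, ∑ i : Fin n,
            ∫⁻ x in Metric.closedBall (0 : Euc n) ((s ^ 2 - 1) / 2),
              ‖alongMink (hypField i) (genPow (boost ∘ I) T) (hypPoint s x, y) a‖ₑ ^ 2) +
            ENNReal.ofReal (B ^ 2)) := by
  obtain ⟨C, hC⟩ := exists_hyperboloid_sobolev hn hM hMn hs₀
  refine ⟨C, fun c m T hT y hy a s hs B hB x₀ hx₀ => ?_⟩
  have hs0 : 0 < s := by linarith
  have hgen : ∀ (r k : ℕ) (I : Fin k → Fin n), r + k ≤ M →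
      ContDiff ℝ r fun p => genPow (boost ∘ I) T (p, y) a := fun r k I h => by
    have h1 : IsSmoothComp c ((r + k : ℕ) : WithTop ℕ∞) T := hT.of_le (by exact_mod_cast h)
    rw [← contDiffOn_univ]
    exact (h1.genPow (boost ∘ I) a).comp (contDiff_id.prodMk contDiff_const).contDiffOn
      fun p _ => ⟨trivial, hy⟩
  have hfd : ∀ k < M, ∀ (I : Fin k → Fin n) i x,
      fderiv ℝ (fun x => genPow (boost ∘ I) T (hypPoint s x, y) a) x
        (EuclideanSpace.single i 1) =
      alongMink (hypField i) (genPow (boost ∘ I) T) (hypPoint s x, y) a := fun k hk I i x =>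
    fderiv_comp_hypPoint hs0 (G := fun p => genPow (boost ∘ I) T (p, y) a)
      ((hgen 1 k I (by omega)).differentiable one_ne_zero _) i
  -- The family consists of iterated boosts restricted to Σ_s; appending an index applies one more
  -- boost, that is t·∂_i in the coordinates x.
  have := hC s hs (fun k I x => genPow (boost ∘ I) T (hypPoint s x, y) a)
    (fun k hk I => (hgen 1 k I (by omega)).comp (contDiff_hypPoint hs0))
    (fun k hk I => ((hgen 0 k I (by omega)).continuous).comp
      (contDiff_hypPoint hs0 (m := 0)).continuous)
    (fun k hk I i x => by
      rw [hfd k hk, Fin.comp_snoc, genPow_snoc, alongMink_boost _ _ (hypTime_pos hs0 x).ne']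
      rfl)
    B hB x₀ hx₀
  refine this.trans (mul_le_mul_right (add_le_add_left (Finset.sum_le_sum fun k hk =>
    Finset.sum_le_sum fun I _ => Finset.sum_le_sum fun i _ => ?_) _) _)
  simp only [hfd k (Finset.mem_range.mp hk)]
  exact le_rfl

variable [IsManifold 𝓘(ℝ, EuclideanSpace ℝ (Fin d)) ∞ K]

/-- Interior estimate for the internal Laplacian, uniformly in the Minkowski coordinates. -/
theorem exists_internal_sobolev (n : ℕ) [NeZero d] (g : RMetric d K) (c : K) {y₀ : Euc d} {r₀ : ℝ}
    (hr₀ : 0 < r₀) (hball : Metric.closedBall y₀ r₀ ⊆ chartDom c) {M : ℕ}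
    (hM : (d : ℝ) / 2 < 2 * M) :
    ∃ C : ℝ≥0, ∀ S : ℕ → Comp n d 2, (∀ j < M, IsSmoothComp c ((2 : ℕ) : WithTop ℕ∞) (S j)) →
      IsSmoothComp c ((0 : ℕ) : WithTop ℕ∞) (S M) →
      (∀ j < M, ∀ q ∈ prodDom n c, ∀ a, S (j + 1) q a = intLaplacian g c (S j) q a) →
      ∀ (p : Mink n), ∀ y ∈ Metric.closedBall y₀ (r₀ / 2), (∑ a, ‖S 0 (p, y) a‖ₑ) ^ 2 ≤
        C * ∑ j ∈ Finset.range (M + 1), ∫⁻ y in Metric.closedBall y₀ r₀,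
          (∑ a, ‖S j (p, y) a‖ₑ) ^ 2 := by
  obtain ⟨β, γ, hβ, hγ, hL⟩ := exists_intLaplacian_eq n g c
  obtain ⟨C, hC⟩ := exists_elliptic_sup_bound (isOpen_chartDom c) hr₀ hball
    (k := gram g c) (h := fun A B y => (gram g c y)⁻¹ A B)
    (fun A B => (contDiffOn_gram g c A B).continuousOn) (fun y _ => isSymm_gram g c y)
    (fun y hy z hz => quadForm_gram_pos g hy z hz)
    (fun A B => (contDiffOn_matrix_inv (contDiffOn_gram g c) (fun y hy => (posDef_gram g
      hy).det_pos.ne') A B).of_le ENat.LEInfty.out)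
    (fun y hy => gram_inv_mul g hy)
    (fun a e A => (hβ a e A).of_le ENat.LEInfty.out)
    (fun a e => (hγ a e).continuousOn) hM
  refine ⟨C, fun S hS hSM hLS p => ?_⟩
  have hslice : ∀ {m : WithTop ℕ∞} {j : ℕ}, IsSmoothComp c m (S j) → ∀ a,
      ContDiffOn ℝ m (fun y => S j (p, y) a) (chartDom c) := fun h a =>
    (h a).comp (contDiff_const.prodMk contDiff_id).contDiffOn fun y hy => ⟨trivial, hy⟩
  refine hC (fun j a y => S j (p, y) a) (fun j hj a => hslice (hS j hj) a)
    (fun a => (hslice hSM a).continuousOn) fun j hj a y hy => ?_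
  have hq : ((p, y) : Coord n d) ∈ prodDom n c := ⟨trivial, hy⟩
  have h1 : ∀ e A, ∀ y ∈ chartDom c, pdE A (fun y => S j (p, y) e) y =
      pd (Sum.inr A) (fun q => S j q e) (p, y) := fun e A y hy =>
    fderiv_slice_snd (q := (p, y)) ((hS j hj).differentiableAt (by simp) e ⟨trivial, hy⟩) _
  have h2 : ∀ A B, pdE A (pdE B fun y => S j (p, y) a) y =
      pd (Sum.inr A) (pd (Sum.inr B) fun q => S j q a) (p, y) := fun A B => by
    have h3 : DifferentiableAt ℝ (pd (Sum.inr B) fun q => S j q a) (p, y) :=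
      ((contDiffOn_pd (m' := 1) (isOpen_prodDom c) (hS j hj a) (by norm_num) _).contDiffAt
        ((isOpen_prodDom c).mem_nhds hq)).differentiableAt one_ne_zero
    have h4 := fderiv_slice_snd (q := (p, y)) h3 (EuclideanSpace.single A 1)
    refine Eq.trans ?_ h4
    refine congrArg (fun L : Euc d →L[ℝ] ℝ => L (EuclideanSpace.single A 1))
      (Filter.EventuallyEq.fderiv_eq ?_)
    filter_upwards [(isOpen_chartDom c).mem_nhds hy] with y hy using h1 a B y hy
  simp only [h2, h1 _ _ y hy]
  exact (hLS j hj _ hq a).trans (hL (S j) (hS j hj) _ hq a)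

end HyperboloidSlices

theorem sum_enorm_sq_le {ι : Type*} [Fintype ι] (f : ι → ℝ) :
    (∑ a, ‖f a‖ₑ) ^ 2 ≤ ENNReal.ofReal (Fintype.card ι * ∑ a, f a ^ 2) := by
  have h1 : ∑ a, ‖f a‖ₑ = ENNReal.ofReal (∑ a, |f a|) := by
    rw [ENNReal.ofReal_sum_of_nonneg fun a _ => abs_nonneg _]
    exact Finset.sum_congr rfl fun a _ => Real.enorm_eq_ofReal_abs _
  rw [h1, ← ENNReal.ofReal_pow (Finset.sum_nonneg fun a _ => abs_nonneg _)]
  refine ENNReal.ofReal_le_ofReal ?_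
  have h2 := sq_sum_le_card_mul_sum_sq (s := Finset.univ) (f := fun a => |f a|)
  simpa using h2

/-! ### From integrals at one internal point to energies over the whole internal manifold. -/

section EnergyDensity

open Filter Topology

variable {n d : ℕ} {K : Type*} [TopologicalSpace K] [ChartedSpace (EuclideanSpace ℝ (Fin d)) K]

theorem continuousOn_alongMink_hypField {c : K} {k : ℕ} {T : Comp n d k}
    (hT : IsSmoothComp c ((1 : ℕ) : WithTop ℕ∞) T) (i : Fin n) (a : Fin k → Idx n d) :
    ContinuousOn (fun q => alongMink (hypField i) T q a) (prodDom n c ∩ {q | q.1 0 ≠ 0}) := by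
  have hc : ∀ j, Continuous fun q : Coord n d => q.1 j := fun j =>
    (EuclideanSpace.proj (𝕜 := ℝ) j).continuous.comp continuous_fst
  have h1 : ContinuousOn (fun q : Coord n d => hypField i q.1) {q | q.1 0 ≠ 0} :=
    continuousOn_const.add ((ContinuousOn.div (hc _).continuousOn (hc _).continuousOn
      fun q hq => hq).smul continuousOn_const)
  have h2 : ContinuousOn (fun q => fderiv ℝ (fun q => T q a) q ((hypField i q.1, 0) : Coord n d))
      (prodDom n c ∩ {q | q.1 0 ≠ 0}) :=
    (((hT a).continuousOn_fderiv_of_isOpen (isOpen_prodDom c) (by simp)).mono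
      inter_subset_left).clm_apply ((h1.mono inter_subset_right).prodMk continuousOn_const)
  exact h2.congr fun q hq => alongMink_eq (hT.differentiableAt (by simp) a hq.1) _

variable [IsManifold 𝓘(ℝ, EuclideanSpace ℝ (Fin d)) ∞ K]

theorem isSmoothComp_genPow_iterate (g : RMetric d K) {u : TensorField n d K} {N r j m : ℕ}
    (hu : u.IsCk (N : WithTop ℕ∞)) (hN : r + 2 * j + m ≤ N) (I : Fin r → GenIndex n) (c : K) :
    IsSmoothComp c (m : WithTop ℕ∞) (genPow I ((intLaplacian g c)^[j] (u.comp c))) := by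
  have h1 : IsSmoothComp c (N : WithTop ℕ∞) (u.comp c) := fun a =>
    contDiffOn_comp (by exact_mod_cast le_top) hu c a
  refine IsSmoothComp.genPow I (IsSmoothComp.intLaplacian_iterate j (h1.of_le ?_))
  exact_mod_cast (by omega : m + r + 2 * j ≤ N)

/-- The density at w is computed in the chart centred at w, which varies with w. Near any point it
can be rewritten in one fixed chart, where continuity is visible. -/
theorem continuous_termSq (g : RMetric d K) {u : TensorField n d K} {r j N : ℕ} (i : Fin n)
    (I : Fin r → GenIndex n) (hu : u.IsCk (N : WithTop ℕ∞)) (hN : r + 2 * j + 1 ≤ N) {p : Mink n}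
    (hp : p 0 ≠ 0) : Continuous fun w => termSq g u i I j (p, w) := by
  rw [continuous_iff_continuousAt]
  intro c
  set φ := extChartAt 𝓘(ℝ, EuclideanSpace ℝ (Fin d)) c with hφ
  set Q := alongMink (hypField i) (genPow I ((intLaplacian g c)^[j] (u.comp c))) with hQ
  have hQc : ∀ a, ContinuousOn (fun y => Q (p, y) a) (chartDom c) := fun a =>
    (continuousOn_alongMink_hypField (isSmoothComp_genPow_iterate g hu hN I c) i a).comp
      (by fun_prop) fun y hy => ⟨⟨trivial, hy⟩, hp⟩
  have h1 : ContinuousOn (fun y => normSqE g c (p, y) (Q (p, y))) (chartDom c) := by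
    simp only [normSqE_two_eq]
    exact continuousOn_finsetSum _ fun a _ => continuousOn_finsetSum _ fun b _ =>
      ((continuousOn_finsetProd _ fun j _ => continuousOn_inv_fromBlocks_gram g c _ _).mul
        (hQc a)).mul (hQc b)
  have h2 : ContinuousAt (fun w => normSqE g c (p, φ w) (Q (p, φ w))) c :=
    ContinuousAt.comp (g := fun y => normSqE g c (p, y) (Q (p, y)))
      (h1.continuousAt ((isOpen_chartDom c).mem_nhds (φ.map_source (mem_extChartAt_source c))))
      (continuousAt_extChartAt c)
  refine h2.congr ?_
  filter_upwards [extChartAt_source_mem_nhds (I := 𝓘(ℝ, EuclideanSpace ℝ (Fin d))) c] with w hw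
  rw [← termSq_eq g i I hu hN (φ.map_source hw) p, φ.left_inv hw]

variable [T2Space K] [CompactSpace K] [MeasurableSpace K]

/-- The square integral over a slice at a fixed internal point of a component of `Y_i Z^I u` is
controlled by the energies of `Y_i Z^I Δ^j u`. -/
theorem exists_lintegral_slice_le (n : ℕ) [NeZero d] (g : RMetric d K) {c : K} {y₀ : Euc d}
    {r₀ : ℝ} (hr₀ : 0 < r₀) (hball : Metric.closedBall y₀ r₀ ⊆ chartDom c) {Cv : ℝ≥0}
    (hCv : ∀ F : K → ℝ≥0∞, Continuous F → ∫⁻ y in Metric.closedBall y₀ r₀,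
      F ((extChartAt 𝓘(ℝ, EuclideanSpace ℝ (Fin d)) c).symm y) ≤
      Cv * ∫⁻ w, F w ∂(riemVolume g)) {M : ℕ} (hM : (d : ℝ) / 2 < 2 * M) :
    ∃ C : ℝ≥0, ∀ (u : TensorField n d K) (N : ℕ), u.IsCk (N : WithTop ℕ∞) →
      ∀ (k : ℕ) (I : Fin k → GenIndex n) (i : Fin n), k + 2 * M + 1 ≤ N → ∀ s > 0, ∀ R : ℝ,
      ∀ y ∈ Metric.closedBall y₀ (r₀ / 2), ∀ a,
      ∫⁻ x in Metric.closedBall (0 : Euc n) R,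
        ‖alongMink (hypField i) (genPow I (u.comp c)) (hypPoint s x, y) a‖ₑ ^ 2 ≤
      C * ∑ j ∈ Finset.range (M + 1), ∫⁻ x in Metric.closedBall (0 : Euc n) R,
        ∫⁻ w, ENNReal.ofReal (termSq g u i I j (hypPoint s x, w)) ∂(riemVolume g) := by
  obtain ⟨κ, hκ, hnorm⟩ := exists_normSqE_equiv n g c (isCompact_closedBall y₀ r₀) hball
  obtain ⟨C, hC⟩ := exists_internal_sobolev n g c hr₀ hball hM
  set A := (Fintype.card (Fin 2 → Idx n d) * κ).toNNReal with hA
  refine ⟨C * (A * Cv), fun u N hu k I i hN s hs R y hy a => ?_⟩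
  set Q : ℕ → Comp n d 2 := fun j => genPow I ((intLaplacian g c)^[j] (u.comp c)) with hQ
  have hQs : ∀ j m, j ≤ M → m ≤ 2 * (M - j) + 1 → IsSmoothComp c (m : WithTop ℕ∞) (Q j) :=
    fun j m hj hm => isSmoothComp_genPow_iterate g hu (by omega) I c
  have hp : ∀ x : Euc n, hypPoint s x 0 ≠ 0 := fun x => (hypTime_pos hs x).ne'
  set G : ℕ → Euc n → ℝ≥0∞ := fun j x => ∫⁻ y in Metric.closedBall y₀ r₀,
    (∑ a, ‖alongMink (hypField i) (Q j) (hypPoint s x, y) a‖ₑ) ^ 2 with hG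
  have hpt : ∀ x, ‖alongMink (hypField i) (Q 0) (hypPoint s x, y) a‖ₑ ^ 2 ≤
      C * ∑ j ∈ Finset.range (M + 1), G j x := by
    intro x
    -- Y_i is frozen at the point under consideration: the value there is unchanged, and a constant
    -- field is smooth, whereas Y_i is singular at t = 0.
    set V : Mink n → Mink n := fun _ => hypField i (hypPoint s x) with hV
    have h1 : ‖alongMink (hypField i) (Q 0) (hypPoint s x, y) a‖ₑ ^ 2 ≤
        (∑ a, ‖alongMink V (Q 0) (hypPoint s x, y) a‖ₑ) ^ 2 := by
      gcongr
      exact Finset.single_le_sum (f := fun a => ‖alongMink V (Q 0) (hypPoint s x, y) a‖ₑ)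
        (fun _ _ => zero_le) (Finset.mem_univ a)
    refine h1.trans (hC (fun j => alongMink V (Q j)) (fun j hj => ?_) ?_ ?_ (hypPoint s x) y hy)
    · exact (hQs j 3 hj.le (by omega)).alongMink (by norm_cast) contDiff_const
    · exact (hQs M 1 le_rfl (by omega)).alongMink (by norm_cast) contDiff_const
    · intro j hj q hq a
      have h2 : IsSmoothComp c ((3 + k : ℕ) : WithTop ℕ∞) ((intLaplacian g c)^[j] (u.comp c)) :=
        isSmoothComp_genPow_iterate g hu (r := 0) (by omega) Fin.elim0 c
      simp only [hQ, Function.iterate_succ_apply']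
      exact alongMink_genPow_intLaplacian g I h2 contDiff_const hq a
  -- Measurability in x is required to interchange the sum over j with the integral over the slice.
  have hGm : ∀ j ≤ M, AEMeasurable (G j) (volume.restrict (Metric.closedBall (0 : Euc n) R)) := by
    intro j hj
    have h1 : ContinuousOn (fun z : Euc n × Euc d =>
        (∑ a, ‖alongMink (hypField i) (Q j) (hypPoint s z.1, z.2) a‖ₑ) ^ 2)
        (Metric.closedBall (0 : Euc n) R ×ˢ Metric.closedBall y₀ r₀) := by
      have h2 : ∀ a, ContinuousOn (fun z : Euc n × Euc d =>
          alongMink (hypField i) (Q j) (hypPoint s z.1, z.2) a)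
          (Metric.closedBall (0 : Euc n) R ×ˢ Metric.closedBall y₀ r₀) := fun a =>
        (continuousOn_alongMink_hypField (hQs j 1 hj (by omega)) i a).comp
          (((contDiff_hypPoint hs (m := 0)).continuous.comp continuous_fst).prodMk
            continuous_snd).continuousOn fun z hz => ⟨⟨trivial, hball hz.2⟩, hp z.1⟩
      exact (ENNReal.continuous_pow 2).comp_continuousOn
        (continuousOn_finsetSum _ fun a _ => (h2 a).enorm)
    have h3 := h1.aemeasurable (μ := volume)
      (measurableSet_closedBall.prod measurableSet_closedBall)
    rw [Measure.volume_eq_prod, ← Measure.prod_restrict] at h3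
    exact h3.lintegral_prod_right'
  have hGle : ∀ j ≤ M, ∀ x, G j x ≤ (A * Cv : ℝ≥0) *
      ∫⁻ w, ENNReal.ofReal (termSq g u i I j (hypPoint s x, w)) ∂(riemVolume g) := by
    intro j hj x
    have hF : Continuous fun w => ENNReal.ofReal (termSq g u i I j (hypPoint s x, w)) :=
      ENNReal.continuous_ofReal.comp (continuous_termSq g i I hu (by omega) (hp x))
    have h1 : G j x ≤ A * ∫⁻ y in Metric.closedBall y₀ r₀, ENNReal.ofReal (termSq g u i I j
        (hypPoint s x, (extChartAt 𝓘(ℝ, EuclideanSpace ℝ (Fin d)) c).symm y)) := by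
      rw [← lintegral_const_mul' _ _ ENNReal.coe_ne_top]
      refine setLIntegral_mono' measurableSet_closedBall fun y hy => (sum_enorm_sq_le _).trans ?_
      rw [termSq_eq g i I hu (by omega) (hball hy), hA, ← ENNReal.ofReal_coe_nnreal,
        ← ENNReal.ofReal_mul NNReal.zero_le_coe, Real.coe_toNNReal _ (by positivity), mul_assoc]
      exact ENNReal.ofReal_le_ofReal (mul_le_mul_of_nonneg_left (hnorm _ y hy _).2 (by positivity))
    refine h1.trans ?_
    rw [ENNReal.coe_mul, mul_assoc]
    exact mul_le_mul_right (hCv _ hF) _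
  calc _ ≤ ∫⁻ x in Metric.closedBall (0 : Euc n) R, C * ∑ j ∈ Finset.range (M + 1), G j x :=
        lintegral_mono fun x => hpt x
    _ = C * ∑ j ∈ Finset.range (M + 1), ∫⁻ x in Metric.closedBall (0 : Euc n) R, G j x := by
        rw [lintegral_const_mul' _ _ ENNReal.coe_ne_top, lintegral_finsetSum' _ fun j hj =>
          hGm j (Nat.lt_succ_iff.mp (Finset.mem_range.mp hj))]
    _ ≤ _ := by
        rw [ENNReal.coe_mul, mul_assoc, Finset.mul_sum (a := ((A * Cv : ℝ≥0) : ℝ≥0∞))]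
        refine mul_le_mul_right (Finset.sum_le_sum fun j hj => ?_) _
        rw [← lintegral_const_mul' _ _ ENNReal.coe_ne_top]
        exact lintegral_mono fun x => hGle j (Nat.lt_succ_iff.mp (Finset.mem_range.mp hj)) x

end EnergyDensity

/-! ### Arithmetic of the differentiability orders, and geometry of the truncated hyperboloid. -/

theorem dTilde_spec (d : ℕ) : Even (dTilde d) ∧ (d : ℝ) / 2 < dTilde d := by
  refine Nat.sInf_mem (s := {m : ℕ | Even m ∧ (d : ℝ) / 2 < m}) ⟨2 * (d + 1), even_two_mul _, ?_⟩
  push_cast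
  have : (0 : ℝ) ≤ d := d.cast_nonneg
  linarith

theorem lt_nuTilde (n d : ℕ) : (n : ℝ) / 2 + dTilde d < nuTilde n d := by
  refine Nat.sInf_mem (s := {m : ℕ | (n : ℝ) / 2 + dTilde d < m}) ⟨n + dTilde d + 1, ?_⟩
  change (n : ℝ) / 2 + dTilde d < ((n + dTilde d + 1 : ℕ) : ℝ)
  push_cast
  have : (0 : ℝ) ≤ n := n.cast_nonneg
  linarith

/-- By minimality. This leaves at most n/2 + 1 derivatives for the hyperboloid, fewer than n, as the
composition of potentials requires. -/
theorem nuTilde_le (n d : ℕ) : (nuTilde n d : ℝ) ≤ (n : ℝ) / 2 + dTilde d + 1 := by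
  by_contra h
  push Not at h
  have h0 : 1 ≤ nuTilde n d := by
    have := lt_nuTilde n d
    have h1 : (0 : ℝ) < nuTilde n d := lt_of_le_of_lt (by positivity) this
    exact_mod_cast h1
  have h1 : nuTilde n d ≤ nuTilde n d - 1 := Nat.sInf_le (by
    change (n : ℝ) / 2 + dTilde d < ((nuTilde n d - 1 : ℕ) : ℝ)
    push_cast [h0]
    linarith)
  omega

/-- Here s² ≤ 2|y| + 1, hence t² = s² + |y|² ≤ (|y| + 1)². -/
theorem hypTime_le_norm_add_one {n : ℕ} {s : ℝ} {y : Euc n} (h : (s ^ 2 - 1) / 2 ≤ ‖y‖) :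
    hypTime s y ≤ ‖y‖ + 1 := by
  refine Real.sqrt_le_iff.mpr ⟨by positivity, ?_⟩
  nlinarith

theorem eq_hypPoint_of_mem_hyperboloid {n : ℕ} {s : ℝ} {p : Mink n} (hp : p ∈ hyperboloid n s) :
    p = hypPoint s (spatial p) := by
  obtain ⟨h0, h1, h2⟩ := hp
  ext i
  refine Fin.cases ?_ (fun i => rfl) i
  have h3 : s ^ 2 = p 0 ^ 2 - ‖spatial p‖ ^ 2 := by
    rw [← h2, Real.sq_sqrt]
    nlinarith [norm_nonneg (spatial p)]
  rw [hypPoint_zero, hypTime, h3, sub_add_cancel, Real.sqrt_sq h0.le]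

/-! ### Assembly of the interior and exterior pointwise bounds. -/

section SupBound

open Filter Topology

variable {n d : ℕ} {K : Type*} [TopologicalSpace K] [ChartedSpace (EuclideanSpace ℝ (Fin d)) K]
  [IsManifold 𝓘(ℝ, EuclideanSpace ℝ (Fin d)) ∞ K]

theorem normE_congr (g : RMetric d K) {u f : TensorField n d K} {p : Mink n}
    (h : ∀ w, u (p, w) = f (p, w)) (w : K) : normE g u (p, w) = normE g f (p, w) := by
  have : u.comp w (coordOf (p, w)) = f.comp w (coordOf (p, w)) := by
    funext a
    simp only [TensorField.comp, coordOf, h]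
  simp only [normE, this]

variable [T2Space K] [CompactSpace K] [MeasurableSpace K]

/-- Each integral of an admissible order is one of the nonnegative summands of the energy. -/
theorem lintegral_termSq_le_hypEnergy (g : RMetric d K) (u : TensorField n d K) {N k j : ℕ}
    (h : k + 2 * j ≤ N) (I : Fin k → GenIndex n) (i : Fin n) (s : ℝ) :
    ∫⁻ x in Metric.closedBall (0 : Euc n) ((s ^ 2 - 1) / 2),
      ∫⁻ w, ENNReal.ofReal (termSq g u i I j (hypPoint s x, w)) ∂(riemVolume g) ≤
      hypEnergy g u N s := by
  have h1 : Metric.closedBall (0 : Euc n) ((s ^ 2 - 1) / 2) =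
      {x : EuclideanSpace ℝ (Fin n) | ‖x‖ ≤ (hypPoint s x) 0 - 1} := by
    ext x
    rw [mem_closedBall_zero_iff, ← hypTime_le_iff]
    rfl
  rw [h1, hypEnergy]
  have hmem : (k, j) ∈ (Finset.range (N + 1) ×ˢ Finset.range (N + 1)).filter
      (fun kj : ℕ × ℕ => kj.1 + 2 * kj.2 ≤ N) := by
    simp only [Finset.mem_filter, Finset.mem_product, Finset.mem_range]
    omega
  refine le_trans ?_ (Finset.single_le_sum (fun _ _ => zero_le) hmem)
  refine le_trans ?_ (Finset.single_le_sum (fun _ _ => zero_le) (Finset.mem_univ I))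
  exact Finset.single_le_sum (f := fun i => ∫⁻ x in {x : EuclideanSpace ℝ (Fin n) |
    ‖x‖ ≤ (hypPoint s x) 0 - 1}, ∫⁻ w, ENNReal.ofReal (termSq g u i I j (hypPoint s x, w))
      ∂(riemVolume g)) (fun _ _ => zero_le) (Finset.mem_univ i)

variable [BorelSpace K]

/-- The weighted pointwise estimate in the solid hyperboloidal region, near a point of the internal
manifold. -/
theorem exists_local_bound (hn : 4 ≤ n) [NeZero d] (g : RMetric d K) {s₀ : ℝ} (hs₀ : 1 < s₀)
    {ν M N : ℕ} (hν : (n : ℝ) / 2 < ν) (hνn : ν < n) (hM : (d : ℝ) / 2 < 2 * M)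
    (hN : ν + 2 * M ≤ N) (w₀ : K) :
    ∃ U ∈ 𝓝 w₀, ∃ C : ℝ≥0, ∀ u : TensorField n d K, u.IsCk (N : WithTop ℕ∞) →
      ∀ s, s₀ ≤ s → ∀ B : ℝ, (∀ x w, ‖x‖ = (s ^ 2 - 1) / 2 →
        normE g u (hypPoint s x, w) ≤ B * ((s ^ 2 - 1) / 2) ^ (-((n : ℝ) - 1) / 2)) →
      ∀ w ∈ U, ∀ x, ‖x‖ ≤ (s ^ 2 - 1) / 2 →
        ENNReal.ofReal (hypTime s x ^ ((n : ℝ) - 2) * normE g u (hypPoint s x, w) ^ 2) ≤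
          C * (hypEnergy g u N s + ENNReal.ofReal (B ^ 2)) := by
  obtain ⟨c, hw, r₀, hr₀, hball, Cv, hCv⟩ := exists_lintegral_chart_le g w₀
  set φ := extChartAt 𝓘(ℝ, EuclideanSpace ℝ (Fin d)) c with hφ
  obtain ⟨C₁, hC₁⟩ := exists_slice_sobolev (d := d) (K := K) hn hν hνn hs₀
  obtain ⟨C₂, hC₂⟩ := exists_lintegral_slice_le n g hr₀ hball hCv hM
  obtain ⟨κ, hκ, hnorm⟩ := exists_normSqE_equiv n g c (isCompact_closedBall (φ w₀) r₀) hball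
  refine ⟨φ.source ∩ φ ⁻¹' Metric.closedBall (φ w₀) (r₀ / 2),
    (inter_mem (extChartAt_source_mem_nhds' hw) ((continuousAt_extChartAt' hw).preimage_mem_nhds
      (Metric.closedBall_mem_nhds _ (half_pos hr₀)))),
    κ.toNNReal * ∑ _a : Fin 2 → Idx n d, C₁ *
      ((∑ k ∈ Finset.range ν, ∑ _I : Fin k → Fin n, ∑ _i : Fin n,
        C₂ * ∑ _j ∈ Finset.range (M + 1), 1) + κ.toNNReal), ?_⟩
  rintro u hu s hs B hB w ⟨hws, hwb⟩ x hx
  set y := φ w with hy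
  have hyr : y ∈ Metric.closedBall (φ w₀) r₀ :=
    Metric.closedBall_subset_closedBall (half_le_self hr₀.le) hwb
  have hyd : y ∈ chartDom c := φ.map_source hws
  have hsymm : φ.symm y = w := φ.left_inv hws
  set T := u.comp c with hT
  have hnE : ∀ p, normE g u (p, w) = Real.sqrt (normSqE g c (p, y) (T (p, y))) := fun p => by
    rw [← hsymm]
    exact normE_sq_nonneg_eq g u hyd p
  have hTs : IsSmoothComp c (N : WithTop ℕ∞) T := fun a =>
    contDiffOn_comp (by exact_mod_cast le_top) hu c a
  -- The boundary bound on the invariant norm passes to components at the cost of √κ, the constant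
  -- of equivalence of norms.
  have hbd : ∀ a x, ‖x‖ = (s ^ 2 - 1) / 2 → |T (hypPoint s x, y) a| ≤
      Real.sqrt κ * B * ((s ^ 2 - 1) / 2) ^ (-((n : ℝ) - 1) / 2) := by
    intro a x hx
    have h1 : T (hypPoint s x, y) a ^ 2 ≤ κ * normSqE g c (hypPoint s x, y) (T (hypPoint s x, y)) :=
      (Finset.single_le_sum (f := fun a => T (hypPoint s x, y) a ^ 2) (fun _ _ => sq_nonneg _)
        (Finset.mem_univ a)).trans (hnorm _ y hyr _).2
    calc |T (hypPoint s x, y) a| ≤ Real.sqrt κ * normE g u (hypPoint s x, w) := by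
          rw [hnE, ← Real.sqrt_mul hκ]
          exact Real.abs_le_sqrt h1
      _ ≤ _ := by
          rw [mul_assoc]
          exact mul_le_mul_of_nonneg_left (hB x w hx) (Real.sqrt_nonneg _)
  have hcomp : ∀ a, ENNReal.ofReal (hypTime s x ^ ((n : ℝ) - 2)) * ‖T (hypPoint s x, y) a‖ₑ ^ 2 ≤
      C₁ * ((∑ k ∈ Finset.range ν, ∑ _I : Fin k → Fin n, ∑ _i : Fin n,
        C₂ * ∑ _j ∈ Finset.range (M + 1), 1) + κ.toNNReal : ℝ≥0) *
          (hypEnergy g u N s + ENNReal.ofReal (B ^ 2)) := by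
    intro a
    refine (hC₁ c 2 T (hTs.of_le (by exact_mod_cast (by omega : ν ≤ N))) y hyd a s hs _
      (hbd a) x hx).trans ?_
    rw [mul_assoc]
    refine mul_le_mul_right ?_ _
    rw [ENNReal.coe_add, add_mul]
    refine add_le_add ?_ ?_
    · push_cast
      simp only [Finset.sum_mul]
      refine Finset.sum_le_sum fun k hk => Finset.sum_le_sum fun I _ =>
        Finset.sum_le_sum fun i _ => ?_
      have hk' := Finset.mem_range.mp hk
      -- Here k ≤ ν - 1, so k + 2M + 1 ≤ N: only derivatives of u that exist are used.
      refine (hC₂ u N hu k (boost ∘ I) i (by omega) s (by linarith) _ y hwb a).trans ?_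
      rw [mul_assoc, Finset.sum_mul]
      refine mul_le_mul_right (Finset.sum_le_sum fun j hj => ?_) _
      have hj' := Finset.mem_range.mp hj
      rw [one_mul]
      exact (lintegral_termSq_le_hypEnergy g u (by omega) _ i s).trans le_self_add
    · rw [mul_pow, Real.sq_sqrt hκ, ENNReal.ofReal_mul hκ]
      exact mul_le_mul_right le_add_self _
  have ht0 : 0 ≤ hypTime s x ^ ((n : ℝ) - 2) := Real.rpow_nonneg (hypTime_nonneg s x) _
  have hE : normE g u (hypPoint s x, w) ^ 2 ≤ κ * ∑ a, T (hypPoint s x, y) a ^ 2 := by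
    rw [hnE]
    refine (pow_le_pow_left₀ (Real.sqrt_nonneg _)
      (Real.sqrt_le_sqrt (hnorm _ y hyr _).1) 2).trans_eq (Real.sq_sqrt ?_)
    exact mul_nonneg hκ (Finset.sum_nonneg fun _ _ => sq_nonneg _)
  calc ENNReal.ofReal (hypTime s x ^ ((n : ℝ) - 2) * normE g u (hypPoint s x, w) ^ 2)
      ≤ ENNReal.ofReal (κ * ∑ a, hypTime s x ^ ((n : ℝ) - 2) * T (hypPoint s x, y) a ^ 2) := by
        refine ENNReal.ofReal_le_ofReal ((mul_le_mul_of_nonneg_left hE ht0).trans_eq ?_)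
        rw [← Finset.mul_sum]
        ring
    _ = κ.toNNReal * ∑ a, ENNReal.ofReal (hypTime s x ^ ((n : ℝ) - 2)) *
          ‖T (hypPoint s x, y) a‖ₑ ^ 2 := by
        rw [ENNReal.ofReal_mul hκ, ENNReal.ofReal_sum_of_nonneg fun a _ =>
          mul_nonneg ht0 (sq_nonneg _)]
        congr 1
        refine Finset.sum_congr rfl fun a _ => ?_
        rw [ENNReal.ofReal_mul ht0, ← sq_abs, ENNReal.ofReal_pow (abs_nonneg _),
          Real.enorm_eq_ofReal_abs]
    _ ≤ _ := by
        rw [ENNReal.coe_mul, mul_assoc, ENNReal.ofNNReal_finsetSum, Finset.sum_mul]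
        refine mul_le_mul_right (Finset.sum_le_sum fun a _ => ?_) _
        rw [ENNReal.coe_mul]
        exact hcomp a

/-- The weighted pointwise estimate in the solid hyperboloidal region. -/
theorem exists_interior_bound (hn : 4 ≤ n) [NeZero d] (g : RMetric d K) {s₀ : ℝ} (hs₀ : 1 < s₀)
    {ν M N : ℕ} (hν : (n : ℝ) / 2 < ν) (hνn : ν < n) (hM : (d : ℝ) / 2 < 2 * M)
    (hN : ν + 2 * M ≤ N) :
    ∃ C : ℝ≥0, ∀ u : TensorField n d K, u.IsCk (N : WithTop ℕ∞) →
      ∀ s, s₀ ≤ s → ∀ B : ℝ, (∀ x w, ‖x‖ = (s ^ 2 - 1) / 2 →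
        normE g u (hypPoint s x, w) ≤ B * ((s ^ 2 - 1) / 2) ^ (-((n : ℝ) - 1) / 2)) →
      ∀ w x, ‖x‖ ≤ (s ^ 2 - 1) / 2 →
        ENNReal.ofReal (hypTime s x ^ ((n : ℝ) - 2) * normE g u (hypPoint s x, w) ^ 2) ≤
          C * (hypEnergy g u N s + ENNReal.ofReal (B ^ 2)) := by
  choose U hU C hC using exists_local_bound hn g hs₀ hν hνn hM hN
  obtain ⟨t, -, ht⟩ := isCompact_univ.elim_nhds_subcover U fun w _ => hU w
  refine ⟨∑ w ∈ t, C w, fun u hu s hs B hB w x hx => ?_⟩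
  obtain ⟨w₀, hw₀, hw⟩ := mem_iUnion₂.mp (ht (mem_univ w))
  refine (hC w₀ u hu s hs B hB w hw x hx).trans (mul_le_mul_left ?_ _)
  exact_mod_cast Finset.single_le_sum (f := C) (fun _ _ => zero_le) hw₀

/-- The estimate in the region where the field is given by the asymptotic profile. -/
theorem rpow_mul_sq_le_of_decay {R₀ t r b B ρ : ℝ} (hR₀ : 0 < R₀) (hr : R₀ ≤ r) (ht0 : 0 ≤ t)
    (ht : t ≤ r + 1) (hρ : 0 ≤ ρ) (hb0 : 0 ≤ b) (hb : b ≤ B * r ^ (-(ρ + 1) / 2)) :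
    t ^ ρ * b ^ 2 ≤ (1 + R₀⁻¹) ^ ρ * R₀⁻¹ * B ^ 2 := by
  have hr0 : 0 < r := hR₀.trans_le hr
  have h1 : t ≤ (1 + R₀⁻¹) * r := by
    have : 1 ≤ R₀⁻¹ * r := by rwa [← div_eq_inv_mul, one_le_div hR₀]
    linarith
  have h2 : t ^ ρ ≤ (1 + R₀⁻¹) ^ ρ * r ^ ρ := by
    rw [← Real.mul_rpow (by positivity) hr0.le]
    exact Real.rpow_le_rpow ht0 h1 hρ
  have h3 : b ^ 2 ≤ B ^ 2 * r ^ (-(ρ + 1)) := by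
    refine (pow_le_pow_left₀ hb0 hb 2).trans_eq ?_
    rw [mul_pow, ← Real.rpow_natCast, ← Real.rpow_natCast (r ^ _), ← Real.rpow_mul hr0.le]
    norm_num
  have h4 : r ^ ρ * r ^ (-(ρ + 1)) = r⁻¹ := by
    rw [← Real.rpow_add hr0, ← Real.rpow_neg_one]
    congr 1
    ring
  calc t ^ ρ * b ^ 2 ≤ ((1 + R₀⁻¹) ^ ρ * r ^ ρ) * (B ^ 2 * r ^ (-(ρ + 1))) := by gcongr
    _ = (1 + R₀⁻¹) ^ ρ * r⁻¹ * B ^ 2 := by rw [← h4]; ring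
    _ ≤ _ := by gcongr

end SupBound

end HypSobolev

end

/-! ### The main estimate. -/

theorem lemma3p2 {n d : ℕ} (hn : 4 ≤ n) (hd : 1 ≤ d)
    {K : Type*} [TopologicalSpace K] [ChartedSpace (EuclideanSpace ℝ (Fin d)) K]
    [IsManifold 𝓘(ℝ, EuclideanSpace ℝ (Fin d)) ∞ K] [T2Space K] [CompactSpace K]
    [MeasurableSpace K] [BorelSpace K]
    (g : HypSobolev.RMetric d K) (s₀ : ℝ) (hs₀ : 1 < s₀) :
    ∃ C : ℝ≥0, ∀ (u f : HypSobolev.TensorField n d K) (Cf : ℕ → ℝ),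
      u.IsCk (HypSobolev.nuTilde n d : ℕ) →
      f.IsCk ∞ →
      HypSobolev.DependsOnlyOnMink g f →
      (∀ z : HypSobolev.Mink n × K, z.1 0 - 1 ≤ ‖HypSobolev.spatial z.1‖ → u z = f z) →
      (∀ (k : ℕ) (z : HypSobolev.Mink n × K), HypSobolev.spatial z.1 ≠ 0 →
        HypSobolev.normCovDeriv g f k z ≤
          Cf k * ‖HypSobolev.spatial z.1‖ ^ (-((n : ℝ) - 1) / 2 - (k : ℝ))) →
      ∀ s : ℝ, s₀ ≤ s →
        (⨆ z : HypSobolev.Mink n × K, ⨆ _ : z.1 ∈ HypSobolev.hyperboloid n s,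
            ENNReal.ofReal
              (s ^ (4 * HypSobolev.decayRate n) * HypSobolev.normE g u z ^ 2)) ≤
          C * HypSobolev.hypEnergy g u (HypSobolev.nuTilde n d) s
            + C * ENNReal.ofReal (∑ k ∈ Finset.range (HypSobolev.nuTilde n d), Cf k ^ 2) ∧
        (⨆ z : HypSobolev.Mink n × K, ⨆ _ : z.1 ∈ HypSobolev.hyperboloid n s,
            ENNReal.ofReal
              ((z.1 0) ^ (2 * HypSobolev.decayRate n) * HypSobolev.normE g u z ^ 2)) ≤
          C * HypSobolev.hypEnergy g u (HypSobolev.nuTilde n d) s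
            + C * ENNReal.ofReal (∑ k ∈ Finset.range (HypSobolev.nuTilde n d), Cf k ^ 2) := by
  have : NeZero d := ⟨by omega⟩
  have hn' : (4 : ℝ) ≤ n := by exact_mod_cast hn
  -- Evenness lets the internal derivatives be spent as M powers of the Laplacian, with 2M > d/2;
  -- the remaining ν > n/2 derivatives go to the hyperboloid.
  obtain ⟨⟨M, hM⟩, hd2⟩ := HypSobolev.dTilde_spec d
  have hν1 := HypSobolev.lt_nuTilde n d
  have hν2 := HypSobolev.nuTilde_le n d
  have hle : HypSobolev.dTilde d ≤ HypSobolev.nuTilde n d := by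
    have : (HypSobolev.dTilde d : ℝ) ≤ HypSobolev.nuTilde n d := by linarith
    exact_mod_cast this
  obtain ⟨ν, hν⟩ := Nat.exists_eq_add_of_le hle
  have hνr : (HypSobolev.nuTilde n d : ℝ) = HypSobolev.dTilde d + ν := by exact_mod_cast hν
  have hνn : ν < n := by
    have : (ν : ℝ) < n := by linarith
    exact_mod_cast this
  have hM2 : (HypSobolev.dTilde d : ℝ) = 2 * M := by rw [hM]; push_cast; ring
  obtain ⟨C₁, hC₁⟩ := HypSobolev.exists_interior_bound hn g hs₀ (ν := ν) (M := M)
    (N := HypSobolev.nuTilde n d) (by linarith) hνn (by linarith) (by omega)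
  set R₀ := (s₀ ^ 2 - 1) / 2 with hR₀def
  have hR₀ : 0 < R₀ := by rw [hR₀def]; nlinarith
  -- The constant of the exterior region, where |x| ≥ R₀ makes t at most (1 + R₀⁻¹)|x|.
  set C₂ := ((1 + R₀⁻¹) ^ ((n : ℝ) - 2) * R₀⁻¹).toNNReal with hC₂
  refine ⟨C₁ + C₂, fun u f Cf hu _ _ huf hf s hs => ?_⟩
  have hR : R₀ ≤ (s ^ 2 - 1) / 2 := by rw [hR₀def]; nlinarith
  -- From the sphere |x| = R outwards u is the profile f. At equality this is the boundary value for
  -- the interior estimate, beyond it the exterior estimate itself.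
  have hprofile : ∀ x w, (s ^ 2 - 1) / 2 ≤ ‖x‖ → HypSobolev.normE g u (HypSobolev.hypPoint s x, w) ≤
      Cf 0 * ‖x‖ ^ (-((n : ℝ) - 1) / 2) := by
    intro x w hx
    have h1 : HypSobolev.hypPoint s x 0 - 1 ≤ ‖x‖ := by
      rw [HypSobolev.hypPoint_zero]
      linarith [HypSobolev.hypTime_le_norm_add_one hx]
    rw [HypSobolev.normE_congr g (f := f) (fun w => huf _ (by
      rwa [HypSobolev.spatial_hypPoint])) w]
    have h2 := hf 0 (HypSobolev.hypPoint s x, w) (by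
      rw [HypSobolev.spatial_hypPoint, ← norm_pos_iff]
      linarith)
    rw [HypSobolev.spatial_hypPoint, Nat.cast_zero, sub_zero] at h2
    exact h2
  have hmain : ∀ x w, ENNReal.ofReal (HypSobolev.hypTime s x ^ ((n : ℝ) - 2) *
      HypSobolev.normE g u (HypSobolev.hypPoint s x, w) ^ 2) ≤
      (C₁ + C₂ : ℝ≥0) * HypSobolev.hypEnergy g u (HypSobolev.nuTilde n d) s +
        (C₁ + C₂ : ℝ≥0) * ENNReal.ofReal
          (∑ k ∈ Finset.range (HypSobolev.nuTilde n d), Cf k ^ 2) := by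
    intro x w
    have hCf : ENNReal.ofReal (Cf 0 ^ 2) ≤ ENNReal.ofReal
        (∑ k ∈ Finset.range (HypSobolev.nuTilde n d), Cf k ^ 2) := by
      refine ENNReal.ofReal_le_ofReal (Finset.single_le_sum (f := fun k => Cf k ^ 2)
        (fun _ _ => sq_nonneg _) (Finset.mem_range.mpr ?_))
      have : (0 : ℝ) < HypSobolev.nuTilde n d := by
        linarith [(HypSobolev.dTilde d).cast_nonneg (α := ℝ)]
      exact_mod_cast this
    rcases le_or_gt ‖x‖ ((s ^ 2 - 1) / 2) with hx | hx
    · refine (hC₁ u hu s hs (Cf 0) (fun x w hx => ?_) w x hx).trans ?_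
      · have := hprofile x w hx.ge
        rwa [hx] at this
      · rw [mul_add]
        gcongr <;> exact le_self_add
    · have h1 := HypSobolev.rpow_mul_sq_le_of_decay hR₀ (hR.trans hx.le)
        (HypSobolev.hypTime_nonneg s x) (ρ := (n : ℝ) - 2) (t := HypSobolev.hypTime s x)
        (HypSobolev.hypTime_le_norm_add_one hx.le) (by linarith) (Real.sqrt_nonneg _)
        ((hprofile x w hx.le).trans_eq (by ring_nf))
      refine (ENNReal.ofReal_le_ofReal h1).trans (le_trans ?_ le_add_self)
      rw [ENNReal.ofReal_mul (by positivity)]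
      exact mul_le_mul' (by rw [ENNReal.coe_add]; exact le_add_self) hCf
  constructor
  -- Both weights are compared with t^(n-2): the first has the same exponent with s ≤ t, the second
  -- half the exponent with t ≥ 1.
  all_goals
    refine iSup₂_le fun z hz => ?_
    obtain ⟨p, w⟩ := z
    have hp := HypSobolev.eq_hypPoint_of_mem_hyperboloid hz
    simp only at hp
    rw [hp]
    refine le_trans (ENNReal.ofReal_le_ofReal (mul_le_mul_of_nonneg_right ?_ (sq_nonneg _)))
      (hmain (HypSobolev.spatial p) w)
  · rw [show 4 * HypSobolev.decayRate n = (n : ℝ) - 2 by rw [HypSobolev.decayRate]; ring]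
    exact Real.rpow_le_rpow (by linarith) (HypSobolev.le_hypTime s _) (by linarith)
  · rw [HypSobolev.hypPoint_zero]
    refine Real.rpow_le_rpow_of_exponent_le ?_ ?_
    · linarith [HypSobolev.le_hypTime s (HypSobolev.spatial p)]
    · rw [HypSobolev.decayRate]
      linarith
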